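/- Lemma 3.1 (boundary-adapted Clément interpolant). Let $d\in\{2,3\}$, let $p\ge 1$ be an integer, and let $\Omega\subset\mathbb R^d$ be a bounded, simply-connected Lipschitz domain. Consider the conforming affine meshes $\mathcal T_h$ of $\overline\Omega$ into triangles ($d=2$) or tetrahedra ($d=3$) that are shape regular with a parameter $\sigma$: each $K\in\mathcal T_h$ contains a ball of some radius $\rho>0$ with $\operatorname{diam}K\le\sigma\rho$. Let $a_i$ be the Lagrange nodes of degree $p$ of $\mathcal T_h$ (the points of the elements whose barycentric coordinates are integer multiples of $1/p$), let $\theta_i$ be the corresponding Lagrange basis functions (continuous, in $P_p(K)$ on each $K\in\mathcal T_h$, with $\theta_i(a_j)=\delta_{ij}$), let $\Delta_i$ be the union of the elements that contain $a_i$, and let $h_{\Delta_i}=\operatorname{diam}\Delta_i$. For $\boldsymbol v\in L^1(\Omega)^d$ let $\boldsymbol R_i\boldsymbol v\in P_p(\Delta_i)^d$ be the $L^2(\Delta_i)$-projection of $\boldsymbol v$, i.e. $\int_{\Delta_i}(\boldsymbol R_i\boldsymbol v-\boldsymbol v)\cdot\boldsymbol q=0$ for all $\boldsymbol q\in P_p(\Delta_i)^d$,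 and put $$\Pi_{h,0}\boldsymbol v=\sum_{a_i\in\Omega}\boldsymbol R_i\boldsymbol v(a_i)\,\theta_i+\sum_{a_i\in\partial\Omega}J\boldsymbol v(a_i)\,\theta_i .$$ Here $J\boldsymbol v(a_i)=(\boldsymbol R_i\boldsymbol v(a_i)\cdot\boldsymbol n)\,\boldsymbol n$ if all faces (edges, if $d=2$) of $\mathcal T_h$ that lie in $\partial\Omega$ and contain $a_i$ have the same outward unit normal $\boldsymbol n$, and $J\boldsymbol v(a_i)=0$ if two of these normals differ. For real $s\ge0$ and open $D$, let $|\cdot|_{s,D}$ be the usual seminorm of $H^s(D)^d=W^{s,2}(D)^d$, built from all weak partial derivatives of order $\lfloor s\rfloor$ (through their $L^2(D)$ norms if $s$ is an integer, through their Sobolev–Slobodeckij seminorms of order $s-\lfloor s\rfloor$ otherwise); on a closed set such as $K$ or $\Delta_i$ it is taken on the interior. Let $H_0(\mathrm{curl},\Omega)$ be the space of all $\boldsymbol v\in L^2(\Omega)^d$ with $\mathrm{curl}\,\boldsymbol v\in L^2$ and vanishing tangential trace $\boldsymbol v\times\boldsymbol n=0$ on $\partial\Omega$. Then for all real $s,m$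 with $\tfrac12<s\le p+1$ and $0\le m\le s$ there is a constant $C$, depending only on $d,p,\Omega,\sigma,s,m$ and thus not on the mesh, such that for every such mesh $\mathcal T_h$, every $\boldsymbol v\in H^s(\Omega)^d\cap H_0(\mathrm{curl},\Omega)$ and every $K\in\mathcal T_h$ $$|\Pi_{h,0}\boldsymbol v-\boldsymbol v|_{m,K}\le C\sum_{i:\,a_i\in K}h_{\Delta_i}^{\,s-m}\,|\boldsymbol v|_{s,\Delta_i}.$$ -/

import Mathlib

open scoped NNReal ENNReal ContDiff
open MeasureTheory

noncomputable section

namespace ClementFE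

/-- The ambient space `ℝ^d` with its Euclidean norm. -/
abbrev Euc (d : ℕ) : Type := EuclideanSpace ℝ (Fin d)

variable {d : ℕ}

/-! ### Lipschitz domains -/

/-- A bounded Lipschitz domain: a bounded, connected, open set which near each boundary point
lies on one side of the graph of a Lipschitz function. Here `e` is the vertical direction of the
local coordinates and `y - ⟪e, y⟫ e` is the horizontal part of `y`. -/
structure IsLipschitzDomain (Ω : Set (Euc d)) : Prop where
  isOpen : IsOpen Ω
  isConnected : IsConnected Ω
  isBounded : Bornology.IsBounded Ω
  lipschitz_boundary : ∀ x ∈ frontier Ω, ∃ (e : Euc d) (r : ℝ) (L : ℝ≥0) (φ : Euc d → ℝ),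
    ‖e‖ = 1 ∧ 0 < r ∧ LipschitzWith L φ ∧
      ∀ y ∈ Metric.ball x r, (y ∈ Ω ↔ inner ℝ e y < φ (y - (inner ℝ e y : ℝ) • e))

/-! ### Sobolev spaces of vector fields -/

/-- `g` is the weak derivative `∂_{I 0} ∂_{I 1} ⋯ ∂_{I (k-1)} v` of the vector field `v` on the
open set `U`. -/
def HasWeakDeriv (U : Set (Euc d)) {k : ℕ} (I : Fin k → Fin d) (v g : Euc d → Euc d) : Prop :=
  LocallyIntegrableOn v U ∧ LocallyIntegrableOn g U ∧
    ∀ φ : Euc d → ℝ, ContDiff ℝ ∞ φ → HasCompactSupport φ → tsupport φ ⊆ U →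
      ∫ x in U, (iteratedFDeriv ℝ k φ x fun j => EuclideanSpace.single (I j) (1 : ℝ)) • v x =
        (-1 : ℝ) ^ k • ∫ x in U, φ x • g x

/-- For `θ = 0` the square of the `L²(U)` norm of `g`; for `0 < θ < 1` the square of the
Sobolev–Slobodeckij seminorm of order `θ` of `g` on `U`. -/
def slobodeckijSq (θ : ℝ) (U : Set (Euc d)) (g : Euc d → Euc d) : ℝ≥0∞ :=
  open Classical in
  if θ = 0 then ∫⁻ x in U, ‖g x‖ₑ ^ 2
  else ∫⁻ x in U, ∫⁻ y in U, ‖g x - g y‖ₑ ^ 2 / ENNReal.ofReal (‖x - y‖ ^ ((d : ℝ) + 2 * θ))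

/-- The seminorm `|v|_{s,U}` of `H^s(U) = W^{s,2}(U)`, for real `s ≥ 0`, built from all the
partial derivatives of order `⌊s⌋`. Weak derivatives are unique up to null sets, so the infimum is
over (representatives of) one function; the value is `∞` if some weak derivative of order `⌊s⌋`
does not exist. For `s = 0` this is the `L²(U)` norm. -/
def sobolevSeminorm (s : ℝ) (U : Set (Euc d)) (v : Euc d → Euc d) : ℝ≥0∞ :=
  (∑ I : Fin ⌊s⌋₊ → Fin d, ⨅ (g : Euc d → Euc d) (_ : HasWeakDeriv U I v g),
    slobodeckijSq (s - (⌊s⌋₊ : ℝ)) U g) ^ (1 / 2 : ℝ)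

/-- `v ∈ H^s(U)^d`: the weak derivatives up to order `⌊s⌋` exist and are square integrable, and
the seminorm of order `s` is finite. -/
def MemSobolev (s : ℝ) (U : Set (Euc d)) (v : Euc d → Euc d) : Prop :=
  (∀ j : ℕ, j ≤ ⌊s⌋₊ → sobolevSeminorm (j : ℝ) U v < ⊤) ∧ sobolevSeminorm s U v < ⊤

/-- The partial derivative `∂_i φ`. -/
def partialDeriv (i : Fin d) (φ : Euc d → ℝ) (x : Euc d) : ℝ :=
  fderiv ℝ φ x (EuclideanSpace.single i (1 : ℝ))

/-- `w` is the weak curl of `v` on `Ω`, written through its components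
`w i j = ∂_i v_j - ∂_j v_i`. For `d = 3` the components `w 1 2`, `w 2 0`, `w 0 1` form the usual
vector `curl v`; for `d = 2` the component `w 0 1` is the usual scalar curl. -/
def HasWeakCurl (Ω : Set (Euc d)) (v : Euc d → Euc d) (w : Fin d → Fin d → Euc d → ℝ) : Prop :=
  ∀ (i j : Fin d) (φ : Euc d → ℝ), ContDiff ℝ ∞ φ → HasCompactSupport φ → tsupport φ ⊆ Ω →
    ∫ x in Ω, w i j x * φ x = ∫ x in Ω, (v x i * partialDeriv j φ x - v x j * partialDeriv i φ x)

/-- The tangential trace `v × n` of a field `v` with weak curl `w` vanishes on `∂Ω`, in the sense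
of Green's formula: `∫_Ω (curl v) φ` and `∫_Ω v ∧ ∇φ` differ by the boundary term
`∫_{∂Ω} (v × n) φ`, which has to vanish for every `φ ∈ C^∞(closure Ω)`. -/
def HasZeroTangentialTrace (Ω : Set (Euc d)) (v : Euc d → Euc d)
    (w : Fin d → Fin d → Euc d → ℝ) : Prop :=
  ∀ (i j : Fin d) (φ : Euc d → ℝ), ContDiff ℝ ∞ φ → HasCompactSupport φ →
    ∫ x in Ω, w i j x * φ x = ∫ x in Ω, (v x i * partialDeriv j φ x - v x j * partialDeriv i φ x)

/-- `v ∈ H₀(curl, Ω)`: `v ∈ L²`, `curl v ∈ L²` and `v × n = 0` on `∂Ω`. -/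
def MemHZeroCurl (Ω : Set (Euc d)) (v : Euc d → Euc d) : Prop :=
  MemLp v 2 (volume.restrict Ω) ∧ ∃ w : Fin d → Fin d → Euc d → ℝ,
    (∀ i j, MemLp (w i j) 2 (volume.restrict Ω)) ∧ HasWeakCurl Ω v w ∧
      HasZeroTangentialTrace Ω v w

/-! ### Polynomial fields and the local projection -/

/-- `q ∈ (P_p)^d`: each component of `q` is a polynomial of total degree at most `p`. -/
def IsPolyField (p : ℕ) (q : Euc d → Euc d) : Prop :=
  ∃ P : Fin d → MvPolynomial (Fin d) ℝ,
    ∀ j, (P j).totalDegree ≤ p ∧ ∀ x : Euc d, q x j = MvPolynomial.eval (fun i => x i) (P j)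

/-- The projection of `v ∈ L¹(D)^d` to `(P_p)^d` that is orthogonal in `L²(D)`: the polynomial
field `q` with `∫_D (q - v) · r = 0` for all `r ∈ (P_p)^d`. -/
def polyProj (p : ℕ) (D : Set (Euc d)) (v : Euc d → Euc d) : Euc d → Euc d :=
  open Classical in
  if h : ∃ q : Euc d → Euc d, IsPolyField p q ∧
      ∀ r : Euc d → Euc d, IsPolyField p r → ∫ x in D, (inner ℝ (q x - v x) (r x) : ℝ) = 0
  then h.choose else 0

/-! ### Simplicial meshes -/

/-- A conforming affine simplicial mesh of `Ω ⊆ ℝ^d`. An element is given by the set of its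
`d + 1` vertices; the elements cover the closure of `Ω`, and two elements meet in the convex hull
of their common vertices (which may be empty). -/
structure Mesh (Ω : Set (Euc d)) where
  elements : Finset (Finset (Euc d))
  card_eq : ∀ K ∈ elements, K.card = d + 1
  indep : ∀ K ∈ elements, AffineIndependent ℝ ((↑) : K → Euc d)
  inter_subset : ∀ K ∈ elements, ∀ L ∈ elements,
    convexHull ℝ (K : Set (Euc d)) ∩ convexHull ℝ (L : Set (Euc d)) ⊆
      convexHull ℝ ((K : Set (Euc d)) ∩ (L : Set (Euc d)))
  cover : ⋃ K ∈ elements, convexHull ℝ (K : Set (Euc d)) = closure Ω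

namespace Mesh

variable {Ω : Set (Euc d)} (T : Mesh Ω)

/-- Shape regularity with parameter `σ`: each element `K` contains a ball of some radius `ρ` with
`diam K ≤ σ ρ`. -/
def ShapeRegular (σ : ℝ) : Prop :=
  ∀ K ∈ T.elements, ∃ (x : Euc d) (ρ : ℝ), 0 < ρ ∧
    Metric.ball x ρ ⊆ convexHull ℝ (K : Set (Euc d)) ∧
      Metric.diam (convexHull ℝ (K : Set (Euc d))) ≤ σ * ρ

/-- All vertices of the mesh. -/
def vertices : Finset (Euc d) :=
  open Classical in T.elements.biUnion id

/-- The vertices of an element as an affine basis of `ℝ^d`; its coordinates are the barycentric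
coordinates of the element. -/
def affineBasis (K : Finset (Euc d)) (hK : K ∈ T.elements) : AffineBasis K ℝ (Euc d) where
  toFun := (↑)
  ind' := T.indep K hK
  tot' := by
    rw [(T.indep K hK).affineSpan_eq_top_iff_card_eq_finrank_add_one]
    simp [T.card_eq K hK]

/-- The continuous piecewise affine function that is `1` at the vertex `a` and `0` at the other
vertices: on an element with vertex `a` it is the barycentric coordinate that belongs to `a`, and
on the other elements it is `0`. (On a common face all elements give the same value.) -/
def hat (a x : Euc d) : ℝ :=
  open Classical in
  if h : ∃ K : Finset (Euc d), ∃ _ : K ∈ T.elements, a ∈ K ∧ x ∈ convexHull ℝ (K : Set (Euc d))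
  then (T.affineBasis h.choose h.choose_spec.1).coord ⟨a, h.choose_spec.2.1⟩ x
  else 0

/-- The indices of the Lagrange nodes of degree `p` in the element `K`: the families
`c : vertices → ℕ` supported in `K` with sum `p`. -/
def elementNodes (p : ℕ) (K : Finset (Euc d)) : Finset (Euc d → ℕ) :=
  open Classical in K.piAntidiag p

/-- The indices of all Lagrange nodes of degree `p` of the mesh. (A node on a common face has the
same index in all elements that contain it, and different indices give different nodes.) -/
def nodes (p : ℕ) : Finset (Euc d → ℕ) :=
  open Classical in T.elements.biUnion (elementNodes p)

/-- The Lagrange node with index `c`: the point with barycentric coordinates `c a / p`. -/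
def nodePoint (p : ℕ) (c : Euc d → ℕ) : Euc d :=
  ∑ a ∈ T.vertices, ((c a : ℝ) / (p : ℝ)) • a

/-- The (interior of the) patch of a node: the union of the elements that contain it. -/
def patch (p : ℕ) (c : Euc d → ℕ) : Set (Euc d) :=
  interior (⋃ K ∈ {K ∈ (T.elements : Set (Finset (Euc d))) |
    T.nodePoint p c ∈ convexHull ℝ (K : Set (Euc d))}, convexHull ℝ (K : Set (Euc d)))

/-- The Lagrange basis function of degree `p` of the node with index `c`, in closed form: it is
continuous, a polynomial of degree at most `p` on each element, `1` at the node `c`, and `0` at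
all other nodes, since at the node with index `c'` it equals `∏ a, (c' a).choose (c a)`. -/
def lagrangeBasis (p : ℕ) (c : Euc d → ℕ) (x : Euc d) : ℝ :=
  ∏ a ∈ T.vertices, ∏ j ∈ Finset.range (c a),
    ((p : ℝ) * T.hat a x - (j : ℝ)) / ((c a : ℝ) - (j : ℝ))

/-- The boundary faces of the mesh (edges for `d = 2`): the faces with `d` vertices of an element
that lie in `∂Ω`. -/
def boundaryFaces : Set (Finset (Euc d)) :=
  {f | (∃ K ∈ T.elements, f ⊆ K) ∧ f.card = d ∧ convexHull ℝ (f : Set (Euc d)) ⊆ frontier Ω}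

/-- `n` is the outward unit normal vector on the boundary face `f`: it is orthogonal to `f` and
points away from the element that has the face `f`. -/
def IsOutwardNormal (f : Finset (Euc d)) (n : Euc d) : Prop :=
  ‖n‖ = 1 ∧ (∀ a ∈ f, ∀ b ∈ f, (inner ℝ n (b - a) : ℝ) = 0) ∧
    ∀ K ∈ T.elements, f ⊆ K → ∀ a ∈ f, ∀ b ∈ K, b ∉ f → (inner ℝ n (b - a) : ℝ) < 0

/-- The nodal value at a boundary point `a`: if all boundary faces that contain `a` have the same
outward unit normal `n`, it is the normal part `(u · n) n` of `u`; if two of these normals differ,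
it is `0`. -/
def boundaryValue (a u : Euc d) : Euc d :=
  open Classical in
  if h : ∃ n : Euc d, ∀ f ∈ T.boundaryFaces, a ∈ convexHull ℝ (f : Set (Euc d)) →
      T.IsOutwardNormal f n
  then (inner ℝ u h.choose : ℝ) • h.choose else 0

/-- The nodal value of the interpolant of `v` at the node with index `c`. -/
def nodalValue (p : ℕ) (v : Euc d → Euc d) (c : Euc d → ℕ) : Euc d :=
  open Classical in
  if T.nodePoint p c ∈ frontier Ω
  then T.boundaryValue (T.nodePoint p c) (polyProj p (T.patch p c) v (T.nodePoint p c))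
  else polyProj p (T.patch p c) v (T.nodePoint p c)

/-- The boundary-adapted Clément interpolant `Π_{h,0} v` of degree `p`. -/
def clementZero (p : ℕ) (v : Euc d → Euc d) (x : Euc d) : Euc d :=
  ∑ c ∈ T.nodes p, T.lagrangeBasis p c x • T.nodalValue p v c

end Mesh

end ClementFE

end

open ClementFE

/-! On an element `K` of diameter `h`, let `q` be a polynomial field with `|v - q|_m ≤ C h^(s-m)
|v|_s` for all `0 ≤ m ≤ s` (Bramble–Hilbert). The Lagrange functions of `K` reproduce `q`, so `Π v -
v = (q - v) + w`, where `w` interpolates the nodal errors `nodalValue c - q(a_c)`. The inverse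
estimate gives `|w|_m ≤ C h^(-m) ‖w‖`, and `‖w‖` is at most `C h^(d/2)` times the sum of the nodal
errors. Everything thus reduces to `|nodalValue c - q(a_c)| ≤ C h^(s-d/2) |v|_{s,Δ}` with a constant
that does not see the mesh.

Interior part. The difference `R v(a) - q(a)` is the value of a polynomial that is small in `L²(K)`,
provided `‖v - R v‖ ≤ C h^s |v|_{s,Δ}` on the patch (`slob_zero_patch_sub_polyProj_le`). The patch
need not be convex, and infinitely many shapes of patches occur. The uniform cone property of the
Lipschitz domain helps: below each node there is a ball, of size comparable with `h`, whose convex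
hull with a small ball in any element of the patch stays in the patch (`exists_links`). Polynomial
approximation is therefore needed only on convex sets containing a ball of comparable size (`Fat`),
where it follows from Poincaré inequalities with explicit constants, and it is carried from set to
set through common balls (`Fat.transfer`). The diameters of elements at one vertex are comparable:
there are at most `σ^d` of them by packing, they are connected through common edges by the cone
property, and elements with a common edge differ in diameter by a factor of at most `σ`
(`diam_le_of_mem_star`).

Boundary part. At a boundary node the interpolant drops the tangential part of `R v(a)`, or all of
`R v(a)`. A trace estimate for `s > 1/2` is needed, with a vanishing trace that is only known
through Green's formula. It is obtained from weighted means over thin layers parallel to a boundary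
face. Halving the distance of the layer from the face changes the mean of a field `F` by at most a
constant times `ε^(θ-1/2) |F|_θ`, so the means stay bounded by a geometric series when `θ > 1/2`
(`exists_abs_layerMean_le`). The tangential means of `v` tend to zero by Green's formula with a
cutoff (`tendsto_layerMean_inner`), while those of a polynomial field `q` tend to an integral over
its values on the face. With `F = q - v` this bounds the tangential part of `q` on the face by `q -
v` alone (`exists_norm_tangential_le`); the choice `q = R v` finishes the case of one normal.

If two normals differ at the node, both tangential parts of `R v(a)` are small, and together they
control the whole vector. The constant depends on the angle between the normals. It is uniform
because all boundary normals of all meshes of `Ω` come from one finite set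
(`exists_finite_normals`), and because opposite normals cannot meet at a point of a Lipschitz
boundary (`normal_ne_neg`). -/

noncomputable section

namespace ClementFE

variable {d : ℕ}

/-! ### Weak derivatives and Sobolev–Slobodeckij seminorms -/

section

/-! ### Iterated directional derivatives of test functions -/

/-- The iterated partial derivative `∂_{I 0} ⋯ ∂_{I (k-1)} φ`. -/
def iterDeriv {k : ℕ} (I : Fin k → Fin d) (φ : Euc d → ℝ) (x : Euc d) : ℝ :=
  iteratedFDeriv ℝ k φ x fun j => EuclideanSpace.single (I j) (1 : ℝ)

theorem iterDeriv_contDiff {k : ℕ} (I : Fin k → Fin d) {φ : Euc d → ℝ} (hφ : ContDiff ℝ ∞ φ) :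
    ContDiff ℝ ∞ (iterDeriv I φ) := by
  have h : ContDiff ℝ ∞ (iteratedFDeriv ℝ k φ) := hφ.iteratedFDeriv_right (by norm_cast)
  exact (ContinuousMultilinearMap.apply ℝ (fun _ : Fin k => Euc d) ℝ
    (fun j => EuclideanSpace.single (I j) (1 : ℝ))).contDiff.comp h

theorem iterDeriv_eq_zero {k : ℕ} (I : Fin k → Fin d) {φ : Euc d → ℝ} {x : Euc d}
    (hx : x ∉ tsupport φ) : iterDeriv I φ x = 0 := by
  have : iteratedFDeriv ℝ k φ x = 0 := by
    by_contra h
    exact hx (support_iteratedFDeriv_subset (𝕜 := ℝ) k h)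
  simp [iterDeriv, this]

theorem tsupport_iterDeriv {k : ℕ} (I : Fin k → Fin d) (φ : Euc d → ℝ) :
    tsupport (iterDeriv I φ) ⊆ tsupport φ := by
  refine closure_minimal (fun x hx => ?_) (isClosed_tsupport φ)
  by_contra h
  exact hx (iterDeriv_eq_zero I h)

theorem hasCompactSupport_iterDeriv {k : ℕ} (I : Fin k → Fin d) {φ : Euc d → ℝ}
    (hφ : HasCompactSupport φ) : HasCompactSupport (iterDeriv I φ) :=
  IsCompact.of_isClosed_subset hφ (isClosed_tsupport _) (tsupport_iterDeriv I φ)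

theorem iterDeriv_one (i : Fin d) (φ : Euc d → ℝ) :
    iterDeriv (fun _ : Fin 1 => i) φ = partialDeriv i φ := by
  ext x
  simp [iterDeriv, partialDeriv]

theorem iterDeriv_zero (I : Fin 0 → Fin d) (φ : Euc d → ℝ) : iterDeriv I φ = φ := by
  ext x
  simp [iterDeriv]

/-- The last direction of an iterated derivative is the one applied first, and evaluation of
`fderiv` at a fixed vector is continuous linear, so it commutes with the remaining differentiations.
-/
theorem iterDeriv_snoc {k : ℕ} (I : Fin k → Fin d) (i : Fin d) {φ : Euc d → ℝ}
    (hφ : ContDiff ℝ ∞ φ) :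
    iterDeriv (Fin.snoc I i : Fin (k + 1) → Fin d) φ = iterDeriv I (partialDeriv i φ) := by
  ext x
  have h1 : ContDiff ℝ ∞ (fderiv ℝ φ) := hφ.fderiv_right (by simp)
  have h2 : partialDeriv i φ =
      (ContinuousLinearMap.apply ℝ ℝ (EuclideanSpace.single i (1 : ℝ) : Euc d)) ∘ fderiv ℝ φ := by
    ext y; simp [partialDeriv]
  rw [iterDeriv, iteratedFDeriv_succ_apply_right, iterDeriv, h2,
    ContinuousLinearMap.iteratedFDeriv_comp_left _ (h1.contDiffAt (x := x)) (i := k)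
      (by exact_mod_cast le_top)]
  simp only [ContinuousLinearMap.compContinuousMultilinearMap_coe, Function.comp_apply,
    ContinuousLinearMap.apply_apply, Fin.snoc_last]
  congr 2
  ext j
  simp [Fin.init]

theorem partialDeriv_comm (i j : Fin d) {φ : Euc d → ℝ} (hφ : ContDiff ℝ ∞ φ) :
    partialDeriv i (partialDeriv j φ) = partialDeriv j (partialDeriv i φ) := by
  have key : ∀ a b : Fin d, ∀ x, partialDeriv a (partialDeriv b φ) x =
      fderiv ℝ (fderiv ℝ φ) x (EuclideanSpace.single a 1) (EuclideanSpace.single b 1) := by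
    intro a b x
    have h1 : ContDiff ℝ ∞ (fderiv ℝ φ) := hφ.fderiv_right (by norm_cast)
    have h2 : DifferentiableAt ℝ (fderiv ℝ φ) x := (h1.differentiable (by simp)) x
    have h3 := h2.hasFDerivAt.clm_apply
      (hasFDerivAt_const (EuclideanSpace.single b (1 : ℝ) : Euc d) x)
    change fderiv ℝ (fun y => fderiv ℝ φ y (EuclideanSpace.single b (1 : ℝ))) x _ = _
    rw [h3.fderiv]
    simp
  ext x
  rw [key, key]
  have := (hφ.contDiffAt (x := x)).isSymmSndFDerivAt (by
    rw [minSmoothness_of_isRCLikeNormedField]; norm_cast)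
  exact this.eq _ _

/-- The multiset of the directions of an iterated derivative. -/
def dirs {k : ℕ} (I : Fin k → Fin d) : Multiset (Fin d) := Finset.univ.val.map I

theorem card_dirs {k : ℕ} (I : Fin k → Fin d) : (dirs I).card = k := by simp [dirs]

theorem dirs_snoc {k : ℕ} (I : Fin k → Fin d) (i : Fin d) :
    dirs (Fin.snoc I i : Fin (k + 1) → Fin d) = i ::ₘ dirs I := by
  rw [dirs, Fin.univ_castSuccEmb]
  simp [dirs]

theorem exists_dirs_eq (s : Multiset (Fin d)) : ∃ I : Fin s.card → Fin d, dirs I = s := by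
  induction s using Quotient.inductionOn with
  | h l =>
    refine ⟨fun j => l.get (j.cast (by simp)), ?_⟩
    simp only [dirs]
    rw [Fin.univ_val_map]
    simp

theorem partialDeriv_contDiff (i : Fin d) {φ : Euc d → ℝ} (hφ : ContDiff ℝ ∞ φ) :
    ContDiff ℝ ∞ (partialDeriv i φ) := iterDeriv_one i φ ▸ iterDeriv_contDiff _ hφ

/-- Partial derivatives of smooth functions commute, so an iterated derivative is a fold over an
unordered multiset. This allows weak derivatives to be indexed by multisets of directions, which is
what polynomial derivatives and the descent in order require. -/
theorem iterDeriv_congr_dirs {k : ℕ} (I J : Fin k → Fin d) (h : dirs I = dirs J)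
    {φ : Euc d → ℝ} (hφ : ContDiff ℝ ∞ φ) : iterDeriv I φ = iterDeriv J φ := by
  -- Commutativity holds only for smooth functions, so the fold runs over the subtype of smooth
  -- functions, which partial derivatives preserve.
  let D : {φ : Euc d → ℝ // ContDiff ℝ ∞ φ} → Fin d → {φ : Euc d → ℝ // ContDiff ℝ ∞ φ} :=
    fun φ i => ⟨partialDeriv i φ.1, partialDeriv_contDiff i φ.2⟩
  have : RightCommutative D := ⟨fun φ i j => Subtype.ext (partialDeriv_comm j i φ.2)⟩
  have key : ∀ (k : ℕ) (I : Fin k → Fin d) (φ : {φ : Euc d → ℝ // ContDiff ℝ ∞ φ}),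
      iterDeriv I φ.1 = ((dirs I).foldl D φ).1 := by
    intro k
    induction k with
    | zero => intro I φ; simp [iterDeriv_zero, dirs]
    | succ k ih =>
      intro I φ
      obtain ⟨I', i, rfl⟩ : ∃ (I' : Fin k → Fin d) (i : Fin d), I = Fin.snoc I' i :=
        ⟨Fin.init I, I (Fin.last k), (Fin.snoc_init_self I).symm⟩
      rw [dirs_snoc, Multiset.foldl_cons, iterDeriv_snoc I' i φ.2]
      exact ih I' (D φ i)
  rw [key k I ⟨φ, hφ⟩, key k J ⟨φ, hφ⟩, h]

/-! ### Weak derivatives -/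

variable {U V : Set (Euc d)} {k : ℕ} {I : Fin k → Fin d} {v w g g' : Euc d → Euc d}

theorem integrable_smul_of_tsupport_subset (hU : IsOpen U) {v : Euc d → Euc d}
    (hv : LocallyIntegrableOn v U) {ψ : Euc d → ℝ} (hc : Continuous ψ)
    (hs : HasCompactSupport ψ) (hsU : tsupport ψ ⊆ U) :
    Integrable (fun x => ψ x • v x) (volume.restrict U) := by
  have h1 : IntegrableOn v (tsupport ψ) := hv.integrableOn_compact_subset hsU hs
  have h2 : IntegrableOn (fun x => ψ x • v x) (tsupport ψ) :=
    h1.continuousOn_smul hc.continuousOn hs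
  have h3 : Integrable (fun x => ψ x • v x) := by
    refine (integrableOn_iff_integrable_of_support_subset (s := tsupport ψ) ?_).1 h2
    intro x hx
    refine subset_tsupport ψ ?_
    intro h0
    exact hx (by simp [h0])
  exact h3.integrableOn

theorem HasWeakDeriv.eq (h : HasWeakDeriv U I v g) {φ : Euc d → ℝ} (h1 : ContDiff ℝ ∞ φ)
    (h2 : HasCompactSupport φ) (h3 : tsupport φ ⊆ U) :
    ∫ x in U, iterDeriv I φ x • v x = (-1 : ℝ) ^ k • ∫ x in U, φ x • g x := h.2.2 φ h1 h2 h3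

theorem HasWeakDeriv.mono (h : HasWeakDeriv U I v g) (hVU : V ⊆ U) (hV : MeasurableSet V)
    (hU : MeasurableSet U) : HasWeakDeriv V I v g := by
  refine ⟨h.1.mono_set hVU, h.2.1.mono_set hVU, fun φ h1 h2 h3 => ?_⟩
  have h4 := h.2.2 φ h1 h2 (h3.trans hVU)
  rw [setIntegral_eq_of_subset_of_forall_sdiff_eq_zero hU hVU,
    setIntegral_eq_of_subset_of_forall_sdiff_eq_zero hU hVU] at h4
  · exact h4
  · intro x hx
    rw [image_eq_zero_of_notMem_tsupport fun hh => hx.2 (h3 hh), zero_smul]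
  · intro x hx
    have := iterDeriv_eq_zero I (φ := φ) (x := x) fun hh => hx.2 (h3 hh)
    rw [iterDeriv] at this
    rw [this, zero_smul]

/-- Fundamental lemma of the calculus of variations. It makes the infimum in the seminorm range over
representatives of one function, so any weak derivative at hand may be used to evaluate it. -/
theorem HasWeakDeriv.ae_unique (hU : IsOpen U) (h : HasWeakDeriv U I v g)
    (h' : HasWeakDeriv U I v g') : g =ᵐ[volume.restrict U] g' := by
  have key := hU.ae_eq_zero_of_integral_contDiff_smul_eq_zero (μ := volume) (f := fun x => g x - g' x)
    (h.2.1.sub h'.2.1) (fun φ h1 h2 h3 => by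
      have e1 := h.2.2 φ h1 h2 h3
      rw [h'.2.2 φ h1 h2 h3] at e1
      have e2 : ∫ x in U, φ x • g x = ∫ x in U, φ x • g' x := by
        have hne : ((-1 : ℝ) ^ k) ≠ 0 := pow_ne_zero _ (by norm_num)
        exact (smul_right_injective _ hne e1).symm
      have e3 : ∫ x in U, φ x • (g x - g' x) = 0 := by
        simp only [smul_sub]
        rw [integral_sub (integrable_smul_of_tsupport_subset hU h.2.1 h1.continuous h2 h3)
          (integrable_smul_of_tsupport_subset hU h'.2.1 h1.continuous h2 h3), e2, sub_self]
      rw [← e3, setIntegral_eq_integral_of_forall_compl_eq_zero]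
      intro x hx
      rw [image_eq_zero_of_notMem_tsupport fun hh => hx (h3 hh), zero_smul])
  rw [Filter.EventuallyEq, ae_restrict_iff' hU.measurableSet]
  filter_upwards [key] with x hx hxU
  exact sub_eq_zero.1 (hx hxU)

theorem LocallyIntegrableOn.congr_ae_restrict (hU : IsOpen U) (hg : LocallyIntegrableOn g U)
    (hgg : g =ᵐ[volume.restrict U] g') : LocallyIntegrableOn g' U := by
  rw [locallyIntegrableOn_iff hU.isLocallyClosed] at hg ⊢
  intro K hK hKc
  exact (hg K hK hKc).congr (ae_restrict_of_ae_restrict_of_subset hK hgg)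

theorem HasWeakDeriv.congr (hU : IsOpen U) (h : HasWeakDeriv U I v g)
    (hv : v =ᵐ[volume.restrict U] w) (hg : g =ᵐ[volume.restrict U] g') :
    HasWeakDeriv U I w g' := by
  refine ⟨LocallyIntegrableOn.congr_ae_restrict hU h.1 hv,
    LocallyIntegrableOn.congr_ae_restrict hU h.2.1 hg, fun φ h1 h2 h3 => ?_⟩
  have e := h.2.2 φ h1 h2 h3
  have e1 : ∫ x in U, φ x • g x = ∫ x in U, φ x • g' x := by
    refine integral_congr_ae ?_
    filter_upwards [hg] with x hx
    rw [hx]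
  rw [← e1, ← e]
  refine integral_congr_ae ?_
  filter_upwards [hv] with x hx
  rw [hx]

theorem HasWeakDeriv.sub {v' : Euc d → Euc d} (hU : IsOpen U) (h : HasWeakDeriv U I v g)
    (h' : HasWeakDeriv U I v' g') :
    HasWeakDeriv U I (fun x => v x - v' x) (fun x => g x - g' x) := by
  refine ⟨h.1.sub h'.1, h.2.1.sub h'.2.1, fun φ h1 h2 h3 => ?_⟩
  have c1 := (iterDeriv_contDiff I h1).continuous
  have c2 := hasCompactSupport_iterDeriv I h2
  have c3 := (tsupport_iterDeriv I φ).trans h3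
  change ∫ x in U, iterDeriv I φ x • (v x - v' x) = _
  simp only [smul_sub]
  rw [integral_sub (integrable_smul_of_tsupport_subset hU h.1 c1 c2 c3)
      (integrable_smul_of_tsupport_subset hU h'.1 c1 c2 c3),
    integral_sub (integrable_smul_of_tsupport_subset hU h.2.1 h1.continuous h2 h3)
      (integrable_smul_of_tsupport_subset hU h'.2.1 h1.continuous h2 h3),
    h.eq h1 h2 h3, h'.eq h1 h2 h3, smul_sub]

theorem HasWeakDeriv.add {v' : Euc d → Euc d} (hU : IsOpen U) (h : HasWeakDeriv U I v g)
    (h' : HasWeakDeriv U I v' g') :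
    HasWeakDeriv U I (fun x => v x + v' x) (fun x => g x + g' x) := by
  refine ⟨h.1.add h'.1, h.2.1.add h'.2.1, fun φ h1 h2 h3 => ?_⟩
  have c1 := (iterDeriv_contDiff I h1).continuous
  have c2 := hasCompactSupport_iterDeriv I h2
  have c3 := (tsupport_iterDeriv I φ).trans h3
  change ∫ x in U, iterDeriv I φ x • (v x + v' x) = _
  simp only [smul_add]
  rw [integral_add (integrable_smul_of_tsupport_subset hU h.1 c1 c2 c3)
      (integrable_smul_of_tsupport_subset hU h'.1 c1 c2 c3),
    integral_add (integrable_smul_of_tsupport_subset hU h.2.1 h1.continuous h2 h3)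
      (integrable_smul_of_tsupport_subset hU h'.2.1 h1.continuous h2 h3),
    h.eq h1 h2 h3, h'.eq h1 h2 h3, smul_add]

theorem HasWeakDeriv.congr_dirs {J : Fin k → Fin d} (h : HasWeakDeriv U I v g)
    (hIJ : dirs I = dirs J) : HasWeakDeriv U J v g := by
  refine ⟨h.1, h.2.1, fun φ h1 h2 h3 => ?_⟩
  have := h.eq h1 h2 h3
  rw [iterDeriv_congr_dirs I J hIJ h1] at this
  exact this

theorem HasWeakDeriv.zero {I : Fin 0 → Fin d} (h : LocallyIntegrableOn v U) :
    HasWeakDeriv U I v v := by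
  refine ⟨h, h, fun φ h1 h2 h3 => ?_⟩
  change ∫ x in U, iterDeriv I φ x • v x = _
  simp [iterDeriv_zero]

/-- The weak `i`-th partial derivative of the weak derivative of index `I`. -/
theorem HasWeakDeriv.chain {i : Fin d} (h : HasWeakDeriv U I v g)
    (h' : HasWeakDeriv U (Fin.snoc I i : Fin (k + 1) → Fin d) v g') :
    HasWeakDeriv U (fun _ : Fin 1 => i) g g' := by
  refine ⟨h.2.1, h'.2.1, fun φ h1 h2 h3 => ?_⟩
  change ∫ x in U, iterDeriv (fun _ : Fin 1 => i) φ x • g x = _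
  have c1 := iterDeriv_contDiff (fun _ : Fin 1 => i) h1
  have c2 := hasCompactSupport_iterDeriv (fun _ : Fin 1 => i) h2
  have c3 := (tsupport_iterDeriv (fun _ : Fin 1 => i) φ).trans h3
  have e1 := h.eq c1 c2 c3
  have e2 := h'.eq h1 h2 h3
  rw [iterDeriv_snoc I i h1, ← iterDeriv_one, e1, pow_succ, mul_smul] at e2
  have hne : ((-1 : ℝ) ^ k) ≠ 0 := pow_ne_zero _ (by norm_num)
  have := smul_right_injective _ hne e2
  simpa using this

theorem HasWeakDeriv.snoc {i : Fin d} (h : HasWeakDeriv U I v g)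
    (h' : HasWeakDeriv U (fun _ : Fin 1 => i) g g') :
    HasWeakDeriv U (Fin.snoc I i : Fin (k + 1) → Fin d) v g' := by
  refine ⟨h.1, h'.2.1, fun φ h1 h2 h3 => ?_⟩
  change ∫ x in U, iterDeriv (Fin.snoc I i : Fin (k + 1) → Fin d) φ x • v x = _
  have c1 := iterDeriv_contDiff (fun _ : Fin 1 => i) h1
  have c2 := hasCompactSupport_iterDeriv (fun _ : Fin 1 => i) h2
  have c3 := (tsupport_iterDeriv (fun _ : Fin 1 => i) φ).trans h3
  rw [iterDeriv_snoc I i h1, ← iterDeriv_one, h.eq c1 c2 c3, h'.eq h1 h2 h3, smul_smul, ← pow_add]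

/-! ### Seminorms -/

/-- The square root of `slobodeckijSq`. -/
def slob (θ : ℝ) (U : Set (Euc d)) (g : Euc d → Euc d) : ℝ≥0∞ :=
  slobodeckijSq θ U g ^ (1 / 2 : ℝ)

/-- The Sobolev seminorm of order `k + θ`. -/
def semi (k : ℕ) (θ : ℝ) (U : Set (Euc d)) (v : Euc d → Euc d) : ℝ≥0∞ :=
  (∑ I : Fin k → Fin d, ⨅ (g : Euc d → Euc d) (_ : HasWeakDeriv U I v g),
    slobodeckijSq θ U g) ^ (1 / 2 : ℝ)

theorem sobolevSeminorm_eq_semi (s : ℝ) (U : Set (Euc d)) (v : Euc d → Euc d) :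
    sobolevSeminorm s U v = semi ⌊s⌋₊ (s - ⌊s⌋₊) U v := rfl

theorem sobolevSeminorm_natCast (k : ℕ) (U : Set (Euc d)) (v : Euc d → Euc d) :
    sobolevSeminorm (k : ℝ) U v = semi k 0 U v := by
  rw [sobolevSeminorm_eq_semi, Nat.floor_natCast, sub_self]

theorem slob_sq (θ : ℝ) (U : Set (Euc d)) (g : Euc d → Euc d) :
    slob θ U g ^ 2 = slobodeckijSq θ U g := by
  rw [slob, ← ENNReal.rpow_natCast, ← ENNReal.rpow_mul]
  norm_num

theorem slobodeckijSq_congr {θ : ℝ} (h : g =ᵐ[volume.restrict U] g') :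
    slobodeckijSq θ U g = slobodeckijSq θ U g' := by
  unfold slobodeckijSq
  split_ifs
  · exact lintegral_congr_ae (by filter_upwards [h] with x hx; rw [hx])
  · refine lintegral_congr_ae ?_
    filter_upwards [h] with x hx
    refine lintegral_congr_ae ?_
    filter_upwards [h] with y hy
    rw [hx, hy]

theorem slob_congr {θ : ℝ} (h : g =ᵐ[volume.restrict U] g') : slob θ U g = slob θ U g' := by
  rw [slob, slob, slobodeckijSq_congr h]

theorem slobodeckijSq_mono {θ : ℝ} (h : V ⊆ U) : slobodeckijSq θ V g ≤ slobodeckijSq θ U g := by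
  unfold slobodeckijSq
  split_ifs
  · exact lintegral_mono_set h
  · exact (lintegral_mono_set h).trans (lintegral_mono fun x => lintegral_mono_set h)

theorem slob_mono {θ : ℝ} (h : V ⊆ U) : slob θ V g ≤ slob θ U g :=
  ENNReal.rpow_le_rpow (slobodeckijSq_mono h) (by norm_num)

theorem sum_rpow_half_le {ι : Type*} (s : Finset ι) (f : ι → ℝ≥0∞) :
    (∑ i ∈ s, f i) ^ (1 / 2 : ℝ) ≤ ∑ i ∈ s, f i ^ (1 / 2 : ℝ) := by
  classical
  induction s using Finset.induction_on with
  | empty => simp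
  | insert a s ha ih =>
    rw [Finset.sum_insert ha, Finset.sum_insert ha]
    exact (ENNReal.rpow_add_le_add_rpow _ _ (by norm_num) (by norm_num)).trans (by gcongr)

theorem semi_le {θ : ℝ} {G : (Fin k → Fin d) → Euc d → Euc d}
    (hG : ∀ I, HasWeakDeriv U I v (G I)) : semi k θ U v ≤ ∑ I, slob θ U (G I) := by
  refine le_trans ?_ (sum_rpow_half_le _ _)
  refine ENNReal.rpow_le_rpow (Finset.sum_le_sum fun I _ => ?_) (by norm_num)
  exact iInf₂_le (G I) (hG I)

theorem iInf_slobodeckijSq (hU : IsOpen U) {θ : ℝ} (hg : HasWeakDeriv U I v g) :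
    (⨅ (g : Euc d → Euc d) (_ : HasWeakDeriv U I v g), slobodeckijSq θ U g) =
      slobodeckijSq θ U g := by
  refine le_antisymm (iInf₂_le g hg) (le_iInf₂ fun g' hg' => ?_)
  rw [slobodeckijSq_congr (hg.ae_unique hU hg')]

theorem slob_le_semi (hU : IsOpen U) {θ : ℝ} (hg : HasWeakDeriv U I v g) :
    slob θ U g ≤ semi k θ U v := by
  refine ENNReal.rpow_le_rpow ?_ (by norm_num)
  rw [← iInf_slobodeckijSq hU hg]
  exact Finset.single_le_sum (f := fun I : Fin k → Fin d =>
    ⨅ (g : Euc d → Euc d) (_ : HasWeakDeriv U I v g), slobodeckijSq θ U g)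
    (fun _ _ => zero_le) (Finset.mem_univ I)

theorem exists_hasWeakDeriv_of_semi_lt_top {θ : ℝ} (h : semi k θ U v < ⊤) (I : Fin k → Fin d) :
    ∃ g, HasWeakDeriv U I v g ∧ slob θ U g < ⊤ := by
  have h1 : (∑ I : Fin k → Fin d, ⨅ (g : Euc d → Euc d) (_ : HasWeakDeriv U I v g),
    slobodeckijSq θ U g) < ⊤ := by
    by_contra hcon
    rw [not_lt, top_le_iff] at hcon
    rw [semi, hcon] at h
    simp at h
  have h2 := (ENNReal.sum_lt_top.1 h1) I (Finset.mem_univ I)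
  simp only [iInf_lt_iff] at h2
  obtain ⟨g, hg, h3⟩ := h2
  exact ⟨g, hg, ENNReal.rpow_lt_top_of_nonneg (by norm_num) h3.ne⟩

theorem semi_mono {θ : ℝ} (hV : IsOpen V) (hU : IsOpen U) (h : V ⊆ U) :
    semi k θ V v ≤ semi k θ U v := by
  refine ENNReal.rpow_le_rpow (Finset.sum_le_sum fun I _ => ?_) (by norm_num)
  refine le_iInf₂ fun g hg => ?_
  exact (iInf₂_le g (hg.mono h hV.measurableSet hU.measurableSet)).trans (slobodeckijSq_mono h)

theorem sobolevSeminorm_mono {s : ℝ} (hV : IsOpen V) (hU : IsOpen U) (h : V ⊆ U) :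
    sobolevSeminorm s V v ≤ sobolevSeminorm s U v := semi_mono hV hU h

theorem MemSobolev.mono {s : ℝ} (hv : MemSobolev s U v) (hV : IsOpen V) (hU : IsOpen U)
    (h : V ⊆ U) : MemSobolev s V v :=
  ⟨fun j hj => (sobolevSeminorm_mono hV hU h).trans_lt (hv.1 j hj),
    (sobolevSeminorm_mono hV hU h).trans_lt hv.2⟩

end

/-! ### Translation estimates and the bound of fractional seminorms by gradients -/

section

/-! ### Elementary integral inequalities -/

theorem sq_lintegral_le {α : Type*} [MeasurableSpace α] (μ : Measure α) {f : α → ℝ≥0∞}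
    (hf : AEMeasurable f μ) : (∫⁻ x, f x ∂μ) ^ 2 ≤ μ Set.univ * ∫⁻ x, f x ^ 2 ∂μ := by
  have h := ENNReal.lintegral_mul_le_Lp_mul_Lq μ (p := 2) (q := 2)
    (Real.holderConjugate_iff.2 ⟨by norm_num, by norm_num⟩) hf (aemeasurable_const (b := 1))
  simp only [Pi.mul_apply, mul_one, ENNReal.one_rpow, lintegral_const, one_mul] at h
  calc (∫⁻ x, f x ∂μ) ^ 2 ≤ ((∫⁻ x, f x ^ (2 : ℝ) ∂μ) ^ (1 / 2 : ℝ) * μ Set.univ ^ (1 / 2 : ℝ)) ^ 2 := by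
        gcongr
    _ = _ := by
        rw [mul_pow, ← ENNReal.rpow_natCast, ← ENNReal.rpow_natCast, ← ENNReal.rpow_mul,
          ← ENNReal.rpow_mul]
        norm_num
        rw [mul_comm]

theorem lintegral_comp_add_smul (F : Euc d → ℝ≥0∞) (y : Euc d) {h : ℝ} (hh : 0 < h) :
    ∫⁻ u, F (y + h • u) = ENNReal.ofReal (h ^ d)⁻¹ * ∫⁻ x, F x := by
  have h1 : ∫⁻ u, F (y + h • u) =
      ∫⁻ x, F (y + x) ∂(Measure.map (fun u : Euc d => h • u) volume) :=
    ((Homeomorph.smulOfNeZero h hh.ne').toMeasurableEquiv.measurableEmbedding.lintegral_map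
      (fun x => F (y + x))).symm
  rw [h1]
  have h2 := Measure.map_addHaar_smul (volume : Measure (Euc d)) hh.ne'
  rw [h2, lintegral_smul_measure, lintegral_add_left_eq_self]
  simp [abs_of_pos hh]

/-! ### Translation estimate for functions with a weak gradient -/

variable {D : Set (Euc d)} {g : Euc d → Euc d} {G : Fin d → Euc d → Euc d}

/-- For each fixed `r` the map is a translation, so the integral of the norm does not depend on `r`;
this joint integrability is what Fubini needs along segments. -/
theorem integrable_shear {f : Euc d → Euc d} (hf : StronglyMeasurable f) (hi : Integrable f)
    (τ : Euc d) : Integrable (fun z : ℝ × Euc d => f (z.2 + z.1 • τ))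
      ((volume.restrict (Set.Icc (0 : ℝ) 1)).prod volume) := by
  have hm : StronglyMeasurable (fun z : ℝ × Euc d => f (z.2 + z.1 • τ)) :=
    hf.comp_measurable (by fun_prop)
  rw [integrable_prod_iff hm.aestronglyMeasurable]
  refine ⟨.of_forall fun r => hi.comp_add_right (r • τ), ?_⟩
  have : (fun r : ℝ => ∫ y, ‖f (y + r • τ)‖) = fun _ => ∫ y, ‖f y‖ := by
    ext r
    exact integral_add_right_eq_self (fun y => ‖f y‖) (r • τ)
  simp only [this]
  exact integrable_const _

theorem weakGrad_integral_eq {U : Set (Euc d)}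
    (hG : ∀ i, HasWeakDeriv U (fun _ : Fin 1 => i) g (G i)) {φ : Euc d → ℝ}
    (h1 : ContDiff ℝ ∞ φ) (h2 : HasCompactSupport φ) (h3 : tsupport φ ⊆ U) (hU : IsOpen U)
    (τ : Euc d) :
    ∫ x in U, φ x • ∑ i, τ i • G i x = - ∫ x in U, fderiv ℝ φ x τ • g x := by
  have e1 : ∀ x, fderiv ℝ φ x τ = ∑ i, τ i * iterDeriv (fun _ : Fin 1 => i) φ x := by
    intro x
    have : τ = ∑ i, τ i • (EuclideanSpace.single i (1 : ℝ) : Euc d) := by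
      ext j; simp [Finset.sum_apply, Pi.single_apply]
    conv_lhs => rw [this]
    simp [iterDeriv_one, partialDeriv]
  have hi1 : ∀ i, Integrable (fun x => iterDeriv (fun _ : Fin 1 => i) φ x • g x)
      (volume.restrict U) := fun i => integrable_smul_of_tsupport_subset hU (hG i).1
      (iterDeriv_contDiff _ h1).continuous (hasCompactSupport_iterDeriv _ h2)
      ((tsupport_iterDeriv _ _).trans h3)
  have hi2 : ∀ i, Integrable (fun x => φ x • G i x) (volume.restrict U) := fun i =>
    integrable_smul_of_tsupport_subset hU (hG i).2.1 h1.continuous h2 h3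
  simp only [e1, Finset.sum_smul, Finset.smul_sum, mul_smul]
  rw [integral_finset_sum (μ := volume.restrict U) (f := fun i x =>
      τ i • iterDeriv (fun _ : Fin 1 => i) φ x • g x) _ (fun i _ => (hi1 i).smul (τ i)),
    integral_finset_sum (μ := volume.restrict U) (f := fun i x => φ x • τ i • G i x) _
      (fun i _ => ((hi2 i).smul (τ i)).congr (.of_forall fun x => smul_comm (τ i) (φ x) (G i x))),
    ← Finset.sum_neg_distrib]
  refine Finset.sum_congr rfl fun i _ => ?_
  have := (hG i).eq h1 h2 h3
  rw [integral_smul, this]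
  simp only [smul_comm (φ _) (τ i), integral_smul]
  simp

theorem integral_fderiv_segment {φ : Euc d → ℝ} (h1 : ContDiff ℝ ∞ φ) (y τ : Euc d) :
    ∫ r in Set.Icc (0 : ℝ) 1, fderiv ℝ φ (y - r • τ) τ = φ y - φ (y - τ) := by
  have hd : ∀ r : ℝ, HasDerivAt (fun r : ℝ => φ (y - r • τ)) (-(fderiv ℝ φ (y - r • τ) τ)) r := by
    intro r
    have ha : HasFDerivAt φ (fderiv ℝ φ (y - r • τ)) (y - r • τ) :=
      ((h1.differentiable (by simp)) _).hasFDerivAt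
    have hb : HasDerivAt (fun r : ℝ => y - r • τ) (-τ) r := by
      simpa using ((hasDerivAt_id r).smul_const τ).const_sub y
    have := ha.comp_hasDerivAt r hb
    rw [map_neg] at this
    exact this
  have hc : Continuous fun r : ℝ => -(fderiv ℝ φ (y - r • τ) τ) := by
    have := h1.continuous_fderiv (by simp)
    fun_prop
  have := intervalIntegral.integral_eq_sub_of_hasDerivAt (a := 0) (b := 1) (fun r _ => hd r)
    (hc.intervalIntegrable 0 1)
  rw [intervalIntegral.integral_neg, intervalIntegral.integral_of_le zero_le_one,
    ← integral_Icc_eq_integral_Ioc] at this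
  simp only [one_smul, zero_smul, sub_zero] at this
  linarith

/-- The fundamental theorem of calculus along the segment from `x` to `x + τ` for a field with only
a weak gradient. Tested against `φ`, the translations move onto `φ`, the weak derivative moves the
gradient onto `φ` as well, and there the classical theorem applies. Convexity keeps the segments in
`D`. -/
theorem ae_sub_eq_integral (hD : IsOpen D) (hconv : Convex ℝ D) (hgm : StronglyMeasurable g)
    (hGm : ∀ i, StronglyMeasurable (G i))
    (hG : ∀ i, HasWeakDeriv D (fun _ : Fin 1 => i) g (G i)) (τ : Euc d)
    (hgl : LocallyIntegrableOn g D) :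
    ∀ᵐ x, x ∈ {x | x ∈ D ∧ x + τ ∈ D} →
      g (x + τ) - g x - ∫ r in Set.Icc (0 : ℝ) 1, ∑ i, τ i • G i (x + r • τ) = 0 := by
  set W : Set (Euc d) := {x | x ∈ D ∧ x + τ ∈ D} with hW
  have hWo : IsOpen W := hD.inter (hD.preimage (continuous_id.add continuous_const))
  have hseg : ∀ x ∈ W, ∀ r ∈ Set.Icc (0 : ℝ) 1, x + r • τ ∈ D := by
    intro x hx r hr
    have := hconv hx.1 hx.2 (sub_nonneg.2 hr.2) hr.1 (by ring)
    convert this using 1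
    module
  -- the compact set swept by a compact subset of `W`
  have hsweep : ∀ K ⊆ W, IsCompact K → ∃ K' ⊆ D, IsCompact K' ∧ K ⊆ K' ∧
      ∀ x ∈ K, ∀ r ∈ Set.Icc (0 : ℝ) 1, x + r • τ ∈ K' := by
    intro K hK hKc
    refine ⟨(fun z : Euc d × ℝ => z.1 + z.2 • τ) '' (K ×ˢ Set.Icc (0 : ℝ) 1), ?_,
      (hKc.prod isCompact_Icc).image (by fun_prop), ?_, ?_⟩
    · rintro _ ⟨⟨x, r⟩, ⟨hx, hr⟩, rfl⟩
      exact hseg x (hK hx) r hr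
    · intro x hx
      exact ⟨(x, 0), ⟨hx, by simp⟩, by simp⟩
    · intro x hx r hr
      exact ⟨(x, r), ⟨hx, hr⟩, rfl⟩
  set H : Euc d → Euc d := fun x => ∑ i, τ i • G i x with hHdef
  have hHm : StronglyMeasurable H :=
    Finset.stronglyMeasurable_fun_sum _ fun i _ => (hGm i).const_smul (τ i)
  have hHl : LocallyIntegrableOn H D := by
    rw [locallyIntegrableOn_iff hD.isLocallyClosed]
    intro K hK hKc
    exact integrable_finset_sum _ fun i _ =>
      ((hG i).2.1.integrableOn_compact_subset hK hKc).smul (τ i)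
  have hint : ∀ K ⊆ W, IsCompact K → ∀ {f : Euc d → Euc d}, StronglyMeasurable f →
      LocallyIntegrableOn f D →
      Integrable (fun z : ℝ × Euc d => f (z.2 + z.1 • τ))
        ((volume.restrict (Set.Icc (0 : ℝ) 1)).prod (volume.restrict K)) := by
    intro K hK hKc f hfm hfl
    obtain ⟨K', hK'D, hK'c, -, hK'⟩ := hsweep K hK hKc
    have hi : Integrable (K'.indicator f) :=
      (hfl.integrableOn_compact_subset hK'D hK'c).integrable_indicator hK'c.measurableSet
    have h1 := integrable_shear (hfm.indicator hK'c.measurableSet) hi τ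
    have h2 := Integrable.mono_measure
      (μ := (volume.restrict (Set.Icc (0 : ℝ) 1)).prod (volume.restrict K)) h1
      (Measure.prod_mono le_rfl Measure.restrict_le_self)
    refine h2.congr ?_
    rw [Measure.prod_restrict]
    filter_upwards [ae_restrict_mem (measurableSet_Icc.prod hKc.measurableSet)] with z hz
    exact Set.indicator_of_mem (hK' z.2 hz.2 z.1 hz.1) f
  have hFl : LocallyIntegrableOn (fun x => ∫ r in Set.Icc (0 : ℝ) 1, H (x + r • τ)) W := by
    rw [locallyIntegrableOn_iff hWo.isLocallyClosed]
    intro K hK hKc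
    exact (hint K hK hKc hHm hHl).integral_prod_right
  have hgτ : LocallyIntegrableOn (fun x => g (x + τ)) W := by
    rw [locallyIntegrableOn_iff hWo.isLocallyClosed]
    intro K hK hKc
    have hc : IsCompact ((fun x => x + τ) '' K) := hKc.image (by fun_prop)
    have h1 : IntegrableOn g ((fun x => x + τ) '' K) := by
      refine hgl.integrableOn_compact_subset ?_ hc
      rintro _ ⟨x, hx, rfl⟩
      exact (hK hx).2
    have h2 := (h1.integrable_indicator hc.measurableSet).comp_add_right τ
    refine (integrable_indicator_iff hKc.measurableSet).1 ?_
    refine h2.congr (.of_forall fun x => ?_)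
    by_cases hx : x ∈ K
    · rw [Set.indicator_of_mem hx]
      exact Set.indicator_of_mem (Set.mem_image_of_mem _ hx) g
    · rw [Set.indicator_of_notMem hx]
      refine Set.indicator_of_notMem ?_ g
      rintro ⟨y, hy, hyx⟩
      exact hx (add_right_cancel hyx ▸ hy)
  have hgW : LocallyIntegrableOn g W := hgl.mono_set fun x hx => hx.1
  refine hWo.ae_eq_zero_of_integral_contDiff_smul_eq_zero ((hgτ.sub hgW).sub hFl)
    fun φ h1 h2 h3 => ?_
  obtain ⟨K', hK'D, hK'c, hKK', hK'⟩ := hsweep _ h3 h2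
  have hφ0 : ∀ x, x ∉ tsupport φ → φ x = 0 := fun x hx => image_eq_zero_of_notMem_tsupport hx
  have toW : ∀ f : Euc d → Euc d, ∫ x in W, φ x • f x = ∫ x, φ x • f x := fun f =>
    setIntegral_eq_integral_of_forall_compl_eq_zero fun x hx => by
      rw [hφ0 x fun h => hx (h3 h), zero_smul]
  have toK : ∀ f : Euc d → Euc d, ∫ x in tsupport φ, φ x • f x = ∫ x, φ x • f x := fun f =>
    setIntegral_eq_integral_of_forall_compl_eq_zero fun x hx => by rw [hφ0 x hx, zero_smul]
  -- translates of `φ` as test functions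
  have htr : ∀ r ∈ Set.Icc (0 : ℝ) 1, ContDiff ℝ ∞ (fun y => φ (y - r • τ)) ∧
      HasCompactSupport (fun y => φ (y - r • τ)) ∧ tsupport (fun y => φ (y - r • τ)) ⊆ K' := by
    intro r hr
    have hsup : tsupport (fun y => φ (y - r • τ)) ⊆ K' := by
      refine closure_minimal (fun y hy => ?_) hK'c.isClosed
      have := hK' (y - r • τ) (subset_tsupport φ hy) r hr
      simpa using this
    exact ⟨h1.comp (contDiff_id.sub contDiff_const),
      IsCompact.of_isClosed_subset hK'c (isClosed_tsupport _) hsup, hsup⟩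
  have eF : ∫ x, φ x • ∫ r in Set.Icc (0 : ℝ) 1, H (x + r • τ) =
      ∫ r in Set.Icc (0 : ℝ) 1, ∫ x, φ x • H (x + r • τ) := by
    have h4 : Integrable (fun z : ℝ × Euc d => φ z.2 • H (z.2 + z.1 • τ))
        ((volume.restrict (Set.Icc (0 : ℝ) 1)).prod (volume.restrict (tsupport φ))) := by
      obtain ⟨C, hC⟩ := h1.continuous.bounded_above_of_compact_support h2
      exact (hint _ h3 h2 hHm hHl).bdd_smul (C := C)
        (h1.continuous.comp continuous_snd).aestronglyMeasurable (.of_forall fun z => hC z.2)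
    calc ∫ x, φ x • ∫ r in Set.Icc (0 : ℝ) 1, H (x + r • τ)
        = ∫ x in tsupport φ, φ x • ∫ r in Set.Icc (0 : ℝ) 1, H (x + r • τ) := (toK _).symm
      _ = ∫ x in tsupport φ, ∫ r in Set.Icc (0 : ℝ) 1, φ x • H (x + r • τ) := by
          simp only [integral_smul]
      _ = ∫ r in Set.Icc (0 : ℝ) 1, ∫ x in tsupport φ, φ x • H (x + r • τ) :=
          (integral_integral_swap (f := fun r x => φ x • H (x + r • τ)) h4).symm
      _ = _ := integral_congr_ae (.of_forall fun r => toK _)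
  have eK : ∀ ψ : Euc d → ℝ, ∀ f : Euc d → Euc d, ∀ V : Set (Euc d), K' ⊆ V →
      (∀ y, y ∉ K' → ψ y = 0) → ∫ y in V, ψ y • f y = ∫ y, ψ y • f y := by
    intro ψ f V hV h0
    exact setIntegral_eq_integral_of_forall_compl_eq_zero fun x hx => by
      rw [h0 x fun h => hx (hV h), zero_smul]
  -- The translate `φ(· - r τ)` has support in the swept compact set `K' ⊆ D`, so it is an
  -- admissible test function for the weak gradient.
  have eH : ∀ r ∈ Set.Icc (0 : ℝ) 1, ∫ x, φ x • H (x + r • τ) =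
      - ∫ y in K', fderiv ℝ φ (y - r • τ) τ • g y := by
    intro r hr
    obtain ⟨t1, t2, t3⟩ := htr r hr
    have e1 : ∫ x, φ x • H (x + r • τ) = ∫ y, φ (y - r • τ) • H y := by
      rw [← integral_sub_right_eq_self (fun x => φ x • H (x + r • τ)) (r • τ)]
      simp
    have e2 := weakGrad_integral_eq hG t1 t2 (t3.trans hK'D) hD τ
    have e3 : ∀ y, fderiv ℝ (fun y => φ (y - r • τ)) y = fderiv ℝ φ (y - r • τ) := fun y => by
      exact fderiv_comp_sub _
    have h0 : ∀ y, y ∉ K' → fderiv ℝ φ (y - r • τ) τ = 0 := fun y hy => by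
      rw [← e3, fderiv_of_notMem_tsupport (𝕜 := ℝ) fun h => hy (t3 h)]
      rfl
    rw [e1, ← eK _ H D hK'D fun y hy => image_eq_zero_of_notMem_tsupport fun h => hy (t3 h), e2]
    simp only [e3]
    rw [eK _ g D hK'D h0, eK _ g K' le_rfl h0]
  have hgK : IntegrableOn g K' := hgl.integrableOn_compact_subset hK'D hK'c
  have eI : ∫ r in Set.Icc (0 : ℝ) 1, ∫ x, φ x • H (x + r • τ) =
      - ∫ y in K', (φ y - φ (y - τ)) • g y := by
    rw [setIntegral_congr_fun measurableSet_Icc eH, integral_neg]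
    congr 1
    have h5 : Continuous (fun z : ℝ × Euc d => fderiv ℝ φ (z.2 - z.1 • τ) τ) := by
      have := h1.continuous_fderiv (by simp)
      fun_prop
    have h4 : Integrable (fun z : ℝ × Euc d => fderiv ℝ φ (z.2 - z.1 • τ) τ • g z.2)
        ((volume.restrict (Set.Icc (0 : ℝ) 1)).prod (volume.restrict K')) := by
      obtain ⟨C, hC⟩ := (h1.continuous_fderiv (by simp)).bounded_above_of_compact_support
        (h2.fderiv (𝕜 := ℝ))
      refine Integrable.bdd_smul (C := C * ‖τ‖) (hgK.comp_snd _) h5.aestronglyMeasurable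
        (.of_forall fun z => ?_)
      exact ((fderiv ℝ φ (z.2 - z.1 • τ)).le_opNorm τ).trans (by gcongr; exact hC _)
    rw [integral_integral_swap (f := fun r y => fderiv ℝ φ (y - r • τ) τ • g y) h4]
    simp only [integral_smul_const, integral_fderiv_segment h1]
  have iφ : ∀ {f : Euc d → Euc d}, LocallyIntegrableOn f W → Integrable (fun x => φ x • f x) :=
    fun hf => by
      have := integrable_smul_of_tsupport_subset hWo hf h1.continuous h2 h3
      refine (integrableOn_iff_integrable_of_support_subset (s := W) fun x hx => ?_).1 this
      by_contra h
      exact hx (by simp [hφ0 x fun h' => h (h3 h')])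
  simp only [Pi.sub_apply, smul_sub]
  have eH' : (fun x => ∫ r in Set.Icc (0 : ℝ) 1, ∑ i, τ i • G i (x + r • τ)) =
    fun x => ∫ r in Set.Icc (0 : ℝ) 1, H (x + r • τ) := rfl
  have e0 : ∫ x, φ x • g (x + τ) = ∫ y in K', φ (y - τ) • g y := by
    obtain ⟨-, -, t3⟩ := htr 1 (by simp)
    rw [eK (fun y => φ (y - τ)) g K' le_rfl fun y hy => ?_,
      ← integral_sub_right_eq_self (fun x => φ x • g (x + τ)) τ]
    · simp
    · simp only [one_smul] at t3
      exact image_eq_zero_of_notMem_tsupport (f := fun y => φ (y - τ)) fun h => hy (t3 h)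
  have e00 : ∫ x, φ x • g x = ∫ y in K', φ y • g y :=
    (eK φ g K' le_rfl fun y hy => hφ0 y fun h => hy (hKK' h)).symm
  change ∫ x, (φ x • g (x + τ) - φ x • g x - φ x • ∫ r in Set.Icc (0 : ℝ) 1, H (x + r • τ)) = 0
  rw [integral_sub (f := fun x => φ x • g (x + τ) - φ x • g x) ((iφ hgτ).sub (iφ hgW)) (iφ hFl),
    integral_sub (iφ hgτ) (iφ hgW), eF, eI, e0, e00]
  simp only [sub_smul]
  have b1 : IntegrableOn (fun y => φ y • g y) K' := by
    obtain ⟨C, hC⟩ := h1.continuous.bounded_above_of_compact_support h2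
    exact hgK.bdd_smul (C := C) h1.continuous.aestronglyMeasurable (.of_forall hC)
  have b2 : IntegrableOn (fun y => φ (y - τ) • g y) K' := by
    obtain ⟨C, hC⟩ := h1.continuous.bounded_above_of_compact_support h2
    exact hgK.bdd_smul (C := C) (h1.continuous.comp (by fun_prop)).aestronglyMeasurable
      (.of_forall fun y => hC _)
  rw [integral_sub b1 b2]
  abel

theorem enorm_sum_smul_sq_le (τ : Euc d) (u : Fin d → Euc d) :
    ‖∑ i, τ i • u i‖ₑ ^ 2 ≤ d * ‖τ‖ₑ ^ 2 * ∑ i, ‖u i‖ₑ ^ 2 := by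
  have h : ‖∑ i, τ i • u i‖ ^ 2 ≤ d * ‖τ‖ ^ 2 * ∑ i, ‖u i‖ ^ 2 := by
    have h1 : ‖∑ i, τ i • u i‖ ≤ ‖τ‖ * ∑ i, ‖u i‖ := by
      rw [Finset.mul_sum]
      refine (norm_sum_le _ _).trans (Finset.sum_le_sum fun i _ => ?_)
      rw [norm_smul]
      gcongr
      exact PiLp.norm_apply_le τ i
    calc ‖∑ i, τ i • u i‖ ^ 2 ≤ (‖τ‖ * ∑ i, ‖u i‖) ^ 2 := by gcongr
      _ = ‖τ‖ ^ 2 * (∑ i, ‖u i‖) ^ 2 := by ring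
      _ ≤ ‖τ‖ ^ 2 * ((Finset.univ : Finset (Fin d)).card * ∑ i, ‖u i‖ ^ 2) := by
          gcongr; exact sq_sum_le_card_mul_sum_sq
      _ = _ := by simp; ring
  have e : ∀ x : Euc d, ‖x‖ₑ ^ 2 = ENNReal.ofReal (‖x‖ ^ 2) := fun x => by
    rw [← ofReal_norm, ENNReal.ofReal_pow (norm_nonneg _)]
  simp only [e]
  rw [← ENNReal.ofReal_sum_of_nonneg (fun i _ => by positivity), ← ENNReal.ofReal_natCast,
    ← ENNReal.ofReal_mul (by positivity), ← ENNReal.ofReal_mul (by positivity)]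
  exact ENNReal.ofReal_le_ofReal h

/-- The translation estimate `‖g(· + τ) - g‖ ≤ √d |τ| ‖∇g‖` on a convex set. -/
theorem lintegral_translate_le (hD : IsOpen D) (hconv : Convex ℝ D) (hgm : StronglyMeasurable g)
    (hGm : ∀ i, StronglyMeasurable (G i))
    (hG : ∀ i, HasWeakDeriv D (fun _ : Fin 1 => i) g (G i)) (τ : Euc d)
    (hgl : LocallyIntegrableOn g D volume) :
    ∫⁻ x in {x | x ∈ D ∧ x + τ ∈ D}, ‖g (x + τ) - g x‖ₑ ^ 2 ≤
      d * ‖τ‖ₑ ^ 2 * ∑ i, ∫⁻ x in D, ‖G i x‖ₑ ^ 2 := by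
  set W : Set (Euc d) := {x | x ∈ D ∧ x + τ ∈ D} with hW
  have hWo : IsOpen W := hD.inter (hD.preimage (continuous_id.add continuous_const))
  have hseg : ∀ x ∈ W, ∀ r ∈ Set.Icc (0 : ℝ) 1, x + r • τ ∈ D := by
    intro x hx r hr
    have := hconv hx.1 hx.2 (sub_nonneg.2 hr.2) hr.1 (by ring)
    convert this using 1
    module
  have hHm : StronglyMeasurable (fun x => ∑ i, τ i • G i x) :=
    Finset.stronglyMeasurable_fun_sum _ fun i _ => (hGm i).const_smul (τ i)
  have hHm2 : Measurable (fun z : Euc d × ℝ => ‖∑ i, τ i • G i (z.1 + z.2 • τ)‖ₑ ^ 2) :=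
    ((hHm.comp_measurable (g := fun z : Euc d × ℝ => z.1 + z.2 • τ)
      (by fun_prop)).enorm).pow_const 2
  have hGe : ∀ i, Measurable fun x => ‖G i x‖ₑ ^ 2 := fun i => (hGm i).enorm.pow_const 2
  have key := ae_sub_eq_integral hD hconv hgm hGm hG τ hgl
  -- Cauchy–Schwarz on the unit interval, Tonelli, and for each `r` the translation invariance of
  -- Lebesgue measure together with `W + r τ ⊆ D`.
  calc ∫⁻ x in W, ‖g (x + τ) - g x‖ₑ ^ 2
      ≤ ∫⁻ x in W, ∫⁻ r in Set.Icc (0 : ℝ) 1, ‖∑ i, τ i • G i (x + r • τ)‖ₑ ^ 2 := by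
        refine lintegral_mono_ae ?_
        rw [ae_restrict_iff' hWo.measurableSet]
        filter_upwards [key] with x hx hxW
        rw [sub_eq_zero.1 (hx hxW)]
        refine (pow_le_pow_left' (enorm_integral_le_lintegral_enorm _) 2).trans ?_
        refine (sq_lintegral_le _ ?_).trans_eq ?_
        · exact ((hHm.comp_measurable (g := fun r : ℝ => x + r • τ)
            (by fun_prop)).enorm).aemeasurable
        · simp
    _ = ∫⁻ r in Set.Icc (0 : ℝ) 1, ∫⁻ x in W, ‖∑ i, τ i • G i (x + r • τ)‖ₑ ^ 2 :=
        lintegral_lintegral_swap hHm2.aemeasurable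
    _ ≤ ∫⁻ r in Set.Icc (0 : ℝ) 1, ∫⁻ x in D, ‖∑ i, τ i • G i x‖ₑ ^ 2 := by
        refine setLIntegral_mono' measurableSet_Icc fun r hr => ?_
        rw [← lintegral_indicator hWo.measurableSet, ← lintegral_indicator hD.measurableSet,
          ← lintegral_add_right_eq_self (D.indicator fun x => ‖∑ i, τ i • G i x‖ₑ ^ 2) (r • τ)]
        refine lintegral_mono fun x => ?_
        by_cases hx : x ∈ W
        · rw [Set.indicator_of_mem hx, Set.indicator_of_mem (hseg x hx r hr)]
        · rw [Set.indicator_of_notMem hx]; exact zero_le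
    _ = ∫⁻ x in D, ‖∑ i, τ i • G i x‖ₑ ^ 2 := by simp
    _ ≤ ∫⁻ x in D, d * ‖τ‖ₑ ^ 2 * ∑ i, ‖G i x‖ₑ ^ 2 :=
        lintegral_mono fun x => enorm_sum_smul_sq_le τ fun i => G i x
    _ = _ := by
        rw [lintegral_const_mul _ (Finset.measurable_fun_sum _ fun i _ => hGe i),
          lintegral_finset_sum _ fun i _ => hGe i]

/-! ### The Slobodeckij seminorm is bounded by the gradient -/

/-- The integral of `|τ|^(2 - d - 2θ)` over the ball of radius `h`. -/
def kernelInt (d : ℕ) (θ h : ℝ) : ℝ≥0∞ :=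
  ∫⁻ τ in Metric.closedBall (0 : Euc d) h, ‖τ‖ₑ ^ 2 / ENNReal.ofReal (‖τ‖ ^ ((d : ℝ) + 2 * θ))

/-- Substitution `τ = h u`: the integrand scales with exponent `2 - d - 2θ` and the measure with
`d`. -/
theorem kernelInt_scale {θ h : ℝ} (hh : 0 < h) :
    kernelInt d θ h = ENNReal.ofReal (h ^ (2 - 2 * θ)) * kernelInt d θ 1 := by
  set F : Euc d → ℝ≥0∞ := (Metric.closedBall (0 : Euc d) h).indicator
    fun τ => ‖τ‖ₑ ^ 2 / ENNReal.ofReal (‖τ‖ ^ ((d : ℝ) + 2 * θ)) with hF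
  have h1 := lintegral_comp_add_smul F 0 hh
  have h2 : ∀ u, F (0 + h • u) = ENNReal.ofReal (h ^ (2 - 2 * θ - d)) *
      (Metric.closedBall (0 : Euc d) 1).indicator
        (fun τ => ‖τ‖ₑ ^ 2 / ENNReal.ofReal (‖τ‖ ^ ((d : ℝ) + 2 * θ))) u := by
    intro u
    rw [zero_add]
    by_cases hu : u ∈ Metric.closedBall (0 : Euc d) 1
    · have hu' : h • u ∈ Metric.closedBall (0 : Euc d) h := by
        simp only [mem_closedBall_zero_iff, norm_smul, Real.norm_eq_abs, abs_of_pos hh] at hu ⊢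
        nlinarith
      rw [hF, Set.indicator_of_mem hu', Set.indicator_of_mem hu, enorm_smul, norm_smul,
        Real.norm_eq_abs, abs_of_pos hh, Real.mul_rpow hh.le (norm_nonneg _),
        ENNReal.ofReal_mul (by positivity), mul_pow, Real.enorm_eq_ofReal hh.le,
        ← ENNReal.ofReal_pow hh.le, ENNReal.mul_div_mul_comm]
      · congr 1
        rw [← ENNReal.ofReal_div_of_pos (by positivity), ← Real.rpow_natCast, ← Real.rpow_sub hh]
        congr 2
        push_cast; ring
      · left; rw [Ne, ENNReal.ofReal_eq_zero, not_le]; positivity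
      · left; exact ENNReal.ofReal_ne_top
    · have hu' : h • u ∉ Metric.closedBall (0 : Euc d) h := by
        simp only [mem_closedBall_zero_iff, norm_smul, Real.norm_eq_abs, abs_of_pos hh] at hu ⊢
        nlinarith
      rw [hF, Set.indicator_of_notMem hu', Set.indicator_of_notMem hu, mul_zero]
  simp only [h2] at h1
  rw [lintegral_const_mul' _ _ ENNReal.ofReal_ne_top,
    lintegral_indicator Metric.isClosed_closedBall.measurableSet, hF,
    lintegral_indicator Metric.isClosed_closedBall.measurableSet] at h1
  have h3 : ENNReal.ofReal (h ^ d) * (ENNReal.ofReal (h ^ d)⁻¹ * kernelInt d θ h) = kernelInt d θ h := by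
    rw [← mul_assoc, ← ENNReal.ofReal_mul (by positivity), mul_inv_cancel₀ (by positivity)]
    simp
  rw [← h3, kernelInt, ← h1, ← mul_assoc, ← ENNReal.ofReal_mul (by positivity), ← Real.rpow_natCast,
    ← Real.rpow_add hh, kernelInt]
  congr 3
  ring

/-- In polar coordinates the radial integrand is `r^(1-2θ)`, which is integrable at zero because `θ
< 1`. -/
theorem kernelInt_one_lt_top (hd : 1 ≤ d) {θ : ℝ} (hθ : θ < 1) : kernelInt d θ 1 < ⊤ := by
  have : Nontrivial (Euc d) := by
    have : Nonempty (Fin d) := ⟨⟨0, hd⟩⟩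
    infer_instance
  have h1 : IntegrableOn (fun x : Euc d => ‖x‖ ^ (2 - ((d : ℝ) + 2 * θ))) (Metric.ball 0 2) := by
    rw [integrableOn_fun_norm_addHaar volume (f := fun y : ℝ => y ^ (2 - ((d : ℝ) + 2 * θ)))]
    have h2 : IntegrableOn (fun y : ℝ => y ^ (1 - 2 * θ)) (Set.Ioo 0 2) := by
      rw [intervalIntegral.integrableOn_Ioo_rpow_iff (by norm_num)]
      linarith
    refine h2.congr_fun (fun y hy => ?_) measurableSet_Ioo
    simp only [finrank_euclideanSpace, Fintype.card_fin, smul_eq_mul]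
    rw [← Real.rpow_natCast, ← Real.rpow_add hy.1]
    congr 1
    push_cast [Nat.cast_sub hd]
    ring
  have h3 : ∫⁻ x in Metric.ball (0 : Euc d) 2, ‖‖x‖ ^ (2 - ((d : ℝ) + 2 * θ))‖ₑ < ⊤ := h1.2
  refine lt_of_le_of_lt ?_ h3
  rw [kernelInt]
  refine (lintegral_mono_set (Metric.closedBall_subset_ball one_lt_two)).trans ?_
  refine lintegral_mono_ae ?_
  filter_upwards [ae_restrict_of_ae (Measure.ae_ne volume (0 : Euc d))] with x hx
  have hx0 : 0 < ‖x‖ := norm_pos_iff.2 hx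
  rw [← ofReal_norm x, ← ENNReal.ofReal_pow (norm_nonneg _),
    ← ENNReal.ofReal_div_of_pos (by positivity), Real.enorm_eq_ofReal (by positivity),
    Real.rpow_sub hx0]
  norm_cast

/-- With `y = x + τ` and the order of integration exchanged, the inner integral over `x` is the one
in the translation estimate, which contributes `|τ|²` against the singular kernel. Translations
longer than `h` never connect two points of `D`. -/
theorem slobodeckijSq_le_grad_aux (hD : IsOpen D) (hconv : Convex ℝ D) (hgm : StronglyMeasurable g)
    (hGm : ∀ i, StronglyMeasurable (G i))
    (hG : ∀ i, HasWeakDeriv D (fun _ : Fin 1 => i) g (G i))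
    (hgl : LocallyIntegrableOn g D volume) {θ h : ℝ} (hθ : θ ≠ 0)
    (hh : ∀ x ∈ D, ∀ y ∈ D, ‖x - y‖ ≤ h) :
    slobodeckijSq θ D g ≤ d * kernelInt d θ h * ∑ i, ∫⁻ x in D, ‖G i x‖ₑ ^ 2 := by
  set E := ∑ i, ∫⁻ x in D, ‖G i x‖ₑ ^ 2
  set q : Euc d → ℝ≥0∞ := fun τ => ENNReal.ofReal (‖τ‖ ^ ((d : ℝ) + 2 * θ)) with hq
  have hqm : Measurable q := by fun_prop
  set Φ : Euc d → Euc d → ℝ≥0∞ := fun x τ =>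
    {z : Euc d × Euc d | z.1 ∈ D ∧ z.1 + z.2 ∈ D}.indicator
      (fun z => ‖g (z.1 + z.2) - g z.1‖ₑ ^ 2 / q z.2) (x, τ) with hΦ
  have hmS : MeasurableSet {z : Euc d × Euc d | z.1 ∈ D ∧ z.1 + z.2 ∈ D} :=
    ((hD.preimage continuous_fst).inter (hD.preimage (continuous_fst.add continuous_snd))).measurableSet
  have hΦm : Measurable (Function.uncurry Φ) := by
    refine Measurable.indicator ?_ hmS
    have e1 : Measurable fun z : Euc d × Euc d => g (z.1 + z.2) - g z.1 :=
      ((hgm.measurable).comp (by fun_prop)).sub (hgm.measurable.comp measurable_fst)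
    exact (e1.enorm.pow_const 2).div (hqm.comp measurable_snd)
  have e1 : slobodeckijSq θ D g = ∫⁻ x, ∫⁻ τ, Φ x τ := by
    rw [slobodeckijSq, if_neg hθ, ← lintegral_indicator hD.measurableSet]
    refine lintegral_congr fun x => ?_
    by_cases hx : x ∈ D
    · rw [Set.indicator_of_mem hx, ← lintegral_indicator hD.measurableSet,
        ← lintegral_add_left_eq_self _ x]
      refine lintegral_congr fun τ => ?_
      by_cases hτ : x + τ ∈ D
      · rw [Set.indicator_of_mem hτ, hΦ]
        simp only
        rw [Set.indicator_of_mem (by exact ⟨hx, hτ⟩), hq, enorm_sub_rev, sub_add_cancel_left,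
          norm_neg]
      · rw [Set.indicator_of_notMem hτ, hΦ]
        simp only
        rw [Set.indicator_of_notMem (fun h => hτ h.2)]
    · rw [Set.indicator_of_notMem hx, hΦ]
      simp only
      symm
      rw [lintegral_eq_zero_iff' (by exact (hΦm.comp measurable_prodMk_left).aemeasurable)]
      exact .of_forall fun τ => Set.indicator_of_notMem (fun h => hx h.1) _
  have e2 : ∀ τ, ∫⁻ x, Φ x τ ≤ (Metric.closedBall (0 : Euc d) h).indicator
      (fun τ => d * (‖τ‖ₑ ^ 2 / q τ) * E) τ := by
    intro τ
    have e3 : ∫⁻ x, Φ x τ =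
        (∫⁻ x in {x | x ∈ D ∧ x + τ ∈ D}, ‖g (x + τ) - g x‖ₑ ^ 2) / q τ := by
      have hmW : MeasurableSet {x | x ∈ D ∧ x + τ ∈ D} :=
        (hD.inter (hD.preimage (continuous_id.add continuous_const))).measurableSet
      have hm2 : Measurable fun x => ‖g (x + τ) - g x‖ₑ ^ 2 :=
        ((hgm.measurable.comp (by fun_prop)).sub hgm.measurable).enorm.pow_const 2
      rw [div_eq_mul_inv, ← lintegral_mul_const _ hm2, ← lintegral_indicator hmW]
      exact lintegral_congr fun x => rfl
    rw [e3]
    by_cases hτ : τ ∈ Metric.closedBall (0 : Euc d) h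
    · rw [Set.indicator_of_mem hτ]
      refine (ENNReal.div_le_div_right
        (lintegral_translate_le hD hconv hgm hGm hG τ hgl) _).trans_eq ?_
      simp only [div_eq_mul_inv]
      ring
    · rw [Set.indicator_of_notMem hτ]
      have : {x | x ∈ D ∧ x + τ ∈ D} = ∅ := by
        ext x
        simp only [Set.mem_setOf_eq, Set.mem_empty_iff_false, iff_false]
        rintro ⟨hx, hxτ⟩
        apply hτ
        have := hh _ hxτ _ hx
        simpa using this
      rw [this]
      simp
  rw [e1, lintegral_lintegral_swap hΦm.aemeasurable]
  refine (lintegral_mono e2).trans_eq ?_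
  rw [lintegral_indicator Metric.isClosed_closedBall.measurableSet, kernelInt]
  have hm3 : Measurable fun τ : Euc d => ‖τ‖ₑ ^ 2 / q τ := by fun_prop
  rw [lintegral_mul_const _ (hm3.const_mul _), lintegral_const_mul _ hm3]

theorem slobodeckijSq_le_grad (hD : IsOpen D) (hconv : Convex ℝ D)
    (hG : ∀ i, HasWeakDeriv D (fun _ : Fin 1 => i) g (G i))
    (hgl : LocallyIntegrableOn g D volume) {θ h : ℝ} (hθ : θ ≠ 0)
    (hh : ∀ x ∈ D, ∀ y ∈ D, ‖x - y‖ ≤ h) :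
    slobodeckijSq θ D g ≤ d * kernelInt d θ h * ∑ i, ∫⁻ x in D, ‖G i x‖ₑ ^ 2 := by
  have hgm := hgl.aestronglyMeasurable
  have hGm := fun i => (hG i).2.1.aestronglyMeasurable
  have h1 := slobodeckijSq_le_grad_aux hD hconv hgm.stronglyMeasurable_mk
    (fun i => (hGm i).stronglyMeasurable_mk)
    (fun i => (hG i).congr hD hgm.ae_eq_mk (hGm i).ae_eq_mk)
    (LocallyIntegrableOn.congr_ae_restrict hD hgl hgm.ae_eq_mk) hθ hh
  rw [slobodeckijSq_congr hgm.ae_eq_mk]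
  refine h1.trans_eq ?_
  congr 1
  refine Finset.sum_congr rfl fun i _ => lintegral_congr_ae ?_
  filter_upwards [(hGm i).ae_eq_mk] with x hx
  rw [hx]

end

/-! ### Polynomial fields: derivatives, scaling and norms -/

section

open MvPolynomial (eval pderiv totalDegree coeff)

/-! ### Polynomial functions on Euclidean space -/

/-- The value of a polynomial at a point of Euclidean space. -/
def pev (P : MvPolynomial (Fin d) ℝ) (x : Euc d) : ℝ := eval (fun i => x i) P

theorem hasFDerivAt_pev (P : MvPolynomial (Fin d) ℝ) (x : Euc d) :
    HasFDerivAt (pev P) (∑ i, pev (pderiv i P) x • (EuclideanSpace.proj i : Euc d →L[ℝ] ℝ)) x := by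
  induction P using MvPolynomial.induction_on with
  | C a =>
    have : pev (MvPolynomial.C a : MvPolynomial (Fin d) ℝ) = fun _ => a := by ext; simp [pev]
    rw [this]
    refine (hasFDerivAt_const a x).congr_fderiv ?_
    simp [pev]
  | add p q hp hq =>
    have : pev (p + q) = fun x => pev p x + pev q x := by ext; simp [pev]
    rw [this]
    refine (hp.add hq).congr_fderiv ?_
    simp [pev, add_smul, Finset.sum_add_distrib]
  | mul_X p i hp =>
    have : pev (p * MvPolynomial.X i) = fun x => pev p x * (EuclideanSpace.proj i : Euc d →L[ℝ] ℝ) x := by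
      ext; simp [pev]
    rw [this]
    refine (hp.mul (EuclideanSpace.proj i : Euc d →L[ℝ] ℝ).hasFDerivAt).congr_fderiv ?_
    simp only [Derivation.leibniz, pev, MvPolynomial.pderiv_X, smul_eq_mul, map_add, map_mul,
      MvPolynomial.eval_X, add_smul, Finset.sum_add_distrib, Finset.smul_sum, smul_smul]
    congr 1
    rw [Finset.sum_eq_single i]
    · simp
    · intro j _ hj
      simp [Pi.single_apply, hj.symm]
    · simp

theorem contDiff_pev (P : MvPolynomial (Fin d) ℝ) : ContDiff ℝ ∞ (pev P) := by
  induction P using MvPolynomial.induction_on with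
  | C a =>
    have : pev (MvPolynomial.C a : MvPolynomial (Fin d) ℝ) = fun _ => a := by ext; simp [pev]
    rw [this]; exact contDiff_const
  | add p q hp hq =>
    have : pev (p + q) = fun x => pev p x + pev q x := by ext; simp [pev]
    rw [this]; exact hp.add hq
  | mul_X p i hp =>
    have : pev (p * MvPolynomial.X i) = fun x => pev p x * (EuclideanSpace.proj i : Euc d →L[ℝ] ℝ) x := by
      ext; simp [pev]
    rw [this]; exact hp.mul (EuclideanSpace.proj i : Euc d →L[ℝ] ℝ).contDiff

theorem fderiv_pev (P : MvPolynomial (Fin d) ℝ) (x : Euc d) (i : Fin d) :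
    fderiv ℝ (pev P) x (EuclideanSpace.single i 1) = pev (pderiv i P) x := by
  rw [(hasFDerivAt_pev P x).fderiv]
  simp [ContinuousLinearMap.sum_apply, Pi.single_apply]

/-- The vector field with polynomial components. -/
def pfield (P : Fin d → MvPolynomial (Fin d) ℝ) (x : Euc d) : Euc d :=
  WithLp.toLp 2 fun j => pev (P j) x

theorem pfield_apply (P : Fin d → MvPolynomial (Fin d) ℝ) (x : Euc d) (j : Fin d) :
    pfield P x j = pev (P j) x := rfl

theorem isPolyField_iff {p : ℕ} {q : Euc d → Euc d} :
    IsPolyField p q ↔ ∃ P : Fin d → MvPolynomial (Fin d) ℝ,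
      (∀ j, (P j).totalDegree ≤ p) ∧ q = pfield P := by
  constructor
  · rintro ⟨P, hP⟩
    refine ⟨P, fun j => (hP j).1, ?_⟩
    ext x j
    exact (hP j).2 x
  · rintro ⟨P, hP, rfl⟩
    exact ⟨P, fun j => ⟨hP j, fun x => rfl⟩⟩

theorem isPolyField_pfield {p : ℕ} {P : Fin d → MvPolynomial (Fin d) ℝ}
    (hP : ∀ j, (P j).totalDegree ≤ p) : IsPolyField p (pfield P) :=
  isPolyField_iff.2 ⟨P, hP, rfl⟩

theorem contDiff_pfield (P : Fin d → MvPolynomial (Fin d) ℝ) : ContDiff ℝ ∞ (pfield P) :=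
  contDiff_euclidean.2 fun j => contDiff_pev (P j)

theorem continuous_pfield (P : Fin d → MvPolynomial (Fin d) ℝ) : Continuous (pfield P) :=
  (contDiff_pfield P).continuous

theorem IsPolyField.continuous {p : ℕ} {q : Euc d → Euc d} (hq : IsPolyField p q) :
    Continuous q := by
  obtain ⟨P, -, rfl⟩ := isPolyField_iff.1 hq
  exact continuous_pfield P

theorem IsPolyField.add {p : ℕ} {q r : Euc d → Euc d} (hq : IsPolyField p q)
    (hr : IsPolyField p r) : IsPolyField p (fun x => q x + r x) := by
  obtain ⟨P, hP⟩ := hq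
  obtain ⟨R, hR⟩ := hr
  refine ⟨fun j => P j + R j, fun j => ⟨?_, fun x => ?_⟩⟩
  · exact (MvPolynomial.totalDegree_add _ _).trans (max_le (hP j).1 (hR j).1)
  · simp [(hP j).2, (hR j).2]

theorem IsPolyField.smul {p : ℕ} {q : Euc d → Euc d} (hq : IsPolyField p q) (c : ℝ) :
    IsPolyField p (fun x => c • q x) := by
  obtain ⟨P, hP⟩ := hq
  refine ⟨fun j => MvPolynomial.C c * P j, fun j => ⟨?_, fun x => ?_⟩⟩
  · refine (MvPolynomial.totalDegree_mul _ _).trans ?_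
    simpa using (hP j).1
  · simp [(hP j).2]

theorem IsPolyField.sub {p : ℕ} {q r : Euc d → Euc d} (hq : IsPolyField p q)
    (hr : IsPolyField p r) : IsPolyField p (fun x => q x - r x) := by
  have := hq.add (hr.smul (-1))
  simpa [sub_eq_add_neg] using this

theorem isPolyField_zero (p : ℕ) : IsPolyField p (fun _ : Euc d => 0) :=
  ⟨fun _ => 0, fun j => ⟨by simp, fun x => by simp⟩⟩

/-! ### Iterated partial derivatives of polynomials -/

theorem pderiv_comm (i j : Fin d) (P : MvPolynomial (Fin d) ℝ) :
    pderiv i (pderiv j P) = pderiv j (pderiv i P) := by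
  ext m
  simp only [MvPolynomial.coeff_pderiv]
  rcases eq_or_ne i j with rfl | hij
  · rfl
  · rw [add_right_comm]
    simp [Finsupp.single_apply, hij, hij.symm]
    ring

/-- The iterated partial derivative of a polynomial. -/
def pD (s : Multiset (Fin d)) (P : MvPolynomial (Fin d) ℝ) : MvPolynomial (Fin d) ℝ :=
  haveI : LeftCommutative fun (i : Fin d) (P : MvPolynomial (Fin d) ℝ) => pderiv i P :=
    ⟨fun i j P => pderiv_comm i j P⟩
  s.foldr (fun i P => pderiv i P) P

theorem pD_zero (P : MvPolynomial (Fin d) ℝ) : pD 0 P = P := rfl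

theorem pD_cons (i : Fin d) (s : Multiset (Fin d)) (P : MvPolynomial (Fin d) ℝ) :
    pD (i ::ₘ s) P = pderiv i (pD s P) := by
  simp [pD]

/-- The factor is a product of positive integers from the exponents and does not depend on the
polynomial. Degree bounds and the triangular structure used in `exists_coeff_family` are read off
from it. -/
theorem coeff_pD (s : Multiset (Fin d)) (t : Fin d →₀ ℕ) :
    ∃ a : ℝ, 0 < a ∧ ∀ P : MvPolynomial (Fin d) ℝ,
      coeff t (pD s P) = a * coeff (t + Multiset.toFinsupp s) P := by
  induction s using Multiset.induction_on generalizing t with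
  | empty => exact ⟨1, one_pos, fun P => by simp [pD_zero]⟩
  | cons i s ih =>
    obtain ⟨a, ha, h⟩ := ih (t + Finsupp.single i 1)
    refine ⟨a * (t i + 1), by positivity, fun P => ?_⟩
    rw [pD_cons, MvPolynomial.coeff_pderiv, h, ← Multiset.singleton_add, Multiset.toFinsupp_add,
      Multiset.toFinsupp_singleton, add_assoc]
    push_cast
    ring

theorem pD_linear (s : Multiset (Fin d)) : ∃ L : MvPolynomial (Fin d) ℝ →ₗ[ℝ] MvPolynomial (Fin d) ℝ,
    ∀ P, L P = pD s P := by
  induction s using Multiset.induction_on with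
  | empty => exact ⟨LinearMap.id, fun P => rfl⟩
  | cons i s ih =>
    obtain ⟨L, hL⟩ := ih
    exact ⟨(pderiv i).toLinearMap ∘ₗ L, fun P => by simp [hL, pD_cons]⟩

theorem totalDegree_le_of_coeff {P : MvPolynomial (Fin d) ℝ} {n : ℕ}
    (h : ∀ t : Fin d →₀ ℕ, n < t.degree → coeff t P = 0) : P.totalDegree ≤ n := by
  rw [MvPolynomial.totalDegree]
  refine Finset.sup_le fun t ht => ?_
  by_contra hcon
  rw [not_le] at hcon
  exact (MvPolynomial.mem_support_iff.1 ht) (h t hcon)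

theorem coeff_eq_zero_of_lt_degree {P : MvPolynomial (Fin d) ℝ} {t : Fin d →₀ ℕ}
    (h : P.totalDegree < t.degree) : coeff t P = 0 :=
  MvPolynomial.coeff_eq_zero_of_totalDegree_lt h

theorem degree_toFinsupp (s : Multiset (Fin d)) : (Multiset.toFinsupp s).degree = s.card := by
  conv_rhs => rw [← Multiset.toFinsupp_toMultiset s]
  rw [Finsupp.card_toMultiset]
  rfl

theorem totalDegree_pD_le (s : Multiset (Fin d)) {P : MvPolynomial (Fin d) ℝ} {n : ℕ}
    (h : P.totalDegree ≤ n) : (pD s P).totalDegree ≤ n := by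
  refine totalDegree_le_of_coeff fun t ht => ?_
  obtain ⟨a, -, ha⟩ := coeff_pD s t
  rw [ha, coeff_eq_zero_of_lt_degree, mul_zero]
  rw [map_add]
  omega

theorem pD_eq_zero {s : Multiset (Fin d)} {P : MvPolynomial (Fin d) ℝ}
    (h : P.totalDegree < s.card) : pD s P = 0 := by
  ext t
  obtain ⟨a, -, ha⟩ := coeff_pD s t
  rw [ha, coeff_eq_zero_of_lt_degree, mul_zero, MvPolynomial.coeff_zero]
  rw [map_add, degree_toFinsupp]
  omega

/-- The iterated derivative of a polynomial field. -/
def fD (s : Multiset (Fin d)) (P : Fin d → MvPolynomial (Fin d) ℝ) :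
    Fin d → MvPolynomial (Fin d) ℝ := fun j => pD s (P j)

theorem hasFDerivAt_pfield (P : Fin d → MvPolynomial (Fin d) ℝ) (x : Euc d) (i : Fin d) :
    fderiv ℝ (pfield P) x (EuclideanSpace.single i 1) = pfield (fun j => pderiv i (P j)) x := by
  ext j
  have h1 : DifferentiableAt ℝ (pfield P) x := ((contDiff_pfield P).differentiable (by simp)) x
  have h2 : fderiv ℝ (fun y => (EuclideanSpace.proj j : Euc d →L[ℝ] ℝ) (pfield P y)) x =
      (EuclideanSpace.proj j : Euc d →L[ℝ] ℝ).comp (fderiv ℝ (pfield P) x) :=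
    ((EuclideanSpace.proj j : Euc d →L[ℝ] ℝ).hasFDerivAt.comp x h1.hasFDerivAt).fderiv
  have h3 := DFunLike.congr_fun h2 (EuclideanSpace.single i 1)
  rw [pfield_apply, ← fderiv_pev]
  exact h3.symm

theorem locallyIntegrableOn_of_continuous {q : Euc d → Euc d} (hq : Continuous q)
    (U : Set (Euc d)) : LocallyIntegrableOn q U :=
  hq.locallyIntegrable.locallyIntegrableOn U

theorem hasWeakDeriv_pfield_one (U : Set (Euc d)) (P : Fin d → MvPolynomial (Fin d) ℝ)
    (i : Fin d) :
    HasWeakDeriv U (fun _ : Fin 1 => i) (pfield P) (pfield fun j => pderiv i (P j)) := by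
  refine ⟨locallyIntegrableOn_of_continuous (continuous_pfield _) U,
    locallyIntegrableOn_of_continuous (continuous_pfield _) U, fun φ h1 h2 h3 => ?_⟩
  have cs : ∀ {ψ : Euc d → ℝ} {f : Euc d → Euc d}, Continuous ψ → HasCompactSupport ψ →
      Continuous f → Integrable fun x => ψ x • f x := fun hψ hs hf =>
    (hψ.smul hf).integrable_of_hasCompactSupport hs.smul_right
  have hpd : Continuous fun x => fderiv ℝ φ x (EuclideanSpace.single i 1) :=
    (h1.continuous_fderiv (by simp)).clm_apply continuous_const
  have hps : HasCompactSupport fun x => fderiv ℝ φ x (EuclideanSpace.single i 1) :=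
    h2.fderiv_apply (𝕜 := ℝ) _
  have hcp := continuous_pfield P
  have hcp' := continuous_pfield fun j => pderiv i (P j)
  have key := integral_smul_fderiv_eq_neg_fderiv_smul_of_integrable (μ := (volume : Measure (Euc d)))
    (f := φ) (g := pfield P) (v := EuclideanSpace.single i 1) (cs hpd hps hcp)
    (by simpa only [hasFDerivAt_pfield] using cs h1.continuous h2 hcp') (cs h1.continuous h2 hcp)
    (fun x _ => (h1.differentiable (by simp)) x)
    (fun x _ => ((contDiff_pfield P).differentiable (by simp)) x)
  have e1 : ∀ x, (iteratedFDeriv ℝ 1 φ x fun _ => EuclideanSpace.single i (1 : ℝ)) =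
      fderiv ℝ φ x (EuclideanSpace.single i 1) := fun x => by simp
  simp only [e1]
  rw [setIntegral_eq_integral_of_forall_compl_eq_zero fun x hx => ?_,
    setIntegral_eq_integral_of_forall_compl_eq_zero fun x hx => ?_]
  · simp only [hasFDerivAt_pfield] at key
    rw [key]
    simp
  · rw [image_eq_zero_of_notMem_tsupport fun h => hx (h3 h), zero_smul]
  · rw [fderiv_of_notMem_tsupport (𝕜 := ℝ) fun h => hx (h3 h)]
    simp

theorem hasWeakDeriv_pfield (U : Set (Euc d)) (P : Fin d → MvPolynomial (Fin d) ℝ) {k : ℕ}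
    (I : Fin k → Fin d) : HasWeakDeriv U I (pfield P) (pfield (fD (dirs I) P)) := by
  induction k with
  | zero =>
    have : fD (dirs I) P = P := by ext1 j; simp [fD, dirs, pD_zero]
    rw [this]
    exact HasWeakDeriv.zero (locallyIntegrableOn_of_continuous (continuous_pfield _) U)
  | succ k ih =>
    obtain ⟨I', i, rfl⟩ : ∃ (I' : Fin k → Fin d) (i : Fin d), I = Fin.snoc I' i :=
      ⟨Fin.init I, I (Fin.last k), (Fin.snoc_init_self I).symm⟩
    refine (ih I').snoc ?_
    have := hasWeakDeriv_pfield_one U (fD (dirs I') P) i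
    rw [dirs_snoc]
    convert this using 2
    ext1 j
    simp [fD, pD_cons]

/-! ### Polynomials with prescribed mean derivatives -/

/-- A square linear system: the monomials of degree at most `n` index both the unknown coefficients
and the prescribed values, so injectivity suffices. It is triangular with respect to the degree,
with nonzero diagonal because `Λ` reproduces constants. In the application `Λ` is the mean over a
convex set. -/
theorem exists_coeff_family (n : ℕ) (Λ : MvPolynomial (Fin d) ℝ →ₗ[ℝ] ℝ) (hΛ : ∀ a, Λ (MvPolynomial.C a) = a)
    (c : Multiset (Fin d) → ℝ) :
    ∃ P : MvPolynomial (Fin d) ℝ, P.totalDegree ≤ n ∧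
      ∀ s : Multiset (Fin d), s.card ≤ n → Λ (pD s P) = c s := by
  classical
  let V := MvPolynomial.restrictTotalDegree (Fin d) ℝ n
  choose L hL using fun s : Multiset (Fin d) => pD_linear s
  -- the basis of monomials indexes both sides
  let ι := {m : Fin d →₀ ℕ // m.degree ≤ n}
  have : Finite ι := by
    have hfin : Set.Finite {m : Fin d →₀ ℕ | m.degree ≤ n} := Finsupp.finite_of_degree_le n
    exact hfin.to_subtype
  have : Fintype ι := Fintype.ofFinite ι
  let Q : (ι → ℝ) →ₗ[ℝ] MvPolynomial (Fin d) ℝ :=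
    ∑ m : ι, (MvPolynomial.monomial m.1).comp (LinearMap.proj m)
  have hQ : ∀ a t, coeff t (Q a) = if h : t.degree ≤ n then a ⟨t, h⟩ else 0 := by
    intro a t
    simp only [Q, LinearMap.sum_apply, LinearMap.comp_apply, LinearMap.proj_apply,
      MvPolynomial.coeff_sum, MvPolynomial.coeff_monomial]
    split_ifs with h
    · rw [Finset.sum_eq_single ⟨t, h⟩]
      · simp
      · intro m _ hm
        rw [if_neg]
        rintro rfl
        exact hm rfl
      · simp
    · refine Finset.sum_eq_zero fun m _ => ?_
      rw [if_neg]
      rintro rfl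
      exact h m.2
  let T : (ι → ℝ) →ₗ[ℝ] (ι → ℝ) :=
    LinearMap.pi fun m => Λ ∘ₗ L (Finsupp.toMultiset m.1) ∘ₗ Q
  have hinj : Function.Injective T := by
    rw [injective_iff_map_eq_zero]
    intro a ha
    by_contra hne
    obtain ⟨m, hm, hmax⟩ : ∃ m : ι, a m ≠ 0 ∧ ∀ m' : ι, a m' ≠ 0 → m'.1.degree ≤ m.1.degree := by
      have hne' : (Finset.univ.filter fun m : ι => a m ≠ 0).Nonempty := by
        by_contra hcon
        rw [Finset.not_nonempty_iff_eq_empty, Finset.filter_eq_empty_iff] at hcon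
        exact hne (funext fun m => not_not.1 (hcon (Finset.mem_univ m)))
      obtain ⟨m, hm, h⟩ := Finset.exists_max_image _ (fun m : ι => m.1.degree) hne'
      exact ⟨m, (Finset.mem_filter.1 hm).2, fun m' h' => h m' (Finset.mem_filter.2 ⟨Finset.mem_univ _, h'⟩)⟩
    obtain ⟨b, hb, hcoef⟩ := coeff_pD (Finsupp.toMultiset m.1) 0
    -- A nonconstant term surviving the derivative would come from a coefficient whose degree
    -- exceeds that of `m`, and such coefficients vanish by maximality.
    have h1 : pD (Finsupp.toMultiset m.1) (Q a) = MvPolynomial.C (b * a m) := by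
      ext t
      rw [MvPolynomial.coeff_C]
      split_ifs with ht
      · subst ht
        rw [hcoef, hQ, zero_add, Finsupp.toMultiset_toFinsupp, dif_pos m.2]
      · obtain ⟨b', -, hb'⟩ := coeff_pD (Finsupp.toMultiset m.1) t
        rw [hb', hQ, Finsupp.toMultiset_toFinsupp]
        split_ifs with h
        · have : a ⟨t + m.1, h⟩ = 0 := by
            by_contra hne2
            have := hmax _ hne2
            simp only [map_add] at this
            have ht0 : t.degree = 0 := by omega
            rw [Finsupp.degree_eq_zero_iff] at ht0
            exact ht ht0.symm
          rw [this, mul_zero]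
        · rw [mul_zero]
    have h2 := congrFun ha m
    simp only [T, LinearMap.pi_apply, LinearMap.comp_apply, hL, h1, hΛ, Pi.zero_apply] at h2
    exact (mul_ne_zero hb.ne' hm) h2
  obtain ⟨a, ha⟩ := (LinearMap.injective_iff_surjective.1 hinj) fun m => c (Finsupp.toMultiset m.1)
  refine ⟨Q a, totalDegree_le_of_coeff fun t ht => ?_, fun s hs => ?_⟩
  · rw [hQ, dif_neg (by omega)]
  · have := congrFun ha ⟨Multiset.toFinsupp s, by rw [degree_toFinsupp]; exact hs⟩
    simpa [T, hL] using this

end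

section

open MvPolynomial (eval pderiv totalDegree coeff)

/-! ### Auxiliary facts on powers and on the seminorms of order zero -/

theorem ofReal_rpow_mul {h : ℝ} (hh : 0 < h) (a b : ℝ) :
    ENNReal.ofReal (h ^ a) * ENNReal.ofReal (h ^ b) = ENNReal.ofReal (h ^ (a + b)) := by
  rw [← ENNReal.ofReal_mul (by positivity), Real.rpow_add hh]

theorem slob_zero_eq (U : Set (Euc d)) (g : Euc d → Euc d) :
    slob 0 U g = (∫⁻ x in U, ‖g x‖ₑ ^ 2) ^ (1 / 2 : ℝ) := by
  simp [slob, slobodeckijSq]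

theorem eLpNorm_two_eq {α F : Type*} [MeasurableSpace α] [NormedAddCommGroup F] (μ : Measure α)
    (f : α → F) : eLpNorm f 2 μ = (∫⁻ x, ‖f x‖ₑ ^ 2 ∂μ) ^ (1 / 2 : ℝ) := by
  rw [eLpNorm_eq_lintegral_rpow_enorm_toReal (by norm_num) (by norm_num)]
  norm_num

theorem slob_zero_eq_eLpNorm (U : Set (Euc d)) (g : Euc d → Euc d) :
    slob 0 U g = eLpNorm g 2 (volume.restrict U) := by
  rw [slob_zero_eq, eLpNorm_two_eq]

theorem slob_zero_add_le {U : Set (Euc d)} {f g : Euc d → Euc d}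
    (hf : AEStronglyMeasurable f (volume.restrict U))
    (hg : AEStronglyMeasurable g (volume.restrict U)) :
    slob 0 U (fun x => f x + g x) ≤ slob 0 U f + slob 0 U g := by
  simp only [slob_zero_eq_eLpNorm]
  exact eLpNorm_add_le hf hg (by norm_num)

theorem slob_zero_sub_le {U : Set (Euc d)} {f g : Euc d → Euc d}
    (hf : AEStronglyMeasurable f (volume.restrict U))
    (hg : AEStronglyMeasurable g (volume.restrict U)) :
    slob 0 U (fun x => f x - g x) ≤ slob 0 U f + slob 0 U g := by
  simp only [slob_zero_eq_eLpNorm]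
  exact eLpNorm_sub_le hf hg (by norm_num)

theorem slob_zero_le_sup {U : Set (Euc d)} (hU : MeasurableSet U) {g : Euc d → Euc d} {M : ℝ≥0∞}
    (h : ∀ x ∈ U, ‖g x‖ₑ ≤ M) : slob 0 U g ≤ M * volume U ^ (1 / 2 : ℝ) := by
  rw [slob_zero_eq]
  calc (∫⁻ x in U, ‖g x‖ₑ ^ 2) ^ (1 / 2 : ℝ) ≤ (M ^ 2 * volume U) ^ (1 / 2 : ℝ) := by
        refine ENNReal.rpow_le_rpow ?_ (by norm_num)
        rw [← setLIntegral_const]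
        exact setLIntegral_mono' hU fun x hx => pow_le_pow_left' (h x hx) 2
    _ = _ := by
        rw [ENNReal.mul_rpow_of_nonneg _ _ (by norm_num), ← ENNReal.rpow_natCast,
          ← ENNReal.rpow_mul]
        norm_num

/-- The square root of the volume of the unit ball. -/
def ballConst (d : ℕ) : ℝ≥0∞ := volume (Metric.ball (0 : Euc d) 1) ^ (1 / 2 : ℝ)

theorem ballConst_ne_top : ballConst d ≠ ⊤ :=
  (ENNReal.rpow_lt_top_of_nonneg (by norm_num) measure_ball_lt_top.ne).ne

theorem ballConst_ne_zero : ballConst d ≠ 0 := by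
  rw [ballConst, Ne, ENNReal.rpow_eq_zero_iff]
  have := (Metric.measure_ball_pos volume (0 : Euc d) one_pos).ne'
  simp [this]

theorem volume_closedBall_rpow_half (x : Euc d) {ρ : ℝ} (hρ : 0 < ρ) :
    volume (Metric.closedBall x ρ) ^ (1 / 2 : ℝ) =
      ENNReal.ofReal (ρ ^ ((d : ℝ) / 2)) * ballConst d := by
  rw [Measure.addHaar_closedBall _ _ hρ.le, ENNReal.mul_rpow_of_nonneg _ _ (by norm_num), ballConst,
    finrank_euclideanSpace, Fintype.card_fin, ENNReal.ofReal_rpow_of_nonneg (by positivity)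
    (by norm_num), ← Real.rpow_natCast, ← Real.rpow_mul hρ.le]
  congr 4
  ring

theorem volume_ball_rpow_half (x : Euc d) {ρ : ℝ} (hρ : 0 < ρ) :
    volume (Metric.ball x ρ) ^ (1 / 2 : ℝ) =
      ENNReal.ofReal (ρ ^ ((d : ℝ) / 2)) * ballConst d := by
  rw [← volume_closedBall_rpow_half x hρ, Measure.addHaar_ball_of_pos _ _ hρ,
    Measure.addHaar_closedBall _ _ hρ.le]

/-! ### Norms of polynomials -/

theorem pev_memLp (P : MvPolynomial (Fin d) ℝ) :
    MemLp (pev P) 2 (volume.restrict (Metric.ball (0 : Euc d) 1)) := by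
  obtain ⟨C, hC⟩ := (isCompact_closedBall (0 : Euc d) 1).exists_bound_of_continuousOn
    (contDiff_pev P).continuous.continuousOn
  have : IsFiniteMeasure (volume.restrict (Metric.ball (0 : Euc d) 1)) :=
    ⟨by rw [Measure.restrict_apply_univ]; exact measure_ball_lt_top⟩
  refine MemLp.of_bound (contDiff_pev P).continuous.aestronglyMeasurable C ?_
  filter_upwards [ae_restrict_mem measurableSet_ball] with x hx
  exact hC x (Metric.ball_subset_closedBall hx)

theorem eq_zero_of_ae_ball {P : MvPolynomial (Fin d) ℝ}
    (h : pev P =ᵐ[volume.restrict (Metric.ball (0 : Euc d) 1)] 0) : P = 0 := by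
  have h1 : Set.EqOn (pev P) 0 (Metric.ball (0 : Euc d) 1) :=
    Measure.eqOn_open_of_ae_eq h Metric.isOpen_ball (contDiff_pev P).continuous.continuousOn
      continuousOn_const
  -- A polynomial is determined by its values on a product of infinite sets. The side `1/(d+1)` puts
  -- the cube inside the unit ball, since `d/(d+1)² < 1`.
  refine MvPolynomial.funext_set (s := fun _ => Set.Ioo (0 : ℝ) (1 / (d + 1)))
    (fun i => Set.Ioo_infinite (by positivity)) fun x hx => ?_
  have h2 : WithLp.toLp 2 x ∈ Metric.ball (0 : Euc d) 1 := by
    rw [mem_ball_zero_iff]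
    calc ‖(WithLp.toLp 2 x : Euc d)‖ = √(∑ i, x i ^ 2) := by
          rw [EuclideanSpace.norm_eq]; simp
      _ ≤ √(∑ _i : Fin d, (1 / (d + 1)) ^ 2) := by
          refine Real.sqrt_le_sqrt (Finset.sum_le_sum fun i _ => ?_)
          have := hx i (Set.mem_univ i)
          exact pow_le_pow_left₀ this.1.le this.2.le 2
      _ < 1 := by
          rw [Real.sqrt_lt' one_pos]
          simp only [Finset.sum_const, Finset.card_univ, Fintype.card_fin, nsmul_eq_mul]
          rw [div_pow, one_pow, mul_one_div, div_lt_one (by positivity)]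
          have : (0 : ℝ) ≤ d := by positivity
          nlinarith
  simpa [pev] using h1 h2

/-- On the finite dimensional space of polynomials of degree at most `p` the `L²` norm of the unit
ball is a norm, so every linear map into the continuous functions on a ball of radius `κ` is
bounded. The map `A` is the identity or a partial derivative in the applications. -/
theorem pev_unit_bound (p : ℕ) (κ : ℝ)
    (A : MvPolynomial (Fin d) ℝ →ₗ[ℝ] MvPolynomial (Fin d) ℝ) :
    ∃ C : ℝ≥0, ∀ P : MvPolynomial (Fin d) ℝ, P.totalDegree ≤ p → ∀ x : Euc d, ‖x‖ ≤ κ →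
      ‖pev (A P) x‖ₑ ≤ C * (∫⁻ y in Metric.ball (0 : Euc d) 1, ‖pev P y‖ₑ ^ 2) ^ (1 / 2 : ℝ) := by
  let V := MvPolynomial.restrictTotalDegree (Fin d) ℝ p
  let μ := volume.restrict (Metric.ball (0 : Euc d) 1)
  let ι : V →ₗ[ℝ] Lp ℝ 2 μ :=
    { toFun := fun P => (pev_memLp P.1).toLp _
      map_add' := fun P Q => by
        rw [← MemLp.toLp_add]
        congr 1
        ext x; simp [pev]
      map_smul' := fun c P => by
        rw [RingHom.id_apply, ← MemLp.toLp_const_smul]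
        congr 1
        ext x; simp [pev, MvPolynomial.smul_eval] }
  have hι : Function.Injective ι := by
    rw [injective_iff_map_eq_zero]
    intro P hP
    refine Subtype.ext (eq_zero_of_ae_ball ?_)
    exact ((pev_memLp P.1).coeFn_toLp.symm).trans (Lp.eq_zero_iff_ae_eq_zero.1 hP)
  have : CompactSpace (Metric.closedBall (0 : Euc d) κ) :=
    isCompact_iff_compactSpace.1 (isCompact_closedBall _ _)
  let B : V →ₗ[ℝ] C(Metric.closedBall (0 : Euc d) κ, ℝ) :=
    { toFun := fun P => ⟨fun x => pev (A P.1) x, (contDiff_pev _).continuous.comp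
        continuous_subtype_val⟩
      map_add' := fun P Q => by ext x; simp [pev]
      map_smul' := fun c P => by ext x; simp [pev, MvPolynomial.smul_eval] }
  let e := LinearEquiv.ofInjective ι hι
  let F := LinearMap.toContinuousLinearMap (B ∘ₗ e.symm.toLinearMap)
  refine ⟨‖F‖₊, fun P hP x hx => ?_⟩
  let PV : V := ⟨P, (MvPolynomial.mem_restrictTotalDegree _ _ _).2 hP⟩
  have h1 : ‖F (e PV)‖ ≤ ‖F‖ * ‖e PV‖ := F.le_opNorm _
  have h2 : F (e PV) = B PV := by simp [F]
  have h3 : ‖pev (A P) x‖ ≤ ‖B PV‖ :=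
    (B PV).norm_coe_le_norm ⟨x, by simpa using hx⟩
  have h4 : ‖e PV‖ₑ = (∫⁻ y in Metric.ball (0 : Euc d) 1, ‖pev P y‖ₑ ^ 2) ^ (1 / 2 : ℝ) := by
    have : ‖e PV‖ₑ = ‖(pev_memLp P).toLp _‖ₑ := rfl
    rw [this, Lp.enorm_toLp, eLpNorm_two_eq]
  rw [← h4, ← ofReal_norm, ← ofReal_norm, ← ENNReal.ofReal_coe_nnreal,
    ← ENNReal.ofReal_mul (by positivity)]
  refine ENNReal.ofReal_le_ofReal ?_
  rw [h2] at h1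
  exact h3.trans h1

theorem enorm_apply_le (u : Euc d) (j : Fin d) : ‖u j‖ₑ ≤ ‖u‖ₑ := by
  rw [← ofReal_norm, ← ofReal_norm]
  exact ENNReal.ofReal_le_ofReal (PiLp.norm_apply_le u j)

theorem enorm_le_sum_apply (u : Euc d) : ‖u‖ₑ ≤ ∑ j, ‖u j‖ₑ := by
  have h : u = ∑ j, EuclideanSpace.single j (u j) := by
    ext j; simp [Finset.sum_apply, Pi.single_apply]
  conv_lhs => rw [h]
  refine (enorm_sum_le _ _).trans (Finset.sum_le_sum fun j _ => ?_)
  rw [← ofReal_norm, ← ofReal_norm, EuclideanSpace.norm_single]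

theorem totalDegree_bind₁_le {P : MvPolynomial (Fin d) ℝ} {p : ℕ} (hP : P.totalDegree ≤ p)
    {L : Fin d → MvPolynomial (Fin d) ℝ} (hL : ∀ i, (L i).totalDegree ≤ 1) :
    (MvPolynomial.bind₁ L P).totalDegree ≤ p := by
  rw [MvPolynomial.bind₁, MvPolynomial.aeval_def, MvPolynomial.eval₂_eq]
  refine MvPolynomial.totalDegree_finsetSum_le fun m hm => ?_
  refine (MvPolynomial.totalDegree_mul _ _).trans ?_
  rw [MvPolynomial.algebraMap_eq, MvPolynomial.totalDegree_C, zero_add]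
  refine (MvPolynomial.totalDegree_finset_prod _ _).trans ?_
  refine le_trans (Finset.sum_le_sum fun i _ => (MvPolynomial.totalDegree_pow _ _).trans
    (Nat.mul_le_mul_left _ (hL i))) ?_
  simp only [mul_one]
  exact (MvPolynomial.le_totalDegree hm).trans hP

theorem pev_bind₁ (P : MvPolynomial (Fin d) ℝ) (L : Fin d → MvPolynomial (Fin d) ℝ) (x : Euc d) :
    pev (MvPolynomial.bind₁ L P) x = pev P (WithLp.toLp 2 fun i => pev (L i) x) := by
  simp only [pev, MvPolynomial.eval, MvPolynomial.eval₂Hom_bind₁]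

/-- The polynomial `u ↦ P (y + ρ u)`. -/
def rescale (y : Euc d) (ρ : ℝ) (P : MvPolynomial (Fin d) ℝ) : MvPolynomial (Fin d) ℝ :=
  MvPolynomial.bind₁ (fun i => MvPolynomial.C (y i) + MvPolynomial.C ρ * MvPolynomial.X i) P

theorem totalDegree_rescale (y : Euc d) (ρ : ℝ) {P : MvPolynomial (Fin d) ℝ} {p : ℕ}
    (hP : P.totalDegree ≤ p) : (rescale y ρ P).totalDegree ≤ p := by
  refine totalDegree_bind₁_le hP fun i => ?_
  refine (MvPolynomial.totalDegree_add _ _).trans (max_le (by simp) ?_)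
  refine (MvPolynomial.totalDegree_mul _ _).trans ?_
  simp

theorem pev_rescale (y : Euc d) (ρ : ℝ) (P : MvPolynomial (Fin d) ℝ) (u : Euc d) :
    pev (rescale y ρ P) u = pev P (y + ρ • u) := by
  rw [rescale, pev_bind₁]
  congr 1
  ext i
  simp [pev]

theorem pev_pderiv_rescale (y : Euc d) (ρ : ℝ) (P : MvPolynomial (Fin d) ℝ) (u : Euc d)
    (i : Fin d) : pev (pderiv i (rescale y ρ P)) u = ρ * pev (pderiv i P) (y + ρ • u) := by
  have h1 : pev (rescale y ρ P) = fun u => pev P (y + ρ • u) := funext (pev_rescale y ρ P)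
  have h2 : HasFDerivAt (fun u : Euc d => y + ρ • u) (ρ • ContinuousLinearMap.id ℝ (Euc d)) u :=
    ((hasFDerivAt_id u).const_smul ρ).const_add y
  have h3 := (((contDiff_pev P).differentiable (by simp)) (y + ρ • u)).hasFDerivAt.comp u h2
  rw [← fderiv_pev, ← fderiv_pev, h1]
  have h4 : fderiv ℝ (fun u => pev P (y + ρ • u)) u = _ := h3.fderiv
  rw [h4]
  simp

theorem slob_zero_rescale (y : Euc d) {ρ : ℝ} (hρ : 0 < ρ) (f : Euc d → Euc d) :
    slob 0 (Metric.ball 0 1) (fun u => f (y + ρ • u)) =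
      ENNReal.ofReal (ρ ^ (-(d : ℝ) / 2)) * slob 0 (Metric.ball y ρ) f := by
  have h1 := lintegral_comp_add_smul ((Metric.ball y ρ).indicator fun x => ‖f x‖ₑ ^ 2) y hρ
  have h2 : ∀ u, (Metric.ball y ρ).indicator (fun x => ‖f x‖ₑ ^ 2) (y + ρ • u) =
      (Metric.ball (0 : Euc d) 1).indicator (fun u => ‖f (y + ρ • u)‖ₑ ^ 2) u := by
    intro u
    have : y + ρ • u ∈ Metric.ball y ρ ↔ u ∈ Metric.ball (0 : Euc d) 1 := by
      simp only [Metric.mem_ball, dist_eq_norm, add_sub_cancel_left, norm_smul, Real.norm_eq_abs,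
        abs_of_pos hρ, sub_zero]
      exact mul_lt_iff_lt_one_right hρ
    by_cases hu : u ∈ Metric.ball (0 : Euc d) 1
    · rw [Set.indicator_of_mem hu, Set.indicator_of_mem (this.2 hu)]
    · rw [Set.indicator_of_notMem hu, Set.indicator_of_notMem (fun h => hu (this.1 h))]
  simp only [h2] at h1
  rw [lintegral_indicator measurableSet_ball, lintegral_indicator measurableSet_ball] at h1
  rw [slob_zero_eq, slob_zero_eq, h1, ENNReal.mul_rpow_of_nonneg _ _ (by norm_num),
    ENNReal.ofReal_rpow_of_nonneg (by positivity) (by norm_num), ← Real.rpow_natCast,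
    ← Real.rpow_neg hρ.le, ← Real.rpow_mul hρ.le]
  congr 4
  ring

theorem pfield_unit_bound (p : ℕ) (κ : ℝ)
    (A : MvPolynomial (Fin d) ℝ →ₗ[ℝ] MvPolynomial (Fin d) ℝ) :
    ∃ C : ℝ≥0, ∀ P : Fin d → MvPolynomial (Fin d) ℝ, (∀ j, (P j).totalDegree ≤ p) →
      ∀ x : Euc d, ‖x‖ ≤ κ →
        ‖pfield (fun j => A (P j)) x‖ₑ ≤ C * slob 0 (Metric.ball 0 1) (pfield P) := by
  obtain ⟨C, hC⟩ := pev_unit_bound p κ A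
  refine ⟨d * C, fun P hP x hx => ?_⟩
  refine (enorm_le_sum_apply _).trans ?_
  have h1 : ∀ j, ‖pfield (fun j => A (P j)) x j‖ₑ ≤ C * slob 0 (Metric.ball 0 1) (pfield P) := by
    intro j
    refine (hC (P j) (hP j) x hx).trans ?_
    rw [slob_zero_eq]
    gcongr with y
    exact enorm_apply_le (pfield P y) j
  refine (Finset.sum_le_sum fun j _ => h1 j).trans_eq ?_
  simp [mul_assoc]

/-- The substitution `x = y + ρ u` reduces to the unit ball. The `L²` norm contributes the factor
`ρ^(-d/2)`, and a derivative one more `ρ^(-1)`. -/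
theorem pfield_bound (p : ℕ) (κ : ℝ) :
    ∃ C : ℝ≥0, ∀ P : Fin d → MvPolynomial (Fin d) ℝ, (∀ j, (P j).totalDegree ≤ p) →
      ∀ (y : Euc d) (ρ : ℝ), 0 < ρ → ∀ x : Euc d, ‖x - y‖ ≤ κ * ρ →
        ‖pfield P x‖ₑ ≤ C * (ENNReal.ofReal (ρ ^ (-(d : ℝ) / 2)) *
          slob 0 (Metric.ball y ρ) (pfield P)) ∧
        ∀ i, ‖pfield (fun j => pderiv i (P j)) x‖ₑ ≤ C * (ENNReal.ofReal (ρ ^ (-1 - (d : ℝ) / 2)) *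
          slob 0 (Metric.ball y ρ) (pfield P)) := by
  obtain ⟨C0, hC0⟩ := pfield_unit_bound (d := d) p κ LinearMap.id
  choose C1 hC1 using fun i : Fin d => pfield_unit_bound (d := d) p κ (pderiv i).toLinearMap
  refine ⟨C0 + ∑ i, C1 i, fun P hP y ρ hρ x hx => ?_⟩
  set Q : Fin d → MvPolynomial (Fin d) ℝ := fun j => rescale y ρ (P j) with hQ
  have hQd : ∀ j, (Q j).totalDegree ≤ p := fun j => totalDegree_rescale y ρ (hP j)
  have hQP : pfield Q = fun u => pfield P (y + ρ • u) := by
    ext u j; exact pev_rescale y ρ (P j) u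
  set u : Euc d := ρ⁻¹ • (x - y) with hu
  have hux : y + ρ • u = x := by
    rw [hu, smul_smul, mul_inv_cancel₀ hρ.ne', one_smul, add_sub_cancel]
  have hun : ‖u‖ ≤ κ := by
    rw [hu, norm_smul, norm_inv, Real.norm_eq_abs, abs_of_pos hρ, inv_mul_le_iff₀ hρ, mul_comm]
    exact hx
  have hN : slob 0 (Metric.ball 0 1) (pfield Q) =
      ENNReal.ofReal (ρ ^ (-(d : ℝ) / 2)) * slob 0 (Metric.ball y ρ) (pfield P) := by
    rw [hQP, slob_zero_rescale y hρ]
  constructor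
  · have h := hC0 Q hQd u hun
    simp only [LinearMap.id_coe, id_eq] at h
    rw [hN, hQP] at h
    simp only [hux] at h
    refine h.trans ?_
    gcongr
    simp
  · intro i
    have h := hC1 i Q hQd u hun
    rw [hN] at h
    have e1 : pfield (fun j => (pderiv i).toLinearMap (Q j)) u =
        ρ • pfield (fun j => pderiv i (P j)) x := by
      ext j
      have := pev_pderiv_rescale y ρ (P j) u i
      rw [hux] at this
      exact this
    have hC1le : C1 i ≤ C0 + ∑ i, C1 i :=
      (Finset.single_le_sum (fun _ _ => zero_le) (Finset.mem_univ i)).trans (by simp)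
    have e2 : ‖pfield (fun j => pderiv i (P j)) x‖ₑ =
        ENNReal.ofReal (ρ ^ (-1 : ℝ)) * ‖ρ • pfield (fun j => pderiv i (P j)) x‖ₑ := by
      rw [enorm_smul, ← mul_assoc, Real.enorm_eq_ofReal hρ.le, ← ENNReal.ofReal_mul (by positivity),
        Real.rpow_neg_one, inv_mul_cancel₀ hρ.ne']
      simp
    rw [e2, ← e1]
    calc _ ≤ ENNReal.ofReal (ρ ^ (-1 : ℝ)) * (C1 i * (ENNReal.ofReal (ρ ^ (-(d : ℝ) / 2)) *
          slob 0 (Metric.ball y ρ) (pfield P))) := by gcongr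
      _ = C1 i * (ENNReal.ofReal (ρ ^ (-1 - (d : ℝ) / 2)) * slob 0 (Metric.ball y ρ) (pfield P)) := by
          have : (-1 - (d : ℝ) / 2) = -1 + (-(d : ℝ) / 2) := by ring
          rw [this, ← ofReal_rpow_mul hρ]
          ring
      _ ≤ _ := by gcongr

theorem pfield_fD_bound (p : ℕ) (κ : ℝ) (k : ℕ) :
    ∃ C : ℝ≥0, ∀ P : Fin d → MvPolynomial (Fin d) ℝ, (∀ j, (P j).totalDegree ≤ p) →
      ∀ s : Multiset (Fin d), s.card = k →
      ∀ (y : Euc d) (ρ : ℝ), 0 < ρ → ∀ x : Euc d, ‖x - y‖ ≤ κ * ρ →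
        ‖pfield (fD s P) x‖ₑ ≤ C * (ENNReal.ofReal (ρ ^ (-(k : ℝ) - (d : ℝ) / 2)) *
          slob 0 (Metric.ball y ρ) (pfield P)) := by
  induction k generalizing κ with
  | zero =>
    obtain ⟨C, hC⟩ := pfield_bound (d := d) p κ
    refine ⟨C, fun P hP s hs y ρ hρ x hx => ?_⟩
    have hs0 : s = 0 := Multiset.card_eq_zero.1 hs
    have e : fD s P = P := by ext1 j; simp [fD, hs0, pD_zero]
    have := (hC P hP y ρ hρ x hx).1
    rw [e]
    convert this using 5
    push_cast; ring
  | succ k ih =>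
    -- The induction hypothesis enters only through an `L²` norm over the ball of radius `ρ` itself,
    -- hence with ratio `1`. The volume of that ball supplies `ρ^(d/2)`, which cancels one of the
    -- two factors `ρ^(-d/2)`.
    obtain ⟨C1, hC1⟩ := ih 1
    obtain ⟨C, hC⟩ := pfield_bound (d := d) p κ
    refine ⟨C * C1 * (ballConst d).toNNReal, fun P hP s hs y ρ hρ x hx => ?_⟩
    obtain ⟨i, s', rfl⟩ : ∃ i s', s = i ::ₘ s' := by
      obtain ⟨i, hi⟩ := Multiset.card_pos_iff_exists_mem.1 (by omega : 0 < s.card)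
      exact ⟨i, _, (Multiset.cons_erase hi).symm⟩
    have hs' : s'.card = k := by simpa using hs
    have e : fD (i ::ₘ s') P = fun j => pderiv i (fD s' P j) := by ext1 j; simp [fD, pD_cons]
    have h1 := (hC (fD s' P) (fun j => totalDegree_pD_le s' (hP j)) y ρ hρ x hx).2 i
    have h2 : slob 0 (Metric.ball y ρ) (pfield (fD s' P)) ≤
        C1 * (ENNReal.ofReal (ρ ^ (-(k : ℝ) - (d : ℝ) / 2)) *
          slob 0 (Metric.ball y ρ) (pfield P)) * (ENNReal.ofReal (ρ ^ ((d : ℝ) / 2)) * ballConst d) := by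
      rw [← volume_ball_rpow_half y hρ]
      refine slob_zero_le_sup measurableSet_ball fun z hz => hC1 P hP s' hs' y ρ hρ z ?_
      rw [one_mul]
      exact (mem_ball_iff_norm.1 hz).le
    rw [e]
    refine h1.trans ((mul_le_mul_right (mul_le_mul_right h2 _) _).trans_eq ?_)
    have e3 : ENNReal.ofReal (ρ ^ (-((k + 1 : ℕ) : ℝ) - (d : ℝ) / 2)) =
        ENNReal.ofReal (ρ ^ (-1 - (d : ℝ) / 2)) * ENNReal.ofReal (ρ ^ (-(k : ℝ) - (d : ℝ) / 2)) *
          ENNReal.ofReal (ρ ^ ((d : ℝ) / 2)) := by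
      rw [ofReal_rpow_mul hρ, ofReal_rpow_mul hρ]
      congr 2
      push_cast; ring
    rw [e3, ENNReal.coe_mul, ENNReal.coe_mul, ENNReal.coe_toNNReal ballConst_ne_top]
    ring

end

/-! ### Inverse estimates and Poincaré inequalities on convex sets -/

section

open MvPolynomial (eval pderiv totalDegree coeff)

/-! ### Convex sets of comparable inner and outer size -/

/-- `D` is open and convex, has diameter at most `h`, and contains a ball of radius `κ h`. -/
structure Fat (κ h : ℝ) (D : Set (Euc d)) : Prop where
  isOpen : IsOpen D
  convex : Convex ℝ D
  pos : 0 < h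
  diam : ∀ x ∈ D, ∀ y ∈ D, ‖x - y‖ ≤ h
  ball : ∃ y, Metric.ball y (κ * h) ⊆ D

variable {κ h : ℝ} {D : Set (Euc d)}

theorem Fat.volume_le (hκ : 0 < κ) (hD : Fat κ h D) :
    volume D ^ (1 / 2 : ℝ) ≤ ENNReal.ofReal (h ^ ((d : ℝ) / 2)) * ballConst d := by
  obtain ⟨y, hy⟩ := hD.ball
  have hyD : y ∈ D := hy (Metric.mem_ball_self (mul_pos hκ hD.pos))
  rw [← volume_closedBall_rpow_half y hD.pos]
  refine ENNReal.rpow_le_rpow (measure_mono fun x hx => ?_) (by norm_num)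
  rw [mem_closedBall_iff_norm]
  exact hD.diam x hx y hyD

theorem Fat.le_volume (hκ : 0 < κ) (hD : Fat κ h D) :
    ENNReal.ofReal (κ ^ ((d : ℝ) / 2)) * (ENNReal.ofReal (h ^ ((d : ℝ) / 2)) * ballConst d) ≤
      volume D ^ (1 / 2 : ℝ) := by
  obtain ⟨y, hy⟩ := hD.ball
  rw [← mul_assoc, ← ENNReal.ofReal_mul (by positivity), ← Real.mul_rpow hκ.le hD.pos.le,
    ← volume_ball_rpow_half y (mul_pos hκ hD.pos)]
  exact ENNReal.rpow_le_rpow (measure_mono hy) (by norm_num)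

theorem Fat.volume_lt_top (hD : Fat κ h D) : volume D < ⊤ := by
  rcases D.eq_empty_or_nonempty with rfl | ⟨y, hy⟩
  · simp
  · refine (measure_mono fun x hx => ?_).trans_lt (measure_closedBall_lt_top (x := y) (r := h))
    rw [mem_closedBall_iff_norm]
    exact hD.diam x hx y hy

theorem slobodeckijSq_add_le {θ : ℝ} (hθ : θ ≠ 0) (U : Set (Euc d)) {f g : Euc d → Euc d}
    (hf : Measurable f) (hg : Measurable g) :
    slobodeckijSq θ U (fun x => f x + g x) ≤
      2 * slobodeckijSq θ U f + 2 * slobodeckijSq θ U g := by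
  have mk : ∀ {u : Euc d → Euc d}, Measurable u → Measurable fun z : Euc d × Euc d =>
      ‖u z.1 - u z.2‖ₑ ^ 2 / ENNReal.ofReal (‖z.1 - z.2‖ ^ ((d : ℝ) + 2 * θ)) := fun hu => by
    fun_prop
  have mi : ∀ {u : Euc d → Euc d}, Measurable u → Measurable fun x : Euc d =>
      ∫⁻ y in U, ‖u x - u y‖ₑ ^ 2 / ENNReal.ofReal (‖x - y‖ ^ ((d : ℝ) + 2 * θ)) := fun hu =>
    (mk hu).lintegral_prod_right'
  have ms : ∀ {u : Euc d → Euc d}, Measurable u → ∀ x : Euc d, Measurable fun y : Euc d =>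
      ‖u x - u y‖ₑ ^ 2 / ENNReal.ofReal (‖x - y‖ ^ ((d : ℝ) + 2 * θ)) := fun hu x => by
    fun_prop
  simp only [slobodeckijSq, if_neg hθ]
  rw [← lintegral_const_mul 2 (mi hf), ← lintegral_const_mul 2 (mi hg),
    ← lintegral_add_left ((mi hf).const_mul 2)]
  refine lintegral_mono fun x => ?_
  refine le_trans ?_ (add_le_add (lintegral_const_mul 2 (ms hf x)).le
    (lintegral_const_mul 2 (ms hg x)).le)
  rw [← lintegral_add_left ((ms hf x).const_mul 2)]
  refine lintegral_mono fun y => ?_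
  simp only [← mul_div_assoc, ← ENNReal.add_div]
  refine ENNReal.div_le_div_right ?_ _
  have e : f x + g x - (f y + g y) = (f x - f y) + (g x - g y) := by abel
  rw [e]
  refine (pow_le_pow_left' (enorm_add_le _ _) 2).trans ?_
  have := ENNReal.rpow_add_le_mul_rpow_add_rpow ‖f x - f y‖ₑ ‖g x - g y‖ₑ (p := 2)
    (by norm_num)
  norm_num at this
  rw [← mul_add]
  exact this

theorem slob_add_le {θ : ℝ} {U : Set (Euc d)} {f g : Euc d → Euc d}
    (hf : AEStronglyMeasurable f (volume.restrict U))
    (hg : AEStronglyMeasurable g (volume.restrict U)) :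
    slob θ U (fun x => f x + g x) ≤ 2 * (slob θ U f + slob θ U g) := by
  by_cases hθ : θ = 0
  · subst hθ
    exact (slob_zero_add_le hf hg).trans (le_mul_of_one_le_left zero_le (by norm_num))
  have key : slobodeckijSq θ U (fun x => f x + g x) ≤
      2 * slobodeckijSq θ U f + 2 * slobodeckijSq θ U g := by
    rw [slobodeckijSq_congr hf.ae_eq_mk, slobodeckijSq_congr hg.ae_eq_mk,
      slobodeckijSq_congr (g := fun x => f x + g x) (g' := fun x => hf.mk f x + hg.mk g x)
        (hf.ae_eq_mk.add hg.ae_eq_mk)]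
    exact slobodeckijSq_add_le hθ U hf.stronglyMeasurable_mk.measurable
      hg.stronglyMeasurable_mk.measurable
  rw [slob, slob, slob]
  have h4 : (4 : ℝ≥0∞) ^ (1 / 2 : ℝ) = 2 := by
    rw [show (4 : ℝ≥0∞) = 2 ^ (2 : ℝ) by norm_num, ← ENNReal.rpow_mul]
    norm_num
  calc slobodeckijSq θ U (fun x => f x + g x) ^ (1 / 2 : ℝ)
      ≤ (4 * (slobodeckijSq θ U f + slobodeckijSq θ U g)) ^ (1 / 2 : ℝ) := by
        refine ENNReal.rpow_le_rpow (key.trans ?_) (by norm_num)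
        rw [← mul_add]
        gcongr
        norm_num
    _ = 2 * (slobodeckijSq θ U f + slobodeckijSq θ U g) ^ (1 / 2 : ℝ) := by
        rw [ENNReal.mul_rpow_of_nonneg _ _ (by norm_num), h4]
    _ ≤ _ := by
        gcongr
        exact ENNReal.rpow_add_le_add_rpow _ _ (by norm_num) (by norm_num)

/-- The crude constant comes from bounding each of the `d^k` index tuples by the whole seminorms,
and from the factor `2` in the quasi-triangle inequality for fractional seminorms. -/
theorem semi_add_le {θ : ℝ} {k : ℕ} {U : Set (Euc d)} {v w : Euc d → Euc d} (hU : IsOpen U)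
    (hv : ∀ I : Fin k → Fin d, ∃ g, HasWeakDeriv U I v g)
    (hw : ∀ I : Fin k → Fin d, ∃ g, HasWeakDeriv U I w g) :
    semi k θ U (fun x => v x + w x) ≤ 2 * d ^ k * (semi k θ U v + semi k θ U w) := by
  choose F hF using hv
  choose G hG using hw
  refine (semi_le fun I => (hF I).add hU (hG I)).trans ?_
  calc ∑ I, slob θ U (fun x => F I x + G I x)
      ≤ ∑ _I : Fin k → Fin d, 2 * (semi k θ U v + semi k θ U w) :=
        Finset.sum_le_sum fun I _ => (slob_add_le (hF I).2.1.aestronglyMeasurable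
          (hG I).2.1.aestronglyMeasurable).trans (by
            gcongr
            · exact slob_le_semi hU (hF I)
            · exact slob_le_semi hU (hG I))
    _ = _ := by simp; ring

/-- On convex sets the Slobodeckij seminorm is bounded by the gradient. -/
theorem slob_le_grad (hd : 1 ≤ d) {θ : ℝ} (h0 : 0 < θ) (h1 : θ < 1) :
    ∃ C : ℝ≥0, ∀ (D : Set (Euc d)) (h : ℝ), IsOpen D → Convex ℝ D → 0 < h →
      (∀ x ∈ D, ∀ y ∈ D, ‖x - y‖ ≤ h) → ∀ (g : Euc d → Euc d) (G : Fin d → Euc d → Euc d),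
      (∀ i, HasWeakDeriv D (fun _ : Fin 1 => i) g (G i)) →
      slob θ D g ≤ C * (ENNReal.ofReal (h ^ (1 - θ)) * ∑ i, slob 0 D (G i)) := by
  have hk := kernelInt_one_lt_top hd h1
  have htop : (d * kernelInt d θ 1) ^ (1 / 2 : ℝ) ≠ ⊤ :=
    (ENNReal.rpow_lt_top_of_nonneg (by norm_num) (ENNReal.mul_ne_top (by simp) hk.ne)).ne
  refine ⟨((d * kernelInt d θ 1) ^ (1 / 2 : ℝ)).toNNReal, fun D h hD hc hh hdiam g G hG => ?_⟩
  have hgl : LocallyIntegrableOn g D := (hG ⟨0, hd⟩).1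
  have key := slobodeckijSq_le_grad hD hc hG hgl h0.ne' hdiam
  rw [ENNReal.coe_toNNReal htop]
  calc slob θ D g ≤ (d * kernelInt d θ h * ∑ i, ∫⁻ x in D, ‖G i x‖ₑ ^ 2) ^ (1 / 2 : ℝ) :=
        ENNReal.rpow_le_rpow key (by norm_num)
    _ = (d * kernelInt d θ 1) ^ (1 / 2 : ℝ) * (ENNReal.ofReal (h ^ (1 - θ)) *
          (∑ i, ∫⁻ x in D, ‖G i x‖ₑ ^ 2) ^ (1 / 2 : ℝ)) := by
        rw [kernelInt_scale hh]
        have : ENNReal.ofReal (h ^ (1 - θ)) = (ENNReal.ofReal (h ^ (2 - 2 * θ))) ^ (1 / 2 : ℝ) := by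
          rw [ENNReal.ofReal_rpow_of_nonneg (by positivity) (by norm_num), ← Real.rpow_mul hh.le]
          congr 2; ring
        rw [this, ← ENNReal.mul_rpow_of_nonneg _ _ (by norm_num),
          ← ENNReal.mul_rpow_of_nonneg _ _ (by norm_num)]
        congr 1
        ring
    _ ≤ _ := by
        gcongr
        refine (sum_rpow_half_le _ _).trans_eq ?_
        simp only [slob_zero_eq]

/-! ### Polynomials on fat sets -/

/-- A point within `M h` of `D` is within `(M + 1) h` of the centre of the inner ball of radius `κ
h`, so the estimate from that ball with ratio `(M + 1) / κ` applies, and the norm over the ball is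
at most that over `D`. -/
theorem Fat.pfield_fD_le (p k : ℕ) (hκ : 0 < κ) {M : ℝ} (hM : 0 ≤ M) :
    ∃ C : ℝ≥0, ∀ (h : ℝ) (D : Set (Euc d)), Fat κ h D →
      ∀ P : Fin d → MvPolynomial (Fin d) ℝ, (∀ j, (P j).totalDegree ≤ p) →
      ∀ s : Multiset (Fin d), s.card = k → ∀ x : Euc d, (∃ z ∈ D, ‖x - z‖ ≤ M * h) →
        ‖pfield (fD s P) x‖ₑ ≤ C * (ENNReal.ofReal (h ^ (-(k : ℝ) - (d : ℝ) / 2)) *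
          slob 0 D (pfield P)) := by
  obtain ⟨C, hC⟩ := pfield_fD_bound (d := d) p ((M + 1) / κ) k
  refine ⟨C * Real.toNNReal (κ ^ (-(k : ℝ) - (d : ℝ) / 2)), fun h D hD P hP s hs x ⟨z, hz, hxz⟩ => ?_⟩
  obtain ⟨y, hy⟩ := hD.ball
  have hκh := mul_pos hκ hD.pos
  have hyD : y ∈ D := hy (Metric.mem_ball_self hκh)
  have hxy : ‖x - y‖ ≤ (M + 1) / κ * (κ * h) := by
    have h1 : (M + 1) / κ * (κ * h) = M * h + h := by field_simp
    rw [h1]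
    calc ‖x - y‖ = ‖(x - z) + (z - y)‖ := by congr 1; abel
      _ ≤ ‖x - z‖ + ‖z - y‖ := norm_add_le _ _
      _ ≤ _ := add_le_add hxz (hD.diam z hz y hyD)
  refine (hC P hP s hs y (κ * h) hκh x hxy).trans ?_
  rw [Real.mul_rpow hκ.le hD.pos.le, ENNReal.ofReal_mul (by positivity), ENNReal.coe_mul, mul_assoc,
    mul_assoc]
  gcongr
  · exact le_rfl
  · exact slob_mono hy

theorem Fat.pfield_le (p : ℕ) (hκ : 0 < κ) {M : ℝ} (hM : 0 ≤ M) :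
    ∃ C : ℝ≥0, ∀ (h : ℝ) (D : Set (Euc d)), Fat κ h D →
      ∀ q : Euc d → Euc d, IsPolyField p q → ∀ x : Euc d, (∃ z ∈ D, ‖x - z‖ ≤ M * h) →
        ‖q x‖ₑ ≤ C * (ENNReal.ofReal (h ^ (-(d : ℝ) / 2)) * slob 0 D q) := by
  obtain ⟨C, hC⟩ := Fat.pfield_fD_le (d := d) p 0 hκ hM
  refine ⟨C, fun h D hD q hq x hx => ?_⟩
  obtain ⟨P, hP, rfl⟩ := isPolyField_iff.1 hq
  have := hC h D hD P hP 0 rfl x hx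
  have e : fD 0 P = P := by ext1 j; simp [fD, pD_zero]
  rw [e] at this
  convert this using 5
  push_cast; ring

theorem Fat.slob_fD_le (p k : ℕ) (hκ : 0 < κ) :
    ∃ C : ℝ≥0, ∀ (h : ℝ) (D : Set (Euc d)), Fat κ h D →
      ∀ P : Fin d → MvPolynomial (Fin d) ℝ, (∀ j, (P j).totalDegree ≤ p) →
      ∀ s : Multiset (Fin d), s.card = k →
        slob 0 D (pfield (fD s P)) ≤ C * (ENNReal.ofReal (h ^ (-(k : ℝ))) *
          slob 0 D (pfield P)) := by
  obtain ⟨C, hC⟩ := Fat.pfield_fD_le (d := d) p k hκ zero_le_one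
  refine ⟨C * (ballConst d).toNNReal, fun h D hD P hP s hs => ?_⟩
  refine (slob_zero_le_sup hD.isOpen.measurableSet fun x hx => hC h D hD P hP s hs x
    ⟨x, hx, by simpa using hD.pos.le⟩).trans ?_
  refine (mul_le_mul_right (hD.volume_le hκ) _).trans_eq ?_
  have : -(k : ℝ) = (-(k : ℝ) - (d : ℝ) / 2) + (d : ℝ) / 2 := by ring
  conv_rhs => rw [this, ← ofReal_rpow_mul hD.pos]
  rw [ENNReal.coe_mul, ENNReal.coe_toNNReal ballConst_ne_top]
  ring

/-- Inverse estimate for polynomials. -/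
theorem Fat.semi_pfield_le (hd : 1 ≤ d) (p k : ℕ) (hκ : 0 < κ) {θ : ℝ} (h0 : 0 ≤ θ) (h1 : θ < 1) :
    ∃ C : ℝ≥0, ∀ (h : ℝ) (D : Set (Euc d)), Fat κ h D → ∀ q : Euc d → Euc d, IsPolyField p q →
        semi k θ D q ≤ C * (ENNReal.ofReal (h ^ (-(k : ℝ) - θ)) * slob 0 D q) := by
  rcases h0.eq_or_lt with rfl | h0
  · obtain ⟨C, hC⟩ := Fat.slob_fD_le (d := d) p k hκ
    refine ⟨d ^ k * C, fun h D hD q hq => ?_⟩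
    obtain ⟨P, hP, rfl⟩ := isPolyField_iff.1 hq
    refine (semi_le fun I => hasWeakDeriv_pfield D P I).trans ?_
    refine (Finset.sum_le_sum fun I _ => hC h D hD P hP _ (card_dirs I)).trans_eq ?_
    simp [mul_assoc]
  -- For fractional order one derivative more is taken, costing `h^(-(k+1))`, and the bound of the
  -- fractional seminorm by the gradient gives back `h^(1-θ)`.
  · obtain ⟨C, hC⟩ := Fat.slob_fD_le (d := d) p (k + 1) hκ
    obtain ⟨C', hC'⟩ := slob_le_grad hd h0 h1
    refine ⟨d ^ k * (C' * (d * C)), fun h D hD q hq => ?_⟩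
    obtain ⟨P, hP, rfl⟩ := isPolyField_iff.1 hq
    refine (semi_le fun I => hasWeakDeriv_pfield D P I).trans ?_
    have e : ∀ I : Fin k → Fin d, slob θ D (pfield (fD (dirs I) P)) ≤
        C' * (ENNReal.ofReal (h ^ (1 - θ)) * (d * (C * (ENNReal.ofReal (h ^ (-((k + 1 : ℕ) : ℝ))) *
          slob 0 D (pfield P))))) := by
      intro I
      refine (hC' D h hD.isOpen hD.convex hD.pos hD.diam _ _
        (fun i => hasWeakDeriv_pfield_one D (fD (dirs I) P) i)).trans ?_
      gcongr
      have : ∀ i, slob 0 D (pfield fun j => pderiv i (fD (dirs I) P j)) ≤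
          C * (ENNReal.ofReal (h ^ (-((k + 1 : ℕ) : ℝ))) * slob 0 D (pfield P)) := by
        intro i
        have e1 : (fun j => pderiv i (fD (dirs I) P j)) = fD (i ::ₘ dirs I) P := by
          ext1 j; simp [fD, pD_cons]
        rw [e1]
        exact hC h D hD P hP _ (by simp [card_dirs])
      refine (Finset.sum_le_sum fun i _ => this i).trans_eq ?_
      simp
    refine (Finset.sum_le_sum fun I _ => e I).trans_eq ?_
    have : (-(k : ℝ) - θ) = (1 - θ) + (-((k + 1 : ℕ) : ℝ)) := by push_cast; ring
    rw [this, ← ofReal_rpow_mul hD.pos]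
    simp
    ring

/-! ### Poincaré inequalities -/

/-- For mean zero, `|D| g(x) = ∫ (g(x) - g(y)) dy`. After Cauchy–Schwarz the singular kernel may be
inserted because it is at least `h^(-d-2θ)` on `D`, and fatness bounds `|D|` below by a multiple of
`h^d`. -/
theorem slob_zero_le_of_integral_eq_zero (hκ : 0 < κ) {θ : ℝ} (hθ : 0 < θ) :
    ∃ C : ℝ≥0, ∀ (h : ℝ) (D : Set (Euc d)), Fat κ h D → ∀ g : Euc d → Euc d,
      IntegrableOn g D → ∫ x in D, g x = 0 →
        slob 0 D g ≤ C * (ENNReal.ofReal (h ^ θ) * slob θ D g) := by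
  set c : ℝ≥0∞ := ENNReal.ofReal (κ ^ ((d : ℝ) / 2)) * ballConst d with hc
  have hc0 : c ≠ 0 := mul_ne_zero (by rw [Ne, ENNReal.ofReal_eq_zero, not_le]; positivity)
    ballConst_ne_zero
  have hct : c ≠ ⊤ := ENNReal.mul_ne_top ENNReal.ofReal_ne_top ballConst_ne_top
  refine ⟨c⁻¹.toNNReal, fun h D hD g hg hg0 => ?_⟩
  rw [ENNReal.coe_toNNReal (ENNReal.inv_ne_top.2 hc0)]
  have hvt := hD.volume_lt_top
  have hgm : AEMeasurable (fun y => ‖g y‖ₑ) (volume.restrict D) := hg.1.enorm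
  have e1 : ∀ x ∈ D, volume D * ‖g x‖ₑ ^ 2 ≤ ENNReal.ofReal (h ^ ((d : ℝ) + 2 * θ)) *
      ∫⁻ y in D, ‖g x - g y‖ₑ ^ 2 / ENNReal.ofReal (‖x - y‖ ^ ((d : ℝ) + 2 * θ)) := by
    intro x hx
    have hv0 : volume D ≠ 0 := (hD.isOpen.measure_pos volume ⟨x, hx⟩).ne'
    have i1 : volume D * ‖g x‖ₑ ≤ ∫⁻ y in D, ‖g x - g y‖ₑ := by
      have : ∫ y in D, (g x - g y) = (volume D).toReal • g x := by
        rw [integral_sub (integrableOn_const (C := g x) hvt.ne enorm_ne_top) hg, hg0, sub_zero]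
        simp [Measure.real]
      refine le_trans (le_of_eq ?_) (enorm_integral_le_lintegral_enorm _)
      rw [this, enorm_smul, Real.enorm_eq_ofReal ENNReal.toReal_nonneg, ENNReal.ofReal_toReal hvt.ne]
    have i2 : volume D * (volume D * ‖g x‖ₑ ^ 2) ≤ volume D * ∫⁻ y in D, ‖g x - g y‖ₑ ^ 2 := by
      calc _ = (volume D * ‖g x‖ₑ) ^ 2 := by ring
        _ ≤ (∫⁻ y in D, ‖g x - g y‖ₑ) ^ 2 := pow_le_pow_left' i1 2
        _ ≤ _ := by
          refine (sq_lintegral_le _ (aestronglyMeasurable_const.sub hg.1).enorm).trans_eq ?_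
          simp
    have i3 := (ENNReal.mul_le_mul_iff_right hv0 hvt.ne).1 i2
    refine i3.trans ?_
    rw [← lintegral_const_mul' _ _ ENNReal.ofReal_ne_top]
    refine setLIntegral_mono' hD.isOpen.measurableSet fun y hy => ?_
    rcases eq_or_ne x y with rfl | hxy
    · simp
    · have hpos : 0 < ‖x - y‖ := norm_pos_iff.2 (sub_ne_zero.2 hxy)
      have hp0 : ENNReal.ofReal (‖x - y‖ ^ ((d : ℝ) + 2 * θ)) ≠ 0 := by
        rw [Ne, ENNReal.ofReal_eq_zero, not_le]; positivity
      calc ‖g x - g y‖ₑ ^ 2 = ENNReal.ofReal (‖x - y‖ ^ ((d : ℝ) + 2 * θ)) *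
            (‖g x - g y‖ₑ ^ 2 / ENNReal.ofReal (‖x - y‖ ^ ((d : ℝ) + 2 * θ))) :=
            (ENNReal.mul_div_cancel hp0 ENNReal.ofReal_ne_top).symm
        _ ≤ _ := by
            gcongr
            exact hD.diam x hx y hy
  have e2 : volume D * slobodeckijSq 0 D g ≤ ENNReal.ofReal (h ^ ((d : ℝ) + 2 * θ)) *
      slobodeckijSq θ D g := by
    simp only [slobodeckijSq, if_neg hθ.ne', if_true]
    rw [← lintegral_const_mul' _ _ hvt.ne, ← lintegral_const_mul' _ _ ENNReal.ofReal_ne_top]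
    exact setLIntegral_mono' hD.isOpen.measurableSet e1
  have e3 := ENNReal.rpow_le_rpow e2 (by norm_num : (0 : ℝ) ≤ 1 / 2)
  rw [ENNReal.mul_rpow_of_nonneg _ _ (by norm_num), ENNReal.mul_rpow_of_nonneg _ _ (by norm_num),
    ENNReal.ofReal_rpow_of_nonneg (Real.rpow_nonneg hD.pos.le _) (by norm_num),
    ← Real.rpow_mul hD.pos.le] at e3
  change volume D ^ (1 / 2 : ℝ) * slob 0 D g ≤ _ * slob θ D g at e3
  have e4 : (ENNReal.ofReal (h ^ ((d : ℝ) / 2))) * (c * slob 0 D g) ≤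
      (ENNReal.ofReal (h ^ ((d : ℝ) / 2))) * (ENNReal.ofReal (h ^ θ) * slob θ D g) := by
    rw [← mul_assoc _ (ENNReal.ofReal (h ^ θ)), ofReal_rpow_mul hD.pos]
    calc _ = ENNReal.ofReal (κ ^ ((d : ℝ) / 2)) * (ENNReal.ofReal (h ^ ((d : ℝ) / 2)) * ballConst d) *
          slob 0 D g := by rw [hc]; ring
      _ ≤ volume D ^ (1 / 2 : ℝ) * slob 0 D g := by gcongr; exact hD.le_volume hκ
      _ ≤ _ := e3
      _ = _ := by congr 3; ring
  have hh0 : ENNReal.ofReal (h ^ ((d : ℝ) / 2)) ≠ 0 := by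
    rw [Ne, ENNReal.ofReal_eq_zero, not_le]; exact Real.rpow_pos_of_pos hD.pos _
  have e5 := (ENNReal.mul_le_mul_iff_right hh0 ENNReal.ofReal_ne_top).1 e4
  calc slob 0 D g = c⁻¹ * (c * slob 0 D g) := by
        rw [← mul_assoc, ENNReal.inv_mul_cancel hc0 hct, one_mul]
    _ ≤ _ := by gcongr

/-- Passing through the seminorm of order `1/2` yields the Poincaré inequality with a constant
depending only on `κ` and `d`, without a compactness argument over all convex sets. -/
theorem poincare (hd : 1 ≤ d) (hκ : 0 < κ) :
    ∃ C : ℝ≥0, ∀ (h : ℝ) (D : Set (Euc d)), Fat κ h D →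
      ∀ (g : Euc d → Euc d) (G : Fin d → Euc d → Euc d), IntegrableOn g D → ∫ x in D, g x = 0 →
      (∀ i, HasWeakDeriv D (fun _ : Fin 1 => i) g (G i)) →
        slob 0 D g ≤ C * (ENNReal.ofReal h * ∑ i, slob 0 D (G i)) := by
  obtain ⟨C1, hC1⟩ := slob_zero_le_of_integral_eq_zero (d := d) hκ (θ := 1 / 2) (by norm_num)
  obtain ⟨C2, hC2⟩ := slob_le_grad hd (θ := 1 / 2) (by norm_num) (by norm_num)
  refine ⟨C1 * C2, fun h D hD g G hg hg0 hG => ?_⟩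
  refine (hC1 h D hD g hg hg0).trans ?_
  refine (mul_le_mul_right (mul_le_mul_right
    (hC2 D h hD.isOpen hD.convex hD.pos hD.diam g G hG) _) _).trans_eq ?_
  have : ENNReal.ofReal h = ENNReal.ofReal (h ^ (1 / 2 : ℝ)) * ENNReal.ofReal (h ^ (1 - 1 / 2 : ℝ)) := by
    rw [ofReal_rpow_mul hD.pos]; norm_num
  rw [this, ENNReal.coe_mul]
  ring

/-- The quotient of the two kernels is `|x - y|^(2(θ-η)) ≤ h^(2(θ-η))`. -/
theorem slob_le_slob {θ η : ℝ} (h0 : 0 < η) (h1 : η ≤ θ) (hh : 0 < h) (hD : MeasurableSet D)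
    (hdiam : ∀ x ∈ D, ∀ y ∈ D, ‖x - y‖ ≤ h) (g : Euc d → Euc d) :
    slob η D g ≤ ENNReal.ofReal (h ^ (θ - η)) * slob θ D g := by
  have key : slobodeckijSq η D g ≤ ENNReal.ofReal (h ^ (2 * (θ - η))) * slobodeckijSq θ D g := by
    simp only [slobodeckijSq, if_neg h0.ne', if_neg (h0.trans_le h1).ne']
    rw [← lintegral_const_mul' _ _ ENNReal.ofReal_ne_top]
    refine setLIntegral_mono' hD fun x hx => ?_
    rw [← lintegral_const_mul' _ _ ENNReal.ofReal_ne_top]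
    refine setLIntegral_mono' hD fun y hy => ?_
    rcases eq_or_ne x y with rfl | hxy
    · simp
    · have hpos : 0 < ‖x - y‖ := norm_pos_iff.2 (sub_ne_zero.2 hxy)
      have e : ENNReal.ofReal (‖x - y‖ ^ ((d : ℝ) + 2 * θ)) =
          ENNReal.ofReal (‖x - y‖ ^ (2 * (θ - η))) * ENNReal.ofReal (‖x - y‖ ^ ((d : ℝ) + 2 * η)) := by
        rw [ofReal_rpow_mul hpos]; congr 2; ring
      have hp : ∀ a : ℝ, ENNReal.ofReal (‖x - y‖ ^ a) ≠ 0 := fun a => by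
        rw [Ne, ENNReal.ofReal_eq_zero, not_le]; positivity
      rw [e]
      calc _ = ENNReal.ofReal (‖x - y‖ ^ (2 * (θ - η))) * (‖g x - g y‖ₑ ^ 2 /
            (ENNReal.ofReal (‖x - y‖ ^ (2 * (θ - η))) * ENNReal.ofReal (‖x - y‖ ^ ((d : ℝ) + 2 * η)))) := by
            rw [← mul_div_assoc, ENNReal.mul_div_mul_left _ _ (hp _) ENNReal.ofReal_ne_top]
        _ ≤ _ := by
            gcongr
            exact hdiam x hx y hy
  have := ENNReal.rpow_le_rpow key (by norm_num : (0 : ℝ) ≤ 1 / 2)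
  rw [ENNReal.mul_rpow_of_nonneg _ _ (by norm_num),
    ENNReal.ofReal_rpow_of_nonneg (by positivity) (by norm_num), ← Real.rpow_mul hh.le] at this
  have e : 2 * (θ - η) * (1 / 2) = θ - η := by ring
  rw [e] at this
  exact this

end

/-! ### Bramble–Hilbert estimates -/

section

open MvPolynomial (eval pderiv totalDegree coeff)

/-! ### Polynomial approximation on convex sets -/

variable {κ h : ℝ} {D : Set (Euc d)}

theorem HasWeakDeriv.congr_dirs' {U : Set (Euc d)} {v g : Euc d → Euc d} {k l : ℕ}
    {I : Fin k → Fin d} {J : Fin l → Fin d} (h : HasWeakDeriv U I v g) (hIJ : dirs I = dirs J) :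
    HasWeakDeriv U J v g := by
  have : k = l := by rw [← card_dirs I, hIJ, card_dirs]
  subst this
  exact h.congr_dirs hIJ

/-- The weak derivatives of a Sobolev field as a family indexed by multisets of directions. -/
theorem MemSobolev.exists_family {s : ℝ} {U : Set (Euc d)} {v : Euc d → Euc d}
    (hv : MemSobolev s U v) : ∃ H : Multiset (Fin d) → Euc d → Euc d,
      ∀ (k : ℕ), k ≤ ⌊s⌋₊ → ∀ I : Fin k → Fin d, HasWeakDeriv U I v (H (dirs I)) ∧
        slob 0 U (H (dirs I)) < ⊤ := by
  have key : ∀ S : Multiset (Fin d), ∃ g : Euc d → Euc d, S.card ≤ ⌊s⌋₊ →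
      ∀ (k : ℕ) (I : Fin k → Fin d), dirs I = S → HasWeakDeriv U I v g ∧ slob 0 U g < ⊤ := by
    intro S
    by_cases hS : S.card ≤ ⌊s⌋₊
    · obtain ⟨J, hJ⟩ := exists_dirs_eq S
      have h1 := hv.1 S.card hS
      rw [sobolevSeminorm_natCast] at h1
      obtain ⟨g, hg, hgt⟩ := exists_hasWeakDeriv_of_semi_lt_top h1 J
      exact ⟨g, fun _ k I hI => ⟨hg.congr_dirs' (hJ.trans hI.symm), hgt⟩⟩
    · exact ⟨0, fun h => absurd h hS⟩
  choose H hH using key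
  exact ⟨H, fun k hk I => hH (dirs I) (by rw [card_dirs]; exact hk) k I rfl⟩

theorem pD_eq_C {s : Multiset (Fin d)} {P : MvPolynomial (Fin d) ℝ}
    (h : P.totalDegree ≤ s.card) : ∃ a, pD s P = MvPolynomial.C a := by
  refine ⟨coeff 0 (pD s P), ?_⟩
  ext t
  rw [MvPolynomial.coeff_C]
  split_ifs with ht
  · rw [ht]
  · obtain ⟨a, -, ha⟩ := coeff_pD s t
    rw [ha, coeff_eq_zero_of_lt_degree, mul_zero]
    rw [map_add, degree_toFinsupp]
    have : t.degree ≠ 0 := fun h0 => ht ((Finsupp.degree_eq_zero_iff t).1 h0).symm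
    omega

theorem memLp_of_slob_lt_top {U : Set (Euc d)} {g : Euc d → Euc d}
    (hm : AEStronglyMeasurable g (volume.restrict U)) (h : slob 0 U g < ⊤) :
    MemLp g 2 (volume.restrict U) := ⟨hm, by rwa [slob_zero_eq_eLpNorm] at h⟩

theorem Fat.isFiniteMeasure (hD : Fat κ h D) : IsFiniteMeasure (volume.restrict D) :=
  ⟨by rw [Measure.restrict_apply_univ]; exact hD.volume_lt_top⟩

theorem Fat.integrableOn_pev (hD : Fat κ h D) (P : MvPolynomial (Fin d) ℝ) :
    IntegrableOn (pev P) D := by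
  rcases D.eq_empty_or_nonempty with rfl | ⟨y, hy⟩
  · simp
  · refine ((contDiff_pev P).continuous.continuousOn.integrableOn_compact
      (isCompact_closedBall y h)).mono_set fun x hx => ?_
    rw [mem_closedBall_iff_norm]
    exact hD.diam x hx y hy

/-- The linear functional in `exists_coeff_family` is the mean over `D`. All remainders of order at
most `n` then have mean zero, which is what the Poincaré inequalities require. -/
theorem Fat.exists_mean_eq (hκ : 0 < κ) (hD : Fat κ h D) (n : ℕ)
    (H : Multiset (Fin d) → Euc d → Euc d)
    (hH : ∀ s : Multiset (Fin d), s.card ≤ n → IntegrableOn (H s) D) :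
    ∃ P : Fin d → MvPolynomial (Fin d) ℝ, (∀ j, (P j).totalDegree ≤ n) ∧
      ∀ s : Multiset (Fin d), s.card ≤ n →
        IntegrableOn (fun x => H s x - pfield (fD s P) x) D ∧
        ∫ x in D, (H s x - pfield (fD s P) x) = 0 := by
  obtain ⟨y, hy⟩ := hD.ball
  have hv0 : (volume D).toReal ≠ 0 := by
    refine (ENNReal.toReal_pos ?_ hD.volume_lt_top.ne).ne'
    exact (hD.isOpen.measure_pos volume ⟨y, hy (Metric.mem_ball_self (mul_pos hκ hD.pos))⟩).ne'
  let Λ : MvPolynomial (Fin d) ℝ →ₗ[ℝ] ℝ :=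
    { toFun := fun P => (volume D).toReal⁻¹ * ∫ x in D, pev P x
      map_add' := fun P Q => by
        have : ∀ x, pev (P + Q) x = pev P x + pev Q x := fun x => by simp [pev]
        simp only [this]
        rw [integral_add (hD.integrableOn_pev P) (hD.integrableOn_pev Q), mul_add]
      map_smul' := fun c P => by
        have : ∀ x, pev (c • P) x = c * pev P x := fun x => by simp [pev, MvPolynomial.smul_eval]
        simp only [this, integral_const_mul, smul_eq_mul, RingHom.id_apply]
        ring }
  have hΛ : ∀ a, Λ (MvPolynomial.C a) = a := by
    intro a
    change (volume D).toReal⁻¹ * ∫ x in D, pev (MvPolynomial.C a) x = a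
    simp only [pev, MvPolynomial.eval_C, integral_const, smul_eq_mul]
    simp only [Measure.real, Measure.restrict_apply_univ]
    rw [← mul_assoc, inv_mul_cancel₀ hv0, one_mul]
  choose P hPd hP using fun j : Fin d => exists_coeff_family n Λ hΛ
    (fun s => (volume D).toReal⁻¹ * ∫ x in D, H s x j)
  have hip : ∀ s, IntegrableOn (pfield (fD s P)) D := fun s => by
    rcases D.eq_empty_or_nonempty with rfl | ⟨y, hy⟩
    · simp
    · refine ((continuous_pfield _).continuousOn.integrableOn_compact
        (isCompact_closedBall y h)).mono_set fun x hx => ?_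
      rw [mem_closedBall_iff_norm]
      exact hD.diam x hx y hy
  refine ⟨P, hPd, fun s hs => ⟨(hH s hs).sub (hip s), ?_⟩⟩
  rw [integral_sub (hH s hs) (hip s), sub_eq_zero]
  ext j
  have e1 : (∫ x in D, H s x) j = ∫ x in D, H s x j :=
    ((EuclideanSpace.proj j : Euc d →L[ℝ] ℝ).integral_comp_comm (hH s hs)).symm
  have e2 : (∫ x in D, pfield (fD s P) x) j = ∫ x in D, pev (pD s (P j)) x :=
    ((EuclideanSpace.proj j : Euc d →L[ℝ] ℝ).integral_comp_comm (hip s)).symm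
  rw [e1, e2]
  have := hP j s hs
  change (volume D).toReal⁻¹ * ∫ x in D, pev (pD s (P j)) x = _ at this
  exact (mul_left_cancel₀ (inv_ne_zero hv0) this).symm

/-- The polynomial matches the means of all derivatives of order below `s`. Starting at the highest
order, each application of Poincaré lowers the order of the remainder by one and gains a factor `h`.
The functions `R` are indexed by multisets so that consecutive orders are linked by first weak
derivatives. -/
theorem Fat.exists_remainder (hd : 1 ≤ d) (p : ℕ) {s : ℝ} (hs : 0 < s) (hsp : s ≤ p + 1)
    (hκ : 0 < κ) :
    ∃ C : ℝ≥0, ∀ (h : ℝ) (D : Set (Euc d)), Fat κ h D → ∀ v : Euc d → Euc d, MemSobolev s D v →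
      ∃ P : Fin d → MvPolynomial (Fin d) ℝ, (∀ j, (P j).totalDegree ≤ p) ∧
        ∃ R : Multiset (Fin d) → Euc d → Euc d,
          (∀ k, k ≤ ⌊s⌋₊ → ∀ I : Fin k → Fin d,
            HasWeakDeriv D I (fun x => v x - pfield P x) (R (dirs I))) ∧
          (∀ S : Multiset (Fin d), S.card ≤ ⌊s⌋₊ →
            slob 0 D (R S) ≤ C * (ENNReal.ofReal (h ^ (s - S.card)) * sobolevSeminorm s D v)) ∧
          (s - ⌊s⌋₊ ≠ 0 → ∀ S : Multiset (Fin d), S.card = ⌊s⌋₊ →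
            slob (s - ⌊s⌋₊) D (R S) ≤ sobolevSeminorm s D v) := by
  set k := ⌊s⌋₊ with hk
  set θ := s - k with hθdef
  have hθ0 : 0 ≤ θ := sub_nonneg.2 (Nat.floor_le hs.le)
  obtain ⟨C1, hC1⟩ := poincare (d := d) hd hκ
  obtain ⟨C2, hC2⟩ : ∃ C2 : ℝ≥0, 0 < θ → ∀ (h : ℝ) (D : Set (Euc d)), Fat κ h D →
      ∀ g : Euc d → Euc d, IntegrableOn g D → ∫ x in D, g x = 0 →
        slob 0 D g ≤ C2 * (ENNReal.ofReal (h ^ θ) * slob θ D g) := by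
    by_cases h : 0 < θ
    · obtain ⟨C2, hC2⟩ := slob_zero_le_of_integral_eq_zero (d := d) hκ h
      exact ⟨C2, fun _ => hC2⟩
    · exact ⟨0, fun h' => absurd h' h⟩
  set C : ℝ≥0 := 1 + C2 + d * C1 with hC
  have hCone : 1 ≤ C := by rw [hC, add_assoc]; exact le_self_add
  -- The number `n` is the largest integer strictly below `s`: it is `⌊s⌋` if `s` is not an integer
  -- and `s - 1` otherwise. This is why `s ≤ p + 1` gives `n ≤ p`.
  obtain ⟨n, hn1, hn2⟩ : ∃ n : ℕ, (0 < θ → n = k) ∧ (θ = 0 → n + 1 = k) := by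
    rcases hθ0.eq_or_lt with h0 | h0
    · have hk0 : k ≠ 0 := by
        rintro hk0
        rw [hθdef, hk0] at h0
        simp at h0
        exact hs.ne h0
      exact ⟨k - 1, fun h => absurd h0 h.ne, fun _ => by omega⟩
    · exact ⟨k, fun _ => rfl, fun h => absurd h h0.ne'⟩
  have hnp : n ≤ p := by
    rcases hθ0.eq_or_lt with h0 | h0
    · have h1 : (k : ℝ) ≤ p + 1 := by rw [hθdef] at h0; linarith
      have h2 : k ≤ p + 1 := by exact_mod_cast h1
      have := hn2 h0.symm
      omega
    · have h1 : (k : ℝ) < p + 1 := by rw [hθdef] at h0; linarith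
      have h2 : k < p + 1 := by exact_mod_cast h1
      have := hn1 h0
      omega
  have hnk : n ≤ k := by
    rcases hθ0.eq_or_lt with h0 | h0
    · have := hn2 h0.symm; omega
    · exact (hn1 h0).le
  refine ⟨C ^ (k + 1), fun h D hD v hv => ?_⟩
  have := hD.isFiniteMeasure
  obtain ⟨H, hH⟩ := hv.exists_family
  have hHI : ∀ S : Multiset (Fin d), S.card ≤ k → IntegrableOn (H S) D := by
    intro S hS
    obtain ⟨I, hI⟩ := exists_dirs_eq S
    obtain ⟨h1, h2⟩ := hH _ hS I
    rw [hI] at h1 h2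
    exact (memLp_of_slob_lt_top h1.2.1.aestronglyMeasurable h2).integrable (by norm_num)
  obtain ⟨P, hPd, hP⟩ := hD.exists_mean_eq hκ n H fun S hS => hHI S (hS.trans hnk)
  set R : Multiset (Fin d) → Euc d → Euc d := fun S x => H S x - pfield (fD S P) x with hR
  have hRw : ∀ l, l ≤ k → ∀ I : Fin l → Fin d,
      HasWeakDeriv D I (fun x => v x - pfield P x) (R (dirs I)) := fun l hl I =>
    (hH l hl I).1.sub hD.isOpen (hasWeakDeriv_pfield D P I)
  have hHtop : ∀ S : Multiset (Fin d), S.card = k → slob θ D (H S) ≤ sobolevSeminorm s D v := by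
    intro S hS
    obtain ⟨I, hI⟩ := exists_dirs_eq S
    have h1 := (hH _ hS.le I).1
    rw [hI] at h1
    obtain ⟨J, hJ⟩ : ∃ J : Fin k → Fin d, dirs J = S := by
      rw [← hS]; exact ⟨I, hI⟩
    rw [sobolevSeminorm_eq_semi]
    exact slob_le_semi hD.isOpen (h1.congr_dirs' (hI.trans hJ.symm))
  have hRtop : 0 < θ → ∀ S : Multiset (Fin d), S.card = k → slob θ D (R S) ≤ sobolevSeminorm s D v := by
    intro h0 S hS
    -- The derivatives of order `k` of a polynomial of degree at most `k` are constants, which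
    -- cancel in differences.
    have e : slob θ D (R S) = slob θ D (H S) := by
      choose a ha using fun j => pD_eq_C (s := S) (P := P j) (by rw [hS, ← hn1 h0]; exact hPd j)
      have hc : ∀ x y, R S x - R S y = H S x - H S y := by
        intro x y
        have : pfield (fD S P) x = pfield (fD S P) y := by
          ext j
          simp [pfield_apply, fD, ha, pev]
        simp only [hR, this]
        abel
      simp only [slob, slobodeckijSq, if_neg h0.ne', hc]
    rw [e]
    exact hHtop S hS
  -- Induction on the distance `l` to the top order `k`. For integer `s` the top remainder is the
  -- top derivative of `v` itself, since the polynomial has degree less than `k`; otherwise the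
  -- fractional Poincaré inequality starts the induction.
  have hmain : ∀ l : ℕ, ∀ S : Multiset (Fin d), S.card + l = k →
      slob 0 D (R S) ≤ (C ^ (l + 1) : ℝ≥0) * (ENNReal.ofReal (h ^ (s - S.card)) * sobolevSeminorm s D v) := by
    intro l
    induction l with
    | zero =>
      intro S hS
      rw [add_zero] at hS
      rcases hθ0.eq_or_lt with h0 | h0
      · have e : R S = H S := by
          ext x j
          have : fD S P j = 0 := pD_eq_zero (by
            have := hPd j
            have := hn2 h0.symm
            omega)
          simp [hR, pfield_apply, this, pev]
        have e2 : s - S.card = 0 := by rw [hS]; exact h0.symm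
        rw [e, e2]
        have := hHtop S hS
        rw [← h0] at this
        refine this.trans ?_
        rw [Real.rpow_zero, ENNReal.ofReal_one, one_mul, zero_add, pow_one]
        exact le_mul_of_one_le_left zero_le (by exact_mod_cast hCone)
      · have hSn : S.card ≤ n := by rw [hS, hn1 h0]
        refine (hC2 h0 h D hD (R S) (hP S hSn).1 (hP S hSn).2).trans ?_
        rw [zero_add, pow_one, hS]
        gcongr
        · rw [hC]
          exact (le_add_self).trans le_self_add
        · exact hRtop h0 S hS
    | succ l ih =>
      intro S hS
      have hSn : S.card ≤ n := by
        rcases hθ0.eq_or_lt with h0 | h0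
        · have := hn2 h0.symm; omega
        · have := hn1 h0; omega
      have hchain : ∀ i, HasWeakDeriv D (fun _ : Fin 1 => i) (R S) (R (i ::ₘ S)) := by
        intro i
        obtain ⟨I, hI⟩ := exists_dirs_eq S
        have h1 := hRw S.card (by omega) I
        have h2 := hRw (S.card + 1) (by omega) (Fin.snoc I i)
        rw [dirs_snoc, hI] at h2
        rw [hI] at h1
        exact h1.chain h2
      refine (hC1 h D hD (R S) _ (hP S hSn).1 (hP S hSn).2 hchain).trans ?_
      have h3 : ∀ i, slob 0 D (R (i ::ₘ S)) ≤ (C ^ (l + 1) : ℝ≥0) *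
          (ENNReal.ofReal (h ^ (s - S.card - 1)) * sobolevSeminorm s D v) := by
        intro i
        have := ih (i ::ₘ S) (by simp; omega)
        convert this using 5
        simp; ring
      calc _ ≤ C1 * (ENNReal.ofReal h * ∑ _i : Fin d, (C ^ (l + 1) : ℝ≥0) *
          (ENNReal.ofReal (h ^ (s - S.card - 1)) * sobolevSeminorm s D v)) := by
            gcongr with i; exact h3 i
        _ = (d * C1 * C ^ (l + 1) : ℝ≥0) * (ENNReal.ofReal (h ^ (s - S.card)) * sobolevSeminorm s D v) := by
            have e : ENNReal.ofReal (h ^ (s - S.card)) =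
                ENNReal.ofReal h * ENNReal.ofReal (h ^ (s - S.card - 1)) := by
              conv_rhs => rw [← Real.rpow_one h]
              rw [← Real.rpow_mul hD.pos.le, one_mul, ofReal_rpow_mul hD.pos]
              congr 2; ring
            rw [e]
            simp
            ring
        _ ≤ _ := by
            gcongr
            rw [pow_succ C (l + 1), mul_comm (C ^ (l + 1))]
            gcongr
            rw [hC]
            exact le_add_self
  refine ⟨P, fun j => (hPd j).trans hnp, R, hRw, fun S hS => ?_, fun h0 => hRtop
    (lt_of_le_of_ne hθ0 (Ne.symm h0))⟩
  refine (hmain (k - S.card) S (by omega)).trans ?_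
  gcongr
  exact Nat.sub_le _ _

/-- Bramble–Hilbert: polynomial approximation in all seminorms of order at most `s`. -/
theorem Fat.bramble_hilbert (hd : 1 ≤ d) (p : ℕ) {s : ℝ} (hs : 0 < s) (hsp : s ≤ p + 1)
    (hκ : 0 < κ) :
    ∃ C : ℝ → ℝ≥0, ∀ (h : ℝ) (D : Set (Euc d)), Fat κ h D → ∀ v : Euc d → Euc d,
      MemSobolev s D v → ∃ q : Euc d → Euc d, IsPolyField p q ∧
        ∀ m, 0 ≤ m → m ≤ s →
          (∀ I : Fin ⌊m⌋₊ → Fin d, ∃ g, HasWeakDeriv D I (fun x => v x - q x) g) ∧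
          sobolevSeminorm m D (fun x => v x - q x) ≤
            C m * (ENNReal.ofReal (h ^ (s - m)) * sobolevSeminorm s D v) := by
  obtain ⟨C0, hC0⟩ := Fat.exists_remainder (d := d) hd p hs hsp hκ
  choose! C1 hC1 using fun (η : ℝ) (h : 0 < η ∧ η < 1) => slob_le_grad (d := d) hd h.1 h.2
  refine ⟨fun m => d ^ ⌊m⌋₊ * (C0 + C1 (m - ⌊m⌋₊) * (d * C0) + 1), fun h D hD v hv => ?_⟩
  obtain ⟨P, hPd, R, hR, hR0, hRtop⟩ := hC0 h D hD v hv
  refine ⟨pfield P, isPolyField_pfield hPd, fun m hm hms => ?_⟩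
  set j := ⌊m⌋₊ with hj
  set η := m - j with hη
  have hjk : j ≤ ⌊s⌋₊ := Nat.floor_le_floor hms
  have hη0 : 0 ≤ η := sub_nonneg.2 (Nat.floor_le hm)
  have hη1 : η < 1 := by have := Nat.lt_floor_add_one m; rw [hη]; linarith
  refine ⟨fun I => ⟨_, hR j hjk I⟩, ?_⟩
  rw [sobolevSeminorm_eq_semi]
  refine (semi_le fun I => hR j hjk I).trans ?_
  set N := ENNReal.ofReal (h ^ (s - m)) * sobolevSeminorm s D v with hN
  -- Three cases for `m = j + η`: an integer order is an `L²` bound; if `j = ⌊s⌋` and `η > 0`, two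
  -- fractional seminorms of the same remainder are compared; otherwise one more weak derivative
  -- exists and bounds the fractional seminorm.
  have key : ∀ I : Fin j → Fin d, slob η D (R (dirs I)) ≤ (C0 + C1 η * (d * C0) + 1 : ℝ≥0) * N := by
    intro I
    rcases hη0.eq_or_lt with h0 | h0
    · rw [← h0]
      refine (hR0 (dirs I) (by rw [card_dirs]; exact hjk)).trans ?_
      have e : s - (dirs I).card = s - m := by rw [card_dirs]; linarith
      rw [e]
      gcongr
      rw [add_assoc]
      exact le_self_add
    · rcases hjk.eq_or_lt with h1 | h1
      · have hle : η ≤ s - ⌊s⌋₊ := by rw [hη, h1]; linarith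
        refine (slob_le_slob h0 hle hD.pos hD.isOpen.measurableSet hD.diam _).trans ?_
        have e : s - ⌊s⌋₊ - η = s - m := by rw [hη, h1]; ring
        rw [e]
        calc _ ≤ N := by
              rw [hN]
              gcongr
              exact hRtop (by linarith) _ (by rw [card_dirs, h1])
          _ ≤ _ := le_mul_of_one_le_left zero_le (by push_cast; exact le_add_self)
      · have hchain : ∀ i, HasWeakDeriv D (fun _ : Fin 1 => i) (R (dirs I)) (R (i ::ₘ dirs I)) := by
          intro i
          have h2 := hR (j + 1) (by omega) (Fin.snoc I i)
          rw [dirs_snoc] at h2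
          exact (hR j hjk I).chain h2
        refine (hC1 η ⟨h0, hη1⟩ D h hD.isOpen hD.convex hD.pos hD.diam _ _ hchain).trans ?_
        have h3 : ∀ i, slob 0 D (R (i ::ₘ dirs I)) ≤
            C0 * (ENNReal.ofReal (h ^ (s - j - 1)) * sobolevSeminorm s D v) := by
          intro i
          have := hR0 (i ::ₘ dirs I) (by simp [card_dirs]; omega)
          convert this using 5
          simp [card_dirs]; ring
        calc _ ≤ C1 η * (ENNReal.ofReal (h ^ (1 - η)) * ∑ _i : Fin d,
              C0 * (ENNReal.ofReal (h ^ (s - j - 1)) * sobolevSeminorm s D v)) := by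
              gcongr with i; exact h3 i
          _ = (C1 η * (d * C0) : ℝ≥0) * N := by
              have e : ENNReal.ofReal (h ^ (s - m)) =
                  ENNReal.ofReal (h ^ (1 - η)) * ENNReal.ofReal (h ^ (s - j - 1)) := by
                rw [ofReal_rpow_mul hD.pos]; congr 2; rw [hη]; ring
              rw [hN, e]
              simp
              ring
          _ ≤ _ := by
              gcongr
              rw [add_right_comm]
              exact le_add_self
  refine (Finset.sum_le_sum fun I _ => key I).trans_eq ?_
  simp
  ring

end

/-! ### The local `L²` projection and transfer between overlapping sets -/

section

open MvPolynomial (eval pderiv totalDegree coeff)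

variable {κ h : ℝ} {D : Set (Euc d)}

/-! ### The local projection -/

theorem MemSobolev.locallyIntegrableOn {s : ℝ} {U : Set (Euc d)} {v : Euc d → Euc d}
    (hv : MemSobolev s U v) : LocallyIntegrableOn v U := by
  obtain ⟨H, hH⟩ := hv.exists_family
  exact (hH 0 (Nat.zero_le _) Fin.elim0).1.1

theorem MemSobolev.memLp {s : ℝ} {U : Set (Euc d)} (hU : IsOpen U) {v : Euc d → Euc d}
    (hv : MemSobolev s U v) : MemLp v 2 (volume.restrict U) := by
  obtain ⟨H, hH⟩ := hv.exists_family
  obtain ⟨h1, h2⟩ := hH 0 (Nat.zero_le _) Fin.elim0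
  have e := HasWeakDeriv.ae_unique hU (HasWeakDeriv.zero h1.1) h1
  exact (memLp_congr_ae e).2 (memLp_of_slob_lt_top h1.2.1.aestronglyMeasurable h2)

theorem IsPolyField.memLp {p : ℕ} {q : Euc d → Euc d} (hq : IsPolyField p q)
    (hD : Bornology.IsBounded D) : MemLp q 2 (volume.restrict D) := by
  obtain ⟨R, hR⟩ := hD.subset_closedBall (0 : Euc d)
  obtain ⟨C, hC⟩ := (isCompact_closedBall (0 : Euc d) R).exists_bound_of_continuousOn
    hq.continuous.continuousOn
  have h1 : IsFiniteMeasure (volume.restrict (Metric.closedBall (0 : Euc d) R)) :=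
    ⟨by rw [Measure.restrict_apply_univ]; exact measure_closedBall_lt_top⟩
  refine MemLp.mono_measure (Measure.restrict_mono hR le_rfl) ?_
  refine MemLp.of_bound hq.continuous.aestronglyMeasurable C ?_
  filter_upwards [ae_restrict_mem Metric.isClosed_closedBall.measurableSet] with x hx
  exact hC x hx

/-- The image of the polynomial fields in `L²(D)` is finite dimensional, so the orthogonal
projection onto it exists. A polynomial preimage of the projected function is enough, so `D` may be
any bounded set. -/
theorem exists_polyProj (p : ℕ) (hD : Bornology.IsBounded D) {v : Euc d → Euc d}
    (hv : MemLp v 2 (volume.restrict D)) :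
    ∃ q : Euc d → Euc d, IsPolyField p q ∧
      ∀ r : Euc d → Euc d, IsPolyField p r → ∫ x in D, (inner ℝ (q x - v x) (r x) : ℝ) = 0 := by
  set μ := volume.restrict D
  let V := MvPolynomial.restrictTotalDegree (Fin d) ℝ p
  have hd : ∀ P : Fin d → V, IsPolyField p (pfield fun j => (P j).1) := fun P =>
    isPolyField_pfield fun j => (MvPolynomial.mem_restrictTotalDegree _ _ _).1 (P j).2
  let ι : (Fin d → V) →ₗ[ℝ] Lp (Euc d) 2 μ :=
    { toFun := fun P => ((hd P).memLp hD).toLp _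
      map_add' := fun P Q => by
        rw [← MemLp.toLp_add]
        congr 1
        ext x j; simp [pev, pfield_apply]
      map_smul' := fun c P => by
        rw [RingHom.id_apply, ← MemLp.toLp_const_smul]
        congr 1
        ext x j; simp [pev, pfield_apply, MvPolynomial.smul_eval] }
  let W := LinearMap.range ι
  obtain ⟨P, hP⟩ := LinearMap.mem_range.1 (W.starProjection_apply_mem (hv.toLp v))
  refine ⟨_, hd P, fun r hr => ?_⟩
  obtain ⟨Q, hQ, rfl⟩ := isPolyField_iff.1 hr
  let Q' : Fin d → V := fun j => ⟨Q j, (MvPolynomial.mem_restrictTotalDegree _ _ _).2 (hQ j)⟩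
  have h1 : inner ℝ (ι Q') (hv.toLp v - W.starProjection (hv.toLp v)) = 0 :=
    (W.mem_orthogonal _).1 (W.sub_starProjection_mem_orthogonal _) _ (LinearMap.mem_range_self ι Q')
  rw [← hP, ← neg_sub, inner_neg_right, neg_eq_zero, real_inner_comm, L2.inner_def] at h1
  rw [← h1]
  refine integral_congr_ae ?_
  have e1 : ι P =ᵐ[μ] pfield fun j => (P j).1 := ((hd P).memLp hD).coeFn_toLp
  have e2 : ι Q' =ᵐ[μ] pfield Q := ((hd Q').memLp hD).coeFn_toLp
  filter_upwards [e1, e2, hv.coeFn_toLp, Lp.coeFn_sub (ι P) (hv.toLp v)] with x h1 h2 h3 h4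
  rw [h4, Pi.sub_apply, h1, h2, h3]

/-- Orthogonality determines best approximation by Pythagoras, whichever polynomial field the
definition of `polyProj` selects. -/
theorem polyProj_spec (p : ℕ) (hD : Bornology.IsBounded D) {v : Euc d → Euc d}
    (hv : MemLp v 2 (volume.restrict D)) :
    IsPolyField p (polyProj p D v) ∧ ∀ r : Euc d → Euc d, IsPolyField p r →
      slob 0 D (fun x => v x - polyProj p D v x) ≤ slob 0 D (fun x => v x - r x) := by
  have hex := exists_polyProj p hD hv
  have hdef : polyProj p D v = hex.choose := by
    rw [polyProj, dif_pos hex]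
  obtain ⟨hq, hqo⟩ := hex.choose_spec
  rw [hdef]
  set q := hex.choose
  refine ⟨hq, fun r hr => ?_⟩
  have mq := hq.memLp hD
  have mr := hr.memLp hD
  have h1 : inner ℝ (hv.toLp v - mq.toLp q) (mq.toLp q - mr.toLp r) = 0 := by
    have := hqo _ (hq.sub hr)
    rw [L2.inner_def, ← neg_eq_zero, ← integral_neg, ← this]
    refine integral_congr_ae ?_
    filter_upwards [hv.coeFn_toLp, mq.coeFn_toLp, mr.coeFn_toLp,
      Lp.coeFn_sub (hv.toLp v) (mq.toLp q), Lp.coeFn_sub (mq.toLp q) (mr.toLp r)]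
      with x h1 h2 h3 h4 h5
    rw [h4, h5, Pi.sub_apply, Pi.sub_apply, h1, h2, h3, ← inner_neg_left, neg_sub]
  have h2 : ‖hv.toLp v - mq.toLp q‖ ≤ ‖hv.toLp v - mr.toLp r‖ := by
    have := norm_add_sq_eq_norm_sq_add_norm_sq_real h1
    rw [sub_add_sub_cancel] at this
    nlinarith [norm_nonneg (hv.toLp v - mq.toLp q), norm_nonneg (hv.toLp v - mr.toLp r),
      norm_nonneg (mq.toLp q - mr.toLp r)]
  rw [← MemLp.toLp_sub, ← MemLp.toLp_sub, Lp.norm_toLp, Lp.norm_toLp,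
    ENNReal.toReal_le_toReal (hv.sub mq).eLpNorm_ne_top (hv.sub mr).eLpNorm_ne_top] at h2
  rw [slob_zero_eq_eLpNorm, slob_zero_eq_eLpNorm]
  exact h2

/-! ### Transfer of approximation between overlapping convex sets -/

theorem Fat.slob_zero_le_ball (p : ℕ) (hκ : 0 < κ) :
    ∃ C : ℝ≥0, ∀ (h : ℝ) (D : Set (Euc d)), Fat κ h D → ∀ y : Euc d,
      Metric.ball y (κ * h) ⊆ D → ∀ q : Euc d → Euc d, IsPolyField p q →
        slob 0 D q ≤ C * slob 0 (Metric.ball y (κ * h)) q := by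
  obtain ⟨C, hC⟩ := pfield_bound (d := d) p (1 / κ)
  refine ⟨C * Real.toNNReal (κ ^ (-(d : ℝ) / 2)) * (ballConst d).toNNReal, fun h D hD y hy q hq => ?_⟩
  obtain ⟨P, hP, rfl⟩ := isPolyField_iff.1 hq
  have hκh := mul_pos hκ hD.pos
  have hyD : y ∈ D := hy (Metric.mem_ball_self hκh)
  refine (slob_zero_le_sup hD.isOpen.measurableSet fun x hx => (hC P hP y _ hκh x ?_).1).trans ?_
  · rw [one_div, inv_mul_cancel_left₀ hκ.ne']
    exact hD.diam x hx y hyD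
  refine (mul_le_mul_right (hD.volume_le hκ) _).trans_eq ?_
  rw [Real.mul_rpow hκ.le hD.pos.le, ENNReal.ofReal_mul (by positivity), ENNReal.coe_mul,
    ENNReal.coe_mul, ENNReal.coe_toNNReal ballConst_ne_top]
  have e : ENNReal.ofReal (h ^ (-(d : ℝ) / 2)) * ENNReal.ofReal (h ^ ((d : ℝ) / 2)) = 1 := by
    rw [ofReal_rpow_mul hD.pos, neg_div, neg_add_cancel, Real.rpow_zero, ENNReal.ofReal_one]
  calc _ = C * ENNReal.ofReal (κ ^ (-(d : ℝ) / 2)) * ballConst d *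
        slob 0 (Metric.ball y (κ * h)) (pfield P) *
        (ENNReal.ofReal (h ^ (-(d : ℝ) / 2)) * ENNReal.ofReal (h ^ ((d : ℝ) / 2))) := by ring
    _ = _ := by rw [e, mul_one]; rfl

/-- Let `r` be a Bramble–Hilbert polynomial for `v` on `D₂`. On the common ball both `q` and `r` are
close to `v`, so the polynomial `r - q` is small there, and hence on all of `D₂`. Nothing but the
common ball is required of `D₁`. -/
theorem Fat.transfer (hd : 1 ≤ d) (p : ℕ) {s : ℝ} (hs : 0 < s) (hsp : s ≤ p + 1)
    (hκ : 0 < κ) :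
    ∃ C : ℝ≥0, ∀ (h : ℝ) (D₁ D₂ : Set (Euc d)), Fat κ h D₂ → ∀ y : Euc d,
      Metric.ball y (κ * h) ⊆ D₁ → Metric.ball y (κ * h) ⊆ D₂ → ∀ v : Euc d → Euc d,
      MemSobolev s D₂ v → ∀ q : Euc d → Euc d, IsPolyField p q →
        slob 0 D₂ (fun x => v x - q x) ≤ C * (slob 0 D₁ (fun x => v x - q x) +
          ENNReal.ofReal (h ^ s) * sobolevSeminorm s D₂ v) := by
  obtain ⟨C1, hC1⟩ := Fat.bramble_hilbert (d := d) hd p hs hsp hκ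
  obtain ⟨C2, hC2⟩ := Fat.slob_zero_le_ball (d := d) p hκ
  refine ⟨C2 + (1 + C2) * C1 0, fun h D₁ D₂ hD₂ y h₁ h₂ v hv q hq => ?_⟩
  obtain ⟨r, hr, hrm⟩ := hC1 h D₂ hD₂ v hv
  have h0 := (hrm 0 le_rfl hs.le).2
  have e0 : sobolevSeminorm 0 D₂ (fun x => v x - r x) = semi 0 0 D₂ (fun x => v x - r x) := by
    have := sobolevSeminorm_natCast 0 D₂ (fun x => v x - r x)
    simpa using this
  have hvm := hv.locallyIntegrableOn
  have hrl : LocallyIntegrableOn (fun x => v x - r x) D₂ :=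
    hvm.sub (locallyIntegrableOn_of_continuous hr.continuous _)
  have hr0 : slob 0 D₂ (fun x => v x - r x) ≤
      C1 0 * (ENNReal.ofReal (h ^ s) * sobolevSeminorm s D₂ v) := by
    rw [sub_zero, e0] at h0
    exact (slob_le_semi hD₂.isOpen (HasWeakDeriv.zero (I := Fin.elim0) hrl)).trans h0
  set B := Metric.ball y (κ * h)
  have mB : AEStronglyMeasurable v (volume.restrict B) :=
    hvm.aestronglyMeasurable.mono_measure (Measure.restrict_mono h₂ le_rfl)
  have mq := hq.continuous.aestronglyMeasurable (μ := volume.restrict B)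
  have mr := hr.continuous.aestronglyMeasurable (μ := volume.restrict B)
  have hB : slob 0 B (fun x => r x - q x) ≤ slob 0 D₁ (fun x => v x - q x) +
      C1 0 * (ENNReal.ofReal (h ^ s) * sobolevSeminorm s D₂ v) := by
    have e : (fun x => r x - q x) = fun x => (v x - q x) - (v x - r x) := by ext1 x; abel
    rw [e]
    refine (slob_zero_sub_le (mB.sub mq) (mB.sub mr)).trans ?_
    exact add_le_add (slob_mono h₁) ((slob_mono h₂).trans hr0)
  have e : (fun x => v x - q x) = fun x => (v x - r x) + (r x - q x) := by ext1 x; abel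
  calc slob 0 D₂ (fun x => v x - q x)
      ≤ slob 0 D₂ (fun x => v x - r x) + slob 0 D₂ (fun x => r x - q x) := by
        conv_lhs => rw [e]
        exact slob_zero_add_le hrl.aestronglyMeasurable
          (hr.continuous.sub hq.continuous).aestronglyMeasurable
    _ ≤ C1 0 * (ENNReal.ofReal (h ^ s) * sobolevSeminorm s D₂ v) +
        C2 * (slob 0 D₁ (fun x => v x - q x) +
          C1 0 * (ENNReal.ofReal (h ^ s) * sobolevSeminorm s D₂ v)) :=
        add_le_add hr0 ((hC2 h D₂ hD₂ y h₂ _ (hr.sub hq)).trans (by gcongr))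
    _ = C2 * slob 0 D₁ (fun x => v x - q x) +
        ((1 + C2) * C1 0) * (ENNReal.ofReal (h ^ s) * sobolevSeminorm s D₂ v) := by ring
    _ ≤ _ := by
        rw [mul_add]
        gcongr
        · push_cast; exact le_self_add
        · push_cast; exact le_add_self

end

/-! ### Simplicial meshes: barycentric coordinates, elements and Lagrange nodes -/

section

/-! ### Barycentric coordinates -/

theorem affineMap_sum {ι : Type*} (f : Euc d →ᵃ[ℝ] ℝ) (s : Finset ι) (w : ι → ℝ) (z : ι → Euc d)
    (hw : ∑ i ∈ s, w i = 1) : f (∑ i ∈ s, w i • z i) = ∑ i ∈ s, w i * f (z i) := by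
  have h : ∀ x, f x = f.linear x + f 0 := fun x => by
    have := f.map_vadd 0 x
    simpa using this
  rw [h, map_sum]
  simp only [h (z _), map_smul, smul_eq_mul, mul_add, Finset.sum_add_distrib, ← Finset.sum_mul, hw,
    one_mul]

theorem affineMap_add (f : Euc d →ᵃ[ℝ] ℝ) (x w : Euc d) : f (x + w) = f x + f.linear w := by
  have := f.map_vadd x w
  simpa [add_comm] using this

namespace Mesh

variable {Ω : Set (Euc d)} (T : Mesh Ω) {K L : Finset (Euc d)} {a b x : Euc d}

/-- The closed simplex spanned by `K`. -/
abbrev hull (K : Finset (Euc d)) : Set (Euc d) := convexHull ℝ (K : Set (Euc d))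

/-- The barycentric coordinate of the element `K` that belongs to its vertex `a`. -/
def bary (K : Finset (Euc d)) (a : Euc d) : Euc d →ᵃ[ℝ] ℝ :=
  open Classical in
  if h : K ∈ T.elements ∧ a ∈ K then (T.affineBasis K h.1).coord ⟨a, h.2⟩ else 0

variable {T}

theorem bary_eq_coord (hK : K ∈ T.elements) (ha : a ∈ K) :
    T.bary K a = (T.affineBasis K hK).coord ⟨a, ha⟩ := dif_pos ⟨hK, ha⟩

theorem bary_self (hK : K ∈ T.elements) (ha : a ∈ K) : T.bary K a a = 1 := by
  rw [bary_eq_coord hK ha]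
  exact (T.affineBasis K hK).coord_apply_eq ⟨a, ha⟩

theorem bary_ne (hK : K ∈ T.elements) (hb : b ∈ K) (hab : a ≠ b) : T.bary K a b = 0 := by
  by_cases ha : a ∈ K
  · rw [bary_eq_coord hK ha]
    exact (T.affineBasis K hK).coord_apply_ne (i := ⟨a, ha⟩) (j := ⟨b, hb⟩)
      fun h => hab (congrArg Subtype.val h)
  · rw [bary, dif_neg fun h => ha h.2]; rfl

theorem sum_bary (hK : K ∈ T.elements) (x : Euc d) : ∑ a ∈ K, T.bary K a x = 1 := by
  rw [← (T.affineBasis K hK).sum_coord_apply_eq_one x, ← Finset.sum_coe_sort]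
  exact Finset.sum_congr rfl fun i _ => by rw [bary_eq_coord hK i.2]

theorem sum_bary_smul (hK : K ∈ T.elements) (x : Euc d) : ∑ a ∈ K, T.bary K a x • a = x := by
  conv_rhs => rw [← (T.affineBasis K hK).linear_combination_coord_eq_self x]
  rw [← Finset.sum_coe_sort]
  exact Finset.sum_congr rfl fun i _ => by rw [bary_eq_coord hK i.2]; rfl

theorem hull_eq (hK : K ∈ T.elements) : hull K = {x | ∀ a ∈ K, 0 ≤ T.bary K a x} := by
  have h := (T.affineBasis K hK).convexHull_eq_nonneg_coord
  have hr : Set.range (T.affineBasis K hK) = (K : Set (Euc d)) := Subtype.range_coe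
  rw [hr] at h
  rw [hull, h]
  ext x
  constructor
  · intro hx a ha
    rw [bary_eq_coord hK ha]; exact hx _
  · intro hx i
    have := hx i i.2
    rwa [bary_eq_coord hK i.2] at this

theorem mem_hull (hK : K ∈ T.elements) : x ∈ hull K ↔ ∀ a ∈ K, 0 ≤ T.bary K a x := by
  rw [hull_eq hK]; rfl

theorem mem_interior_hull (hK : K ∈ T.elements) :
    x ∈ interior (hull K) ↔ ∀ a ∈ K, 0 < T.bary K a x := by
  have h := (T.affineBasis K hK).interior_convexHull
  have hr : Set.range (T.affineBasis K hK) = (K : Set (Euc d)) := Subtype.range_coe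
  rw [hr] at h
  rw [hull, h]
  constructor
  · intro hx a ha
    rw [bary_eq_coord hK ha]; exact hx _
  · intro hx i
    have := hx i i.2
    rwa [bary_eq_coord hK i.2] at this

theorem bary_sum (hK : K ∈ T.elements) {w : Euc d → ℝ} (hw : ∑ b ∈ K, w b = 1) (ha : a ∈ K) :
    T.bary K a (∑ b ∈ K, w b • b) = w a := by
  rw [affineMap_sum _ _ _ _ hw, Finset.sum_eq_single_of_mem a ha, bary_self hK ha, mul_one]
  intro b hb hba
  rw [bary_ne hK hb hba.symm, mul_zero]

theorem bary_unique (hK : K ∈ T.elements) {w : Euc d → ℝ} (hw : ∑ b ∈ K, w b = 1)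
    (hx : ∑ b ∈ K, w b • b = x) (ha : a ∈ K) : T.bary K a x = w a := by
  rw [← hx, bary_sum hK hw ha]

theorem continuous_bary (K : Finset (Euc d)) (a : Euc d) : Continuous (T.bary K a) :=
  AffineMap.continuous_of_finiteDimensional _

theorem bary_nonneg (hK : K ∈ T.elements) (hx : x ∈ hull K) (ha : a ∈ K) : 0 ≤ T.bary K a x :=
  (mem_hull hK).1 hx a ha

theorem bary_le_one (hK : K ∈ T.elements) (hx : x ∈ hull K) (ha : a ∈ K) : T.bary K a x ≤ 1 := by
  rw [← sum_bary hK x]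
  exact Finset.single_le_sum (fun b hb => bary_nonneg hK hx hb) ha

/-- Points of the hull of a subset have vanishing remaining coordinates. -/
theorem exists_weights (hK : K ∈ T.elements) {S : Finset (Euc d)} (hS : S ⊆ K) (hx : x ∈ hull S) :
    ∃ w : Euc d → ℝ, (∀ b ∈ S, 0 ≤ w b) ∧ ∑ b ∈ S, w b = 1 ∧ ∑ b ∈ S, w b • b = x ∧
      (∀ a ∈ S, T.bary K a x = w a) ∧ ∀ a ∈ K, a ∉ S → T.bary K a x = 0 := by
  classical
  obtain ⟨w, h0, h1, h2⟩ := Finset.mem_convexHull'.1 hx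
  set w' : Euc d → ℝ := fun b => if b ∈ S then w b else 0
  have hw1 : ∑ b ∈ K, w' b = 1 := by
    rw [← h1, ← Finset.sum_subset hS fun b _ hb => if_neg hb]
    exact Finset.sum_congr rfl fun b hb => if_pos hb
  have hw2 : ∑ b ∈ K, w' b • b = x := by
    rw [← h2, ← Finset.sum_subset hS fun b _ hb => by simp only [w', if_neg hb, zero_smul]]
    exact Finset.sum_congr rfl fun b hb => by simp only [w', if_pos hb]
  refine ⟨w, h0, h1, h2, fun a ha => ?_, fun a ha haS => ?_⟩
  · rw [bary_unique hK hw1 hw2 (hS ha)]; exact if_pos ha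
  · rw [bary_unique hK hw1 hw2 ha]; exact if_neg haS

theorem mem_hull_subset (hK : K ∈ T.elements) {S : Finset (Euc d)} (hS : S ⊆ K) :
    x ∈ hull S ↔ x ∈ hull K ∧ ∀ a ∈ K, a ∉ S → T.bary K a x = 0 := by
  constructor
  · intro hx
    refine ⟨convexHull_mono (by exact_mod_cast hS) hx, ?_⟩
    obtain ⟨w, _, _, _, _, h⟩ := exists_weights hK hS hx
    exact h
  · rintro ⟨hx, h0⟩
    refine Finset.mem_convexHull'.2 ⟨fun a => T.bary K a x, fun a ha => bary_nonneg hK hx (hS ha),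
      ?_, ?_⟩
    · rw [← sum_bary hK x]
      exact Finset.sum_subset hS fun a ha haS => h0 a ha haS
    · conv_rhs => rw [← sum_bary_smul hK x]
      exact Finset.sum_subset hS fun a ha haS => by simp only [h0 a ha haS, zero_smul]

open Classical in
theorem mem_hull_inter (hK : K ∈ T.elements) (hL : L ∈ T.elements) (hxK : x ∈ hull K)
    (hxL : x ∈ hull L) : x ∈ hull (K ∩ L) := by
  have := T.inter_subset K hK L hL ⟨hxK, hxL⟩
  rwa [← Finset.coe_inter] at this

theorem bary_eq_zero_of_mem (hK : K ∈ T.elements) (hL : L ∈ T.elements) (hxK : x ∈ hull K)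
    (hxL : x ∈ hull L) (ha : a ∈ K) (haL : a ∉ L) : T.bary K a x = 0 := by
  classical
  obtain ⟨w, _, _, _, _, h⟩ := exists_weights hK Finset.inter_subset_left
    (mem_hull_inter hK hL hxK hxL)
  exact h a ha fun h' => haL (Finset.mem_inter.1 h').2

/-- By conformity a common point lies in the hull of the common vertices, and its weights there are
its barycentric coordinates in both elements. Hence `hat` does not depend on the element chosen in
its definition. -/
theorem bary_eq_bary (hK : K ∈ T.elements) (hL : L ∈ T.elements) (hxK : x ∈ hull K)
    (hxL : x ∈ hull L) (ha : a ∈ K) (haL : a ∈ L) : T.bary K a x = T.bary L a x := by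
  classical
  have hx := mem_hull_inter hK hL hxK hxL
  have haKL : a ∈ K ∩ L := Finset.mem_inter.2 ⟨ha, haL⟩
  obtain ⟨w, _, h1, h2, h, _⟩ := exists_weights hK Finset.inter_subset_left hx
  set w' : Euc d → ℝ := fun b => if b ∈ K ∩ L then w b else 0
  have hS : K ∩ L ⊆ L := Finset.inter_subset_right
  have hw1 : ∑ b ∈ L, w' b = 1 := by
    rw [← h1, ← Finset.sum_subset hS fun b _ hb => if_neg hb]
    exact Finset.sum_congr rfl fun b hb => if_pos hb
  have hw2 : ∑ b ∈ L, w' b • b = x := by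
    rw [← h2, ← Finset.sum_subset hS fun b _ hb => by simp only [w', if_neg hb, zero_smul]]
    exact Finset.sum_congr rfl fun b hb => by simp only [w', if_pos hb]
  rw [h a haKL, bary_unique hL hw1 hw2 haL]
  exact (if_pos haKL).symm

theorem hat_eq_bary (hK : K ∈ T.elements) (hx : x ∈ hull K) (ha : a ∈ K) :
    T.hat a x = T.bary K a x := by
  have h : ∃ K : Finset (Euc d), ∃ _ : K ∈ T.elements, a ∈ K ∧
      x ∈ convexHull ℝ (K : Set (Euc d)) := ⟨K, hK, ha, hx⟩
  obtain ⟨h1, h2, h3⟩ := h.choose_spec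
  rw [hat, dif_pos h, ← bary_eq_coord h1 h2]
  exact bary_eq_bary h1 hK h3 hx h2 ha

theorem hat_eq_zero (hK : K ∈ T.elements) (hx : x ∈ hull K) (ha : a ∉ K) : T.hat a x = 0 := by
  by_cases h : ∃ K : Finset (Euc d), ∃ _ : K ∈ T.elements, a ∈ K ∧
      x ∈ convexHull ℝ (K : Set (Euc d))
  · obtain ⟨h1, h2, h3⟩ := h.choose_spec
    rw [hat, dif_pos h, ← bary_eq_coord h1 h2]
    exact bary_eq_zero_of_mem h1 hK h3 hx h2 ha
  · rw [hat, dif_neg h]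

/-! ### Elements -/

/-- The barycenter of a simplex. -/
theorem exists_mem_interior (hK : K ∈ T.elements) : (interior (hull K)).Nonempty := by
  have hc : (K.card : ℝ) ≠ 0 := by
    rw [T.card_eq K hK]; positivity
  refine ⟨∑ b ∈ K, (K.card : ℝ)⁻¹ • b, (mem_interior_hull hK).2 fun a ha => ?_⟩
  rw [bary_sum hK (w := fun _ => (K.card : ℝ)⁻¹) (by simp [hc]) ha]
  have : (0 : ℝ) < K.card := lt_of_le_of_ne (by positivity) hc.symm
  positivity

theorem convex_hull (K : Finset (Euc d)) : Convex ℝ (hull K) := convex_convexHull ℝ _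

theorem isCompact_hull (K : Finset (Euc d)) : IsCompact (hull K) :=
  K.finite_toSet.isCompact_convexHull ℝ

theorem closure_interior_hull (hK : K ∈ T.elements) : closure (interior (hull K)) = hull K := by
  rw [(convex_hull K).closure_interior_eq_closure_of_nonempty_interior (exists_mem_interior hK),
    (isCompact_hull K).isClosed.closure_eq]

theorem hull_ae_eq_interior (K : Finset (Euc d)) : interior (hull K) =ᵐ[volume] hull K :=
  interior_ae_eq_of_null_frontier ((convex_hull K).addHaar_frontier volume)

theorem hull_subset_closure (hK : K ∈ T.elements) : hull K ⊆ closure Ω := by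
  rw [← T.cover]
  exact Set.subset_biUnion_of_mem (u := fun K : Finset (Euc d) => convexHull ℝ (K : Set (Euc d))) hK

theorem exists_mem_hull (hx : x ∈ closure Ω) : ∃ K ∈ T.elements, x ∈ hull K := by
  rw [← T.cover] at hx
  simpa using hx

theorem norm_sub_le_diam (hx : a ∈ hull K) (hy : b ∈ hull K) : ‖a - b‖ ≤ Metric.diam (hull K) := by
  rw [← dist_eq_norm]
  exact Metric.dist_le_diam_of_mem (isCompact_hull K).isBounded hx hy

theorem eq_of_subset (hK : K ∈ T.elements) (hL : L ∈ T.elements) (h : K ⊆ L) : K = L :=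
  Finset.eq_of_subset_of_card_le h (by rw [T.card_eq K hK, T.card_eq L hL])

/-- Distinct elements have disjoint interiors. -/
theorem notMem_hull_of_mem_interior (hK : K ∈ T.elements) (hL : L ∈ T.elements) (hKL : K ≠ L)
    (hx : x ∈ interior (hull K)) : x ∉ hull L := by
  intro hxL
  refine hKL (eq_of_subset hK hL fun a ha => by_contra fun haL => ?_)
  have := (mem_interior_hull hK).1 hx a ha
  rw [bary_eq_zero_of_mem hK hL (interior_subset hx) hxL ha haL] at this
  exact this.false

/-- The gradients of the barycentric coordinates of an element that contains a ball of radius `ρ`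
are bounded by `1 / (2ρ)`. -/
theorem bary_linear_le (hK : K ∈ T.elements) (ha : a ∈ K) {z : Euc d} {ρ : ℝ} (hρ : 0 < ρ)
    (hB : Metric.ball z ρ ⊆ hull K) (w : Euc d) : |(T.bary K a).linear w| ≤ ‖w‖ / (2 * ρ) := by
  rcases eq_or_ne w 0 with rfl | hw
  · simp
  have hwn : 0 < ‖w‖ := norm_pos_iff.2 hw
  -- At the points `z ± u` with `|u| < ρ` the coordinate lies in `[0, 1]`, so twice its linear part
  -- at `u` is at most `1`. The factor `t < 1` keeps these points in the open ball; it is removed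
  -- afterwards.
  have key : ∀ t : ℝ, 0 < t → t < 1 → t * |(T.bary K a).linear w| ≤ ‖w‖ / (2 * ρ) := by
    intro t ht0 ht1
    set u : Euc d := (t * ρ / ‖w‖) • w with hu
    have hun : ‖u‖ < ρ := by
      rw [hu, norm_smul, Real.norm_eq_abs, abs_of_pos (by positivity), div_mul_cancel₀ _ hwn.ne']
      nlinarith
    have h1 : z + u ∈ hull K := hB (by simpa using hun)
    have h2 : z + -u ∈ hull K := hB (by simpa using hun)
    have e1 := affineMap_add (T.bary K a) z u
    have e2 := affineMap_add (T.bary K a) z (-u)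
    have b1 := bary_nonneg hK h1 ha
    have b2 := bary_nonneg hK h2 ha
    have b3 := bary_le_one hK h1 ha
    have b4 := bary_le_one hK h2 ha
    rw [map_neg] at e2
    have h3 : |(T.bary K a).linear u| ≤ 1 / 2 := by rw [abs_le]; constructor <;> linarith
    rw [hu, map_smul, smul_eq_mul, abs_mul, abs_of_pos (by positivity)] at h3
    calc t * |(T.bary K a).linear w|
        = (t * ρ / ‖w‖ * |(T.bary K a).linear w|) * (‖w‖ / ρ) := by field_simp
      _ ≤ 1 / 2 * (‖w‖ / ρ) := by gcongr
      _ = _ := by field_simp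
  by_contra! hcon
  set A := |(T.bary K a).linear w|
  set B := ‖w‖ / (2 * ρ)
  have hB0 : 0 < B := by positivity
  have hA : 0 < A := hB0.trans hcon
  -- If `B < A`, the value `t = (A + B) / (2A)` lies between `B/A` and `1` and contradicts the bound
  -- `t A ≤ B`.
  have h1 : (A + B) / 2 / A < 1 := by rw [div_lt_one hA]; linarith
  have := key ((A + B) / 2 / A) (by positivity) h1
  rw [div_mul_cancel₀ _ hA.ne'] at this
  linarith

/-- A ray that starts in an element in a point whose nonzero coordinates are not small and runs
inside the element at the beginning stays in the element for a while. -/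
theorem mem_hull_of_ray (hK : K ∈ T.elements) {z : Euc d} {ρ β t : ℝ} (hρ : 0 < ρ)
    (hB : Metric.ball z ρ ⊆ hull K) (hx : ∀ a ∈ K, T.bary K a x = 0 ∨ β ≤ T.bary K a x)
    {w : Euc d} (hw : ‖w‖ ≤ 2 * ρ * β) (ht : 0 < t) (htw : x + t • w ∈ hull K) :
    x + w ∈ hull K := by
  refine (mem_hull hK).2 fun a ha => ?_
  have e1 := affineMap_add (T.bary K a) x w
  have e2 := affineMap_add (T.bary K a) x (t • w)
  have b2 := bary_nonneg hK htw ha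
  rw [map_smul, smul_eq_mul] at e2
  rcases hx a ha with h | h
  -- A coordinate that vanishes at `x` cannot decrease along the ray, because it is nonnegative at
  -- the later point `x + t w`.
  · rw [h] at e1 e2
    have : 0 ≤ (T.bary K a).linear w := by
      by_contra! hneg
      nlinarith
    linarith
  · have h1 := bary_linear_le hK ha hρ hB w
    have h2 : ‖w‖ / (2 * ρ) ≤ β := by rw [div_le_iff₀ (by positivity)]; linarith
    have := (abs_le.1 h1).1
    linarith

/-! ### Lagrange nodes -/

variable {p : ℕ} {c : Euc d → ℕ}

theorem mem_elementNodes : c ∈ elementNodes p K ↔ K.sum c = p ∧ ∀ a, c a ≠ 0 → a ∈ K := by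
  classical
  rw [elementNodes, Finset.mem_piAntidiag]

theorem subset_vertices (hK : K ∈ T.elements) : K ⊆ T.vertices := by
  classical
  intro a ha
  rw [vertices, Finset.mem_biUnion]
  exact ⟨K, hK, ha⟩

theorem nodePoint_eq (hK : K ∈ T.elements) (hc : c ∈ elementNodes p K) :
    T.nodePoint p c = ∑ a ∈ K, ((c a : ℝ) / p) • a := by
  rw [nodePoint]
  refine (Finset.sum_subset (subset_vertices hK) fun a _ ha => ?_).symm
  have : c a = 0 := by
    by_contra h
    exact ha ((mem_elementNodes.1 hc).2 a h)
  rw [this]; simp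

theorem bary_nodePoint (hp : 1 ≤ p) (hK : K ∈ T.elements) (hc : c ∈ elementNodes p K)
    (ha : a ∈ K) : T.bary K a (T.nodePoint p c) = c a / p := by
  rw [nodePoint_eq hK hc]
  refine bary_sum hK (w := fun a => (c a : ℝ) / p) ?_ ha
  rw [← Finset.sum_div, ← Nat.cast_sum, (mem_elementNodes.1 hc).1, div_self]
  exact_mod_cast (by omega : p ≠ 0)

theorem nodePoint_mem (hp : 1 ≤ p) (hK : K ∈ T.elements) (hc : c ∈ elementNodes p K) :
    T.nodePoint p c ∈ hull K :=
  (mem_hull hK).2 fun a ha => by rw [bary_nodePoint hp hK hc ha]; positivity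

/-- A vertex with nonzero index has a positive coordinate at the node, so conformity makes it a
vertex of every element containing the node. Membership of a node in an element is thus a statement
about the support of its index. -/
theorem mem_elementNodes_of_nodePoint_mem (hp : 1 ≤ p) (hK : K ∈ T.elements)
    (hc : c ∈ elementNodes p K) (hL : L ∈ T.elements) (h : T.nodePoint p c ∈ hull L) :
    c ∈ elementNodes p L := by
  have hcc := mem_elementNodes.1 hc
  have hsub : ∀ a, c a ≠ 0 → a ∈ L := by
    intro a ha
    by_contra haL
    have h1 := bary_eq_zero_of_mem hK hL (nodePoint_mem hp hK hc) h (hcc.2 a ha) haL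
    rw [bary_nodePoint hp hK hc (hcc.2 a ha), div_eq_zero_iff] at h1
    rcases h1 with h1 | h1
    · exact ha (by exact_mod_cast h1)
    · have : p = 0 := by exact_mod_cast h1
      omega
  refine mem_elementNodes.2 ⟨?_, hsub⟩
  classical
  rw [← hcc.1]
  have e : ∀ M : Finset (Euc d), (∀ a, c a ≠ 0 → a ∈ M) → M.sum c = (K ∪ L).sum c ∨ ¬ M ⊆ K ∪ L := by
    intro M hM
    by_cases h : M ⊆ K ∪ L
    · exact Or.inl (Finset.sum_subset h fun a _ ha => by_contra fun h' => ha (hM a h'))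
    · exact Or.inr h
  rw [(e L hsub).resolve_right (not_not.2 Finset.subset_union_right),
    (e K hcc.2).resolve_right (not_not.2 Finset.subset_union_left)]

end Mesh

end

/-! ### Lagrange interpolation on an element -/

section

/-! ### Lagrange interpolation on an element -/

open MvPolynomial (totalDegree)

theorem affineMap_apply_eq_sum (f : Euc d →ᵃ[ℝ] ℝ) (x : Euc d) :
    f x = ∑ i, f.linear (EuclideanSpace.single i (1 : ℝ)) * x i + f 0 := by
  have h := f.map_vadd 0 x
  simp only [vadd_eq_add, add_zero] at h
  rw [h]
  congr 1
  have hx : x = ∑ i, x i • EuclideanSpace.single i (1 : ℝ) := by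
    conv_lhs => rw [← (EuclideanSpace.basisFun (Fin d) ℝ).sum_repr x]
    simp
  conv_lhs => rw [hx, map_sum]
  simp [mul_comm]

theorem exists_pev_affineMap (f : Euc d →ᵃ[ℝ] ℝ) :
    ∃ P : MvPolynomial (Fin d) ℝ, P.totalDegree ≤ 1 ∧ ∀ x, pev P x = f x := by
  refine ⟨∑ i, MvPolynomial.C (f.linear (EuclideanSpace.single i (1 : ℝ))) * MvPolynomial.X i +
    MvPolynomial.C (f 0), ?_, fun x => ?_⟩
  · refine (MvPolynomial.totalDegree_add _ _).trans (max_le ?_ (by simp))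
    refine MvPolynomial.totalDegree_finsetSum_le fun i _ => ?_
    refine (MvPolynomial.totalDegree_mul _ _).trans ?_
    simp
  · rw [affineMap_apply_eq_sum f x]
    simp [pev]

namespace Mesh

variable {Ω : Set (Euc d)} {T : Mesh Ω} {K L : Finset (Euc d)} {a b x : Euc d}
  {p : ℕ} {c : Euc d → ℕ}

variable (T) in
/-- The Lagrange polynomial of the element `K` for the node with index `c`. -/
def shape (p : ℕ) (K : Finset (Euc d)) (c : Euc d → ℕ) (x : Euc d) : ℝ :=
  ∏ a ∈ K, ∏ j ∈ Finset.range (c a), ((p : ℝ) * T.bary K a x - j) / ((c a : ℝ) - j)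

theorem lagrangeBasis_eq_shape (hK : K ∈ T.elements) (hc : c ∈ elementNodes p K)
    (hx : x ∈ hull K) : T.lagrangeBasis p c x = T.shape p K c x := by
  rw [lagrangeBasis, shape, ← Finset.prod_subset (subset_vertices hK)]
  · exact Finset.prod_congr rfl fun a ha => by rw [hat_eq_bary hK hx ha]
  · intro a _ ha
    have : c a = 0 := by_contra fun h => ha ((mem_elementNodes.1 hc).2 a h)
    simp [this]

/-- If the index is not supported in `K`, some vertex `a ∉ K` has `c a ≠ 0`, and the factor with `j
= 0` for this vertex is a multiple of `hat a x = 0`. -/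
theorem lagrangeBasis_eq_zero (hK : K ∈ T.elements) (hx : x ∈ hull K) (hcT : c ∈ T.nodes p)
    (hc : c ∉ elementNodes p K) : T.lagrangeBasis p c x = 0 := by
  classical
  obtain ⟨L, hL, hcL⟩ := Finset.mem_biUnion.1 hcT
  rw [mem_elementNodes] at hcL
  obtain ⟨a, ha, haK⟩ : ∃ a, c a ≠ 0 ∧ a ∉ K := by
    by_contra! h
    refine hc (mem_elementNodes.2 ⟨?_, h⟩)
    rw [← hcL.1]
    have e : ∀ M : Finset (Euc d), M ⊆ K ∪ L → (∀ a, c a ≠ 0 → a ∈ M) →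
        M.sum c = (K ∪ L).sum c := fun M hM h' =>
      Finset.sum_subset hM fun a _ ha => by_contra fun h'' => ha (h' a h'')
    rw [e K Finset.subset_union_left h, e L Finset.subset_union_right hcL.2]
  refine Finset.prod_eq_zero (subset_vertices hL (hcL.2 a ha)) ?_
  refine Finset.prod_eq_zero (Finset.mem_range.2 (Nat.pos_of_ne_zero ha)) ?_
  rw [hat_eq_zero hK hx haK]
  simp

theorem elementNodes_subset (hK : K ∈ T.elements) : elementNodes p K ⊆ T.nodes p := by
  classical
  exact Finset.subset_biUnion_of_mem _ hK

theorem clementZero_eq (hK : K ∈ T.elements) (hx : x ∈ hull K) (v : Euc d → Euc d) :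
    T.clementZero p v x = ∑ c ∈ elementNodes p K, T.shape p K c x • T.nodalValue p v c := by
  rw [clementZero, ← Finset.sum_subset (elementNodes_subset hK)]
  · exact Finset.sum_congr rfl fun c hc => by rw [lagrangeBasis_eq_shape hK hc hx]
  · intro c hcT hc
    rw [lagrangeBasis_eq_zero hK hx hcT hc, zero_smul]

theorem exists_pev_shape (hc : c ∈ elementNodes p K) :
    ∃ P : MvPolynomial (Fin d) ℝ, P.totalDegree ≤ p ∧ ∀ x, pev P x = T.shape p K c x := by
  choose B hB1 hB using fun a => exists_pev_affineMap (T.bary K a)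
  refine ⟨∏ a ∈ K, ∏ j ∈ Finset.range (c a), MvPolynomial.C (((c a : ℝ) - j)⁻¹) *
    (MvPolynomial.C (p : ℝ) * B a - MvPolynomial.C (j : ℝ)), ?_, fun x => ?_⟩
  · calc _ ≤ ∑ a ∈ K, ∑ j ∈ Finset.range (c a), 1 := by
          refine (MvPolynomial.totalDegree_finset_prod _ _).trans (Finset.sum_le_sum fun a _ => ?_)
          refine (MvPolynomial.totalDegree_finset_prod _ _).trans (Finset.sum_le_sum fun j _ => ?_)
          refine (MvPolynomial.totalDegree_mul _ _).trans ?_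
          rw [MvPolynomial.totalDegree_C, zero_add]
          refine (MvPolynomial.totalDegree_sub _ _).trans
            (max_le ?_ ((MvPolynomial.totalDegree_C _).trans_le zero_le_one))
          refine (MvPolynomial.totalDegree_mul _ _).trans ?_
          rw [MvPolynomial.totalDegree_C, zero_add]
          exact hB1 a
      _ = p := by
          rw [← (mem_elementNodes.1 hc).1]
          simp
  · simp only [shape, pev, map_prod, map_mul, map_sub, MvPolynomial.eval_C]
    refine Finset.prod_congr rfl fun a _ => Finset.prod_congr rfl fun j _ => ?_
    rw [← hB a x, pev]
    ring

/-- Each factor has a numerator of modulus at most `p` and a denominator at least `1`, and there are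
`p` factors altogether. The bound is independent of the geometry of the element. -/
theorem abs_shape_le (hK : K ∈ T.elements) (hc : c ∈ elementNodes p K) (hx : x ∈ hull K) :
    |T.shape p K c x| ≤ (p : ℝ) ^ p := by
  have h1 : ∀ a ∈ K, c a ≤ p := fun a ha => by
    rw [← (mem_elementNodes.1 hc).1]
    exact Finset.single_le_sum (f := c) (fun _ _ => Nat.zero_le _) ha
  rw [shape, Finset.abs_prod]
  calc _ ≤ ∏ a ∈ K, (p : ℝ) ^ (c a) := by
        refine Finset.prod_le_prod (fun _ _ => abs_nonneg _) fun a ha => ?_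
        rw [Finset.abs_prod]
        calc _ ≤ ∏ _j ∈ Finset.range (c a), (p : ℝ) := by
              refine Finset.prod_le_prod (fun _ _ => abs_nonneg _) fun j hj => ?_
              have hj1 : (j : ℝ) + 1 ≤ c a := by exact_mod_cast Finset.mem_range.1 hj
              have hjp : (c a : ℝ) ≤ p := by exact_mod_cast h1 a ha
              have h0 := bary_nonneg hK hx ha
              have h2 := bary_le_one hK hx ha
              have hj0 : (0 : ℝ) ≤ j := by positivity
              have hp0 : (0 : ℝ) ≤ p := by positivity
              rw [abs_div, div_le_iff₀ (by rw [abs_pos]; linarith),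
                abs_of_pos (a := (c a : ℝ) - j) (by linarith)]
              have h3 : |(p : ℝ) * T.bary K a x - j| ≤ p := by
                rw [abs_le]; constructor <;> nlinarith
              nlinarith
          _ = _ := by simp
    _ = _ := by rw [Finset.prod_pow_eq_pow_sum, (mem_elementNodes.1 hc).1]

theorem shape_nodePoint (hp : 1 ≤ p) (hK : K ∈ T.elements) (hc : c ∈ elementNodes p K)
    {c' : Euc d → ℕ} (hc' : c' ∈ elementNodes p K) :
    T.shape p K c (T.nodePoint p c') = open Classical in if c = c' then 1 else 0 := by
  have hp0 : (p : ℝ) ≠ 0 := by exact_mod_cast (by omega : p ≠ 0)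
  have e : T.shape p K c (T.nodePoint p c') =
      ∏ a ∈ K, ∏ j ∈ Finset.range (c a), ((c' a : ℝ) - j) / ((c a : ℝ) - j) := by
    refine Finset.prod_congr rfl fun a ha => Finset.prod_congr rfl fun j _ => ?_
    rw [bary_nodePoint hp hK hc' ha, mul_div_cancel₀ _ hp0]
  rw [e]
  split_ifs with h
  · subst h
    refine Finset.prod_eq_one fun a _ => Finset.prod_eq_one fun j hj => ?_
    have : (j : ℝ) < c a := by exact_mod_cast Finset.mem_range.1 hj
    exact div_self (by linarith)
  · obtain ⟨a, ha, hlt⟩ : ∃ a ∈ K, c' a < c a := by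
      by_contra! hle
      refine h (funext fun a => ?_)
      by_cases ha : a ∈ K
      · refine ((Finset.sum_eq_sum_iff_of_le hle).1 ?_) a ha
        exact (mem_elementNodes.1 hc).1.trans (mem_elementNodes.1 hc').1.symm
      · rw [show c a = 0 from by_contra fun h => ha ((mem_elementNodes.1 hc).2 a h),
          show c' a = 0 from by_contra fun h => ha ((mem_elementNodes.1 hc').2 a h)]
    refine Finset.prod_eq_zero ha (Finset.prod_eq_zero (Finset.mem_range.2 hlt) ?_)
    simp

/-- Homogenisation: the exponent `α` of a monomial of degree at most `p`, completed by `p - |α|`, is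
the index of a node. This injects the monomial basis into the nodes. -/
theorem finrank_le_card_elementNodes (hK : K ∈ T.elements) :
    Module.finrank ℝ (MvPolynomial.restrictTotalDegree (Fin d) ℝ p) ≤ (elementNodes p K).card := by
  classical
  let e : K ≃ Fin (d + 1) := Fintype.equivFinOfCardEq (by
    rw [Fintype.card_coe]; exact T.card_eq K hK)
  let f : (Fin d →₀ ℕ) → Fin (d + 1) → ℕ := fun α => Fin.cons (p - ∑ i, α i) α
  let g : (Fin d →₀ ℕ) → Euc d → ℕ := fun α a => if h : a ∈ K then f α (e ⟨a, h⟩) else 0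
  have hb := Module.finrank_eq_nat_card_basis
    (MvPolynomial.basisRestrictSupport ℝ {n : Fin d →₀ ℕ | (n.sum fun _ e => e) ≤ p})
  refine hb.trans_le ?_
  have hg : ∀ α : Fin d →₀ ℕ, (α.sum fun _ e => e) ≤ p → g α ∈ elementNodes p K := by
    intro α hα
    rw [Finsupp.sum_fintype _ _ (fun _ => rfl)] at hα
    refine mem_elementNodes.2 ⟨?_, fun a ha => by_contra fun h => ha (dif_neg h)⟩
    calc K.sum (g α) = ∑ i : K, f α (e i) := by
          rw [← Finset.sum_coe_sort]
          exact Finset.sum_congr rfl fun i _ => dif_pos i.2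
      _ = ∑ i, f α i := Equiv.sum_comp e _
      _ = p := by
          rw [Fin.sum_univ_succ]
          simp only [f, Fin.cons_zero, Fin.cons_succ]
          omega
  have := Nat.card_le_card_of_injective
    (fun α : {n : Fin d →₀ ℕ | (n.sum fun _ e => e) ≤ p} =>
      (⟨g α.1, hg α.1 α.2⟩ : elementNodes p K)) (by
    intro α β h
    have h1 : g α.1 = g β.1 := congrArg Subtype.val h
    refine Subtype.ext (Finsupp.ext fun i => ?_)
    have h2 := congrFun h1 (e.symm i.succ)
    simpa [g, f] using h2)
  simpa using this

/-- The Lagrange polynomials reproduce polynomials. -/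
theorem exists_eq_sum_shape (hp : 1 ≤ p) (hK : K ∈ T.elements) {P : MvPolynomial (Fin d) ℝ}
    (hP : P.totalDegree ≤ p) (x : Euc d) :
    pev P x = ∑ c ∈ elementNodes p K, T.shape p K c x * pev P (T.nodePoint p c) := by
  classical
  let V := MvPolynomial.restrictTotalDegree (Fin d) ℝ p
  choose S hSd hS using fun c : elementNodes p K => exists_pev_shape (T := T) c.2
  let φ : elementNodes p K → V := fun c => ⟨S c, (MvPolynomial.mem_restrictTotalDegree _ _ _).2 (hSd c)⟩
  have hev : ∀ (w : elementNodes p K → ℝ) (x : Euc d),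
      pev (∑ c, w c • φ c : V).1 x = ∑ c, w c * T.shape p K c x := by
    intro w x
    simp only [← hS, pev, Submodule.coe_sum, Submodule.coe_smul, map_sum, MvPolynomial.smul_eval, φ]
  have hnode : ∀ (w : elementNodes p K → ℝ) (c : elementNodes p K),
      pev (∑ c, w c • φ c : V).1 (T.nodePoint p c) = w c := by
    intro w c
    rw [hev, Finset.sum_eq_single c]
    · rw [shape_nodePoint hp hK c.2 c.2, if_pos rfl, mul_one]
    · intro c' _ hne
      rw [shape_nodePoint hp hK c'.2 c.2, if_neg (fun h => hne (Subtype.ext h)), mul_zero]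
    · simp
  have hli : LinearIndependent ℝ φ := by
    rw [Fintype.linearIndependent_iff]
    intro w hw c
    rw [← hnode w c, hw]
    simp [pev]
  -- The shape functions are dual to evaluation at the nodes, so they are independent; with at least
  -- as many nodes as the dimension they form a basis.
  have hcard : Fintype.card (elementNodes p K) = Module.finrank ℝ V := by
    refine le_antisymm hli.fintype_card_le_finrank ?_
    rw [Fintype.card_coe]
    exact finrank_le_card_elementNodes hK
  have hspan := hli.span_eq_top_of_card_eq_finrank' hcard
  let PV : V := ⟨P, (MvPolynomial.mem_restrictTotalDegree _ _ _).2 hP⟩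
  have hmem : PV ∈ Submodule.span ℝ (Set.range φ) := by rw [hspan]; trivial
  obtain ⟨w, hw⟩ := (Submodule.mem_span_range_iff_exists_fun ℝ).1 hmem
  have e : ∀ x, pev P x = pev (∑ c, w c • φ c : V).1 x := fun x => by rw [hw]
  rw [e, hev, ← Finset.sum_coe_sort (elementNodes p K)]
  refine Finset.sum_congr rfl fun c _ => ?_
  rw [e, hnode, mul_comm]

theorem polyField_eq_sum_shape (hp : 1 ≤ p) (hK : K ∈ T.elements) {q : Euc d → Euc d}
    (hq : IsPolyField p q) (x : Euc d) :
    q x = ∑ c ∈ elementNodes p K, T.shape p K c x • q (T.nodePoint p c) := by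
  obtain ⟨P, hP, rfl⟩ := isPolyField_iff.1 hq
  ext j
  have := exists_eq_sum_shape hp hK (hP j) x
  simpa [pfield_apply] using this

theorem isPolyField_shape_smul (hc : c ∈ elementNodes p K) (u : Euc d) :
    IsPolyField p (fun x => T.shape p K c x • u) := by
  obtain ⟨P, hP, h⟩ := exists_pev_shape (T := T) hc
  refine isPolyField_iff.2 ⟨fun j => MvPolynomial.C (u j) * P, fun j => ?_, ?_⟩
  · refine (MvPolynomial.totalDegree_mul _ _).trans ?_
    rw [MvPolynomial.totalDegree_C, zero_add]
    exact hP
  · ext x j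
    rw [pfield_apply, ← h x]
    simp [pev, mul_comm]

end Mesh

end

/-! ### Geometry of Lipschitz domains -/

section

/-! ### The uniform cone property of Lipschitz domains -/

theorem exists_pos_le_of_finset {α : Type*} (s : Finset α) (f : α → ℝ) (hf : ∀ x ∈ s, 0 < f x) :
    ∃ m : ℝ, 0 < m ∧ ∀ x ∈ s, m ≤ f x := by
  classical
  induction s using Finset.induction_on with
  | empty => exact ⟨1, one_pos, by simp⟩
  | insert a s ha ih =>
    obtain ⟨m, hm, h⟩ := ih fun x hx => hf x (Finset.mem_insert_of_mem hx)
    refine ⟨min m (f a), lt_min hm (hf a (Finset.mem_insert_self _ _)), fun x hx => ?_⟩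
    rcases Finset.mem_insert.1 hx with rfl | hx
    · exact min_le_right _ _
    · exact (min_le_left _ _).trans (h x hx)

variable {Ω : Set (Euc d)}

theorem inner_le_of_mem_closure {x e : Euc d} {r : ℝ} {L : ℝ≥0} {φ : Euc d → ℝ}
    (hφ : LipschitzWith L φ)
    (hΩ : ∀ y ∈ Metric.ball x r, (y ∈ Ω ↔ inner ℝ e y < φ (y - (inner ℝ e y : ℝ) • e)))
    {y : Euc d} (hy : y ∈ closure Ω) (hyx : y ∈ Metric.ball x r) :
    inner ℝ e y ≤ φ (y - (inner ℝ e y : ℝ) • e) := by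
  have hcl : IsClosed {y : Euc d | inner ℝ e y ≤ φ (y - (inner ℝ e y : ℝ) • e)} := by
    have := hφ.continuous
    exact isClosed_le (by fun_prop) (by fun_prop)
  have h1 : y ∈ closure (Metric.ball x r ∩ Ω) := Metric.isOpen_ball.inter_closure ⟨hyx, hy⟩
  exact closure_minimal (fun z hz => ((hΩ z hz.1).1 hz.2).le) hcl h1

/-- A boundary point moved slightly in the direction `e` leaves the closure, since the domain lies
below a graph there. The domain has no slits, so interiors of unions of mesh elements lie in `Ω`. -/
theorem IsLipschitzDomain.interior_closure (hΩ : IsLipschitzDomain Ω) :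
    interior (closure Ω) = Ω := by
  refine subset_antisymm (fun y hy => by_contra fun hyΩ => ?_)
    (interior_maximal subset_closure hΩ.isOpen)
  have hyf : y ∈ frontier Ω := ⟨interior_subset hy, by rwa [hΩ.isOpen.interior_eq]⟩
  obtain ⟨e, r, L, φ, he, hr, hφ, hiff⟩ := hΩ.lipschitz_boundary y hyf
  have h0 : φ (y - (inner ℝ e y : ℝ) • e) ≤ inner ℝ e y := by
    by_contra! h
    exact hyΩ ((hiff y (Metric.mem_ball_self hr)).2 h)
  obtain ⟨η, hη, hball⟩ := Metric.isOpen_iff.1 isOpen_interior y hy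
  set t := min η r / 2
  have hm : 0 < min η r := lt_min hη hr
  have ht : 0 < t := by positivity
  have htn : ‖t • e‖ < min η r := by
    rw [norm_smul, he, mul_one, Real.norm_eq_abs, abs_of_pos ht]
    exact half_lt_self hm
  have h1 : y + t • e ∈ closure Ω :=
    interior_subset (hball (by simpa using htn.trans_le (min_le_left _ _)))
  have h2 := inner_le_of_mem_closure hφ hiff h1 (by simpa using htn.trans_le (min_le_right _ _))
  have e1 : (inner ℝ e (y + t • e) : ℝ) = inner ℝ e y + t := by
    rw [inner_add_right, inner_smul_right, real_inner_self_eq_norm_sq, he]; ring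
  rw [e1] at h2
  have e2 : y + t • e - (inner ℝ e y + t) • e = y - (inner ℝ e y : ℝ) • e := by
    rw [add_smul]; abel
  rw [e2] at h2
  linarith

theorem exists_local_cone (hΩ : IsLipschitzDomain Ω) {x : Euc d} (hx : x ∈ frontier Ω) :
    ∃ (e : Euc d) (κ r : ℝ), ‖e‖ = 1 ∧ 0 < κ ∧ 0 < r ∧ ∀ y ∈ closure Ω, ‖y - x‖ < 2 * r →
      ∀ w : Euc d, ‖w + e‖ < κ → ∀ t : ℝ, 0 < t → t < r → y + t • w ∈ Ω := by
  obtain ⟨e, r, L, φ, he, hr, hφ, hiff⟩ := hΩ.lipschitz_boundary x hx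
  -- Moving by `t (u - e)` lowers the vertical coordinate by at least `t (1 - |u|)` and moves the
  -- horizontal part by at most `2 t |u|`, so the graph drops by at most `2 L t |u|`. The point
  -- stays below the graph if `(1 + 2L) |u| < 1`. The radius `r/4` keeps all points in the chart,
  -- because `2 · r/4 + t |w| < r`.
  refine ⟨e, 1 / (2 * L + 2), r / 4, he, by positivity, by positivity, ?_⟩
  intro y hy hyx w hw t ht htr
  set u := w + e with hu
  have hwu : w = u - e := by rw [hu]; abel
  have hL : (0 : ℝ) ≤ L := L.2
  have hu1 : ‖u‖ * (2 * L + 2) < 1 := by rwa [lt_div_iff₀ (by positivity)] at hw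
  have hu2 : ‖u‖ ≤ 1 := by nlinarith [norm_nonneg u]
  have hwn : ‖w‖ ≤ 2 := by
    rw [hwu]; refine (norm_sub_le _ _).trans ?_; rw [he]; linarith
  have hmem : y + t • w ∈ Metric.ball x r := by
    rw [mem_ball_iff_norm]
    calc ‖y + t • w - x‖ = ‖(y - x) + t • w‖ := by congr 1; abel
      _ ≤ ‖y - x‖ + ‖t • w‖ := norm_add_le _ _
      _ < r := by
        rw [norm_smul, Real.norm_eq_abs, abs_of_pos ht]
        nlinarith
  have hyx' : y ∈ Metric.ball x r := by rw [mem_ball_iff_norm]; linarith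
  rw [hiff _ hmem]
  have h1 := inner_le_of_mem_closure hφ hiff hy hyx'
  have hee : (inner ℝ e e : ℝ) = 1 := by rw [real_inner_self_eq_norm_sq, he]; norm_num
  have e1 : (inner ℝ e (y + t • w) : ℝ) = inner ℝ e y + t * (inner ℝ e u - 1) := by
    rw [hwu, inner_add_right, inner_smul_right, inner_sub_right, hee]
  have hin : |(inner ℝ e u : ℝ)| ≤ ‖u‖ := by
    have := abs_real_inner_le_norm e u
    rwa [he, one_mul] at this
  have e2 : y + t • w - (inner ℝ e (y + t • w) : ℝ) • e =
      y - (inner ℝ e y : ℝ) • e + t • (u - (inner ℝ e u : ℝ) • e) := by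
    rw [e1, hwu]; module
  have h2 := hφ.dist_le_mul (y + t • w - (inner ℝ e (y + t • w) : ℝ) • e)
    (y - (inner ℝ e y : ℝ) • e)
  rw [e2, dist_eq_norm (y - _ + _), add_sub_cancel_left, Real.dist_eq, norm_smul, Real.norm_eq_abs,
    abs_of_pos ht] at h2
  have h3 : ‖u - (inner ℝ e u : ℝ) • e‖ ≤ 2 * ‖u‖ := by
    refine (norm_sub_le _ _).trans ?_
    rw [norm_smul, he, Real.norm_eq_abs]
    linarith
  have h4 := (abs_le.1 h2).1
  have h5 : L * (t * ‖u - (inner ℝ e u : ℝ) • e‖) ≤ L * (t * (2 * ‖u‖)) := by gcongr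
  have h6 := (abs_le.1 hin).2
  have h7 : 0 < t * (1 - ‖u‖ - 2 * L * ‖u‖) :=
    mul_pos ht (by nlinarith [norm_nonneg u])
  have h8 : t * inner ℝ e u ≤ t * ‖u‖ := by gcongr
  rw [e2, e1]
  linarith

/-- Uniform cone property. -/
theorem IsLipschitzDomain.exists_cone (hΩ : IsLipschitzDomain Ω) (hd : 1 ≤ d) :
    ∃ κ δ : ℝ, 0 < κ ∧ κ ≤ 1 ∧ 0 < δ ∧ ∀ a ∈ closure Ω, ∃ e : Euc d, ‖e‖ = 1 ∧
      ∀ y ∈ closure Ω, ‖y - a‖ < δ → ∀ w : Euc d, ‖w + e‖ < κ → ∀ t : ℝ, 0 < t → t < δ →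
        y + t • w ∈ Ω := by
  choose! e κ r he hκ hr hcone using fun (x : Euc d) (hx : x ∈ frontier Ω) => exists_local_cone hΩ hx
  have hcomp : IsCompact (frontier Ω) :=
    Metric.isCompact_of_isClosed_isBounded isClosed_frontier
      (hΩ.isBounded.closure.subset frontier_subset_closure)
  obtain ⟨s, hs, hcov⟩ := hcomp.elim_nhds_subcover (fun x => Metric.ball x (r x))
    fun x hx => Metric.ball_mem_nhds x (hr x hx)
  obtain ⟨k, hk, hk'⟩ := exists_pos_le_of_finset s κ fun x hx => hκ x (hs x hx)
  obtain ⟨m, hm, hm'⟩ := exists_pos_le_of_finset s r fun x hx => hr x (hs x hx)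
  -- Points within `m/2` of the boundary inherit the cone of a covering chart. Around the others the
  -- ball of radius `m/2` lies in `Ω`, and steps of length `m/8` cannot leave it.
  refine ⟨min k 1, m / 8, lt_min hk one_pos, min_le_right _ _, by positivity, fun a ha => ?_⟩
  by_cases hb : ∃ b ∈ frontier Ω, ‖b - a‖ < m / 2
  · obtain ⟨b, hbΩ, hba⟩ := hb
    obtain ⟨x, hx, hbx⟩ := Set.mem_iUnion₂.1 (hcov hbΩ)
    rw [mem_ball_iff_norm] at hbx
    refine ⟨e x, he x (hs x hx), fun y hy hya w hw t ht htm => ?_⟩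
    have hmx := hm' x hx
    refine hcone x (hs x hx) y hy ?_ w (hw.trans_le ((min_le_left _ _).trans (hk' x hx))) t ht
      (by linarith)
    calc ‖y - x‖ = ‖(y - a) + ((b - x) - (b - a))‖ := by congr 1; abel
      _ ≤ ‖y - a‖ + (‖b - x‖ + ‖b - a‖) :=
        (norm_add_le _ _).trans (by gcongr; exact norm_sub_le _ _)
      _ < _ := by linarith
  · push Not at hb
    refine ⟨EuclideanSpace.single ⟨0, hd⟩ 1, by simp, fun y hy hya w hw t ht htm => ?_⟩
    -- The ball is connected, misses the boundary and meets `Ω`, so it lies in `Ω`. Any unit vector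
    -- then serves as cone axis.
    have hsub : Metric.ball a (m / 2) ⊆ Ω := by
      obtain ⟨y', hy', hyΩ⟩ := Metric.mem_closure_iff.1 ha (m / 2) (by positivity)
      refine (convex_ball a (m / 2)).isPreconnected.subset_left_of_subset_union hΩ.isOpen
        isClosed_closure.isOpen_compl (Set.disjoint_left.2 fun x hx hx' => hx' (subset_closure hx))
        (fun x hx => ?_) ⟨y', by rwa [Metric.mem_ball, dist_comm], hy'⟩
      by_contra hxn
      simp only [Set.mem_union, Set.mem_compl_iff, not_or, not_not] at hxn
      rw [mem_ball_iff_norm] at hx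
      exact absurd (hb x ⟨hxn.2, by rw [hΩ.isOpen.interior_eq]; exact hxn.1⟩) (not_le.2 hx)
    refine hsub ?_
    have hw1 : ‖w + EuclideanSpace.single ⟨0, hd⟩ 1‖ < 1 := hw.trans_le (min_le_right _ _)
    have hwn : ‖w‖ ≤ 2 := by
      have := norm_sub_le (w + EuclideanSpace.single (⟨0, hd⟩ : Fin d) (1 : ℝ))
        (EuclideanSpace.single ⟨0, hd⟩ 1)
      simp at this
      linarith
    rw [mem_ball_iff_norm]
    calc ‖y + t • w - a‖ = ‖(y - a) + t • w‖ := by congr 1; abel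
      _ ≤ ‖y - a‖ + t * ‖w‖ := by
        refine (norm_add_le _ _).trans ?_
        rw [norm_smul, Real.norm_eq_abs, abs_of_pos ht]
      _ < _ := by nlinarith

end

/-! ### Elements with a common vertex -/

section

/-! ### Elements with a common vertex -/

namespace Mesh

variable {Ω : Set (Euc d)} {T : Mesh Ω} {K L : Finset (Euc d)} {a b x : Euc d} {σ : ℝ}

theorem ShapeRegular.mono {σ' : ℝ} (h : T.ShapeRegular σ) (hσ : σ ≤ σ') : T.ShapeRegular σ' := by
  intro K hK
  obtain ⟨x, ρ, hρ, hB, hd⟩ := h K hK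
  exact ⟨x, ρ, hρ, hB, hd.trans (by gcongr)⟩

/-- The finitely many closed simplices that do not contain `a` have positive distance from it. The
same argument is used for elements and for their lower dimensional faces. -/
theorem exists_radius_of_finset (S : Finset (Finset (Euc d))) (a : Euc d) :
    ∃ η : ℝ, 0 < η ∧ ∀ f ∈ S, ∀ x ∈ hull f, ‖x - a‖ < η → a ∈ hull f := by
  classical
  set S' := S.filter fun K => a ∉ hull K
  have hcl : IsClosed (⋃ K ∈ S', hull K) :=
    S'.finite_toSet.isClosed_biUnion fun K _ => (isCompact_hull K).isClosed
  have ha : a ∈ (⋃ K ∈ S', hull K)ᶜ := by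
    simp [S']
  obtain ⟨η, hη, hball⟩ := Metric.isOpen_iff.1 hcl.isOpen_compl a ha
  refine ⟨η, hη, fun K hK x hx hxa => by_contra fun h => ?_⟩
  refine hball (mem_ball_iff_norm.2 hxa) ?_
  exact Set.mem_biUnion (show K ∈ S' from Finset.mem_filter.2 ⟨hK, h⟩) hx

variable (T) in
theorem exists_radius (a : Euc d) : ∃ η : ℝ, 0 < η ∧ ∀ K ∈ T.elements, ∀ x ∈ hull K, ‖x - a‖ < η →
    a ∈ hull K :=
  exists_radius_of_finset T.elements a

theorem mem_of_mem_hull (hL : L ∈ T.elements) (ha : a ∈ L) (hK : K ∈ T.elements)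
    (h : a ∈ hull K) : a ∈ K := by
  by_contra haK
  have := bary_eq_zero_of_mem hL hK (subset_convexHull ℝ _ (by exact_mod_cast ha)) h ha haK
  rw [bary_self hL ha] at this
  exact one_ne_zero this

theorem mem_hull_of_mem (ha : a ∈ K) : a ∈ hull K := subset_convexHull ℝ _ (by exact_mod_cast ha)

/-- The coordinate of `a` rises from `0` at `b` to `1` at `a`, with slope at most `1 / (2ρ)`. -/
theorem two_mul_le_norm_sub (hK : K ∈ T.elements) (ha : a ∈ K) (hb : b ∈ K) (hab : a ≠ b)
    {z : Euc d} {ρ : ℝ} (hρ : 0 < ρ) (hB : Metric.ball z ρ ⊆ hull K) : 2 * ρ ≤ ‖a - b‖ := by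
  have h1 := bary_linear_le hK ha hρ hB (a - b)
  have h2 := affineMap_add (T.bary K a) b (a - b)
  rw [add_sub_cancel, bary_self hK ha, bary_ne hK hb hab, zero_add] at h2
  rw [← h2, abs_one, le_div_iff₀ (by positivity)] at h1
  linarith

theorem exists_notMem_span (hd : 2 ≤ d) (e : Euc d) : ∃ u : Euc d, u ∉ Submodule.span ℝ {e} := by
  by_contra! h
  have h1 : Submodule.span ℝ {e} = ⊤ := by
    ext u; simp [h u]
  have h2 := finrank_span_le_card (R := ℝ) ({e} : Set (Euc d))
  rw [h1, finrank_top, finrank_euclideanSpace, Fintype.card_fin] at h2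
  simp at h2
  omega

theorem exists_mem_off_line (hd : 2 ≤ d) (a e : Euc d) {U : Set (Euc d)} (hU : IsOpen U)
    (hne : U.Nonempty) : ∃ x ∈ U, ∀ t : ℝ, x ≠ a + t • e := by
  obtain ⟨x0, hx0⟩ := hne
  obtain ⟨u, hu⟩ := exists_notMem_span hd e
  by_contra! h
  obtain ⟨t0, ht0⟩ := h x0 hx0
  obtain ⟨η, hη, hball⟩ := Metric.isOpen_iff.1 hU x0 hx0
  have hu0 : u ≠ 0 := fun h => hu (h ▸ Submodule.zero_mem _)
  have hun : 0 < ‖u‖ := norm_pos_iff.2 hu0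
  set r := η / 2 / ‖u‖
  have hr : 0 < r := by positivity
  have h1 : x0 + r • u ∈ U := hball (by
    rw [mem_ball_iff_norm, add_sub_cancel_left, norm_smul, Real.norm_eq_abs, abs_of_pos hr,
      div_mul_cancel₀ _ hun.ne']
    linarith)
  obtain ⟨t1, ht1⟩ := h _ h1
  refine hu (Submodule.mem_span_singleton.2 ⟨r⁻¹ * (t1 - t0), ?_⟩)
  have : r • u = (t1 - t0) • e := by
    rw [ht0] at ht1
    have : r • u = (a + t0 • e + r • u) - (a + t0 • e) := by abel
    rw [this, ht1, sub_smul]; abel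
  rw [mul_smul, ← this, smul_smul, inv_mul_cancel₀ hr.ne', one_smul]

/-- The elements at a vertex are connected through common edges. -/
theorem of_edge_connected (hΩ : IsLipschitzDomain Ω) (hd : 2 ≤ d) (P : Finset (Euc d) → Prop)
    (hP : ∀ L ∈ T.elements, ∀ L' ∈ T.elements, a ∈ L → a ∈ L' → P L → ¬ P L' →
      ∀ b ∈ L, b ∈ L' → b = a)
    {L L' : Finset (Euc d)} (hL : L ∈ T.elements) (hL' : L' ∈ T.elements) (haL : a ∈ L)
    (haL' : a ∈ L') (hPL : P L) : P L' := by
  classical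
  by_contra hPL'
  obtain ⟨κ, δ, hκ, hκ1, hδ, hcone⟩ := hΩ.exists_cone (by omega)
  have haΩ : a ∈ closure Ω := hull_subset_closure hL (mem_hull_of_mem haL)
  obtain ⟨e, he, hcone⟩ := hcone a haΩ
  obtain ⟨η, hη, hloc⟩ := T.exists_radius a
  set t := min δ η / 4 with ht
  have hm : 0 < min δ η := lt_min hδ hη
  have ht0 : 0 < t := by positivity
  have htδ : 4 * t ≤ δ := by rw [ht]; linarith [min_le_left δ η]
  have htη : 4 * t ≤ η := by rw [ht]; linarith [min_le_right δ η]
  -- The starting points are chosen off the line through `a` in direction `e`, so that descending in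
  -- direction `-e` does not meet `a`. This needs `d ≥ 2`.
  have hpick : ∀ M ∈ T.elements, a ∈ M → ∃ x ∈ hull M, ‖x - a‖ < κ * t ∧ ∀ r : ℝ, x ≠ a + r • e := by
    intro M hM haM
    have h1 : a ∈ closure (interior (hull M)) := by
      rw [closure_interior_hull hM]; exact mem_hull_of_mem haM
    obtain ⟨x0, hx0, hx0'⟩ := Metric.mem_closure_iff.1 h1 (κ * t) (by positivity)
    obtain ⟨x, hx, hx'⟩ := exists_mem_off_line hd a e
      (isOpen_interior.inter Metric.isOpen_ball : IsOpen (interior (hull M) ∩ Metric.ball a (κ * t)))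
      ⟨x0, hx0, by rwa [Metric.mem_ball, dist_comm]⟩
    exact ⟨x, interior_subset hx.1, mem_ball_iff_norm.1 hx.2, hx'⟩
  set B := Metric.ball (a - t • e) (κ * t) with hB
  have hκt : κ * t ≤ t := by nlinarith
  have hte : ‖t • e‖ = t := by rw [norm_smul, he, mul_one, Real.norm_eq_abs, abs_of_pos ht0]
  have hBΩ : ∀ z ∈ B, z ∈ closure Ω ∧ ‖z - a‖ < η ∧ z ≠ a := by
    intro z hz
    rw [hB, mem_ball_iff_norm] at hz
    refine ⟨subset_closure ?_, ?_, ?_⟩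
    · have := hcone a haΩ (by simpa using hδ) (t⁻¹ • (z - a)) ?_ t ht0 (by linarith)
      · rwa [smul_smul, mul_inv_cancel₀ ht0.ne', one_smul, add_sub_cancel] at this
      · have e1 : t⁻¹ • (z - a) + e = t⁻¹ • (z - (a - t • e)) := by
          rw [← sub_add, smul_add, smul_smul, inv_mul_cancel₀ ht0.ne', one_smul]
        rw [e1, norm_smul, norm_inv, Real.norm_eq_abs, abs_of_pos ht0, inv_mul_lt_iff₀ ht0]
        linarith
    · calc ‖z - a‖ = ‖(z - (a - t • e)) - t • e‖ := by congr 1; abel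
        _ ≤ ‖z - (a - t • e)‖ + ‖t • e‖ := norm_sub_le _ _
        _ < η := by rw [hte]; linarith
    · rintro rfl
      rw [sub_sub_cancel, hte] at hz
      linarith
  have hseg : ∀ x : Euc d, x ∈ closure Ω → ‖x - a‖ < κ * t → (∀ r : ℝ, x ≠ a + r • e) →
      ∀ z ∈ segment ℝ x (x - t • e), z ∈ closure Ω ∧ ‖z - a‖ < η ∧ z ≠ a := by
    intro x hx hxa hxe z hz
    rw [segment_eq_image'] at hz
    obtain ⟨r, hr, rfl⟩ := hz
    have e1 : x + r • (x - t • e - x) = x + (r * t) • -e := by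
      rw [sub_sub_cancel_left, mul_smul, smul_neg, smul_neg, smul_neg]
    simp only [e1]
    have hrt0 : 0 ≤ r * t := mul_nonneg hr.1 ht0.le
    have hrt : r * t ≤ t := by nlinarith [hr.2]
    refine ⟨?_, ?_, ?_⟩
    · rcases hrt0.eq_or_lt with h0 | h0
      · rw [← h0, zero_smul, add_zero]; exact hx
      · exact subset_closure (hcone x hx (by linarith) (-e) (by simpa using hκ) _ h0 (by linarith))
    · calc ‖x + (r * t) • -e - a‖ = ‖(x - a) + (r * t) • -e‖ := by congr 1; abel
        _ ≤ ‖x - a‖ + ‖(r * t) • -e‖ := norm_add_le _ _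
        _ < η := by
          rw [norm_smul, norm_neg, he, mul_one, Real.norm_eq_abs, abs_of_nonneg hrt0]
          linarith
    · intro h
      refine hxe (r * t) ?_
      rw [← h, smul_neg]
      abel
  have hend : ∀ x : Euc d, ‖x - a‖ < κ * t → x - t • e ∈ B := by
    intro x hx
    rw [hB, mem_ball_iff_norm, sub_sub_sub_cancel_right]
    exact hx
  obtain ⟨x, hxL, hxa, hxe⟩ := hpick L hL haL
  obtain ⟨y, hyL, hya, hye⟩ := hpick L' hL' haL'
  -- From a point of `L` descend along `-e` into the ball `B` below `a`, cross it, and ascend to a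
  -- point of `L'`. The set `S` is connected, lies in `closure Ω` near `a`, and avoids `a`.
  set S := (segment ℝ x (x - t • e) ∪ B) ∪ segment ℝ y (y - t • e) with hS
  have hSc : IsPreconnected S := by
    refine IsPreconnected.union (y - t • e) (Or.inr (hend y hya)) (right_mem_segment ℝ _ _) ?_
      (convex_segment _ _).isPreconnected
    exact IsPreconnected.union (x - t • e) (right_mem_segment ℝ _ _) (hend x hxa)
      (convex_segment _ _).isPreconnected (convex_ball _ _).isPreconnected
  have hSp : ∀ z ∈ S, z ∈ closure Ω ∧ ‖z - a‖ < η ∧ z ≠ a := by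
    rintro z ((hz | hz) | hz)
    · exact hseg x (hull_subset_closure hL hxL) hxa hxe z hz
    · exact hBΩ z hz
    · exact hseg y (hull_subset_closure hL' hyL) hya hye z hz
  set F : (Finset (Euc d) → Prop) → Set (Euc d) := fun Q =>
    ⋃ M ∈ T.elements.filter fun M => a ∈ M ∧ Q M, hull M with hF
  have hFc : ∀ Q, IsClosed (F Q) := fun Q =>
    (Finset.finite_toSet _).isClosed_biUnion fun M _ => (isCompact_hull M).isClosed
  have hFm : ∀ Q z, z ∈ F Q ↔ ∃ M ∈ T.elements, (a ∈ M ∧ Q M) ∧ z ∈ hull M := by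
    intro Q z
    simp only [hF, Set.mem_iUnion, Finset.mem_filter]
    constructor
    · rintro ⟨M, ⟨h1, h2⟩, h3⟩; exact ⟨M, h1, h2, h3⟩
    · rintro ⟨M, h1, h2, h3⟩; exact ⟨M, ⟨h1, h2⟩, h3⟩
  have hcov : S ⊆ F P ∪ F fun M => ¬ P M := by
    intro z hz
    obtain ⟨h1, h2, -⟩ := hSp z hz
    obtain ⟨M, hM, hzM⟩ := exists_mem_hull (T := T) h1
    have haM := mem_of_mem_hull hL haL hM (hloc M hM z hzM h2)
    by_cases hPM : P M
    · exact Or.inl ((hFm _ _).2 ⟨M, hM, ⟨haM, hPM⟩, hzM⟩)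
    · exact Or.inr ((hFm _ _).2 ⟨M, hM, ⟨haM, hPM⟩, hzM⟩)
  -- The elements at `a` with and without `P` form two closed sets covering the connected set, so
  -- they share a point `z ≠ a`. If the two elements had only the vertex `a` in common, conformity
  -- would force `z = a`.
  obtain ⟨z, hzS, hz1, hz2⟩ := isPreconnected_closed_iff.1 hSc _ _ (hFc P) (hFc _) hcov
    ⟨x, Or.inl (Or.inl (left_mem_segment ℝ _ _)), (hFm _ _).2 ⟨L, hL, ⟨haL, hPL⟩, hxL⟩⟩
    ⟨y, Or.inr (left_mem_segment ℝ _ _), (hFm _ _).2 ⟨L', hL', ⟨haL', hPL'⟩, hyL⟩⟩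
  obtain ⟨M, hM, ⟨haM, hPM⟩, hzM⟩ := (hFm _ _).1 hz1
  obtain ⟨M', hM', ⟨haM', hPM'⟩, hzM'⟩ := (hFm _ _).1 hz2
  have h1 := mem_hull_inter hM hM' hzM hzM'
  have h2 : M ∩ M' = {a} := by
    refine Finset.eq_singleton_iff_unique_mem.2 ⟨Finset.mem_inter.2 ⟨haM, haM'⟩, fun b hb => ?_⟩
    exact hP M hM M' hM' haM haM' hPM hPM' b (Finset.mem_inter.1 hb).1 (Finset.mem_inter.1 hb).2
  rw [h2, hull, Finset.coe_singleton, convexHull_singleton] at h1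
  exact (hSp z hzS).2.2 h1

variable (T) in
/-- The elements that have the vertex `a`. -/
def star (a : Euc d) : Finset (Finset (Euc d)) :=
  open Classical in T.elements.filter fun K => a ∈ K

theorem mem_star : K ∈ T.star a ↔ K ∈ T.elements ∧ a ∈ K := by
  classical
  exact Finset.mem_filter

theorem diam_pos (hd : 1 ≤ d) (hK : K ∈ T.elements) : 0 < Metric.diam (hull K) := by
  obtain ⟨x, hx⟩ := exists_mem_interior hK
  obtain ⟨η, hη, hball⟩ := Metric.isOpen_iff.1 isOpen_interior x hx
  set u : Euc d := EuclideanSpace.single ⟨0, hd⟩ (η / 2)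
  have hu : ‖u‖ = η / 2 := by simp [u, abs_of_pos hη]
  have h1 : x + u ∈ hull K := interior_subset (hball (by
    rw [mem_ball_iff_norm, add_sub_cancel_left, hu]; linarith))
  have h2 := norm_sub_le_diam h1 (interior_subset hx)
  rw [add_sub_cancel_left, hu] at h2
  linarith

theorem smul_sub_mem_hull {t : ℝ} (ha : a ∈ hull K) (hx : x ∈ hull K) (h0 : 0 ≤ t) (h1 : t ≤ 1) :
    a + t • (x - a) ∈ hull K :=
  (convex_hull K).add_smul_sub_mem ha hx ⟨h0, h1⟩

/-- Shrinking an element towards one of its points. -/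
theorem ball_subset_of_scale {z : Euc d} {ρ t : ℝ} (ha : a ∈ hull K)
    (hB : Metric.ball z ρ ⊆ hull K) (h0 : 0 < t) (h1 : t ≤ 1) :
    Metric.ball (a + t • (z - a)) (t * ρ) ⊆ hull K := by
  intro x hx
  rw [mem_ball_iff_norm] at hx
  have e : x = a + t • ((a + t⁻¹ • (x - a)) - a) := by
    rw [add_sub_cancel_left, smul_smul, mul_inv_cancel₀ h0.ne', one_smul, add_sub_cancel]
  rw [e]
  refine smul_sub_mem_hull ha (hB ?_) h0.le h1
  rw [mem_ball_iff_norm]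
  have e2 : a + t⁻¹ • (x - a) - z = t⁻¹ • (x - (a + t • (z - a))) := by
    rw [sub_add_eq_sub_sub, smul_sub _ (x - a), smul_smul, inv_mul_cancel₀ h0.ne', one_smul]
    abel
  rw [e2, norm_smul, norm_inv, Real.norm_eq_abs, abs_of_pos h0, inv_mul_lt_iff₀ h0]
  exact hx

/-- Packing: each element is shrunk towards `a` until its diameter is the smallest one, `h`. The
shrunk elements contain disjoint balls of radius `h / σ`, all inside the ball of radius `h` around
`a`. -/
theorem card_star_le (hd : 1 ≤ d) (hσ : 0 < σ) (hT : T.ShapeRegular σ) (a : Euc d) :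
    ((T.star a).card : ℝ) ≤ σ ^ d := by
  classical
  rcases (T.star a).eq_empty_or_nonempty with h0 | hne
  · rw [h0]; simp; positivity
  obtain ⟨K0, hK0, hmin⟩ := (T.star a).exists_min_image (fun K => Metric.diam (hull K)) hne
  set h := Metric.diam (hull K0) with hh
  have hpos : 0 < h := diam_pos hd (mem_star.1 hK0).1
  choose! z ρ hρ hB hdiam using hT
  set t : Finset (Euc d) → ℝ := fun K => h / Metric.diam (hull K) with ht
  set Bs : Finset (Euc d) → Set (Euc d) := fun K => Metric.ball (a + t K • (z K - a)) (h / σ) with hBs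
  have hK1 : ∀ K ∈ T.star a, Bs K ⊆ interior (hull K) ∧ Bs K ⊆ Metric.closedBall a h := by
    intro K hK
    obtain ⟨hKT, haK⟩ := mem_star.1 hK
    have hdK := diam_pos hd hKT
    have ht0 : 0 < t K := by positivity
    have ht1 : t K ≤ 1 := (div_le_one hdK).2 (hmin K hK)
    have hr : h / σ ≤ t K * ρ K := by
      rw [div_le_iff₀ hσ]
      calc h = t K * Metric.diam (hull K) := by rw [ht]; field_simp
        _ ≤ t K * (σ * ρ K) := by gcongr; exact hdiam K hKT
        _ = _ := by ring
    have ha := mem_hull_of_mem haK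
    refine ⟨interior_maximal ((Metric.ball_subset_ball hr).trans
      (ball_subset_of_scale ha (hB K hKT) ht0 ht1)) Metric.isOpen_ball, fun x hx => ?_⟩
    rw [mem_closedBall_iff_norm]
    rw [hBs, mem_ball_iff_norm] at hx
    have h2 : a + (t K)⁻¹ • (x - a) ∈ hull K := by
      refine hB K hKT ?_
      rw [mem_ball_iff_norm]
      have e2 : a + (t K)⁻¹ • (x - a) - z K = (t K)⁻¹ • (x - (a + t K • (z K - a))) := by
        rw [sub_add_eq_sub_sub, smul_sub _ (x - a), smul_smul, inv_mul_cancel₀ ht0.ne', one_smul]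
        abel
      rw [e2, norm_smul, norm_inv, Real.norm_eq_abs, abs_of_pos ht0, inv_mul_lt_iff₀ ht0]
      linarith
    have h3 := norm_sub_le_diam h2 ha
    rw [add_sub_cancel_left, norm_smul, norm_inv, Real.norm_eq_abs, abs_of_pos ht0,
      inv_mul_le_iff₀ ht0] at h3
    refine h3.trans_eq ?_
    rw [ht]; field_simp
  have hdisj : (T.star a : Set (Finset (Euc d))).PairwiseDisjoint Bs := by
    intro K hK L hL hKL
    refine Set.disjoint_left.2 fun x hxK hxL => ?_
    exact notMem_hull_of_mem_interior (mem_star.1 hK).1 (mem_star.1 hL).1 hKL ((hK1 K hK).1 hxK)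
      (interior_subset ((hK1 L hL).1 hxL))
  have hvol : ∑ K ∈ T.star a, volume (Bs K) ≤ volume (Metric.closedBall a h) := by
    rw [← measure_biUnion_finset hdisj fun _ _ => measurableSet_ball]
    exact measure_mono (Set.iUnion₂_subset fun K hK => (hK1 K hK).2)
  have hv0 : volume (Metric.ball (0 : Euc d) 1) ≠ 0 := (Metric.measure_ball_pos _ _ one_pos).ne'
  have hvt : volume (Metric.ball (0 : Euc d) 1) ≠ ⊤ := measure_ball_lt_top.ne
  have hvK : ∀ K, volume (Bs K) = ENNReal.ofReal ((h / σ) ^ d) * volume (Metric.ball (0 : Euc d) 1) := by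
    intro K
    rw [hBs, Measure.addHaar_ball_of_pos _ _ (by positivity), finrank_euclideanSpace, Fintype.card_fin]
  simp only [hvK] at hvol
  rw [Finset.sum_const, nsmul_eq_mul, Measure.addHaar_closedBall _ _ hpos.le,
    finrank_euclideanSpace, Fintype.card_fin, ← mul_assoc, ENNReal.mul_le_mul_iff_left hv0 hvt,
    ← ENNReal.ofReal_natCast, ← ENNReal.ofReal_mul (by positivity),
    ENNReal.ofReal_le_ofReal_iff (by positivity), div_pow, mul_div_assoc', div_le_iff₀ (by positivity),
    mul_comm (h ^ d)] at hvol
  exact le_of_mul_le_mul_right hvol (by positivity)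

/-- Elements with a common vertex have comparable diameters. -/
theorem diam_le_of_mem_star (hΩ : IsLipschitzDomain Ω) (hd : 2 ≤ d) (hσ : 1 ≤ σ)
    (hT : T.ShapeRegular σ) (hK : K ∈ T.star a) (hL : L ∈ T.star a) :
    Metric.diam (hull K) ≤ σ ^ ⌊σ ^ d⌋₊ * Metric.diam (hull L) := by
  classical
  have hσ0 : 0 < σ := by linarith
  set h0 := Metric.diam (hull L)
  have hh0 : 0 < h0 := diam_pos (by omega) (mem_star.1 hL).1
  set A : ℕ → Finset (Finset (Euc d)) := fun j =>
    (T.star a).filter fun M => Metric.diam (hull M) ≤ σ ^ j * h0 with hA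
  have hAm : ∀ j M, M ∈ A j ↔ M ∈ T.star a ∧ Metric.diam (hull M) ≤ σ ^ j * h0 := fun j M =>
    Finset.mem_filter
  have hmono : ∀ j, A j ⊆ A (j + 1) := by
    intro j M hM
    rw [hAm] at hM ⊢
    refine ⟨hM.1, hM.2.trans ?_⟩
    gcongr
    omega
  -- As long as `A j` is not the whole star, some element of it has a common edge with an element
  -- outside. The latter belongs to `A (j + 1)`, so each step adds an element; at most `σ^d`
  -- elements are available.
  have hstep : ∀ j, A j = T.star a ∨ j + 1 ≤ (A j).card := by
    intro j
    induction j with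
    | zero =>
      right
      refine Finset.card_pos.2 ⟨L, (hAm _ _).2 ⟨hL, ?_⟩⟩
      rw [pow_zero, one_mul]
    | succ j ih =>
      rcases ih with ih | ih
      · left
        exact (Finset.filter_subset _ _).antisymm (ih.symm.subset.trans (hmono j))
      · by_cases hall : A j = T.star a
        · left
          exact (Finset.filter_subset _ _).antisymm (hall.symm.subset.trans (hmono j))
        right
        obtain ⟨M, hM, hMA⟩ : ∃ M ∈ T.star a, M ∉ A j := by
          by_contra! hcon
          exact hall ((Finset.filter_subset _ _).antisymm hcon)
        have hLA : L ∈ A j := (hAm _ _).2 ⟨hL, by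
          have : 1 ≤ σ ^ j := one_le_pow₀ hσ
          change h0 ≤ _
          nlinarith⟩
        obtain ⟨N, hN, N', hN', haN, haN', hNA, hN'A, b, hbN, hbN', hba⟩ :
            ∃ N ∈ T.elements, ∃ N' ∈ T.elements, a ∈ N ∧ a ∈ N' ∧ N ∈ A j ∧ N' ∉ A j ∧
              ∃ b, b ∈ N ∧ b ∈ N' ∧ b ≠ a := by
          by_contra! hcon
          exact hMA (of_edge_connected hΩ hd (fun M => M ∈ A j)
            (fun N hN N' hN' h1 h2 h3 h4 b h5 h6 => hcon N hN N' hN' h1 h2 h3 h4 b h5 h6)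
            (mem_star.1 hL).1 (mem_star.1 hM).1 (mem_star.1 hL).2 (mem_star.1 hM).2 hLA)
        have hN'A1 : N' ∈ A (j + 1) := by
          refine (hAm _ _).2 ⟨mem_star.2 ⟨hN', haN'⟩, ?_⟩
          obtain ⟨z, ρ, hρ, hB, hdiam⟩ := hT N' hN'
          -- The common edge has length at least twice the inner radius of `N'` and at most the
          -- diameter of `N`, so the diameter of `N'` is at most `σ` times that of `N`.
          have h1 := two_mul_le_norm_sub hN' hbN' haN' hba hρ hB
          have h2 := norm_sub_le_diam (mem_hull_of_mem hbN) (mem_hull_of_mem haN)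
          have h3 := ((hAm _ _).1 hNA).2
          refine hdiam.trans ?_
          rw [pow_succ, mul_comm (σ ^ j), mul_assoc]
          gcongr
          linarith
        have : A j ⊂ A (j + 1) := Finset.ssubset_iff_subset_ne.2 ⟨hmono j, fun h => hN'A (h ▸ hN'A1)⟩
        have := Finset.card_lt_card this
        omega
  have hcard : (T.star a).card ≤ ⌊σ ^ d⌋₊ := Nat.le_floor (card_star_le (by omega) hσ0 hT a)
  rcases hstep ⌊σ ^ d⌋₊ with h | h
  · have : K ∈ A ⌊σ ^ d⌋₊ := h ▸ hK
    exact ((hAm _ _).1 this).2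
  · have := Finset.card_le_card (Finset.filter_subset (fun M => Metric.diam (hull M) ≤ σ ^ ⌊σ ^ d⌋₊ * h0)
      (T.star a))
    change (A ⌊σ ^ d⌋₊).card ≤ _ at this
    omega

end Mesh

end

/-! ### Uniform approximation on patches -/

section

/-! ### Approximation on patches -/

theorem slob_zero_le_sobolevSeminorm {U : Set (Euc d)} {v : Euc d → Euc d} (hU : IsOpen U)
    (hv : LocallyIntegrableOn v U) : slob 0 U v ≤ sobolevSeminorm 0 U v := by
  have h1 := slob_le_semi hU (θ := 0) (HasWeakDeriv.zero (I := (Fin.elim0 : Fin 0 → Fin d)) hv)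
  have h2 := sobolevSeminorm_natCast 0 U v
  rw [Nat.cast_zero] at h2
  rwa [h2]

namespace Mesh

variable {Ω : Set (Euc d)} {T : Mesh Ω} {K L : Finset (Euc d)} {a b x : Euc d} {σ : ℝ} {p : ℕ}
  {c : Euc d → ℕ}

variable (T) in
/-- The elements that contain a node. -/
def nodeElements (p : ℕ) (c : Euc d → ℕ) : Finset (Finset (Euc d)) :=
  open Classical in T.elements.filter fun K => T.nodePoint p c ∈ hull K

theorem mem_nodeElements : K ∈ T.nodeElements p c ↔ K ∈ T.elements ∧ T.nodePoint p c ∈ hull K := by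
  classical
  exact Finset.mem_filter

theorem mem_nodeElements_of_mem (hp : 1 ≤ p) (hK : K ∈ T.elements) (hc : c ∈ elementNodes p K) :
    K ∈ T.nodeElements p c := mem_nodeElements.2 ⟨hK, nodePoint_mem hp hK hc⟩

theorem patch_eq : T.patch p c = interior (⋃ K ∈ T.nodeElements p c, hull K) := by
  rw [patch]
  congr 1
  ext x
  simp [mem_nodeElements, and_assoc]

theorem isOpen_patch : IsOpen (T.patch p c) := isOpen_interior

theorem patch_subset (hΩ : IsLipschitzDomain Ω) : T.patch p c ⊆ Ω := by
  rw [patch_eq]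
  refine (interior_mono (Set.iUnion₂_subset fun K hK => ?_)).trans hΩ.interior_closure.subset
  exact hull_subset_closure (mem_nodeElements.1 hK).1

theorem interior_subset_patch (hK : K ∈ T.nodeElements p c) : interior (hull K) ⊆ T.patch p c := by
  rw [patch_eq]
  exact interior_mono (Set.subset_biUnion_of_mem (u := fun K => hull K) hK)

theorem isBounded_patch (hΩ : IsLipschitzDomain Ω) : Bornology.IsBounded (T.patch p c) :=
  hΩ.isBounded.subset (patch_subset hΩ)

theorem diam_le_diam_patch (hΩ : IsLipschitzDomain Ω) (hK : K ∈ T.nodeElements p c) :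
    Metric.diam (hull K) ≤ Metric.diam (T.patch p c) := by
  rw [← closure_interior_hull (mem_nodeElements.1 hK).1, Metric.diam_closure]
  exact Metric.diam_mono (interior_subset_patch hK) (isBounded_patch hΩ)

theorem nodeElements_subset_star (hp : 1 ≤ p) (hK : K ∈ T.elements) (hc : c ∈ elementNodes p K) :
    ∃ b, T.nodeElements p c ⊆ T.star b := by
  obtain ⟨b, hb⟩ : ∃ b, c b ≠ 0 := by
    by_contra! h
    have := (mem_elementNodes.1 hc).1
    simp [h] at this
    omega
  refine ⟨b, fun L hL => ?_⟩
  obtain ⟨hL, haL⟩ := mem_nodeElements.1 hL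
  exact mem_star.2 ⟨hL, (mem_elementNodes.1
    (mem_elementNodes_of_nodePoint_mem hp hK hc hL haL)).2 b hb⟩

/-- The boundaries of simplices are null sets, so the patch may be replaced by the open elements;
the square root is subadditive. -/
theorem slob_zero_patch_le (g : Euc d → Euc d) :
    slob 0 (T.patch p c) g ≤ ∑ K ∈ T.nodeElements p c, slob 0 (interior (hull K)) g := by
  rw [slob_zero_eq]
  simp only [slob_zero_eq (interior _)]
  refine le_trans (ENNReal.rpow_le_rpow ?_ (by norm_num)) (sum_rpow_half_le _ _)
  calc ∫⁻ x in T.patch p c, ‖g x‖ₑ ^ 2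
      ≤ ∫⁻ x in ⋃ K : T.nodeElements p c, hull K.1, ‖g x‖ₑ ^ 2 := by
        refine lintegral_mono_set ?_
        rw [patch_eq]
        refine interior_subset.trans (Set.iUnion₂_subset fun K hK => ?_)
        exact Set.subset_iUnion (fun K : T.nodeElements p c => hull K.1) ⟨K, hK⟩
    _ ≤ ∑' K : T.nodeElements p c, ∫⁻ x in hull K.1, ‖g x‖ₑ ^ 2 := lintegral_iUnion_le _ _
    _ = ∑ K ∈ T.nodeElements p c, ∫⁻ x in interior (hull K), ‖g x‖ₑ ^ 2 := by
        rw [tsum_fintype, ← Finset.sum_coe_sort (T.nodeElements p c)]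
        exact Finset.sum_congr rfl fun K _ => (setLIntegral_congr (hull_ae_eq_interior _)).symm

theorem fat_interior {κ h : ℝ} (hK : K ∈ T.elements) (hh : 0 < h)
    (hd : Metric.diam (hull K) ≤ h) {z : Euc d} (hB : Metric.ball z (κ * h) ⊆ hull K) :
    Fat κ h (interior (hull K)) where
  isOpen := isOpen_interior
  convex := (convex_hull K).interior
  pos := hh
  diam x hx y hy := (norm_sub_le_diam (interior_subset hx) (interior_subset hy)).trans hd
  ball := ⟨z, interior_maximal hB Metric.isOpen_ball⟩

theorem fat_element (hd : 1 ≤ d) (hσ : 0 < σ) (hT : T.ShapeRegular σ) (hK : K ∈ T.elements) :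
    Fat (1 / σ) (Metric.diam (hull K)) (interior (hull K)) := by
  obtain ⟨z, ρ, hρ, hB, hdiam⟩ := hT K hK
  refine fat_interior hK (diam_pos hd hK) le_rfl (z := z)
    ((Metric.ball_subset_ball ?_).trans hB)
  rw [one_div, inv_mul_le_iff₀ hσ]
  exact hdiam

/-- Points near a node that see it inside `Ω` lie in an element that contains the node. -/
theorem exists_mem_nodeElements (hp : 1 ≤ p) (hK : K ∈ T.elements) (hc : c ∈ elementNodes p K)
    {r : ℝ} (hr : ∀ L ∈ T.nodeElements p c, ∃ z ρ, 0 < ρ ∧ Metric.ball z ρ ⊆ hull L ∧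
      r ≤ 2 * ρ * (1 / p)) {w : Euc d} (hw : ‖w‖ ≤ r)
    (hin : ∀ t : ℝ, 0 < t → t ≤ 1 → T.nodePoint p c + t • w ∈ closure Ω) :
    ∃ L ∈ T.nodeElements p c, T.nodePoint p c + w ∈ hull L := by
  set a := T.nodePoint p c
  obtain ⟨η, hη, hloc⟩ := T.exists_radius a
  -- So short a step along the ray stays close enough to the node that an element meeting it also
  -- contains the node.
  set t := min 1 (η / (2 * (‖w‖ + 1))) with ht
  have ht0 : 0 < t := lt_min one_pos (by positivity)
  have htη : t * ‖w‖ < η := by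
    calc t * ‖w‖ ≤ η / (2 * (‖w‖ + 1)) * ‖w‖ := by gcongr; exact min_le_right _ _
      _ < η := by
        rw [div_mul_eq_mul_div, div_lt_iff₀ (by positivity)]
        nlinarith [norm_nonneg w]
  obtain ⟨L, hL, hxL⟩ := exists_mem_hull (T := T) (hin t ht0 (min_le_left _ _))
  have haL : a ∈ hull L := hloc L hL _ hxL (by
    rwa [add_sub_cancel_left, norm_smul, Real.norm_eq_abs, abs_of_pos ht0])
  have hLn : L ∈ T.nodeElements p c := mem_nodeElements.2 ⟨hL, haL⟩
  refine ⟨L, hLn, ?_⟩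
  obtain ⟨z, ρ, hρ, hB, hrρ⟩ := hr L hLn
  have hcL := mem_elementNodes_of_nodePoint_mem hp hK hc hL haL
  -- The coordinates of a node are multiples of `1/p`, so each is zero or at least `1/p`. This lower
  -- bound lets the ray run on up to length `r`.
  refine mem_hull_of_ray hL hρ hB (β := 1 / p) (fun b hb => ?_) (hw.trans hrρ) ht0 hxL
  rw [bary_nodePoint hp hL hcL hb]
  rcases Nat.eq_zero_or_pos (c b) with h | h
  · left; rw [h]; simp
  · right
    have : (1 : ℝ) ≤ c b := by exact_mod_cast h
    gcongr

theorem mem_ball_scale {z y : Euc d} {ρ t : ℝ} (ht : 0 < t)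
    (hB : Metric.ball z ρ ⊆ hull K) (hy : y ∈ Metric.ball (a + t • (z - a)) (t * ρ)) :
    ∃ y' ∈ hull K, y = a + t • (y' - a) := by
  refine ⟨a + t⁻¹ • (y - a), hB ?_, ?_⟩
  · rw [mem_ball_iff_norm] at hy ⊢
    have e2 : a + t⁻¹ • (y - a) - z = t⁻¹ • (y - (a + t • (z - a))) := by
      rw [sub_add_eq_sub_sub, smul_sub _ (y - a), smul_smul, inv_mul_cancel₀ ht.ne', one_smul]
      abel
    rwa [e2, norm_smul, norm_inv, Real.norm_eq_abs, abs_of_pos ht, inv_mul_lt_iff₀ ht]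
  · rw [add_sub_cancel_left, smul_smul, mul_inv_cancel₀ ht.ne', one_smul, add_sub_cancel]

set_option maxHeartbeats 1000000 in
/-- Every element at a node is linked to one fixed ball of comparable size in the patch through
convex subsets of the patch. -/
theorem exists_links (hΩ : IsLipschitzDomain Ω) (hd : 2 ≤ d) (hp : 1 ≤ p) (hσ : 1 ≤ σ) :
    ∃ κ₀ C₀ : ℝ, 0 < κ₀ ∧ 1 ≤ C₀ ∧ ∀ T : Mesh Ω, T.ShapeRegular σ →
      ∀ K ∈ T.elements, ∀ c ∈ elementNodes p K,
        ∃ (y₀ : Euc d) (B : Set (Euc d)), Fat κ₀ (C₀ * Metric.diam (hull K)) B ∧ B ⊆ T.patch p c ∧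
          Metric.ball y₀ (κ₀ * (C₀ * Metric.diam (hull K))) ⊆ B ∧
          ∀ L ∈ T.nodeElements p c, Fat κ₀ (C₀ * Metric.diam (hull K)) (interior (hull L)) ∧
            ∃ (y : Euc d) (H : Set (Euc d)), Fat κ₀ (C₀ * Metric.diam (hull K)) H ∧
              H ⊆ T.patch p c ∧ B ⊆ H ∧
              Metric.ball y (κ₀ * (C₀ * Metric.diam (hull K))) ⊆ H ∧
              Metric.ball y (κ₀ * (C₀ * Metric.diam (hull K))) ⊆ interior (hull L) := by
  obtain ⟨κ, δ, hκ, hκ1, hδ, hcone⟩ := hΩ.exists_cone (by omega)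
  have hσ0 : 0 < σ := by linarith
  have hp0 : (1 : ℝ) ≤ p := by exact_mod_cast hp
  set C0 := σ ^ ⌊σ ^ d⌋₊ with hC0
  have hC01 : 1 ≤ C0 := one_le_pow₀ hσ
  set D0 := Metric.diam (closure Ω) with hD0
  have hD00 : 0 ≤ D0 := Metric.diam_nonneg
  -- The working radius is `R = c1 h_K`. The first term of the minimum gives `R ≤ 2ρ/p` for the
  -- inner radius `ρ` of every element at the node, so rays of length `R` stay in these elements;
  -- the second gives `R < δ` for the cone property.
  set c1 := min (1 / (σ * C0 * p)) (δ / (2 * (D0 + 1))) with hc1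
  have hc10 : 0 < c1 := lt_min (by positivity) (by positivity)
  have hc1a : c1 * (σ * C0 * p) ≤ 1 := by
    rw [← le_div_iff₀ (by positivity)]; exact min_le_left _ _
  have hc1b : c1 * (2 * (D0 + 1)) ≤ δ := by
    rw [← le_div_iff₀ (by positivity)]; exact min_le_right _ _
  have hσC : 1 ≤ σ * C0 * p := one_le_mul_of_one_le_of_one_le
    (one_le_mul_of_one_le_of_one_le hσ hC01) hp0
  have hc11 : c1 ≤ 1 := by nlinarith
  -- The two terms make a ball of radius `κ0 h`, with `h = 2 C0 h_K`, fit into the cone ball `Bz`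
  -- and into the shrunk inner ball of each element.
  set κ0 := min (κ * c1 / (4 * C0)) (c1 / (2 * σ * C0 ^ 3)) with hκ0
  have hκ00 : 0 < κ0 := lt_min (by positivity) (by positivity)
  have hκ0a : κ0 * (2 * C0) ≤ κ * c1 / 2 := by
    calc κ0 * (2 * C0) ≤ κ * c1 / (4 * C0) * (2 * C0) := by gcongr; exact min_le_left _ _
      _ = _ := by field_simp; norm_num
  have hκ0b : κ0 * (2 * C0) ≤ c1 / C0 * (1 / (σ * C0)) := by
    calc κ0 * (2 * C0) ≤ c1 / (2 * σ * C0 ^ 3) * (2 * C0) := by gcongr; exact min_le_right _ _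
      _ = _ := by field_simp
  refine ⟨κ0, 2 * C0, hκ00, by linarith, fun T hT K hK c hc => ?_⟩
  set hK' := Metric.diam (hull K) with hhK
  have hKpos : 0 < hK' := diam_pos (by omega) hK
  set a := T.nodePoint p c with ha
  have haK : a ∈ hull K := nodePoint_mem hp hK hc
  have haΩ := hull_subset_closure hK haK
  obtain ⟨e, he, hcone⟩ := hcone a haΩ
  obtain ⟨b, hb⟩ := nodeElements_subset_star hp hK hc
  have hKn := mem_nodeElements_of_mem hp hK hc
  have hdle : ∀ L ∈ T.nodeElements p c, Metric.diam (hull L) ≤ C0 * hK' ∧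
      hK' ≤ C0 * Metric.diam (hull L) := fun L hL =>
    ⟨diam_le_of_mem_star hΩ hd hσ hT (hb hL) (hb hKn),
      diam_le_of_mem_star hΩ hd hσ hT (hb hKn) (hb hL)⟩
  have hKD : hK' ≤ D0 := Metric.diam_mono (hull_subset_closure hK) hΩ.isBounded.closure
  set R := c1 * hK' with hR
  have hR0 : 0 < R := by positivity
  have hRδ : R < δ := by
    have : c1 * hK' ≤ c1 * D0 := by gcongr
    have h2 : 0 ≤ c1 * D0 := by positivity
    linarith
  set h := 2 * C0 * hK' with hh
  have hh0 : 0 < h := by positivity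
  have hRh : 2 * R ≤ h := by
    rw [hR, hh, mul_assoc]; gcongr; exact hc11.trans hC01
  -- Every point of this ball is `a + (R/2) w` with `w` in the cone of directions pointing into `Ω`.
  set Bz := Metric.ball (a - (R / 2) • e) (κ * (R / 2)) with hBz
  have hBzR : ∀ z ∈ Bz, ∃ w : Euc d, ‖w + e‖ < κ ∧ z = a + (R / 2) • w ∧ ‖z - a‖ ≤ R := by
    intro z hz
    rw [hBz, mem_ball_iff_norm] at hz
    refine ⟨(R / 2)⁻¹ • (z - a), ?_, ?_, ?_⟩
    · have e1 : (R / 2)⁻¹ • (z - a) + e = (R / 2)⁻¹ • (z - (a - (R / 2) • e)) := by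
        rw [← sub_add, smul_add, smul_smul, inv_mul_cancel₀ (by positivity), one_smul]
      rw [e1, norm_smul, norm_inv, Real.norm_eq_abs, abs_of_pos (by positivity),
        inv_mul_lt_iff₀ (by positivity)]
      linarith
    · rw [smul_smul, mul_inv_cancel₀ (by positivity), one_smul, add_sub_cancel]
    · calc ‖z - a‖ = ‖(z - (a - (R / 2) • e)) - (R / 2) • e‖ := by congr 1; abel
        _ ≤ ‖z - (a - (R / 2) • e)‖ + ‖(R / 2) • e‖ := norm_sub_le _ _
        _ ≤ R := by
          rw [norm_smul, he, Real.norm_eq_abs, abs_of_pos (by positivity)]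
          have := mul_le_mul_of_nonneg_right hκ1 (half_pos hR0).le
          linarith
  have hrad : ∀ L ∈ T.nodeElements p c, ∃ z ρ, 0 < ρ ∧ Metric.ball z ρ ⊆ hull L ∧
      R ≤ 2 * ρ * (1 / p) ∧ 1 / (σ * C0) * hK' ≤ ρ := by
    intro L hL
    obtain ⟨z, ρ, hρ, hB, hdiam⟩ := hT L (mem_nodeElements.1 hL).1
    have h1 : hK' ≤ C0 * (σ * ρ) := (hdle L hL).2.trans (by gcongr)
    refine ⟨z, ρ, hρ, hB, ?_, ?_⟩
    · rw [mul_one_div, le_div_iff₀ (by positivity)]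
      calc R * p = c1 * p * hK' := by rw [hR]; ring
        _ ≤ c1 * p * (C0 * (σ * ρ)) := by gcongr
        _ = c1 * (σ * C0 * p) * ρ := by ring
        _ ≤ 1 * ρ := by gcongr
        _ ≤ _ := by linarith
    · rw [one_div, inv_mul_le_iff₀ (by positivity)]
      linarith
  have hκR : κ0 * h ≤ κ * (R / 2) := by
    calc κ0 * h = κ0 * (2 * C0) * hK' := by rw [hh]; ring
      _ ≤ κ * c1 / 2 * hK' := by gcongr
      _ = _ := by rw [hR]; ring
  -- Elements at the node have diameter at most `C0 h_K`, so shrinking towards the node by this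
  -- factor brings them within distance `R`.
  set τ := c1 / C0 with hτ
  have hτ0 : 0 < τ := by positivity
  have hτ1 : τ ≤ 1 := (div_le_one (by positivity)).2 (hc11.trans hC01)
  have hhull : ∀ L ∈ T.nodeElements p c, ∃ y : Euc d, ∃ H : Set (Euc d), Fat κ0 h H ∧
      H ⊆ T.patch p c ∧ Bz ⊆ H ∧ Metric.ball y (κ0 * h) ⊆ H ∧
      Metric.ball y (κ0 * h) ⊆ interior (hull L) := by
    intro L hL
    obtain ⟨hLT, haL⟩ := mem_nodeElements.1 hL
    obtain ⟨z, ρ, hρ, hB, hRρ, hρK⟩ := hrad L hL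
    set BL := Metric.ball (a + τ • (z - a)) (τ * ρ) with hBL
    have hBLL : BL ⊆ hull L := ball_subset_of_scale haL hB hτ0 hτ1
    have hsub : Metric.ball (a + τ • (z - a)) (κ0 * h) ⊆ BL := by
      refine Metric.ball_subset_ball ?_
      calc κ0 * h = κ0 * (2 * C0) * hK' := by rw [hh]; ring
        _ ≤ c1 / C0 * (1 / (σ * C0)) * hK' := by gcongr
        _ = τ * (1 / (σ * C0) * hK') := by rw [hτ]; ring
        _ ≤ τ * ρ := by gcongr
    have hBLR : ∀ y ∈ BL, y ∈ hull L ∧ ‖y - a‖ ≤ R := by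
      intro y hy
      refine ⟨hBLL hy, ?_⟩
      obtain ⟨y', hy', rfl⟩ := mem_ball_scale hτ0 hB hy
      rw [add_sub_cancel_left, norm_smul, Real.norm_eq_abs, abs_of_pos hτ0]
      calc τ * ‖y' - a‖ ≤ τ * (C0 * hK') := by
            gcongr; exact (norm_sub_le_diam hy' haL).trans (hdle L hL).1
        _ = R := by rw [hτ, hR]; field_simp
    set H := convexHull ℝ (BL ∪ Bz) with hH
    have hHo : IsOpen H := (Metric.isOpen_ball.union Metric.isOpen_ball).convexHull
    have hHR : H ⊆ Metric.closedBall a R := by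
      refine convexHull_min (Set.union_subset (fun y hy => ?_) fun y hy => ?_) (convex_closedBall _ _)
      · rw [mem_closedBall_iff_norm]; exact (hBLR y hy).2
      · rw [mem_closedBall_iff_norm]
        obtain ⟨_, _, _, h⟩ := hBzR y hy
        exact h
    have hBLne : BL.Nonempty := ⟨_, Metric.mem_ball_self (by positivity)⟩
    have hBzne : Bz.Nonempty := ⟨_, Metric.mem_ball_self (by positivity)⟩
    have hHp : H ⊆ T.patch p c := by
      rw [patch_eq]
      refine interior_maximal (fun P hP => ?_) hHo
      have hPR : ‖P - a‖ ≤ R := mem_closedBall_iff_norm.1 (hHR hP)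
      rw [hH, (convex_ball _ _).convexHull_union (convex_ball _ _) hBLne hBzne] at hP
      obtain ⟨y, hy, z', hz', hP⟩ := mem_convexJoin.1 hP
      obtain ⟨hyL, hyR⟩ := hBLR y hy
      obtain ⟨w, hwκ, hzw, hzR⟩ := hBzR z' hz'
      rw [segment_eq_image'] at hP
      obtain ⟨μ, hμ, hP⟩ := hP
      -- The ray from the node to a point `P` of the hull consists of a point of `L`, shrunk towards
      -- the node, plus a multiple of a cone direction. It therefore stays in `closure Ω`, and `P`
      -- lies in an element containing the node.
      obtain ⟨M, hM, hPM⟩ := exists_mem_nodeElements hp hK hc (r := R) (fun L hL => by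
        obtain ⟨z, ρ, h1, h2, h3, _⟩ := hrad L hL
        exact ⟨z, ρ, h1, h2, h3⟩) hPR fun t ht0 ht1 => by
          have e1 : a + t • (P - a) = (a + (t * (1 - μ)) • (y - a)) + (t * μ * (R / 2)) • w := by
            rw [← hP, hzw]; module
          change a + t • (P - a) ∈ closure Ω
          rw [e1]
          have hy1 : a + (t * (1 - μ)) • (y - a) ∈ hull L :=
            smul_sub_mem_hull haL hyL (mul_nonneg ht0.le (by linarith [hμ.2]))
              (mul_le_one₀ ht1 (by linarith [hμ.2]) (by linarith [hμ.1]))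
          have hyc := hull_subset_closure hLT hy1
          rcases hμ.1.eq_or_lt with h0 | h0
          · rw [← h0] at hyc ⊢
            simpa using hyc
          · refine subset_closure (hcone _ hyc ?_ w hwκ _ (by positivity) ?_)
            · rw [add_sub_cancel_left, norm_smul, Real.norm_eq_abs,
                abs_of_nonneg (mul_nonneg ht0.le (by linarith [hμ.2]))]
              have h5 : t * (1 - μ) ≤ 1 := mul_le_one₀ ht1 (by linarith [hμ.2]) (by linarith [hμ.1])
              have h6 := mul_le_mul_of_nonneg_right h5 (norm_nonneg (y - a))
              linarith
            · have h5 : t * μ ≤ 1 := mul_le_one₀ ht1 hμ.1 hμ.2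
              have h6 := mul_le_mul_of_nonneg_right h5 (half_pos hR0).le
              linarith
      change a + (P - a) ∈ _ at hPM
      rw [add_sub_cancel] at hPM
      exact Set.mem_biUnion (show M ∈ _ from hM) hPM
    have hBLH : BL ⊆ H := Set.subset_union_left.trans (subset_convexHull ℝ _)
    refine ⟨a + τ • (z - a), H, ⟨hHo, convex_convexHull ℝ _, hh0, fun x hx y hy => ?_,
      ⟨_, hsub.trans hBLH⟩⟩, hHp, Set.subset_union_right.trans (subset_convexHull ℝ _),
      hsub.trans hBLH, interior_maximal (hsub.trans hBLL) Metric.isOpen_ball⟩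
    have h1 := mem_closedBall_iff_norm.1 (hHR hx)
    have h2 := mem_closedBall_iff_norm.1 (hHR hy)
    calc ‖x - y‖ = ‖(x - a) - (y - a)‖ := by congr 1; abel
      _ ≤ ‖x - a‖ + ‖y - a‖ := norm_sub_le _ _
      _ ≤ h := by linarith
  have hBzp : Bz ⊆ T.patch p c := by
    obtain ⟨y, H, _, h1, h2, _⟩ := hhull K hKn
    exact h2.trans h1
  have hBzF : Fat κ0 h Bz := by
    refine ⟨Metric.isOpen_ball, convex_ball _ _, hh0, fun x hx y hy => ?_,
      ⟨a - (R / 2) • e, Metric.ball_subset_ball hκR⟩⟩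
    obtain ⟨_, _, _, h1⟩ := hBzR x hx
    obtain ⟨_, _, _, h2⟩ := hBzR y hy
    calc ‖x - y‖ = ‖(x - a) - (y - a)‖ := by congr 1; abel
      _ ≤ ‖x - a‖ + ‖y - a‖ := norm_sub_le _ _
      _ ≤ h := by linarith
  refine ⟨a - (R / 2) • e, Bz, hBzF, hBzp, Metric.ball_subset_ball hκR, fun L hL => ?_⟩
  obtain ⟨y, H, hHF, hHp, hBH, hyH, hyL⟩ := hhull L hL
  exact ⟨fat_interior (mem_nodeElements.1 hL).1 hh0
    ((hdle L hL).1.trans (by rw [hh]; gcongr; linarith)) (hyL.trans interior_subset),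
    y, H, hHF, hHp, hBH, hyH, hyL⟩

/-- The projection is at least as good as the polynomial that approximates `v` on the small ball
below the node. The quality of that polynomial is transferred from the ball to the linking convex
set and from there into each element, and the number of elements is bounded. -/
theorem slob_zero_patch_sub_polyProj_le (hΩ : IsLipschitzDomain Ω) (hd : 2 ≤ d) (hp : 1 ≤ p)
    (hσ : 1 ≤ σ) {s : ℝ} (hs : 0 < s) (hsp : s ≤ p + 1) :
    ∃ C : ℝ≥0, ∀ T : Mesh Ω, T.ShapeRegular σ → ∀ v : Euc d → Euc d, MemSobolev s Ω v →
      ∀ K ∈ T.elements, ∀ c ∈ elementNodes p K,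
        slob 0 (T.patch p c) (fun x => v x - polyProj p (T.patch p c) v x) ≤
          C * (ENNReal.ofReal (Metric.diam (hull K) ^ s) * sobolevSeminorm s (T.patch p c) v) := by
  obtain ⟨κ0, C0, hκ00, hC01, hgeo⟩ := exists_links hΩ hd hp hσ
  obtain ⟨CB, hCB⟩ := Fat.bramble_hilbert (d := d) (by omega) p hs hsp hκ00
  obtain ⟨CT, hCT⟩ := Fat.transfer (d := d) (by omega) p hs hsp hκ00
  set C3 : ℝ≥0 := CT * (CT * (CB 0 + 1) + 1) with hC3
  refine ⟨⌊σ ^ d⌋₊ * C3 * Real.toNNReal (C0 ^ s), fun T hT v hv K hK c hc => ?_⟩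
  obtain ⟨y₀, Bz, hBzF, hBzp, hy₀, hlink⟩ := hgeo T hT K hK c hc
  have hKpos := diam_pos (by omega) hK
  set h := C0 * Metric.diam (hull K) with hh
  set X := ENNReal.ofReal (h ^ s) * sobolevSeminorm s (T.patch p c) v with hX
  have hvp : MemSobolev s (T.patch p c) v := hv.mono isOpen_patch hΩ.isOpen (patch_subset hΩ)
  have hX' : ∀ D : Set (Euc d), IsOpen D → D ⊆ T.patch p c →
      ENNReal.ofReal (h ^ s) * sobolevSeminorm s D v ≤ X := fun D hD hDs => by
    rw [hX]; gcongr; exact sobolevSeminorm_mono hD isOpen_patch hDs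
  obtain ⟨q, hq, hqm⟩ := hCB h Bz hBzF v (hvp.mono hBzF.isOpen isOpen_patch hBzp)
  have hq0 : slob 0 Bz (fun x => v x - q x) ≤ CB 0 * X := by
    have := (hqm 0 le_rfl hs.le).2
    rw [sub_zero] at this
    refine (slob_zero_le_sobolevSeminorm hBzF.isOpen
      ((hvp.mono hBzF.isOpen isOpen_patch hBzp).locallyIntegrableOn.sub
        (locallyIntegrableOn_of_continuous hq.continuous _))).trans (this.trans ?_)
    gcongr
    exact hX' _ hBzF.isOpen hBzp
  have hLle : ∀ L ∈ T.nodeElements p c, slob 0 (interior (hull L)) (fun x => v x - q x) ≤ C3 * X := by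
    intro L hL
    obtain ⟨hLT, haL⟩ := mem_nodeElements.1 hL
    obtain ⟨hLF, y, H, hHF, hHp, hBH, hyH, hyL⟩ := hlink L hL
    have h1 := hCT h Bz H hHF y₀ hy₀ (hy₀.trans hBH) v (hvp.mono hHF.isOpen isOpen_patch hHp) q hq
    have h2 := hCT h H (interior (hull L)) hLF y hyH hyL v
      (hvp.mono isOpen_interior isOpen_patch (interior_subset_patch hL)) q hq
    have hX1 := hX' H hHF.isOpen hHp
    have hX2 := hX' _ isOpen_interior (interior_subset_patch hL)
    calc _ ≤ CT * (CT * (CB 0 * X + X) + X) := by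
          refine h2.trans ?_
          gcongr
          refine h1.trans ?_
          gcongr
      _ = C3 * X := by rw [hC3]; push_cast; ring
  obtain ⟨-, hopt⟩ := polyProj_spec p (isBounded_patch hΩ) (hvp.memLp isOpen_patch)
  obtain ⟨b, hb⟩ := nodeElements_subset_star hp hK hc
  have hcard : (T.nodeElements p c).card ≤ ⌊σ ^ d⌋₊ :=
    (Finset.card_le_card hb).trans (Nat.le_floor (card_star_le (by omega) (by linarith) hT b))
  calc _ ≤ slob 0 (T.patch p c) (fun x => v x - q x) := hopt q hq
    _ ≤ ∑ L ∈ T.nodeElements p c, slob 0 (interior (hull L)) (fun x => v x - q x) :=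
      slob_zero_patch_le _
    _ ≤ ∑ _L ∈ T.nodeElements p c, C3 * X := Finset.sum_le_sum hLle
    _ ≤ (⌊σ ^ d⌋₊ : ℝ≥0∞) * (C3 * X) := by
      rw [Finset.sum_const, nsmul_eq_mul]
      gcongr
    _ = _ := by
      rw [hX, hh, Real.mul_rpow (by positivity) hKpos.le, ENNReal.ofReal_mul (by positivity)]
      push_cast
      rw [ENNReal.ofReal]
      ring

end Mesh

end

/-! ### Boundary faces -/

section

/-! ### Boundary faces -/

namespace Mesh

variable {Ω : Set (Euc d)} {T : Mesh Ω} {K L f : Finset (Euc d)} {a b x z : Euc d}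

theorem exists_opposite (hK : K ∈ T.elements) (hf : f ⊆ K) (hcard : f.card = d) :
    ∃ b ∈ K, b ∉ f ∧ ∀ a ∈ K, a = b ∨ a ∈ f := by
  classical
  have h1 : (K \ f).card = 1 := by
    rw [Finset.card_sdiff_of_subset hf, T.card_eq K hK, hcard]; omega
  obtain ⟨b, hb⟩ := Finset.card_eq_one.1 h1
  have hbm : b ∈ K \ f := by rw [hb]; exact Finset.mem_singleton_self b
  refine ⟨b, (Finset.mem_sdiff.1 hbm).1, (Finset.mem_sdiff.1 hbm).2, fun a ha => ?_⟩
  by_cases haf : a ∈ f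
  · exact Or.inr haf
  · left
    have : a ∈ K \ f := Finset.mem_sdiff.2 ⟨ha, haf⟩
    rw [hb] at this
    exact Finset.mem_singleton.1 this

theorem subset_of_pos (hK : K ∈ T.elements) (hL : L ∈ T.elements) (hf : f ⊆ K)
    (hzK : z ∈ hull K) (hpos : ∀ a ∈ f, 0 < T.bary K a z) (hzL : z ∈ hull L) : f ⊆ L := by
  intro a ha
  by_contra haL
  exact (hpos a ha).ne' (bary_eq_zero_of_mem hK hL hzK hzL (hf ha) haL)

/-- An affine function that vanishes on the face opposite to `b` is a multiple of the coordinate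
of `b`. -/
theorem affine_eq_mul_bary (hK : K ∈ T.elements) (hb : b ∈ K) (F : Euc d →ᵃ[ℝ] ℝ)
    (hF : ∀ a ∈ K, a ≠ b → F a = 0) (x : Euc d) : F x = T.bary K b x * F b := by
  conv_lhs => rw [← sum_bary_smul hK x, affineMap_sum _ _ _ _ (sum_bary hK x)]
  refine Finset.sum_eq_single_of_mem b hb fun a ha hab => ?_
  rw [hF a ha hab, mul_zero]

/-- Two elements sharing a facet lie on opposite sides of it, since otherwise they would overlap.
Near a relatively interior point of the facet, the sign of one barycentric coordinate then decides
which of the two elements contains a point. -/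
theorem mem_interior_union (hK : K ∈ T.elements) (hL : L ∈ T.elements) (hKL : K ≠ L) (hf : f ⊆ K)
    (hcard : f.card = d) (hzK : z ∈ hull f) (hpos : ∀ a ∈ f, 0 < T.bary K a z) (hzL : z ∈ hull L) :
    z ∈ interior (hull K ∪ hull L) := by
  have hzK' : z ∈ hull K := ((mem_hull_subset hK hf).1 hzK).1
  have hfL := subset_of_pos hK hL hf hzK' hpos hzL
  obtain ⟨b, hbK, hbf, hKb⟩ := exists_opposite hK hf hcard
  obtain ⟨b', hbL', hbf', hLb⟩ := exists_opposite hL hfL hcard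
  have hposL : ∀ a ∈ f, 0 < T.bary L a z := fun a ha => by
    rw [← bary_eq_bary hK hL hzK' hzL (hf ha) (hfL ha)]; exact hpos a ha
  have hbL : b ∉ L := by
    intro h
    refine hKL (eq_of_subset hK hL fun a ha => ?_)
    rcases hKb a ha with rfl | h'
    · exact h
    · exact hfL h'
  have hprop : ∀ x, T.bary L b' x = T.bary K b x * T.bary L b' b :=
    affine_eq_mul_bary hK hbK _ fun a ha hab => by
      have haf := (hKb a ha).resolve_left hab
      exact bary_ne hL (hfL haf) fun h => hbf' (h ▸ haf)
  set κ := T.bary L b' b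
  have hκ0 : κ ≠ 0 := by
    intro h0
    have := hprop b'
    rw [bary_self hL hbL', h0, mul_zero] at this
    exact one_ne_zero this
  have hopen : IsOpen {y | ∀ a ∈ f, 0 < T.bary K a y ∧ 0 < T.bary L a y} := by
    have : {y | ∀ a ∈ f, 0 < T.bary K a y ∧ 0 < T.bary L a y} =
        ⋂ a ∈ f, ({y | 0 < T.bary K a y} ∩ {y | 0 < T.bary L a y}) := by
      ext y; simp
    rw [this]
    exact isOpen_biInter_finset fun a _ =>
      (isOpen_lt continuous_const (continuous_bary K a)).inter
        (isOpen_lt continuous_const (continuous_bary L a))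
  have hzN : z ∈ {y | ∀ a ∈ f, 0 < T.bary K a y ∧ 0 < T.bary L a y} :=
    fun a ha => ⟨hpos a ha, hposL a ha⟩
  have hzb : T.bary K b z = 0 := ((mem_hull_subset hK hf).1 hzK).2 b hbK hbf
  -- If `κ` were positive, points slightly towards `b` from `z` would lie in both elements although
  -- their coordinate at `b ∉ L` is positive, against conformity.
  have hneg : κ < 0 := by
    by_contra! hge
    have hκ : 0 < κ := lt_of_le_of_ne hge hκ0.symm
    have hcont : Continuous fun t : ℝ => z + t • (b - z) := by fun_prop
    have h1 : ∀ᶠ t : ℝ in nhdsWithin 0 (Set.Ioi 0), z + t • (b - z) ∈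
        {y | ∀ a ∈ f, 0 < T.bary K a y ∧ 0 < T.bary L a y} :=
      (hcont.continuousAt.eventually (hopen.mem_nhds (by simpa using hzN))).filter_mono
        nhdsWithin_le_nhds
    have h2 : ∀ᶠ t : ℝ in nhdsWithin 0 (Set.Ioi 0), 0 < t ∧ t < 1 := Ioo_mem_nhdsGT one_pos
    obtain ⟨t, ht, ht0, ht1⟩ := (h1.and h2).exists
    have hyb : T.bary K b (z + t • (b - z)) = t := by
      have e1 := affineMap_add (T.bary K b) z (t • (b - z))
      have e2 := affineMap_add (T.bary K b) z (b - z)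
      rw [add_sub_cancel, bary_self hK hbK, hzb, zero_add] at e2
      rw [e1, map_smul, ← e2, hzb, zero_add, smul_eq_mul, mul_one]
    have hyK : z + t • (b - z) ∈ hull K := smul_sub_mem_hull hzK' (mem_hull_of_mem hbK) ht0.le ht1.le
    have hyL : z + t • (b - z) ∈ hull L := by
      refine (mem_hull hL).2 fun a ha => ?_
      rcases hLb a ha with rfl | haf
      · rw [hprop, hyb]; positivity
      · exact (ht a haf).2.le
    have := bary_eq_zero_of_mem hK hL hyK hyL hbK hbL
    rw [hyb] at this
    exact ht0.ne' this
  refine interior_maximal (fun y hy => ?_) hopen hzN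
  rcases le_total 0 (T.bary K b y) with h | h
  · left
    refine (mem_hull hK).2 fun a ha => ?_
    rcases hKb a ha with rfl | haf
    · exact h
    · exact (hy a haf).1.le
  · right
    refine (mem_hull hL).2 fun a ha => ?_
    rcases hLb a ha with rfl | haf
    · rw [hprop]; exact mul_nonneg_of_nonpos_of_nonpos h hneg.le
    · exact (hy a haf).2.le

theorem hull_union_subset (hK : K ∈ T.elements) (hL : L ∈ T.elements) (hΩ : IsLipschitzDomain Ω) :
    interior (hull K ∪ hull L) ⊆ Ω :=
  (interior_mono (Set.union_subset (hull_subset_closure hK) (hull_subset_closure hL))).trans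
    hΩ.interior_closure.subset

theorem notMem_of_mem_frontier (hΩ : IsLipschitzDomain Ω) (hx : x ∈ frontier Ω) : x ∉ Ω := by
  rw [hΩ.isOpen.frontier_eq] at hx
  exact hx.2

/-- The relative interior of a boundary face meets only one element. -/
theorem eq_of_mem_boundaryFace (hΩ : IsLipschitzDomain Ω) (hf : f ∈ T.boundaryFaces)
    (hK : K ∈ T.elements) (hfK : f ⊆ K) (hz : z ∈ hull f) (hpos : ∀ a ∈ f, 0 < T.bary K a z)
    (hL : L ∈ T.elements) (hzL : z ∈ hull L) : L = K := by
  by_contra hne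
  exact notMem_of_mem_frontier hΩ (hf.2.2 hz) (hull_union_subset hK hL hΩ
    (mem_interior_union hK hL (Ne.symm hne) hfK hf.2.1 hz hpos hzL))

/-- One relatively interior point outside `Ω` forces the whole face into the boundary. If another
element met the relative interior of the face, it would contain the face, and then all relatively
interior points, including `z`, would lie in `Ω`. -/
theorem mem_boundaryFaces (hΩ : IsLipschitzDomain Ω) (hK : K ∈ T.elements) (hfK : f ⊆ K)
    (hcard : f.card = d) (hz : z ∈ hull f) (hpos : ∀ a ∈ f, 0 < T.bary K a z) (hzΩ : z ∉ Ω) :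
    f ∈ T.boundaryFaces := by
  obtain ⟨b, hbK, hbf, hKb⟩ := exists_opposite hK hfK hcard
  have huniq : ∀ x ∈ hull f, (∀ a ∈ f, 0 < T.bary K a x) → ∀ L ∈ T.elements, x ∈ hull L → L = K := by
    intro x hx hxpos L hL hxL
    by_contra hne
    have hfL := subset_of_pos hK hL hfK ((mem_hull_subset hK hfK).1 hx).1 hxpos hxL
    have hzL : z ∈ hull L := convexHull_mono (by exact_mod_cast hfL) hz
    exact hzΩ (hull_union_subset hK hL hΩ
      (mem_interior_union hK hL (Ne.symm hne) hfK hcard hz hpos hzL))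
  have hrel : ∀ x ∈ hull f, (∀ a ∈ f, 0 < T.bary K a x) → x ∈ frontier Ω := by
    intro x hx hxpos
    have hxK := ((mem_hull_subset hK hfK).1 hx).1
    have hxb := ((mem_hull_subset hK hfK).1 hx).2 b hbK hbf
    rw [hΩ.isOpen.frontier_eq]
    refine ⟨hull_subset_closure hK hxK, fun hxΩ => ?_⟩
    obtain ⟨η, hη, hloc⟩ := T.exists_radius x
    have hcont : Continuous fun t : ℝ => x + t • (x - b) := by fun_prop
    have h1 : ∀ᶠ t : ℝ in nhdsWithin 0 (Set.Ioi 0), x + t • (x - b) ∈ Ω ∩ Metric.ball x η :=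
      (hcont.continuousAt.eventually ((hΩ.isOpen.inter Metric.isOpen_ball).mem_nhds
        (by simpa using ⟨hxΩ, hη⟩))).filter_mono nhdsWithin_le_nhds
    -- Were `x` in `Ω`, a small step across the face away from `b` would still be in the only
    -- element at `x`, but with negative coordinate at `b`.
    obtain ⟨t, ⟨ht1, ht2⟩, ht0⟩ := (h1.and self_mem_nhdsWithin).exists
    obtain ⟨M, hM, hxM⟩ := exists_mem_hull (T := T) (subset_closure ht1)
    have hMx := hloc M hM _ hxM (mem_ball_iff_norm.1 ht2)
    obtain rfl := huniq x hx hxpos M hM hMx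
    have h0 := bary_nonneg hM hxM hbK
    have e1 := affineMap_add (T.bary M b) x (t • (x - b))
    have e2 := affineMap_add (T.bary M b) b (x - b)
    rw [add_sub_cancel, bary_self hM hbK, hxb] at e2
    rw [map_smul, hxb, zero_add, smul_eq_mul] at e1
    have ht0' : (0 : ℝ) < t := ht0
    have : (T.bary M b).linear (x - b) = -1 := by linarith
    rw [e1, this] at h0
    linarith
  refine ⟨⟨K, hK, hfK⟩, hcard, fun y hy => ?_⟩
  have hcont : Continuous fun t : ℝ => y + t • (z - y) := by fun_prop
  have hlim : Filter.Tendsto (fun t : ℝ => y + t • (z - y)) (nhdsWithin 0 (Set.Ioi 0)) (nhds y) := by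
    have := hcont.tendsto 0
    simp only [zero_smul, add_zero] at this
    exact this.mono_left nhdsWithin_le_nhds
  -- The remaining points of the face are limits of relatively interior ones, and the frontier is
  -- closed.
  refine isClosed_frontier.mem_of_tendsto hlim ?_
  filter_upwards [Ioo_mem_nhdsGT (zero_lt_one' ℝ)] with t ht
  refine hrel _ (smul_sub_mem_hull hy hz ht.1.le ht.2.le) fun a ha => ?_
  have e1 := affineMap_add (T.bary K a) y (t • (z - y))
  have e2 := affineMap_add (T.bary K a) y (z - y)
  rw [add_sub_cancel] at e2
  rw [e1, map_smul, smul_eq_mul]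
  have hya := bary_nonneg hK ((mem_hull_subset hK hfK).1 hy).1 (hfK ha)
  have hza := hpos a ha
  have : T.bary K a y + t * (T.bary K a).linear (z - y) =
      (1 - t) * T.bary K a y + t * T.bary K a z := by rw [e2]; ring
  rw [this]
  have := mul_nonneg (sub_nonneg.2 ht.2.le) hya
  have := mul_pos ht.1 hza
  linarith

theorem volume_affineSpan_eq_zero (S : Finset (Euc d)) (h1 : S.Nonempty) (h : S.card ≤ d) :
    volume (affineSpan ℝ (S : Set (Euc d)) : Set (Euc d)) = 0 := by
  classical
  refine Measure.addHaar_affineSubspace _ _ fun htop => ?_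
  obtain ⟨n, hn⟩ : ∃ n, S.card = n + 1 := ⟨S.card - 1, by have := Finset.card_pos.2 h1; omega⟩
  have h2 := finrank_vectorSpan_image_finset_le ℝ (id : Euc d → Euc d) S hn
  have h3 : vectorSpan ℝ (S : Set (Euc d)) = ⊤ := by
    rw [← direction_affineSpan, htop, AffineSubspace.direction_top]
  rw [Finset.image_id, h3, finrank_top, finrank_euclideanSpace, Fintype.card_fin] at h2
  omega

/-- Every boundary point lies on a boundary face. -/
theorem exists_boundaryFace (hΩ : IsLipschitzDomain Ω) (hd : 1 ≤ d) (T : Mesh Ω)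
    (ha : a ∈ frontier Ω) : ∃ f ∈ T.boundaryFaces, a ∈ hull f := by
  classical
  set S : Finset (Finset (Euc d)) := T.elements.biUnion Finset.powerset with hS
  have hSm : ∀ K ∈ T.elements, ∀ g ⊆ K, g ∈ S := fun K hK g hg =>
    Finset.mem_biUnion.2 ⟨K, hK, Finset.mem_powerset.2 hg⟩
  obtain ⟨η, hη, hloc⟩ := exists_radius_of_finset S a
  obtain ⟨M, hM, haM⟩ := exists_mem_hull (T := T) (frontier_subset_closure ha)
  obtain ⟨x, hx, hxa⟩ : ∃ x ∈ interior (hull M), dist a x < η :=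
    Metric.mem_closure_iff.1 (by rwa [closure_interior_hull hM]) η hη
  have hint : ∀ K ∈ T.elements, interior (hull K) ⊆ Ω := fun K hK =>
    (interior_mono (hull_subset_closure hK)).trans hΩ.interior_closure.subset
  have hxΩ : x ∈ Ω := hint M hM hx
  have haΩ : a ∉ interior (closure Ω) := fun h =>
    notMem_of_mem_frontier hΩ ha (hΩ.interior_closure.subset h)
  -- A generic exterior point near `a`: it avoids the affine spans of `x` with faces of at most `d -
  -- 1` vertices. There are finitely many such spans, each of measure zero, while the exterior near
  -- `a` is open and nonempty.
  obtain ⟨y, hya, hyΩ, hyS⟩ : ∃ y ∈ Metric.ball a η, y ∉ closure Ω ∧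
      ∀ g ∈ S, g.card + 1 ≤ d → y ∉ affineSpan ℝ ((insert x g : Finset (Euc d)) : Set (Euc d)) := by
    have hopen : IsOpen (Metric.ball a η ∩ (closure Ω)ᶜ) :=
      Metric.isOpen_ball.inter isClosed_closure.isOpen_compl
    have hne : (Metric.ball a η ∩ (closure Ω)ᶜ).Nonempty := by
      by_contra hemp
      rw [Set.not_nonempty_iff_eq_empty] at hemp
      refine haΩ (interior_maximal (fun z hz => ?_) Metric.isOpen_ball (Metric.mem_ball_self hη))
      by_contra hzn
      exact Set.notMem_empty z (hemp ▸ ⟨hz, hzn⟩)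
    have hnull : volume (⋃ g ∈ S.filter fun g => g.card + 1 ≤ d,
        (affineSpan ℝ ((insert x g : Finset (Euc d)) : Set (Euc d)) : Set (Euc d))) = 0 := by
      refine (measure_biUnion_null_iff (Finset.countable_toSet _)).2 fun g hg => ?_
      refine volume_affineSpan_eq_zero _ (Finset.insert_nonempty _ _) ?_
      exact (Finset.card_insert_le _ _).trans (Finset.mem_filter.1 hg).2
    by_contra! hcon
    have hsub : Metric.ball a η ∩ (closure Ω)ᶜ ⊆ ⋃ g ∈ S.filter fun g => g.card + 1 ≤ d,
        (affineSpan ℝ ((insert x g : Finset (Euc d)) : Set (Euc d)) : Set (Euc d)) := by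
      rintro y ⟨hy1, hy2⟩
      obtain ⟨g, hg, hgc, hyg⟩ := hcon y hy1 hy2
      exact Set.mem_biUnion (show g ∈ _ from Finset.mem_filter.2 ⟨hg, hgc⟩) hyg
    exact (hopen.measure_pos volume hne).ne' (measure_mono_null hsub hnull)
  have hcont : Continuous fun t : ℝ => x + t • (y - x) := by fun_prop
  have hcomp : IsCompact (Set.Icc (0 : ℝ) 1 ∩ (fun t : ℝ => x + t • (y - x)) ⁻¹' closure Ω) :=
    isCompact_Icc.inter_right (isClosed_closure.preimage hcont)
  -- The last point of the segment from `x` to `y` in `closure Ω` is a boundary point close to `a`.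
  obtain ⟨t, ⟨⟨ht0, ht1⟩, htΩ⟩, htmax⟩ := hcomp.exists_isGreatest
    ⟨0, ⟨le_rfl, zero_le_one⟩, by simpa using subset_closure hxΩ⟩
  set z := x + t • (y - x) with hz
  change z ∈ closure Ω at htΩ
  have ht1' : t < 1 := by
    refine lt_of_le_of_ne ht1 fun h => hyΩ ?_
    rwa [hz, h, one_smul, add_sub_cancel] at htΩ
  have hzΩ : z ∉ Ω := by
    intro hzΩ
    have h1 : ∀ᶠ r : ℝ in nhdsWithin t (Set.Ioi t), x + r • (y - x) ∈ Ω :=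
      (hcont.continuousAt.eventually (hΩ.isOpen.mem_nhds hzΩ)).filter_mono nhdsWithin_le_nhds
    obtain ⟨r, hr, hrt, hr1⟩ := (h1.and (Ioo_mem_nhdsGT ht1')).exists
    have := htmax (show r ∈ _ from ⟨⟨ht0.trans hrt.le, hr1.le⟩, subset_closure hr⟩)
    exact absurd this (not_le.2 hrt)
  have htpos : 0 < t := by
    refine lt_of_le_of_ne ht0 fun h => hzΩ ?_
    rw [hz, ← h, zero_smul, add_zero]; exact hxΩ
  have hza : ‖z - a‖ < η := by
    have : z ∈ Metric.ball a η := (convex_ball a η).add_smul_sub_mem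
      (by rwa [Metric.mem_ball, dist_comm]) hya ⟨ht0, ht1⟩
    exact mem_ball_iff_norm.1 this
  obtain ⟨K, hK, hzK⟩ := exists_mem_hull (T := T) htΩ
  -- The face whose relative interior contains `z`. It cannot be all of `K`, since `z ∉ Ω`, and
  -- fewer than `d` vertices would put `y` on an excluded span through `x` and `z`; so it has
  -- exactly `d` vertices.
  set g := K.filter fun b => 0 < T.bary K b z with hg
  have hgK : g ⊆ K := Finset.filter_subset _ _
  have hgpos : ∀ b ∈ g, 0 < T.bary K b z := fun b hb => (Finset.mem_filter.1 hb).2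
  have hzg : z ∈ hull g := (mem_hull_subset hK hgK).2 ⟨hzK, fun b hb hbg => by
    refine le_antisymm (not_lt.1 fun h => hbg (Finset.mem_filter.2 ⟨hb, h⟩)) (bary_nonneg hK hzK hb)⟩
  have hcard : g.card = d := by
    have h1 : g.card ≤ d + 1 := (T.card_eq K hK) ▸ Finset.card_le_card hgK
    have h2 : g.card ≠ d + 1 := by
      intro h
      have hgK' : g = K := Finset.eq_of_subset_of_card_le hgK (by rw [h, T.card_eq K hK])
      refine hzΩ (hint K hK ((mem_interior_hull hK).2 fun b hb => hgpos b (hgK'.symm ▸ hb)))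
    have h3 : ¬ g.card + 1 ≤ d := by
      intro h
      refine hyS g (hSm K hK g hgK) h ?_
      have hxs : x ∈ affineSpan ℝ ((insert x g : Finset (Euc d)) : Set (Euc d)) :=
        subset_affineSpan ℝ _ (by simp)
      have hzs : z ∈ affineSpan ℝ ((insert x g : Finset (Euc d)) : Set (Euc d)) :=
        affineSpan_mono ℝ (by simp) (convexHull_subset_affineSpan _ hzg)
      have e : y = AffineMap.lineMap x z t⁻¹ := by
        rw [AffineMap.lineMap_apply, hz, vsub_eq_sub, add_sub_cancel_left, smul_smul,
          inv_mul_cancel₀ htpos.ne', one_smul, vadd_eq_add, sub_add_cancel]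
      rw [e]
      exact AffineMap.lineMap_mem _ hxs hzs
    omega
  exact ⟨g, mem_boundaryFaces hΩ hK hgK hcard hzg hgpos hzΩ, hloc g (hSm K hK g hgK) z hzg hza⟩

end Mesh

end

/-! ### Normal vectors of boundary faces -/

section

/-! ### Normal vectors of boundary faces -/

theorem exists_gradient (ℓ : Euc d →ₗ[ℝ] ℝ) : ∃ g : Euc d, ∀ w, (inner ℝ g w : ℝ) = ℓ w := by
  refine ⟨(InnerProductSpace.toDual ℝ (Euc d)).symm (LinearMap.toContinuousLinearMap ℓ), fun w => ?_⟩
  rw [InnerProductSpace.toDual_symm_apply]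
  rfl

theorem eq_or_eq_neg_of_orthogonal {n m : Euc d} (hn : ‖n‖ = 1) (hm : ‖m‖ = 1)
    (h : ∀ w : Euc d, (inner ℝ n w : ℝ) = 0 → (inner ℝ m w : ℝ) = 0) : n = m ∨ n = -m := by
  have hnn : (inner ℝ n n : ℝ) = 1 := by rw [real_inner_self_eq_norm_sq, hn]; norm_num
  have hmm : (inner ℝ m m : ℝ) = 1 := by rw [real_inner_self_eq_norm_sq, hm]; norm_num
  set c : ℝ := inner ℝ n m with hc
  have h1 : (inner ℝ n (m - c • n) : ℝ) = 0 := by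
    rw [inner_sub_right, inner_smul_right, hnn]; ring
  have h2 := h _ h1
  have h3 : m = c • n := by
    rw [← sub_eq_zero, ← inner_self_eq_zero (𝕜 := ℝ), inner_sub_left, h2, inner_smul_left, h1]
    simp
  have h4 : |c| = 1 := by
    rw [h3, norm_smul, hn, mul_one] at hm
    exact hm
  rcases (abs_eq zero_le_one).1 h4 with h5 | h5
  · left; rw [h3, h5, one_smul]
  · right; rw [h3, h5, neg_one_smul, neg_neg]

namespace Mesh

variable {Ω : Set (Euc d)} {T : Mesh Ω} {K L f : Finset (Euc d)} {a b x z n : Euc d}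

/-- The barycenter of a face. -/
def center (f : Finset (Euc d)) : Euc d := ∑ b ∈ f, (f.card : ℝ)⁻¹ • b

theorem center_spec (hd : 1 ≤ d) (hK : K ∈ T.elements) (hf : f ⊆ K) (hcard : f.card = d) :
    center f ∈ hull f ∧ ∀ a ∈ f, T.bary K a (center f) = (d : ℝ)⁻¹ := by
  have hd0 : (0 : ℝ) < d := by exact_mod_cast hd
  have h1 : ∑ _b ∈ f, (f.card : ℝ)⁻¹ = 1 := by
    rw [hcard]; simp [hcard, hd0.ne']
  have hm : center f ∈ hull f := Finset.mem_convexHull'.2 ⟨fun _ => (f.card : ℝ)⁻¹,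
    fun _ _ => by positivity, h1, rfl⟩
  refine ⟨hm, fun a ha => ?_⟩
  rw [center, affineMap_sum _ _ _ _ h1, Finset.sum_eq_single_of_mem a ha, bary_self hK (hf ha),
    mul_one, hcard]
  intro b hb hba
  rw [bary_ne hK (hf hb) hba.symm, mul_zero]

theorem face_nonempty (hd : 1 ≤ d) (hcard : f.card = d) : f.Nonempty := by
  rw [← Finset.card_pos, hcard]; exact hd

theorem eq_of_boundaryFace_subset (hΩ : IsLipschitzDomain Ω) (hd : 1 ≤ d) (hf : f ∈ T.boundaryFaces)
    (hK : K ∈ T.elements) (hfK : f ⊆ K) (hL : L ∈ T.elements) (hfL : f ⊆ L) : L = K := by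
  obtain ⟨h1, h2⟩ := center_spec hd hK hfK hf.2.1
  refine eq_of_mem_boundaryFace hΩ hf hK hfK h1 (fun a ha => ?_) hL
    (convexHull_mono (by exact_mod_cast hfL) h1)
  rw [h2 a ha]
  have : (0 : ℝ) < d := by exact_mod_cast hd
  positivity

/-- The normalised negative gradient of the barycentric coordinate opposite to the face. The outward
condition concerns a single element, because a boundary face belongs to only one. -/
theorem exists_isOutwardNormal (hΩ : IsLipschitzDomain Ω) (hd : 1 ≤ d) (hf : f ∈ T.boundaryFaces) :
    ∃ n, T.IsOutwardNormal f n := by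
  obtain ⟨⟨K, hK, hfK⟩, hcard, hfr⟩ := id hf
  obtain ⟨b, hbK, hbf, hKb⟩ := exists_opposite hK hfK hcard
  obtain ⟨g, hg⟩ := exists_gradient (T.bary K b).linear
  have hlin : ∀ a ∈ f, ∀ y, (T.bary K b).linear (y - a) = T.bary K b y := by
    intro a ha y
    have e := affineMap_add (T.bary K b) a (y - a)
    rw [add_sub_cancel, bary_ne hK (hfK ha) (show b ≠ a from fun h => hbf (h ▸ ha)), zero_add] at e
    exact e.symm
  obtain ⟨a0, ha0⟩ := face_nonempty hd hcard
  have hg0 : g ≠ 0 := by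
    rintro rfl
    have := hg (b - a0)
    rw [hlin a0 ha0, bary_self hK hbK, inner_zero_left] at this
    exact zero_ne_one this
  have hgn : 0 < ‖g‖ := norm_pos_iff.2 hg0
  refine ⟨-(‖g‖⁻¹ • g), ?_, fun a ha a' ha' => ?_, fun L hL hfL a ha b' hb' hb'f => ?_⟩
  · rw [norm_neg, norm_smul, norm_inv, norm_norm, inv_mul_cancel₀ hgn.ne']
  · rw [inner_neg_left, inner_smul_left, hg, hlin a ha, bary_ne hK (hfK ha')
      (show b ≠ a' from fun h => hbf (h ▸ ha'))]
    simp
  · obtain rfl := eq_of_boundaryFace_subset hΩ hd hf hK hfK hL hfL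
    obtain rfl := (hKb b' hb').resolve_right hb'f
    rw [inner_neg_left, inner_smul_left, hg, hlin a ha, bary_self hK hbK]
    simpa using hg0

/-- On the element with the boundary face `f` the height above `f` is a multiple of a barycentric
coordinate. -/
theorem inner_normal_eq (hK : K ∈ T.elements) (hfK : f ⊆ K) (hcard : f.card = d)
    (hn : T.IsOutwardNormal f n) (ha : a ∈ hull f) (hb : b ∈ K) (hbf : b ∉ f) :
    0 < (inner ℝ n (a - b) : ℝ) ∧
      ∀ x, (inner ℝ n (a - x) : ℝ) = T.bary K b x * inner ℝ n (a - b) := by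
  obtain ⟨b', hb'K, hb'f, hKb⟩ := exists_opposite hK hfK hcard
  obtain rfl := (hKb b hb).resolve_right hbf
  have hconst : ∀ a' ∈ f, (inner ℝ n (a - a') : ℝ) = 0 := by
    intro a' ha'
    have hsub : hull f ⊆ {y | (inner ℝ n y : ℝ) = inner ℝ n a'} := by
      refine convexHull_min (fun y hy => ?_) ?_
      · have := hn.2.1 a' ha' y (by exact_mod_cast hy)
        rw [inner_sub_right] at this
        exact sub_eq_zero.1 this
      · exact (convex_hyperplane (f := fun y => (inner ℝ n y : ℝ))
          ⟨fun x y => inner_add_right _ _ _, fun c x => inner_smul_right _ _ _⟩ _)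
    rw [inner_sub_right, sub_eq_zero]
    exact hsub ha
  refine ⟨?_, fun x => ?_⟩
  · obtain ⟨a', ha'⟩ : f.Nonempty := by
      by_contra h
      rw [Finset.not_nonempty_iff_eq_empty] at h
      subst h
      simp [hull] at ha
    have h1 := hn.2.2 K hK hfK a' ha' b hb hbf
    have h2 := hconst a' ha'
    have : a - b = (a - a') - (b - a') := by abel
    rw [this, inner_sub_right, h2]
    linarith
  · let F : Euc d →ᵃ[ℝ] ℝ :=
      { toFun := fun x => inner ℝ n (a - x)
        linear := -(innerₛₗ ℝ n)
        map_vadd' := fun p v => by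
          simp only [vadd_eq_add, LinearMap.neg_apply, innerₛₗ_apply_apply]
          rw [sub_add_eq_sub_sub_swap, inner_sub_right, inner_sub_right]
          ring }
    exact affine_eq_mul_bary hK hb F (fun a' ha' hab => hconst a' ((hKb a' ha').resolve_left hab)) x

theorem inner_eq_zero_of_mem_face (hK : K ∈ T.elements) (hfK : f ⊆ K) (hcard : f.card = d)
    (hn : T.IsOutwardNormal f n) (ha : a ∈ hull f) (hx : x ∈ hull f) :
    (inner ℝ n (a - x) : ℝ) = 0 := by
  obtain ⟨b, hbK, hbf, -⟩ := exists_opposite hK hfK hcard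
  rw [(inner_normal_eq hK hfK hcard hn ha hbK hbf).2,
    ((mem_hull_subset hK hfK).1 hx).2 b hbK hbf, zero_mul]

theorem finite_boundaryFaces (T : Mesh Ω) : T.boundaryFaces.Finite := by
  classical
  refine (T.elements.biUnion Finset.powerset).finite_toSet.subset fun f hf => ?_
  obtain ⟨K, hK, hfK⟩ := hf.1
  exact Finset.mem_coe.2 (Finset.mem_biUnion.2 ⟨K, hK, Finset.mem_powerset.2 hfK⟩)

/-- Small steps from the centre of `f` along `w` remain in `f`, hence in the boundary, which the
finitely many faces of `T₀` cover. Two of infinitely many steps fall into the same face, and their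
difference is tangential to it. -/
theorem exists_face_orthogonal (hΩ : IsLipschitzDomain Ω) (hd : 1 ≤ d) (T₀ : Mesh Ω)
    {N : Finset (Euc d) → Euc d} (hN : ∀ g ∈ T₀.boundaryFaces, T₀.IsOutwardNormal g (N g))
    (hf : f ∈ T.boundaryFaces) (hn : T.IsOutwardNormal f n) {w : Euc d}
    (hw : (inner ℝ n w : ℝ) = 0) : ∃ g ∈ T₀.boundaryFaces, (inner ℝ (N g) w : ℝ) = 0 := by
  obtain ⟨⟨K, hK, hfK⟩, hcard, hfr⟩ := id hf
  obtain ⟨b, hbK, hbf, hKb⟩ := exists_opposite hK hfK hcard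
  obtain ⟨hc1, hc2⟩ := center_spec hd hK hfK hcard
  have hd0 : (0 : ℝ) < (d : ℝ)⁻¹ := by
    have : (0 : ℝ) < d := by exact_mod_cast hd
    positivity
  have hcont : Continuous fun t : ℝ => center f + t • w := by fun_prop
  have hev : ∀ᶠ t : ℝ in nhdsWithin 0 (Set.Ioi 0), ∀ a ∈ f, 0 < T.bary K a (center f + t • w) := by
    rw [Filter.eventually_all_finset]
    intro a ha
    have h1 : Continuous fun t : ℝ => T.bary K a (center f + t • w) := (continuous_bary K a).comp hcont
    have h2 := (h1.tendsto 0).eventually (lt_mem_nhds (a := (0 : ℝ)) (by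
      simpa [hc2 a ha] using hd0))
    exact h2.filter_mono nhdsWithin_le_nhds
  obtain ⟨u, hu0, hu⟩ := mem_nhdsGT_iff_exists_Ioo_subset.1 hev
  have hmem : ∀ t ∈ Set.Ioo (0 : ℝ) u, center f + t • w ∈ hull f := by
    intro t ht
    have hb0 : T.bary K b (center f + t • w) = 0 := by
      obtain ⟨h1, h2⟩ := inner_normal_eq hK hfK hcard hn hc1 hbK hbf
      have h3 := h2 (center f + t • w)
      rw [sub_add_cancel_left, inner_neg_right, inner_smul_right, hw, mul_zero, neg_zero] at h3
      exact (mul_eq_zero.1 h3.symm).resolve_right h1.ne'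
    refine (mem_hull_subset hK hfK).2 ⟨(mem_hull hK).2 fun a ha => ?_, fun a ha haf => ?_⟩
    · rcases hKb a ha with rfl | haf
      · exact hb0.ge
      · exact (hu ht a haf).le
    · obtain rfl := (hKb a ha).resolve_right haf
      exact hb0
  choose! G hG hGm using fun (t : ℝ) (ht : t ∈ Set.Ioo (0 : ℝ) u) =>
    exists_boundaryFace hΩ hd T₀ (hfr (hmem t ht))
  obtain ⟨t, ht, t', ht', hne, heq⟩ := (Set.Ioo_infinite (show (0 : ℝ) < u from hu0)).exists_ne_map_eq_of_mapsTo
    (fun t ht => hG t ht) T₀.finite_boundaryFaces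
  refine ⟨G t, hG t ht, ?_⟩
  obtain ⟨⟨M, hM, hGM⟩, hGc, -⟩ := hG t ht
  have h1 := inner_eq_zero_of_mem_face hM hGM hGc (hN _ (hG t ht)) (hGm t ht) (heq ▸ hGm t' ht')
  have e : center f + t • w - (center f + t' • w) = (t - t') • w := by module
  rw [e, inner_smul_right] at h1
  exact (mul_eq_zero.1 h1).resolve_left (sub_ne_zero.2 hne)

/-- The normal vectors of boundary faces of all meshes of `Ω` form a finite set. -/
theorem exists_finite_normals (hΩ : IsLipschitzDomain Ω) (hd : 1 ≤ d) :
    ∃ S : Finset (Euc d), ∀ T : Mesh Ω, ∀ f ∈ T.boundaryFaces, ∀ n, T.IsOutwardNormal f n →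
      n ∈ S := by
  classical
  by_cases hne : Nonempty (Mesh Ω)
  swap
  · exact ⟨∅, fun T => absurd ⟨T⟩ hne⟩
  obtain ⟨T₀⟩ := hne
  choose! N hN using fun (g : Finset (Euc d)) (hg : g ∈ T₀.boundaryFaces) =>
    exists_isOutwardNormal hΩ hd hg
  set B := T₀.finite_boundaryFaces.toFinset
  refine ⟨B.image N ∪ B.image fun g => -N g, fun T f hf n hn => ?_⟩
  set V : Submodule ℝ (Euc d) := (Submodule.span ℝ {n})ᗮ
  have hV : ∀ w, w ∈ V ↔ (inner ℝ n w : ℝ) = 0 := fun w => Submodule.mem_orthogonal_singleton_iff_inner_right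
  -- The hyperplane orthogonal to `n` is a finite union of subspaces, so one of them is everything.
  -- The corresponding normal of the reference mesh `T₀` is then `n` up to sign.
  have hcov : ⋃ g : B, (((Submodule.span ℝ {N g})ᗮ.comap V.subtype : Submodule ℝ V) : Set V) =
      Set.univ := by
    refine Set.eq_univ_of_forall fun w => ?_
    obtain ⟨g, hg, hgw⟩ := exists_face_orthogonal hΩ hd T₀ hN hf hn ((hV w).1 w.2)
    exact Set.mem_iUnion.2 ⟨⟨g, T₀.finite_boundaryFaces.mem_toFinset.2 hg⟩,
      Submodule.mem_orthogonal_singleton_iff_inner_right.2 hgw⟩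
  obtain ⟨⟨g, hgB⟩, hg⟩ := Subspace.exists_eq_top_of_iUnion_eq_univ hcov
  have hgT := T₀.finite_boundaryFaces.mem_toFinset.1 hgB
  have hor : ∀ w : Euc d, (inner ℝ n w : ℝ) = 0 → (inner ℝ (N g) w : ℝ) = 0 := by
    intro w hw
    have : (⟨w, (hV w).2 hw⟩ : V) ∈ ((Submodule.span ℝ {N g})ᗮ.comap V.subtype : Submodule ℝ V) := by
      rw [hg]; trivial
    exact Submodule.mem_orthogonal_singleton_iff_inner_right.1 this
  rcases eq_or_eq_neg_of_orthogonal hn.1 (hN g hgT).1 hor with h | h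
  · exact Finset.mem_union_left _ (Finset.mem_image.2 ⟨g, hgB, h.symm⟩)
  · exact Finset.mem_union_right _ (Finset.mem_image.2 ⟨g, hgB, h.symm⟩)

/-- The direction `-e + (κ/2) n` still lies in the cone and so points into `Ω`. At a relatively
interior point of the face it must enter the only adjacent element, which gives `⟪n, e⟫ ≥ κ/2`. -/
theorem inner_normal_pos (hΩ : IsLipschitzDomain Ω) (hd : 1 ≤ d) (hf : f ∈ T.boundaryFaces)
    (hn : T.IsOutwardNormal f n) (ha : a ∈ hull f) {e : Euc d} {κ δ : ℝ} (hκ : 0 < κ) (hδ : 0 < δ)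
    (hcone : ∀ y ∈ closure Ω, ‖y - a‖ < δ → ∀ w : Euc d, ‖w + e‖ < κ → ∀ t : ℝ, 0 < t → t < δ →
        y + t • w ∈ Ω) : 0 < (inner ℝ n e : ℝ) := by
  obtain ⟨⟨K, hK, hfK⟩, hcard, hfr⟩ := id hf
  obtain ⟨b, hbK, hbf, hKb⟩ := exists_opposite hK hfK hcard
  obtain ⟨hc1, hc2⟩ := center_spec hd hK hfK hcard
  have hd0 : (0 : ℝ) < (d : ℝ)⁻¹ := by
    have : (0 : ℝ) < d := by exact_mod_cast hd
    positivity
  have hcont : Continuous fun t : ℝ => a + t • (center f - a) := by fun_prop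
  have hev : ∀ᶠ t : ℝ in nhdsWithin 0 (Set.Ioi 0), a + t • (center f - a) ∈ Metric.ball a δ :=
    (hcont.continuousAt.eventually (Metric.isOpen_ball.mem_nhds (by simpa using hδ))).filter_mono
      nhdsWithin_le_nhds
  -- A step towards the centre of the face reaches a relatively interior point, where only one
  -- element is present, without leaving the range of the cone property at `a`.
  obtain ⟨s, hs, hs0, hs1⟩ := (hev.and (Ioo_mem_nhdsGT (zero_lt_one' ℝ))).exists
  set x := a + s • (center f - a) with hx
  have hxf : x ∈ hull f := smul_sub_mem_hull ha hc1 hs0.le hs1.le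
  have hxpos : ∀ a' ∈ f, 0 < T.bary K a' x := by
    intro a' ha'
    have e1 := affineMap_add (T.bary K a') a (s • (center f - a))
    have e2 := affineMap_add (T.bary K a') a (center f - a)
    rw [add_sub_cancel, hc2 a' ha'] at e2
    have haa := bary_nonneg hK ((mem_hull_subset hK hfK).1 ha).1 (hfK ha')
    have : T.bary K a' x = (1 - s) * T.bary K a' a + s * (d : ℝ)⁻¹ := by
      rw [hx, e1, map_smul, smul_eq_mul, e2]; ring
    rw [this]
    have := mul_nonneg (sub_nonneg.2 hs1.le) haa
    have := mul_pos hs0 hd0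
    linarith
  set w : Euc d := -e + (κ / 2) • n with hw
  have hwe : ‖w + e‖ < κ := by
    rw [hw, neg_add_cancel_comm, norm_smul, hn.1, Real.norm_eq_abs, abs_of_pos (by positivity)]
    linarith
  obtain ⟨η, hη, hloc⟩ := T.exists_radius x
  have hcont2 : Continuous fun t : ℝ => x + t • w := by fun_prop
  have hev2 : ∀ᶠ t : ℝ in nhdsWithin 0 (Set.Ioi 0), x + t • w ∈ Metric.ball x η :=
    (hcont2.continuousAt.eventually (Metric.isOpen_ball.mem_nhds (by simpa using hη))).filter_mono
      nhdsWithin_le_nhds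
  obtain ⟨t, ht, ht0, htδ⟩ := (hev2.and (Ioo_mem_nhdsGT hδ)).exists
  have hxΩ := hull_subset_closure hK ((mem_hull_subset hK hfK).1 hxf).1
  have hmem := hcone x hxΩ (mem_ball_iff_norm.1 hs) w hwe t ht0 htδ
  obtain ⟨M, hM, hxM⟩ := exists_mem_hull (T := T) (subset_closure hmem)
  have hMx := hloc M hM _ hxM (mem_ball_iff_norm.1 ht)
  obtain rfl := eq_of_mem_boundaryFace hΩ hf hK hfK hxf hxpos hM hMx
  obtain ⟨h1, h2⟩ := inner_normal_eq hM hfK hcard hn hxf hbK hbf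
  have h3 := h2 (x + t • w)
  have h4 := mul_nonneg (bary_nonneg hM hxM hbK) h1.le
  have hnn : (inner ℝ n n : ℝ) = 1 := by rw [real_inner_self_eq_norm_sq, hn.1]; norm_num
  rw [← h3, sub_add_cancel_left, inner_neg_right, inner_smul_right, hw, inner_add_right,
    inner_neg_right, inner_smul_right, hnn] at h4
  by_contra! hle
  nlinarith

/-- Outward normals of two boundary faces with a common point are not opposite. -/
theorem normal_ne_neg (hΩ : IsLipschitzDomain Ω) (hd : 1 ≤ d) {f' : Finset (Euc d)} {n' : Euc d}
    (hf : f ∈ T.boundaryFaces) (hn : T.IsOutwardNormal f n) (ha : a ∈ hull f)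
    (hf' : f' ∈ T.boundaryFaces) (hn' : T.IsOutwardNormal f' n') (ha' : a ∈ hull f') : n ≠ -n' := by
  obtain ⟨κ, δ, hκ, -, hδ, hcone⟩ := hΩ.exists_cone hd
  obtain ⟨e, -, hcone⟩ := hcone a (frontier_subset_closure (hf.2.2 ha))
  have h1 := inner_normal_pos hΩ hd hf hn ha hκ hδ hcone
  have h2 := inner_normal_pos hΩ hd hf' hn' ha' hκ hδ hcone
  rintro rfl
  rw [inner_neg_left] at h1
  linarith

end Mesh

/-- Two different tangential parts control a vector. -/
theorem norm_le_tangential {n m : Euc d} (hn : ‖n‖ = 1) (hm : ‖m‖ = 1) (h1 : n ≠ m)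
    (h2 : n ≠ -m) : ∃ C : ℝ≥0, ∀ u : Euc d,
      ‖u‖ ≤ C * (‖u - (inner ℝ u n : ℝ) • n‖ + ‖u - (inner ℝ u m : ℝ) • m‖) := by
  have hnn : (inner ℝ n n : ℝ) = 1 := by rw [real_inner_self_eq_norm_sq, hn]; norm_num
  set c : ℝ := inner ℝ n m with hc
  have hpos : 0 < ‖m - c • n‖ := by
    rw [norm_pos_iff, sub_ne_zero]
    intro h
    have h4 : |c| = 1 := by
      have := congrArg norm h
      rw [hm, norm_smul, hn, mul_one] at this
      exact this.symm
    rcases (abs_eq zero_le_one).1 h4 with h5 | h5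
    · rw [h5, one_smul] at h; exact h1 h.symm
    · rw [h5, neg_one_smul] at h; exact h2 (by rw [h, neg_neg])
  set C := 2 / ‖m - c • n‖ + 1 with hC
  have hC0 : 0 ≤ C := by positivity
  refine ⟨⟨C, hC0⟩, fun u => ?_⟩
  change ‖u‖ ≤ C * _
  set α : ℝ := inner ℝ u n
  set β : ℝ := inner ℝ u m
  set t1 := u - α • n with ht1
  set t2 := u - β • m with ht2
  have hproj : ∀ w : Euc d, ‖w - (inner ℝ n w : ℝ) • n‖ ≤ 2 * ‖w‖ := by
    intro w
    refine (norm_sub_le _ _).trans ?_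
    rw [norm_smul, hn, mul_one, Real.norm_eq_abs]
    have := abs_real_inner_le_norm n w
    rw [hn] at this
    linarith
  -- The difference of the tangential parts is `β m - α n`. Removing its component along `n` leaves
  -- `β (m - c n)`, which isolates the normal component of `u` along `m`.
  have hβ : |β| * ‖m - c • n‖ ≤ 2 * (‖t1‖ + ‖t2‖) := by
    have e : β • (m - c • n) = (t1 - t2) - (inner ℝ n (t1 - t2) : ℝ) • n := by
      have : t1 - t2 = β • m - α • n := by rw [ht1, ht2]; abel
      rw [this, inner_sub_right, inner_smul_right, inner_smul_right, hnn, ← hc]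
      module
    have := hproj (t1 - t2)
    rw [← e, norm_smul, Real.norm_eq_abs] at this
    linarith [norm_sub_le t1 t2]
  have hβ' : |β| ≤ 2 / ‖m - c • n‖ * (‖t1‖ + ‖t2‖) := by
    rw [div_mul_eq_mul_div, le_div_iff₀ hpos]; exact hβ
  calc ‖u‖ = ‖t2 + β • m‖ := by rw [ht2, sub_add_cancel]
    _ ≤ ‖t2‖ + |β| := by
      refine (norm_add_le _ _).trans ?_
      rw [norm_smul, hm, mul_one, Real.norm_eq_abs]
    _ ≤ _ := by rw [hC, add_mul, one_mul]; linarith [norm_nonneg t1]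

end

/-! ### Layer means at a hyperplane -/

section

open Metric Filter Topology

/-! ### Layers at a hyperplane -/

/-- The height of `x` over the hyperplane through `x₀` with unit normal `n`, counted against `n`. -/
def height (n x₀ x : Euc d) : ℝ := inner ℝ n (x₀ - x)

/-- The orthogonal projection to the hyperplane through `x₀` with unit normal `n`. -/
def planeProj (n x₀ x : Euc d) : Euc d := x + height n x₀ x • n

/-- The map that halves the height over a hyperplane. -/
def squeeze (n x₀ x : Euc d) : Euc d := x + (height n x₀ x / 2) • n

section Layer

variable {n x₀ x y : Euc d}

theorem height_add (x w : Euc d) : height n x₀ (x + w) = height n x₀ x - inner ℝ n w := by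
  simp only [height, inner_sub_right, inner_add_right]; ring

theorem height_add_smul (hn : ‖n‖ = 1) (x : Euc d) (t : ℝ) :
    height n x₀ (x + t • n) = height n x₀ x - t := by
  rw [height_add, inner_smul_right, real_inner_self_eq_norm_sq, hn]; ring

theorem height_self : height n x₀ x₀ = 0 := by simp [height]

theorem height_planeProj (hn : ‖n‖ = 1) (x : Euc d) : height n x₀ (planeProj n x₀ x) = 0 := by
  rw [planeProj, height_add_smul hn, sub_self]

theorem height_squeeze (hn : ‖n‖ = 1) (x : Euc d) :
    height n x₀ (squeeze n x₀ x) = height n x₀ x / 2 := by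
  rw [squeeze, height_add_smul hn]; ring

theorem planeProj_add_smul (hn : ‖n‖ = 1) (x : Euc d) (t : ℝ) :
    planeProj n x₀ (x + t • n) = planeProj n x₀ x := by
  rw [planeProj, height_add_smul hn, planeProj, sub_smul]; abel

theorem planeProj_squeeze (hn : ‖n‖ = 1) (x : Euc d) :
    planeProj n x₀ (squeeze n x₀ x) = planeProj n x₀ x := planeProj_add_smul hn x _

theorem planeProj_of_height_eq_zero (h : height n x₀ x = 0) : planeProj n x₀ x = x := by
  simp [planeProj, h]

theorem abs_height_sub_le (hn : ‖n‖ = 1) (x y : Euc d) :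
    |height n x₀ x - height n x₀ y| ≤ ‖x - y‖ := by
  rw [height, height, ← inner_sub_right]
  refine (abs_real_inner_le_norm _ _).trans ?_
  rw [hn, one_mul, ← norm_neg]
  exact (congrArg _ (by abel)).le

theorem norm_planeProj_sub_le (hn : ‖n‖ = 1) (x y : Euc d) :
    ‖planeProj n x₀ x - planeProj n x₀ y‖ ≤ ‖x - y‖ := by
  have e : planeProj n x₀ x - planeProj n x₀ y = (x - y) - (inner ℝ n (x - y) : ℝ) • n := by
    rw [planeProj, planeProj, height, height]
    have : (inner ℝ n (x - y) : ℝ) = inner ℝ n (x₀ - y) - inner ℝ n (x₀ - x) := by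
      rw [← inner_sub_right]; congr 1; abel
    rw [this, sub_smul]; abel
  rw [e]
  refine abs_le_of_sq_le_sq' ?_ (norm_nonneg _) |>.2
  rw [norm_sub_sq_real, inner_smul_right, norm_smul, hn, real_inner_comm n (x - y)]
  simp only [Real.norm_eq_abs, mul_one, sq_abs]
  nlinarith [sq_nonneg (inner ℝ n (x - y) : ℝ)]

theorem norm_sub_planeProj (hn : ‖n‖ = 1) (x : Euc d) :
    ‖x - planeProj n x₀ x‖ = |height n x₀ x| := by
  rw [planeProj, sub_add_cancel_left, norm_neg, norm_smul, hn, mul_one, Real.norm_eq_abs]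

theorem norm_sub_le_of_planeProj (hn : ‖n‖ = 1) (x : Euc d) :
    ‖x - x₀‖ ≤ ‖planeProj n x₀ x - x₀‖ + |height n x₀ x| := by
  rw [← norm_sub_planeProj hn x, add_comm]
  exact norm_sub_le_norm_sub_add_norm_sub _ _ _

theorem contDiff_height : ContDiff ℝ ∞ (height n x₀) :=
  contDiff_const.inner ℝ (contDiff_const.sub contDiff_id)

theorem contDiff_planeProj : ContDiff ℝ ∞ (planeProj n x₀) :=
  contDiff_id.add (contDiff_height.smul contDiff_const)

theorem continuous_height : Continuous (height n x₀) := contDiff_height.continuous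

theorem continuous_planeProj : Continuous (planeProj n x₀) := contDiff_planeProj.continuous

theorem continuous_squeeze : Continuous (squeeze n x₀) :=
  continuous_id.add ((continuous_height.div_const 2).smul continuous_const)

theorem hasFDerivAt_height (x : Euc d) : HasFDerivAt (height n x₀) (-innerSL ℝ n) x := by
  have e : height n x₀ = fun y => (inner ℝ n x₀ : ℝ) - innerSL ℝ n y := by
    ext y; simp [height, inner_sub_right]
  rw [e]
  exact (innerSL ℝ n).hasFDerivAt.const_sub _

/-- The linear part of `squeeze`. -/
def squeezeLinear (n : Euc d) : Euc d →ₗ[ℝ] Euc d :=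
  LinearMap.transvection ((-(1 / 2 : ℝ)) • (innerSL ℝ n : Euc d →L[ℝ] ℝ).toLinearMap) n

theorem squeeze_eq (n x₀ x : Euc d) : squeeze n x₀ x = squeezeLinear n (x - x₀) + x₀ := by
  simp only [squeeze, squeezeLinear, LinearMap.transvection.apply, height, LinearMap.smul_apply]
  have : (inner ℝ n (x₀ - x) : ℝ) = - inner ℝ n (x - x₀) := by
    rw [← inner_neg_right]; congr 1; abel
  rw [this]
  simp only [ContinuousLinearMap.coe_coe, innerSL_apply_apply, smul_eq_mul]
  rw [show (-(inner ℝ n (x - x₀) : ℝ) / 2) = -(1 / 2) * inner ℝ n (x - x₀) by ring]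
  abel

theorem det_squeezeLinear (hn : ‖n‖ = 1) : LinearMap.det (squeezeLinear n) = 1 / 2 := by
  rw [squeezeLinear, LinearMap.transvection.det]
  simp [hn]; norm_num

/-- The squeezing map is affine with determinant `1/2`, so the image measure is twice the volume. -/
theorem map_squeeze (hn : ‖n‖ = 1) :
    Measure.map (squeeze n x₀) volume = (2 : ℝ≥0∞) • (volume : Measure (Euc d)) := by
  have e : squeeze n x₀ = (fun y => y + x₀) ∘ squeezeLinear n ∘ fun y => y - x₀ := by
    ext1 x; exact squeeze_eq n x₀ x
  have hm : Measurable (squeezeLinear n) := (LinearMap.continuous_of_finiteDimensional _).measurable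
  have hdet := det_squeezeLinear hn
  rw [e, ← Measure.map_map (by fun_prop) (hm.comp (by fun_prop)),
    ← Measure.map_map hm (by fun_prop), (measurePreserving_sub_right volume x₀).map_eq,
    Measure.map_linearMap_addHaar_eq_smul_addHaar _ (by rw [hdet]; norm_num), hdet,
    Measure.map_smul, (measurePreserving_add_right volume x₀).map_eq]
  norm_num

theorem injective_squeeze (hn : ‖n‖ = 1) : Function.Injective (squeeze n x₀) := by
  intro x y h
  have h2 := congrArg (height n x₀) h
  rw [height_squeeze hn, height_squeeze hn] at h2
  have h3 : height n x₀ x = height n x₀ y := by linarith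
  rw [squeeze, squeeze, h3] at h
  exact add_right_cancel h

theorem measurableEmbedding_squeeze (hn : ‖n‖ = 1) :
    MeasurableEmbedding (squeeze n x₀) :=
  continuous_squeeze.measurableEmbedding (injective_squeeze hn)

theorem integral_comp_squeeze (hn : ‖n‖ = 1) (f : Euc d → ℝ) :
    ∫ x, f (squeeze n x₀ x) = 2 * ∫ x, f x := by
  rw [← (measurableEmbedding_squeeze hn).integral_map, map_squeeze hn, integral_smul_measure]
  simp

theorem lintegral_comp_squeeze (hn : ‖n‖ = 1) (f : Euc d → ℝ≥0∞) :
    ∫⁻ x, f (squeeze n x₀ x) = 2 * ∫⁻ x, f x := by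
  rw [← (measurableEmbedding_squeeze hn).lintegral_map, map_squeeze hn, lintegral_smul_measure]
  simp

/-- The derivative of a smooth increasing step, supported in `[1/2, 1]`. -/
def profile (t : ℝ) : ℝ := 2 * deriv Real.smoothTransition (2 - 2 * t)

theorem hasDerivAt_smoothTransition (t : ℝ) :
    HasDerivAt (fun t => Real.smoothTransition (2 - 2 * t)) (-profile t) t := by
  have h1 : HasDerivAt Real.smoothTransition (deriv Real.smoothTransition (2 - 2 * t)) (2 - 2 * t) :=
    ((Real.smoothTransition.contDiff (n := 1)).differentiable (by norm_num) _).hasDerivAt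
  have h2 : HasDerivAt (fun t : ℝ => 2 - 2 * t) (-2) t := by
    simpa using ((hasDerivAt_id t).const_mul (2 : ℝ)).const_sub 2
  have := h1.comp t h2
  refine this.congr_deriv ?_
  rw [profile]; ring

theorem continuous_profile : Continuous profile :=
  continuous_const.mul (((Real.smoothTransition.contDiff (n := 1)).continuous_deriv le_rfl).comp
    (by fun_prop))

theorem profile_nonneg (t : ℝ) : 0 ≤ profile t :=
  mul_nonneg zero_le_two Real.smoothTransition.monotone.deriv_nonneg

theorem profile_eq_zero {t : ℝ} (h : t < 1 / 2 ∨ 1 < t) : profile t = 0 := by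
  rw [profile]
  have : deriv Real.smoothTransition (2 - 2 * t) = 0 := by
    rcases h with h | h
    · have e : Real.smoothTransition =ᶠ[𝓝 (2 - 2 * t)] fun _ => 1 := by
        filter_upwards [lt_mem_nhds (show 1 < 2 - 2 * t by linarith)] with u hu
        exact Real.smoothTransition.one_of_one_le hu.le
      rw [e.deriv_eq, deriv_const]
    · have e : Real.smoothTransition =ᶠ[𝓝 (2 - 2 * t)] fun _ => 0 := by
        filter_upwards [gt_mem_nhds (show 2 - 2 * t < 0 by linarith)] with u hu
        exact Real.smoothTransition.zero_of_nonpos hu.le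
      rw [e.deriv_eq, deriv_const]
  rw [this, mul_zero]

theorem mem_Icc_of_profile_ne_zero {t : ℝ} (h : profile t ≠ 0) : t ∈ Set.Icc (1 / 2 : ℝ) 1 := by
  by_contra hc
  exact h (profile_eq_zero (by rw [Set.mem_Icc, not_and_or, not_le, not_le] at hc; exact hc))

theorem exists_profile_le : ∃ C : ℝ, 0 < C ∧ ∀ t, profile t ≤ C := by
  obtain ⟨C, hC⟩ := (isCompact_Icc (a := (1 / 2 : ℝ)) (b := 1)).exists_bound_of_continuousOn
    continuous_profile.continuousOn
  refine ⟨max C 1, by positivity, fun t => ?_⟩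
  by_cases h : profile t = 0
  · rw [h]; positivity
  · exact (le_abs_self _).trans ((hC t (mem_Icc_of_profile_ne_zero h)).trans (le_max_left _ _))

/-- The profile is continuous and not identically zero, because the step whose derivative it is
descends from `1` to `0`. The interval of positivity provides the lower bound for the layer mean of
a polynomial. -/
theorem exists_le_profile : ∃ t c δ : ℝ, 1 / 2 ≤ t ∧ t ≤ 1 ∧ 0 < c ∧ 0 < δ ∧ δ ≤ 1 / 2 ∧
    ∀ u, |u - t| ≤ δ → c ≤ profile u := by
  have hne : ∃ t, profile t ≠ 0 := by
    by_contra! h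
    have hconst : ∀ a b : ℝ, Real.smoothTransition (2 - 2 * a) = Real.smoothTransition (2 - 2 * b) :=
      is_const_of_deriv_eq_zero (fun t => (hasDerivAt_smoothTransition t).differentiableAt)
        fun t => by rw [(hasDerivAt_smoothTransition t).deriv, h, neg_zero]
    have := hconst (1 / 2) 1
    norm_num at this
  obtain ⟨t, ht⟩ := hne
  have htI := mem_Icc_of_profile_ne_zero ht
  have hpos : 0 < profile t := lt_of_le_of_ne (profile_nonneg t) (Ne.symm ht)
  obtain ⟨δ, hδ, hb⟩ := Metric.mem_nhds_iff.1
    (continuous_profile.continuousAt.eventually (lt_mem_nhds (half_lt_self hpos)))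
  refine ⟨t, profile t / 2, min (δ / 2) (1 / 2), htI.1, htI.2, half_pos hpos, by positivity,
    min_le_right _ _, fun u hu => ?_⟩
  have hu' : u ∈ ball t δ := by
    rw [mem_ball, Real.dist_eq]
    exact (hu.trans (min_le_left _ _)).trans_lt (half_lt_self hδ)
  exact (hb hu').le

/-- The weighted mean of `f` over the layer of heights between `ε / 2` and `ε`. -/
def layerMean (n x₀ : Euc d) (ε : ℝ) (f : Euc d → ℝ) : ℝ :=
  ε⁻¹ * ∫ x, f x * profile (height n x₀ x / ε)

/-- A change of variables turns the mean over the layer of half the height into a mean of the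
squeezed field over the same layer. Means at successive scales then differ by a mean of `F ∘ squeeze
- F`. -/
theorem layerMean_half (hn : ‖n‖ = 1) (ε : ℝ) (f : Euc d → ℝ) :
    layerMean n x₀ (ε / 2) f = layerMean n x₀ ε fun x => f (squeeze n x₀ x) := by
  have h := integral_comp_squeeze (x₀ := x₀) hn fun x => f x * profile (height n x₀ x / (ε / 2))
  have e : (fun x => f (squeeze n x₀ x) *
      profile (height n x₀ (squeeze n x₀ x) / (ε / 2))) =
      fun x => f (squeeze n x₀ x) * profile (height n x₀ x / ε) := by
    ext x
    rw [height_squeeze hn, div_div_div_cancel_right₀ two_ne_zero]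
  rw [e] at h
  rw [layerMean, layerMean, h, inv_div]
  ring

end Layer

end

/-! ### Change of a field under squeezing -/

section

open Metric Filter Topology

section

variable {n x₀ x y : Euc d} {F : Euc d → Euc d}

/-- The flat cylinder of radius and height `2 r` over a hyperplane. -/
def cylinder (n x₀ : Euc d) (r : ℝ) : Set (Euc d) :=
  {x | ‖planeProj n x₀ x - x₀‖ < 2 * r ∧ 0 < height n x₀ x ∧ height n x₀ x < 2 * r}

/-- The part of a cylinder of radius `r` with heights up to `ε`. -/
def slab (n x₀ : Euc d) (r ε : ℝ) : Set (Euc d) :=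
  {x | ‖planeProj n x₀ x - x₀‖ ≤ r ∧ 0 < height n x₀ x ∧ height n x₀ x ≤ ε}

theorem isOpen_cylinder (r : ℝ) : IsOpen (cylinder n x₀ r) :=
  (isOpen_lt (continuous_planeProj.sub continuous_const).norm continuous_const).inter
    ((isOpen_lt continuous_const continuous_height).inter
      (isOpen_lt continuous_height continuous_const))

theorem measurableSet_slab (r ε : ℝ) : MeasurableSet (slab n x₀ r ε) :=
  (isClosed_le (continuous_planeProj.sub continuous_const).norm
    continuous_const).measurableSet.inter
    ((isOpen_lt continuous_const continuous_height).measurableSet.inter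
      (isClosed_le continuous_height continuous_const).measurableSet)

theorem slab_subset_cylinder {r ε : ℝ} (hr : 0 < r) (hε : ε ≤ r) :
    slab n x₀ r ε ⊆ cylinder n x₀ r := fun _ hx =>
  ⟨by linarith [hx.1], hx.2.1, by linarith [hx.2.2]⟩

theorem slab_mono {r ε ε' : ℝ} (h : ε ≤ ε') : slab n x₀ r ε ⊆ slab n x₀ r ε' :=
  fun _ hx => ⟨hx.1, hx.2.1, hx.2.2.trans h⟩

theorem cylinder_subset_ball (hn : ‖n‖ = 1) (r : ℝ) : cylinder n x₀ r ⊆ ball x₀ (4 * r) := by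
  intro x hx
  rw [mem_ball_iff_norm]
  have := norm_sub_le_of_planeProj (x₀ := x₀) hn x
  rw [abs_of_pos hx.2.1] at this
  linarith [hx.1, hx.2.2]

theorem squeeze_mem_slab (hn : ‖n‖ = 1) {r ε : ℝ} :
    squeeze n x₀ x ∈ slab n x₀ r (ε / 2) ↔ x ∈ slab n x₀ r ε := by
  simp only [slab, Set.mem_setOf_eq, planeProj_squeeze hn, height_squeeze hn]
  constructor
  · rintro ⟨h1, h2, h3⟩; exact ⟨h1, by linarith, by linarith⟩
  · rintro ⟨h1, h2, h3⟩; exact ⟨h1, by linarith, by linarith⟩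

theorem volume_slab_half (hn : ‖n‖ = 1) (r ε : ℝ) :
    2 * volume (slab n x₀ r (ε / 2)) = volume (slab n x₀ r ε) := by
  have h := lintegral_comp_squeeze (x₀ := x₀) hn ((slab n x₀ r (ε / 2)).indicator 1)
  rw [lintegral_indicator_one (measurableSet_slab _ _)] at h
  rw [← h, ← lintegral_indicator_one (measurableSet_slab _ _)]
  congr 1
  ext x
  by_cases hx : x ∈ slab n x₀ r ε
  · rw [Set.indicator_of_mem hx, Set.indicator_of_mem ((squeeze_mem_slab hn).2 hx)]; rfl
  · rw [Set.indicator_of_notMem hx, Set.indicator_of_notMem (mt (squeeze_mem_slab hn).1 hx)]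

theorem volume_slab_le (hn : ‖n‖ = 1) {r : ℝ} (hr : 0 < r) (k : ℕ) :
    volume (slab n x₀ r (r / 2 ^ k)) ≤ ENNReal.ofReal ((1 / 2) ^ k * (4 * r) ^ d) *
      volume (ball (0 : Euc d) 1) := by
  induction k with
  | zero =>
    rw [pow_zero, pow_zero, div_one, one_mul]
    refine (measure_mono ((slab_subset_cylinder hr le_rfl).trans (cylinder_subset_ball hn r))).trans ?_
    rw [Measure.addHaar_ball_of_pos _ _ (by positivity), finrank_euclideanSpace_fin]
  | succ k ih =>
    have h := volume_slab_half (x₀ := x₀) hn r (r / 2 ^ k)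
    rw [← h] at ih
    rw [pow_succ, ← div_div]
    refine (ENNReal.mul_le_mul_iff_right two_ne_zero ENNReal.ofNat_ne_top).1 (ih.trans (le_of_eq ?_))
    rw [← mul_assoc]
    congr 1
    rw [show (2 : ℝ≥0∞) = ENNReal.ofReal 2 by simp, ← ENNReal.ofReal_mul zero_le_two]
    congr 1
    ring

theorem measurable_lintegral_sub {U : Set (Euc d)} (hU : MeasurableSet U) (hF : Measurable F)
    (ε : ℝ) : Measurable fun x => ∫⁻ z in ball x ε ∩ U, ‖F x - F z‖ₑ := by
  have hmeas2 : Measurable fun z : Euc d × Euc d => ‖F z.1 - F z.2‖ₑ := by fun_prop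
  have e : (fun x => ∫⁻ z in ball x ε ∩ U, ‖F x - F z‖ₑ) = fun x => ∫⁻ z,
      ({z : Euc d × Euc d | dist z.2 z.1 < ε} ∩ Prod.snd ⁻¹' U).indicator
        (fun z => ‖F z.1 - F z.2‖ₑ) (x, z) := by
    ext x
    rw [← lintegral_indicator (measurableSet_ball.inter hU)]
    rfl
  rw [e]
  refine Measurable.lintegral_prod_right (f := fun x z => ({z : Euc d × Euc d |
    dist z.2 z.1 < ε} ∩ Prod.snd ⁻¹' U).indicator (fun z => ‖F z.1 - F z.2‖ₑ) (x, z)) ?_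
  refine hmeas2.indicator (MeasurableSet.inter ?_ (measurable_snd hU))
  exact measurableSet_lt (by fun_prop) (by fun_prop)

/-- Mean differences of `F` over short distances are controlled by the fractional seminorm. -/
theorem sq_lintegral_sub_le {θ : ℝ} (h0 : 0 < θ) {U W : Set (Euc d)} (hU : MeasurableSet U)
    (hWU : W ⊆ U) (hF : Measurable F) {ε : ℝ} (hε : 0 < ε) :
    (∫⁻ x in W, ∫⁻ z in ball x ε ∩ U, ‖F x - F z‖ₑ) ^ 2 ≤
      volume W * (volume (ball (0 : Euc d) ε) *
        (ENNReal.ofReal (ε ^ ((d : ℝ) + 2 * θ)) * slobodeckijSq θ U F)) := by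
  have hmeas := measurable_lintegral_sub hU hF ε
  refine (sq_lintegral_le _ hmeas.aemeasurable).trans ?_
  rw [Measure.restrict_apply_univ]
  gcongr
  -- Cauchy–Schwarz in `z`, and `|x - z| ≤ ε` to insert the kernel of the fractional seminorm.
  have hinner : ∀ x, (∫⁻ z in ball x ε ∩ U, ‖F x - F z‖ₑ) ^ 2 ≤
      (volume (ball (0 : Euc d) ε) * ENNReal.ofReal (ε ^ ((d : ℝ) + 2 * θ))) *
        ∫⁻ z in U, ‖F x - F z‖ₑ ^ 2 / ENNReal.ofReal (‖x - z‖ ^ ((d : ℝ) + 2 * θ)) := by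
    intro x
    refine (sq_lintegral_le _ (by fun_prop)).trans ?_
    rw [Measure.restrict_apply_univ, mul_assoc]
    have hv : volume (ball x ε ∩ U) ≤ volume (ball (0 : Euc d) ε) := by
      exact (measure_mono Set.inter_subset_left).trans
        (Measure.addHaar_ball_center volume x _).le
    refine mul_le_mul' hv ?_
    rw [← lintegral_const_mul' _ _ ENNReal.ofReal_ne_top]
    refine le_trans ?_ (lintegral_mono_set (Set.inter_subset_right (s := ball x ε)))
    refine setLIntegral_mono_ae' (measurableSet_ball.inter hU) (Eventually.of_forall fun z hz => ?_)
    have hxz : ‖x - z‖ ≤ ε := by rw [norm_sub_rev]; exact (mem_ball_iff_norm.1 hz.1).le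
    rcases eq_or_ne x z with rfl | hne
    · simp
    have hpos : 0 < ‖x - z‖ := norm_pos_iff.2 (sub_ne_zero.2 hne)
    have hle : ENNReal.ofReal (‖x - z‖ ^ ((d : ℝ) + 2 * θ)) ≤
        ENNReal.ofReal (ε ^ ((d : ℝ) + 2 * θ)) :=
      ENNReal.ofReal_le_ofReal (Real.rpow_le_rpow hpos.le hxz (by positivity))
    have hne0 : ENNReal.ofReal (‖x - z‖ ^ ((d : ℝ) + 2 * θ)) ≠ 0 := by
      rw [Ne, ENNReal.ofReal_eq_zero, not_le]; positivity
    rw [← mul_div_assoc, ENNReal.le_div_iff_mul_le (Or.inl hne0) (Or.inl ENNReal.ofReal_ne_top),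
      mul_comm]
    gcongr
  refine (lintegral_mono fun x => hinner x).trans ?_
  rw [lintegral_const_mul' _ _ (ENNReal.mul_ne_top measure_ball_lt_top.ne ENNReal.ofReal_ne_top),
    mul_assoc]
  gcongr
  rw [slobodeckijSq, if_neg h0.ne']
  exact lintegral_mono_set hWU

/-- The squeezing map changes `F` on a layer by an amount that its fractional seminorm controls. -/
theorem lintegral_squeeze_sub_le {θ : ℝ} (h0 : 0 < θ) (hn : ‖n‖ = 1) {r ε : ℝ} (hε : 0 < ε)
    (hεr : ε ≤ r) (hF : Measurable F) :
    (volume (ball (0 : Euc d) (ε / 4)) * ∫⁻ x in slab n x₀ r ε ∩ {x | ε / 2 ≤ height n x₀ x},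
        ‖F (squeeze n x₀ x) - F x‖ₑ) ^ 2 ≤
      9 * (volume (slab n x₀ r ε) * (volume (ball (0 : Euc d) ε) *
        (ENNReal.ofReal (ε ^ ((d : ℝ) + 2 * θ)) * slobodeckijSq θ (cylinder n x₀ r) F))) := by
  set W := slab n x₀ r ε with hW
  set U := cylinder n x₀ r with hU
  have hUm : MeasurableSet U := (isOpen_cylinder r).measurableSet
  have hr : 0 < r := hε.trans_le hεr
  have hWU : W ⊆ U := slab_subset_cylinder hr hεr
  have hWm : MeasurableSet W := measurableSet_slab r ε
  have hW'm : MeasurableSet (W ∩ {x | ε / 2 ≤ height n x₀ x}) :=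
    hWm.inter (isClosed_le continuous_const continuous_height).measurableSet
  set I : Euc d → ℝ≥0∞ := fun x => ∫⁻ z in ball x ε ∩ U, ‖F x - F z‖ₑ with hI
  -- The two values are compared through averages over the ball of radius `ε/4` around the squeezed
  -- point. Its height is at least `ε/4`, so the ball stays in the cylinder, and it lies within `ε`
  -- of both points.
  have hpt : ∀ x ∈ W ∩ {x | ε / 2 ≤ height n x₀ x},
      volume (ball (0 : Euc d) (ε / 4)) * ‖F (squeeze n x₀ x) - F x‖ₑ ≤
      I x + I (squeeze n x₀ x) := by
    rintro x ⟨hx, hx2⟩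
    set y := squeeze n x₀ x with hy
    have hyx : ‖y - x‖ ≤ ε / 2 := by
      rw [hy, squeeze, add_sub_cancel_left, norm_smul, hn, mul_one, Real.norm_eq_abs,
        abs_of_pos (by linarith [hx.2.1])]
      linarith [hx.2.2]
    have hyh : height n x₀ y = height n x₀ x / 2 := height_squeeze hn x
    have hB : ball y (ε / 4) ⊆ U := by
      intro z hz
      have hz' := mem_ball_iff_norm.1 hz
      have h1 := norm_planeProj_sub_le (x₀ := x₀) hn z y
      have h2 := abs_le.1 (abs_height_sub_le (x₀ := x₀) hn z y)
      have h3 : planeProj n x₀ y = planeProj n x₀ x := planeProj_squeeze hn x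
      have h4 := norm_sub_le_norm_sub_add_norm_sub (planeProj n x₀ z) (planeProj n x₀ y) x₀
      have hx2' : ε / 2 ≤ height n x₀ x := hx2
      rw [h3] at h4 h1
      refine ⟨?_, ?_, ?_⟩ <;> linarith [hx.1, hx.2.2]
    have hBx : ball y (ε / 4) ⊆ ball x ε ∩ U := fun z hz => ⟨by
      have h4 := norm_sub_le_norm_sub_add_norm_sub z y x
      rw [mem_ball_iff_norm] at hz ⊢
      linarith, hB hz⟩
    have hBy : ball y (ε / 4) ⊆ ball y ε ∩ U := fun z hz =>
      ⟨ball_subset_ball (by linarith) hz, hB hz⟩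
    have hv : volume (ball (0 : Euc d) (ε / 4)) = volume (ball y (ε / 4)) :=
      (Measure.addHaar_ball_center volume y _).symm
    calc volume (ball (0 : Euc d) (ε / 4)) * ‖F y - F x‖ₑ
        = ∫⁻ _ in ball y (ε / 4), ‖F y - F x‖ₑ := by
          rw [setLIntegral_const, mul_comm, hv]
      _ ≤ ∫⁻ z in ball y (ε / 4), (‖F x - F z‖ₑ + ‖F y - F z‖ₑ) := by
          refine lintegral_mono fun z => ?_
          rw [show F y - F x = (F y - F z) - (F x - F z) by abel, add_comm]
          exact enorm_sub_le
      _ = (∫⁻ z in ball y (ε / 4), ‖F x - F z‖ₑ) + ∫⁻ z in ball y (ε / 4), ‖F y - F z‖ₑ :=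
          lintegral_add_left (by fun_prop) _
      _ ≤ I x + I y := add_le_add (lintegral_mono_set hBx) (lintegral_mono_set hBy)
  have hIm : Measurable I := measurable_lintegral_sub hUm hF ε
  have hsq : ∫⁻ x in W, I (squeeze n x₀ x) ≤ 2 * ∫⁻ x in W, I x := by
    have h := lintegral_comp_squeeze (x₀ := x₀) hn ((slab n x₀ r (ε / 2)).indicator I)
    rw [lintegral_indicator (measurableSet_slab _ _)] at h
    have e : (fun x => (slab n x₀ r (ε / 2)).indicator I (squeeze n x₀ x)) =
        W.indicator fun x => I (squeeze n x₀ x) := by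
      ext x
      by_cases hx : x ∈ W
      · rw [Set.indicator_of_mem hx, Set.indicator_of_mem ((squeeze_mem_slab hn).2 hx)]
      · rw [Set.indicator_of_notMem hx, Set.indicator_of_notMem (mt (squeeze_mem_slab hn).1 hx)]
    rw [e, lintegral_indicator hWm] at h
    rw [h]
    gcongr
    exact slab_mono (by linarith)
  -- The factor `3` is `1` for the integral at `x` and `2` for the one at the squeezed point, from
  -- the Jacobian.
  have key : volume (ball (0 : Euc d) (ε / 4)) *
      ∫⁻ x in W ∩ {x | ε / 2 ≤ height n x₀ x}, ‖F (squeeze n x₀ x) - F x‖ₑ ≤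
      3 * ∫⁻ x in W, I x := by
    rw [← lintegral_const_mul' _ _ measure_ball_lt_top.ne]
    calc _ ≤ ∫⁻ x in W ∩ {x | ε / 2 ≤ height n x₀ x}, (I x + I (squeeze n x₀ x)) :=
          setLIntegral_mono_ae' hW'm (Eventually.of_forall hpt)
      _ ≤ ∫⁻ x in W, (I x + I (squeeze n x₀ x)) := lintegral_mono_set Set.inter_subset_left
      _ = (∫⁻ x in W, I x) + ∫⁻ x in W, I (squeeze n x₀ x) := lintegral_add_left hIm _
      _ ≤ (∫⁻ x in W, I x) + 2 * ∫⁻ x in W, I x := by gcongr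
      _ = 3 * ∫⁻ x in W, I x := by ring
  calc _ ≤ (3 * ∫⁻ x in W, I x) ^ 2 := by gcongr
    _ = 9 * (∫⁻ x in W, I x) ^ 2 := by rw [mul_pow]; norm_num
    _ ≤ _ := by gcongr; exact sq_lintegral_sub_le h0 hUm hWU hF hε

end

end

/-! ### Uniform bound of the layer means -/

section

open Metric Filter Topology

section

variable {n x₀ x y : Euc d} {F Ψ : Euc d → Euc d} {r ε M θ : ℝ}

/-- At scale `ε = r / 2^k` the change of the mean is governed by the square root of the slab volume
times `ε^(θ-1)`. This identity exhibits the ratio `2^(1/2-θ)` of consecutive scales. -/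
theorem sqrt_mul_rpow_eq (hr : 0 < r) (θ : ℝ) (k : ℕ) :
    √((1 / 2) ^ k * (4 * r) ^ d) * (r / 2 ^ k) ^ θ * (r / 2 ^ k)⁻¹ =
      2 ^ d * r ^ ((d : ℝ) / 2 + θ - 1) * ((2 : ℝ) ^ (1 / 2 - θ)) ^ k := by
  have h2 : (0 : ℝ) < 2 := two_pos
  have e1 : √((1 / 2 : ℝ) ^ k * (4 * r) ^ d) = 2 ^ (-((k : ℝ) / 2)) * (2 ^ d * r ^ ((d : ℝ) / 2)) := by
    rw [Real.sqrt_eq_iff_mul_self_eq (by positivity) (by positivity)]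
    have a1 : (2 : ℝ) ^ (-((k : ℝ) / 2)) * 2 ^ (-((k : ℝ) / 2)) = (1 / 2) ^ k := by
      rw [← Real.rpow_add h2, show -((k : ℝ) / 2) + -((k : ℝ) / 2) = -(k : ℝ) by ring,
        Real.rpow_neg h2.le, Real.rpow_natCast, one_div, inv_pow]
    have a2 : r ^ ((d : ℝ) / 2) * r ^ ((d : ℝ) / 2) = r ^ d := by
      rw [← Real.rpow_add hr, add_halves, Real.rpow_natCast]
    rw [mul_pow, show (4 : ℝ) = 2 * 2 by norm_num, mul_pow, ← a1, ← a2]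
    ring
  have e2 : (r / 2 ^ k) ^ θ * (r / 2 ^ k)⁻¹ = r ^ (θ - 1) * 2 ^ (-((k : ℝ) * (θ - 1))) := by
    have : (0 : ℝ) < r / 2 ^ k := by positivity
    rw [← Real.rpow_neg_one (r / 2 ^ k), ← Real.rpow_add this, ← sub_eq_add_neg,
      Real.div_rpow hr.le (by positivity), ← Real.rpow_natCast, ← Real.rpow_mul h2.le,
      Real.rpow_neg h2.le, div_eq_mul_inv]
  rw [mul_assoc, e2, e1, show (d : ℝ) / 2 + θ - 1 = d / 2 + (θ - 1) by ring, Real.rpow_add hr,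
    ← Real.rpow_natCast ((2 : ℝ) ^ (1 / 2 - θ)), ← Real.rpow_mul h2.le,
    show (1 / 2 - θ) * (k : ℝ) = -((k : ℝ) / 2) + -((k : ℝ) * (θ - 1)) by ring, Real.rpow_add h2]
  ring

/-- Test fields for the layer means: continuous, bounded by `M`, independent of the height and
supported in the cylinder of radius `r`. -/
structure LayerField (n x₀ : Euc d) (r M : ℝ) (Ψ : Euc d → Euc d) : Prop where
  continuous : Continuous Ψ
  norm_le : ∀ x, ‖Ψ x‖ ≤ M
  comp_planeProj : ∀ x, Ψ (planeProj n x₀ x) = Ψ x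
  support : ∀ x, Ψ x ≠ 0 → ‖planeProj n x₀ x - x₀‖ ≤ r

theorem LayerField.comp_squeeze (hΨ : LayerField n x₀ r M Ψ) (hn : ‖n‖ = 1) (x : Euc d) :
    Ψ (squeeze n x₀ x) = Ψ x := by
  rw [← hΨ.comp_planeProj, planeProj_squeeze hn, hΨ.comp_planeProj]

theorem LayerField.mem_slab (hΨ : LayerField n x₀ r M Ψ) (hε : 0 < ε) (hx : Ψ x ≠ 0)
    (hp : profile (height n x₀ x / ε) ≠ 0) :
    x ∈ slab n x₀ r ε ∩ {x | ε / 2 ≤ height n x₀ x} := by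
  have h := mem_Icc_of_profile_ne_zero hp
  rw [Set.mem_Icc, le_div_iff₀ hε, div_le_iff₀ hε] at h
  refine ⟨⟨hΨ.support x hx, ?_, ?_⟩, ?_⟩
  · linarith [h.1]
  · linarith [h.2]
  · show ε / 2 ≤ height n x₀ x
    linarith [h.1]

theorem LayerField.integrable (hΨ : LayerField n x₀ r M Ψ) (hr : 0 < r) (hε : 0 < ε) (hεr : ε ≤ r)
    (hF : IntegrableOn F (cylinder n x₀ r)) :
    Integrable fun x => (inner ℝ (Ψ x) (F x) : ℝ) * profile (height n x₀ x / ε) := by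
  obtain ⟨C, hC, hCp⟩ := exists_profile_le
  have hM : 0 ≤ M := (norm_nonneg _).trans (hΨ.norm_le 0)
  refine IntegrableOn.integrable_of_forall_notMem_eq_zero (s := cylinder n x₀ r) ?_ ?_
  · refine (hF.norm.const_mul (M * C)).mono' ?_ (Eventually.of_forall fun x => ?_)
    · exact (hΨ.continuous.aestronglyMeasurable.inner hF.1).mul
        ((continuous_profile.comp (continuous_height.div_const ε)).aestronglyMeasurable)
    · rw [norm_mul, Real.norm_eq_abs, Real.norm_eq_abs, abs_of_nonneg (profile_nonneg _)]
      calc |(inner ℝ (Ψ x) (F x) : ℝ)| * profile (height n x₀ x / ε)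
          ≤ (M * ‖F x‖) * C := mul_le_mul ((abs_real_inner_le_norm _ _).trans
            (mul_le_mul_of_nonneg_right (hΨ.norm_le x) (norm_nonneg _))) (hCp _)
            (profile_nonneg _) (by positivity)
        _ = M * C * ‖F x‖ := by ring
  · intro x hx
    by_contra h
    have h1 : Ψ x ≠ 0 := fun h1 => h (by rw [h1, inner_zero_left, zero_mul])
    have h2 : profile (height n x₀ x / ε) ≠ 0 := fun h2 => h (by rw [h2, mul_zero])
    exact hx (slab_subset_cylinder hr hεr (hΨ.mem_slab hε h1 h2).1)

/-- The test field does not depend on the height, so squeezing changes only `F`; both the test field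
and the profile confine the integral to the layer. -/
theorem LayerField.enorm_layerMean_half_sub_le (hΨ : LayerField n x₀ r M Ψ) (hn : ‖n‖ = 1)
    (hr : 0 < r) (hε : 0 < ε) (hεr : ε ≤ r) (hF : IntegrableOn F (cylinder n x₀ r))
    {C : ℝ} (hC : 0 < C) (hCp : ∀ t, profile t ≤ C) :
    ‖layerMean n x₀ (ε / 2) (fun x => inner ℝ (Ψ x) (F x)) -
      layerMean n x₀ ε fun x => inner ℝ (Ψ x) (F x)‖ₑ ≤
      ENNReal.ofReal (ε⁻¹ * (M * C)) * ∫⁻ x in slab n x₀ r ε ∩ {x | ε / 2 ≤ height n x₀ x},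
        ‖F (squeeze n x₀ x) - F x‖ₑ := by
  have hM : 0 ≤ M := (norm_nonneg _).trans (hΨ.norm_le 0)
  have i1 := hΨ.integrable hr hε hεr hF
  have i2 : Integrable fun x => (inner ℝ (Ψ (squeeze n x₀ x)) (F (squeeze n x₀ x)) : ℝ) *
      profile (height n x₀ x / ε) := by
    have h := hΨ.integrable hr (half_pos hε) (by linarith) hF
    have h' : Integrable (fun x => (inner ℝ (Ψ x) (F x) : ℝ) * profile (height n x₀ x / (ε / 2)))
        (Measure.map (squeeze n x₀) volume) := by
      rw [map_squeeze hn]; exact h.smul_measure ENNReal.ofNat_ne_top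
    rw [(measurableEmbedding_squeeze hn).integrable_map_iff] at h'
    refine h'.congr (Eventually.of_forall fun x => ?_)
    simp only [Function.comp, height_squeeze hn]
    rw [div_div_div_cancel_right₀ (two_ne_zero (α := ℝ))]
  have hW'm : MeasurableSet (slab n x₀ r ε ∩ {x | ε / 2 ≤ height n x₀ x}) :=
    (measurableSet_slab r ε).inter (isClosed_le continuous_const continuous_height).measurableSet
  rw [layerMean_half hn, layerMean, layerMean, ← mul_sub, ← integral_sub i2 i1, enorm_mul,
    Real.enorm_eq_ofReal (by positivity : 0 ≤ ε⁻¹), ENNReal.ofReal_mul (by positivity), mul_assoc]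
  gcongr
  refine (enorm_integral_le_lintegral_enorm _).trans ?_
  rw [← lintegral_const_mul' _ _ ENNReal.ofReal_ne_top, ← lintegral_indicator hW'm]
  refine lintegral_mono fun x => ?_
  by_cases hx : x ∈ slab n x₀ r ε ∩ {x | ε / 2 ≤ height n x₀ x}
  · rw [Set.indicator_of_mem hx, hΨ.comp_squeeze hn, ← sub_mul, ← inner_sub_right, enorm_mul,
      Real.enorm_eq_ofReal_abs, Real.enorm_eq_ofReal (profile_nonneg _), ← ofReal_norm,
      ← ENNReal.ofReal_mul (abs_nonneg _), ← ENNReal.ofReal_mul (by positivity)]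
    refine ENNReal.ofReal_le_ofReal ?_
    calc _ ≤ (M * ‖F (squeeze n x₀ x) - F x‖) * C :=
          mul_le_mul ((abs_real_inner_le_norm _ _).trans
            (mul_le_mul_of_nonneg_right (hΨ.norm_le x) (norm_nonneg _))) (hCp _)
            (profile_nonneg _) (by positivity)
      _ = _ := by ring
  · rw [Set.indicator_of_notMem hx]
    have : (inner ℝ (Ψ (squeeze n x₀ x)) (F (squeeze n x₀ x)) : ℝ) * profile (height n x₀ x / ε) -
        (inner ℝ (Ψ x) (F x) : ℝ) * profile (height n x₀ x / ε) = 0 := by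
      by_contra h
      have h1 : Ψ x ≠ 0 := fun h1 => h (by rw [hΨ.comp_squeeze hn, h1]; simp)
      have h2 : profile (height n x₀ x / ε) ≠ 0 := fun h2 => h (by rw [h2]; simp)
      exact hx (hΨ.mem_slab hε h1 h2)
    rw [this, enorm_zero]

theorem LayerField.abs_layerMean_succ_sub_le (h0 : 0 < θ) (hΨ : LayerField n x₀ r M Ψ)
    (hn : ‖n‖ = 1) (hr : 0 < r) (hFm : Measurable F) (hF : IntegrableOn F (cylinder n x₀ r))
    (hfin : slob θ (cylinder n x₀ r) F ≠ ⊤)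
    {C : ℝ} (hC : 0 < C) (hCp : ∀ t, profile t ≤ C) (k : ℕ) :
    |layerMean n x₀ (r / 2 ^ (k + 1)) (fun x => inner ℝ (Ψ x) (F x)) -
      layerMean n x₀ (r / 2 ^ k) fun x => inner ℝ (Ψ x) (F x)| ≤
      3 * 4 ^ d * 2 ^ d * C * M * r ^ ((d : ℝ) / 2 + θ - 1) *
        (slob θ (cylinder n x₀ r) F).toReal * ((2 : ℝ) ^ (1 / 2 - θ)) ^ k := by
  have hM : 0 ≤ M := (norm_nonneg _).trans (hΨ.norm_le 0)
  set ε := r / 2 ^ k with hεdef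
  have hε : 0 < ε := by positivity
  have hεr : ε ≤ r := div_le_self hr.le (one_le_pow₀ one_le_two)
  set N := (slob θ (cylinder n x₀ r) F).toReal with hN
  have hN0 : 0 ≤ N := ENNReal.toReal_nonneg
  set v₁ := (volume (ball (0 : Euc d) 1)).toReal with hv
  have hv0 : 0 < v₁ := ENNReal.toReal_pos (measure_ball_pos volume _ one_pos).ne' measure_ball_lt_top.ne
  have hve : volume (ball (0 : Euc d) 1) = ENNReal.ofReal v₁ :=
    (ENNReal.ofReal_toReal measure_ball_lt_top.ne).symm
  have hball : ∀ t : ℝ, 0 < t → volume (ball (0 : Euc d) t) = ENNReal.ofReal (t ^ d * v₁) := by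
    intro t ht
    rw [Measure.addHaar_ball_of_pos _ _ ht, finrank_euclideanSpace_fin, hve,
      ← ENNReal.ofReal_mul (by positivity)]
  set X := ∫⁻ x in slab n x₀ r ε ∩ {x | ε / 2 ≤ height n x₀ x}, ‖F (squeeze n x₀ x) - F x‖ₑ with hX
  set S := √((1 / 2) ^ k * (4 * r) ^ d) with hS
  have hS2 : S ^ 2 = (1 / 2) ^ k * (4 * r) ^ d := Real.sq_sqrt (by positivity)
  have hXle : X ≤ ENNReal.ofReal (3 * 4 ^ d * S * ε ^ θ * N) := by
    have h := lintegral_squeeze_sub_le (x₀ := x₀) h0 hn hε hεr hFm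
    have hsl := volume_slab_le (x₀ := x₀) hn hr k
    rw [← slob_sq, ← ENNReal.ofReal_toReal hfin, ← hN, ← ENNReal.ofReal_pow hN0, hball _ hε,
      hball _ (by positivity)] at h
    rw [hve, ← ENNReal.ofReal_mul (by positivity)] at hsl
    have hj : (ENNReal.ofReal ((ε / 4) ^ d * v₁) * X) ^ 2 ≤
        (ENNReal.ofReal (3 * S * v₁ * ε ^ d * ε ^ θ * N)) ^ 2 := by
      refine (h.trans (mul_le_mul_right (mul_le_mul_left hsl _) _)).trans (le_of_eq ?_)
      rw [← ENNReal.ofReal_pow (by positivity), ← ENNReal.ofReal_mul (by positivity),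
        ← ENNReal.ofReal_mul (by positivity), ← ENNReal.ofReal_mul (by positivity),
        show (9 : ℝ≥0∞) = ENNReal.ofReal 9 by simp, ← ENNReal.ofReal_mul (by positivity)]
      congr 1
      have : ε ^ ((d : ℝ) + 2 * θ) = ε ^ d * (ε ^ θ) ^ 2 := by
        rw [Real.rpow_add hε, Real.rpow_natCast, two_mul, Real.rpow_add hε, sq]
      rw [this]
      calc _ = 9 * ((1 / 2) ^ k * (4 * r) ^ d) * v₁ ^ 2 * (ε ^ d) ^ 2 * (ε ^ θ) ^ 2 * N ^ 2 := by ring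
        _ = _ := by rw [← hS2]; ring
    have hj' := (ENNReal.pow_le_pow_left_iff two_ne_zero).1 hj
    have ha : 0 < (ε / 4) ^ d * v₁ := by positivity
    have e : 3 * S * v₁ * ε ^ d * ε ^ θ * N = ((ε / 4) ^ d * v₁) * (3 * 4 ^ d * S * ε ^ θ * N) := by
      have : ε ^ d = (ε / 4) ^ d * 4 ^ d := by rw [← mul_pow, div_mul_cancel₀ _ four_ne_zero]
      rw [this]; ring
    rw [e, ENNReal.ofReal_mul ha.le] at hj'
    exact (ENNReal.mul_le_mul_iff_right (by simpa using ha) ENNReal.ofReal_ne_top).1 hj'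
  have h1 := hΨ.enorm_layerMean_half_sub_le hn hr hε hεr hF hC hCp
  have e2 : r / 2 ^ (k + 1) = ε / 2 := by rw [hεdef, pow_succ, div_div]
  rw [e2, ← Real.norm_eq_abs]
  have hb := sqrt_mul_rpow_eq (d := d) hr θ k
  rw [← hεdef, ← hS] at hb
  have h2 := h1.trans (mul_le_mul_right hXle _)
  rw [← ENNReal.ofReal_mul (by positivity), ← ofReal_norm] at h2
  refine ((ENNReal.ofReal_le_ofReal_iff (by positivity)).1 h2).trans (le_of_eq ?_)
  calc _ = 3 * 4 ^ d * C * M * N * (S * ε ^ θ * ε⁻¹) := by ring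
    _ = _ := by rw [hb]; ring

/-- The layer means of `Ψ · F` are bounded by the `L²` norm and the fractional seminorm of order
`θ > 1/2` of `F`, uniformly down to the hyperplane. -/
theorem exists_abs_layerMean_le (d : ℕ) (h1 : 1 / 2 < θ) : ∃ C : ℝ, 0 < C ∧
    ∀ (n x₀ : Euc d) (r M : ℝ) (F Ψ : Euc d → Euc d), ‖n‖ = 1 → 0 < r → LayerField n x₀ r M Ψ →
      Measurable F → MemLp F 2 (volume.restrict (cylinder n x₀ r)) →
      slob θ (cylinder n x₀ r) F ≠ ⊤ → ∀ k : ℕ,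
      |layerMean n x₀ (r / 2 ^ k) fun x => inner ℝ (Ψ x) (F x)| ≤
        C * M * r ^ ((d : ℝ) / 2 - 1) * ((slob 0 (cylinder n x₀ r) F).toReal +
          r ^ θ * (slob θ (cylinder n x₀ r) F).toReal) := by
  obtain ⟨C, hC, hCp⟩ := exists_profile_le
  set v₁ := (volume (ball (0 : Euc d) 1)).toReal with hv
  -- The ratio of the geometric series is below `1` precisely because `θ > 1/2`; this is where the
  -- restriction on `s` enters.
  set l : ℝ := (2 : ℝ) ^ (1 / 2 - θ) with hl
  have hl0 : 0 < l := by positivity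
  have hl1 : l < 1 := Real.rpow_lt_one_of_one_lt_of_neg one_lt_two (by linarith)
  set A : ℝ := C * 2 ^ d * √v₁ with hA
  set B : ℝ := 3 * 4 ^ d * 2 ^ d * C * (1 - l)⁻¹ with hB
  have hA0 : 0 ≤ A := by positivity
  have hl2 : 0 < 1 - l := by linarith
  have hB0 : 0 < B := by positivity
  refine ⟨A + B, by positivity, fun n x₀ r M F Ψ hn hr hΨ hFm hF2 hfin k => ?_⟩
  have hM : 0 ≤ M := (norm_nonneg _).trans (hΨ.norm_le 0)
  have hvol : volume (cylinder n x₀ r) ≤ ENNReal.ofReal ((4 * r) ^ d * v₁) := by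
    refine (measure_mono (cylinder_subset_ball hn r)).trans (le_of_eq ?_)
    rw [Measure.addHaar_ball_of_pos _ _ (by positivity), finrank_euclideanSpace_fin,
      ENNReal.ofReal_mul (by positivity), hv, ENNReal.ofReal_toReal measure_ball_lt_top.ne]
  have hfm : IsFiniteMeasure (volume.restrict (cylinder n x₀ r)) :=
    ⟨by rw [Measure.restrict_apply_univ]; exact hvol.trans_lt ENNReal.ofReal_lt_top⟩
  have hF : IntegrableOn F (cylinder n x₀ r) := hF2.integrable one_le_two
  have h0fin : slob 0 (cylinder n x₀ r) F ≠ ⊤ := by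
    rw [slob_zero_eq_eLpNorm]; exact hF2.2.ne
  set N := (slob 0 (cylinder n x₀ r) F).toReal with hN
  have hN0 : 0 ≤ N := ENNReal.toReal_nonneg
  set Nθ := (slob θ (cylinder n x₀ r) F).toReal with hNθ
  have hNθ0 : 0 ≤ Nθ := ENNReal.toReal_nonneg
  set L : ℕ → ℝ := fun k => layerMean n x₀ (r / 2 ^ k) fun x => inner ℝ (Ψ x) (F x) with hL
  -- The layer at scale `r` is bounded by Cauchy–Schwarz over the cylinder; all finer layers are
  -- reached by telescoping.
  have hstart : |L 0| ≤ A * M * r ^ ((d : ℝ) / 2 - 1) * N := by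
    have hint : ∫⁻ x in cylinder n x₀ r, ‖F x‖ₑ ≤ ENNReal.ofReal (2 ^ d * √v₁ * r ^ ((d : ℝ) / 2) * N) := by
      rw [← ENNReal.pow_le_pow_left_iff two_ne_zero]
      refine (sq_lintegral_le _ hFm.enorm.aemeasurable).trans ?_
      rw [Measure.restrict_apply_univ]
      have e : ∫⁻ x in cylinder n x₀ r, ‖F x‖ₑ ^ 2 = ENNReal.ofReal (N ^ 2) := by
        rw [ENNReal.ofReal_pow hN0, hN, ENNReal.ofReal_toReal h0fin, slob_sq]
        simp [slobodeckijSq]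
      rw [e, ← ENNReal.ofReal_pow (by positivity)]
      refine (mul_le_mul_left hvol _).trans (le_of_eq ?_)
      rw [← ENNReal.ofReal_mul (by positivity)]
      congr 1
      have e1 : (r ^ ((d : ℝ) / 2)) ^ 2 = r ^ d := by
        rw [sq, ← Real.rpow_add hr, add_halves, Real.rpow_natCast]
      have e2 : √v₁ ^ 2 = v₁ := Real.sq_sqrt ENNReal.toReal_nonneg
      have e3 : ((2 : ℝ) ^ d) ^ 2 = 4 ^ d := by rw [← pow_mul, mul_comm d 2, pow_mul]; norm_num
      rw [mul_pow, mul_pow, mul_pow, mul_pow, e1, e2, e3]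
      ring
    have h1 : ‖L 0‖ₑ ≤ ENNReal.ofReal (r⁻¹ * (M * C)) * ∫⁻ x in cylinder n x₀ r, ‖F x‖ₑ := by
      simp only [hL, pow_zero, div_one]
      rw [layerMean, enorm_mul, Real.enorm_eq_ofReal (by positivity : 0 ≤ r⁻¹),
        ENNReal.ofReal_mul (by positivity), mul_assoc]
      gcongr
      refine (enorm_integral_le_lintegral_enorm _).trans ?_
      rw [← lintegral_const_mul' _ _ ENNReal.ofReal_ne_top,
        ← lintegral_indicator (isOpen_cylinder r).measurableSet]
      refine lintegral_mono fun x => ?_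
      by_cases hx : x ∈ cylinder n x₀ r
      · rw [Set.indicator_of_mem hx, enorm_mul,
          Real.enorm_eq_ofReal_abs, Real.enorm_eq_ofReal (profile_nonneg _), ← ofReal_norm,
          ← ENNReal.ofReal_mul (abs_nonneg _), ← ENNReal.ofReal_mul (by positivity)]
        refine ENNReal.ofReal_le_ofReal ?_
        calc _ ≤ (M * ‖F x‖) * C :=
              mul_le_mul ((abs_real_inner_le_norm _ _).trans
                (mul_le_mul_of_nonneg_right (hΨ.norm_le x) (norm_nonneg _))) (hCp _)
                (profile_nonneg _) (by positivity)
          _ = _ := by ring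
      · rw [Set.indicator_of_notMem hx]
        have : (inner ℝ (Ψ x) (F x) : ℝ) * profile (height n x₀ x / r) = 0 := by
          by_contra h
          have h1 : Ψ x ≠ 0 := fun h1 => h (by rw [h1]; simp)
          have h2 : profile (height n x₀ x / r) ≠ 0 := fun h2 => h (by rw [h2]; simp)
          exact hx (slab_subset_cylinder hr le_rfl (hΨ.mem_slab hr h1 h2).1)
        rw [this, enorm_zero]
    have h2 := h1.trans (mul_le_mul_right hint _)
    rw [← ENNReal.ofReal_mul (by positivity), ← ofReal_norm] at h2
    refine ((ENNReal.ofReal_le_ofReal_iff (by positivity)).1 h2).trans (le_of_eq ?_)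
    rw [Real.rpow_sub_one hr.ne', hA]
    ring
  have hstep : ∀ k, |L (k + 1) - L k| ≤ (3 * 4 ^ d * 2 ^ d * C * M * r ^ ((d : ℝ) / 2 + θ - 1) * Nθ) *
      l ^ k := fun k =>
    hΨ.abs_layerMean_succ_sub_le (by linarith) hn hr hFm hF hfin hC hCp k
  set b := 3 * 4 ^ d * 2 ^ d * C * M * r ^ ((d : ℝ) / 2 + θ - 1) * Nθ with hb
  have hb0 : 0 ≤ b := by positivity
  have hind : ∀ k, |L k| ≤ A * M * r ^ ((d : ℝ) / 2 - 1) * N + b * ∑ i ∈ Finset.range k, l ^ i := by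
    intro k
    induction k with
    | zero => simpa using hstart
    | succ k ih =>
      rw [Finset.sum_range_succ, mul_add, ← add_assoc]
      calc |L (k + 1)| = |L k + (L (k + 1) - L k)| := by rw [add_sub_cancel]
        _ ≤ |L k| + |L (k + 1) - L k| := abs_add_le _ _
        _ ≤ _ := add_le_add ih (hstep k)
  have hgeo : ∑ i ∈ Finset.range k, l ^ i ≤ (1 - l)⁻¹ := by
    rw [← tsum_geometric_of_lt_one hl0.le hl1]
    exact (summable_geometric_of_lt_one hl0.le hl1).sum_le_tsum _ fun _ _ => by positivity
  have e : b * (1 - l)⁻¹ = B * M * r ^ ((d : ℝ) / 2 - 1) * (r ^ θ * Nθ) := by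
    rw [hb, hB, show (d : ℝ) / 2 + θ - 1 = (d / 2 - 1) + θ by ring, Real.rpow_add hr]
    ring
  calc |L k| ≤ A * M * r ^ ((d : ℝ) / 2 - 1) * N + b * (1 - l)⁻¹ :=
        (hind k).trans (by gcongr)
    _ ≤ (A + B) * M * r ^ ((d : ℝ) / 2 - 1) * N +
          (A + B) * M * r ^ ((d : ℝ) / 2 - 1) * (r ^ θ * Nθ) := by
        rw [e]; gcongr <;> linarith
    _ = _ := by ring

end

end

/-! ### Vanishing tangential layer means from Green's formula -/

section

open Metric Filter Topology

section

variable {Ω : Set (Euc d)} {n x₀ x : Euc d} {v g : Euc d → Euc d} {r : ℝ}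

/-- An even smooth cutoff that is `1` near `0` and supported in `[-1, 1]`. -/
def cutoff (t : ℝ) : ℝ := Real.smoothTransition (2 - 2 * t) * Real.smoothTransition (2 + 2 * t)

theorem contDiff_cutoff : ContDiff ℝ ∞ cutoff :=
  (Real.smoothTransition.contDiff.comp (contDiff_const.sub (contDiff_const.mul contDiff_id))).mul
    (Real.smoothTransition.contDiff.comp (contDiff_const.add (contDiff_const.mul contDiff_id)))

theorem cutoff_eq_zero {t : ℝ} (h : 1 ≤ |t|) : cutoff t = 0 := by
  rw [cutoff]
  rcases le_abs.1 h with h | h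
  · rw [Real.smoothTransition.zero_of_nonpos (by linarith), zero_mul]
  · rw [Real.smoothTransition.zero_of_nonpos (x := 2 + 2 * t) (by linarith), mul_zero]

theorem abs_cutoff_le (t : ℝ) : |cutoff t| ≤ 1 := by
  rw [cutoff, abs_mul, abs_of_nonneg (Real.smoothTransition.nonneg _),
    abs_of_nonneg (Real.smoothTransition.nonneg _)]
  exact mul_le_one₀ (Real.smoothTransition.le_one _) (Real.smoothTransition.nonneg _)
    (Real.smoothTransition.le_one _)

theorem deriv_cutoff_of_pos {t : ℝ} (h : 0 < t) : deriv cutoff t = -profile t := by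
  have e : cutoff =ᶠ[𝓝 t] fun t => Real.smoothTransition (2 - 2 * t) := by
    filter_upwards [lt_mem_nhds h] with u hu
    rw [cutoff, Real.smoothTransition.one_of_one_le (x := 2 + 2 * u) (by linarith), mul_one]
  rw [e.deriv_eq, (hasDerivAt_smoothTransition t).deriv]

theorem deriv_cutoff_eq_zero {t : ℝ} (h : 1 < |t|) : deriv cutoff t = 0 := by
  have e : cutoff =ᶠ[𝓝 t] fun _ => 0 := by
    filter_upwards [continuous_abs.continuousAt.eventually (lt_mem_nhds h)] with u hu
    exact cutoff_eq_zero (le_of_lt hu)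
  rw [e.deriv_eq, deriv_const]

theorem integrable_mul_continuous (hb : Bornology.IsBounded Ω) {f c : Euc d → ℝ}
    (hf : MemLp f 2 (volume.restrict Ω)) (hc : Continuous c) :
    Integrable (fun x => f x * c x) (volume.restrict Ω) := by
  have hcl : IsCompact (closure Ω) := hb.isCompact_closure
  have : IsFiniteMeasure (volume.restrict Ω) :=
    ⟨by rw [Measure.restrict_apply_univ]
        exact (measure_mono subset_closure).trans_lt hcl.measure_lt_top⟩
  obtain ⟨C, hC⟩ := hcl.exists_bound_of_continuousOn hc.continuousOn
  have hfi : IntegrableOn f Ω := hf.integrable one_le_two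
  refine (hfi.norm.const_mul C).mono' (hfi.1.mul hc.aestronglyMeasurable) ?_
  have : ∀ᵐ x ∂volume.restrict Ω, x ∈ closure Ω :=
    ae_mono (Measure.restrict_mono subset_closure le_rfl)
      (ae_restrict_mem isClosed_closure.measurableSet)
  filter_upwards [this] with x hx
  rw [norm_mul, mul_comm]
  exact mul_le_mul_of_nonneg_right (hC x hx) (norm_nonneg _)

/-- If `v × n = 0` on the flat boundary portion `height = 0`, then the layer means of the
tangential components of `v` tend to zero. -/
theorem tendsto_layerMean_inner (hΩo : IsOpen Ω) (hb : Bornology.IsBounded Ω)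
    (hv : MemHZeroCurl Ω v)
    (hn : ‖n‖ = 1) (hr : 0 < r) (hg : ContDiff ℝ ∞ g)
    (hsupp : ∀ x, g x ≠ 0 → ‖planeProj n x₀ x - x₀‖ ≤ r) (hgn : ∀ x, (inner ℝ (g x) n : ℝ) = 0)
    (hcyl : cylinder n x₀ r ⊆ Ω) {ε₁ : ℝ} (hε₁ : 0 < ε₁)
    (hloc : ∀ x ∈ Ω, ‖planeProj n x₀ x - x₀‖ ≤ r → |height n x₀ x| ≤ ε₁ → 0 < height n x₀ x) :
    Tendsto (fun ε => layerMean n x₀ ε fun x => inner ℝ (g x) (v x)) (𝓝[>] 0) (𝓝 0) := by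
  obtain ⟨hv2, w, hw2, -, hw⟩ := hv
  have hgi : ∀ i, ContDiff ℝ ∞ fun x => g x i := fun i => contDiff_euclidean.1 hg i
  have hvi : ∀ i, MemLp (fun x => v x i) 2 (volume.restrict Ω) := fun i =>
    hv2.of_le ((EuclideanSpace.proj (𝕜 := ℝ) i).continuous.comp_aestronglyMeasurable hv2.1)
      (Eventually.of_forall fun x => PiLp.norm_apply_le (v x) i)
  -- Green's formula is tested with `g_i n_j χ_ε` and summed over `i, j`. The function `H` collects
  -- the terms in which no derivative falls on the cutoff `χ_ε`.
  set H : Euc d → ℝ := fun x => ∑ i, ∑ j, n j * (w i j x * g x i -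
    v x i * partialDeriv j (fun y => g y i) x + v x j * partialDeriv i (fun y => g y i) x) with hH
  have hHint : Integrable H (volume.restrict Ω) := by
    refine integrable_finset_sum _ fun i _ => integrable_finset_sum _ fun j _ => ?_
    refine Integrable.const_mul ?_ _
    exact ((integrable_mul_continuous hb (hw2 i j) (hgi i).continuous).sub
      (integrable_mul_continuous hb (hvi i) (partialDeriv_contDiff j (hgi i)).continuous)).add
      (integrable_mul_continuous hb (hvi j) (partialDeriv_contDiff i (hgi i)).continuous)
  set χ : ℝ → Euc d → ℝ := fun ε x => cutoff (height n x₀ x / ε) with hχ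
  have hχc : ∀ ε, ContDiff ℝ ∞ (χ ε) := fun ε => contDiff_cutoff.comp (contDiff_height.div_const ε)
  -- the limit of the volume terms
  have hlim : Tendsto (fun ε => ∫ x in Ω, χ ε x * H x) (𝓝[>] 0) (𝓝 (∫ _ in Ω, (0 : ℝ))) := by
    refine tendsto_integral_filter_of_dominated_convergence (fun x => ‖H x‖) ?_ ?_ hHint.norm ?_
    · exact Eventually.of_forall fun ε => (hχc ε).continuous.aestronglyMeasurable.mul hHint.1
    · refine Eventually.of_forall fun ε => Eventually.of_forall fun x => ?_
      rw [norm_mul]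
      exact mul_le_of_le_one_left (norm_nonneg _) (abs_cutoff_le _)
    · filter_upwards [ae_restrict_mem hΩo.measurableSet] with x hx
      refine tendsto_const_nhds.congr' ?_
      by_cases hxr : ‖planeProj n x₀ x - x₀‖ ≤ r
      · have hne : height n x₀ x ≠ 0 := fun h => by
          have := hloc x hx hxr (by rw [h, abs_zero]; exact hε₁.le)
          exact this.ne' h
        filter_upwards [Ioo_mem_nhdsGT (abs_pos.2 hne)] with ε hε
        rw [hχ]
        simp only
        rw [cutoff_eq_zero, zero_mul]
        rw [abs_div, abs_of_pos hε.1, one_le_div hε.1]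
        exact hε.2.le
      · have hnhds : ∀ᶠ y in 𝓝 x, g y = 0 := by
          have : ∀ᶠ y in 𝓝 x, r < ‖planeProj n x₀ y - x₀‖ :=
            (continuous_planeProj.sub continuous_const).norm.continuousAt.eventually
              (lt_mem_nhds (not_le.1 hxr))
          filter_upwards [this] with y hy
          by_contra h
          exact absurd (hsupp y h) (not_le.2 hy)
        have hpd : ∀ i k, partialDeriv k (fun y => g y i) x = 0 := by
          intro i k
          have e : (fun y => g y i) =ᶠ[𝓝 x] fun _ => (0 : ℝ) := by
            filter_upwards [hnhds] with y hy
            rw [hy]; rfl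
          rw [partialDeriv, e.fderiv_eq]
          simp
        have hgx : g x = 0 := hnhds.self_of_nhds
        have : H x = 0 := by simp [hH, hpd, hgx]
        exact Eventually.of_forall fun ε => by simp [this]
  rw [integral_zero] at hlim
  refine hlim.congr' ?_
  filter_upwards [Ioo_mem_nhdsGT (lt_min hε₁ hr)] with ε hε
  have hε0 : 0 < ε := hε.1
  -- the test functions
  set φ : Fin d → Fin d → Euc d → ℝ := fun i j x => g x i * (n j * χ ε x) with hφ
  have hφc : ∀ i j, ContDiff ℝ ∞ (φ i j) := fun i j => (hgi i).mul (contDiff_const.mul (hχc ε))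
  -- The test functions do not vanish on the boundary of `Ω`, so their use depends on the zero
  -- tangential trace and not merely on the weak curl.
  have hφs : ∀ i j, HasCompactSupport (φ i j) := by
    intro i j
    refine HasCompactSupport.intro (isCompact_closedBall x₀ (r + ε)) fun x hx => ?_
    by_contra h
    have h1 : g x ≠ 0 := fun h1 => h (by simp [hφ, h1])
    have h2 : |height n x₀ x / ε| < 1 := by
      by_contra h2
      exact h (by simp [hφ, hχ, cutoff_eq_zero (not_lt.1 h2)])
    rw [abs_div, abs_of_pos hε0, div_lt_one hε0] at h2
    refine hx (mem_closedBall_iff_norm.2 ?_)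
    exact (norm_sub_le_of_planeProj hn x).trans (add_le_add (hsupp x h1) h2.le)
  have hpd : ∀ i j k x, partialDeriv k (φ i j) x = n j * (partialDeriv k (fun y => g y i) x * χ ε x -
      g x i * (deriv cutoff (height n x₀ x / ε) * (n k / ε))) := by
    intro i j k x
    have h1 : HasFDerivAt (fun y => g y i) (fderiv ℝ (fun y => g y i) x) x :=
      ((hgi i).differentiable (by simp) x).hasFDerivAt
    have h2 : HasDerivAt cutoff (deriv cutoff (height n x₀ x / ε)) (height n x₀ x / ε) :=
      (contDiff_cutoff.differentiable (by simp) _).hasDerivAt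
    have h3 : HasFDerivAt (fun y => height n x₀ y / ε) (ε⁻¹ • (-innerSL ℝ n)) x := by
      simpa [div_eq_inv_mul] using (hasFDerivAt_height (x₀ := x₀) (n := n) x).const_mul ε⁻¹
    have h4 := h2.comp_hasFDerivAt x h3
    have h5 := h1.mul (h4.const_mul (n j))
    have h6 : HasFDerivAt (φ i j) _ x := h5
    rw [partialDeriv, h6.fderiv, partialDeriv]
    simp only [ContinuousLinearMap.add_apply, ContinuousLinearMap.smul_apply,
      ContinuousLinearMap.neg_apply, innerSL_apply_apply, smul_eq_mul, hχ, Function.comp,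
      EuclideanSpace.inner_single_right]
    simp
    ring
  have hsum : ∫ x in Ω, ∑ i, ∑ j, (w i j x * φ i j x -
      (v x i * partialDeriv j (φ i j) x - v x j * partialDeriv i (φ i j) x)) = 0 := by
    have a1 : ∀ i j, Integrable (fun x => w i j x * φ i j x) (volume.restrict Ω) := fun i j =>
      integrable_mul_continuous hb (hw2 i j) (hφc i j).continuous
    have a2 : ∀ i j, Integrable (fun x => v x i * partialDeriv j (φ i j) x -
        v x j * partialDeriv i (φ i j) x) (volume.restrict Ω) := fun i j =>
      (integrable_mul_continuous hb (hvi i) (partialDeriv_contDiff j (hφc i j)).continuous).sub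
        (integrable_mul_continuous hb (hvi j) (partialDeriv_contDiff i (hφc i j)).continuous)
    have a3 : ∀ i j, Integrable (fun x => w i j x * φ i j x - (v x i * partialDeriv j (φ i j) x -
        v x j * partialDeriv i (φ i j) x)) (volume.restrict Ω) := fun i j => (a1 i j).sub (a2 i j)
    rw [integral_finset_sum _ fun i _ => integrable_finset_sum _ fun j _ => a3 i j]
    refine Finset.sum_eq_zero fun i _ => ?_
    rw [integral_finset_sum _ fun j _ => a3 i j]
    refine Finset.sum_eq_zero fun j _ => ?_
    rw [integral_sub (a1 i j) (a2 i j), hw i j (φ i j) (hφc i j) (hφs i j), sub_self]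
  have hn2 : ∑ j, n j * n j = 1 := by
    have := real_inner_self_eq_norm_sq n
    rw [hn, PiLp.inner_apply] at this
    simpa [sq] using this
  have hgn' : ∀ x, ∑ i, g x i * n i = 0 := by
    intro x
    have := hgn x
    rw [PiLp.inner_apply] at this
    simpa [mul_comm] using this
  -- The derivative of the cutoff produces `∑ g_i n_j (v_i n_j - v_j n_i)`, which equals `g · v`
  -- because `n` is a unit vector and `g` is orthogonal to it.
  have hpt : ∀ x, ∑ i, ∑ j, (w i j x * φ i j x -
      (v x i * partialDeriv j (φ i j) x - v x j * partialDeriv i (φ i j) x)) =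
      χ ε x * H x + ε⁻¹ * ((inner ℝ (g x) (v x) : ℝ) * deriv cutoff (height n x₀ x / ε)) := by
    intro x
    set D := deriv cutoff (height n x₀ x / ε) with hD
    have hin : (inner ℝ (g x) (v x) : ℝ) = ∑ i, g x i * v x i := by
      rw [PiLp.inner_apply]; simp [mul_comm]
    have e1 : ∑ i, ∑ j, (g x i * n j * (v x i * n j)) = ∑ i, g x i * v x i := by
      refine Finset.sum_congr rfl fun i _ => ?_
      calc _ = (g x i * v x i) * ∑ j, n j * n j := by
            rw [Finset.mul_sum]; exact Finset.sum_congr rfl fun j _ => by ring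
        _ = _ := by rw [hn2, mul_one]
    have e2 : ∑ i, ∑ j, (g x i * n j * (v x j * n i)) = 0 := by
      calc _ = (∑ i, g x i * n i) * ∑ j, n j * v x j := by
            rw [Finset.sum_mul_sum]
            exact Finset.sum_congr rfl fun i _ => Finset.sum_congr rfl fun j _ => by ring
        _ = 0 := by rw [hgn', zero_mul]
    have e3 : ε⁻¹ * ((inner ℝ (g x) (v x) : ℝ) * D) =
        ε⁻¹ * D * (∑ i, ∑ j, (g x i * n j * (v x i * n j)) -
          ∑ i, ∑ j, (g x i * n j * (v x j * n i))) := by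
      rw [e1, e2, hin]; ring
    rw [e3, hH, ← Finset.sum_sub_distrib, Finset.mul_sum, Finset.mul_sum, ← Finset.sum_add_distrib]
    refine Finset.sum_congr rfl fun i _ => ?_
    rw [← Finset.sum_sub_distrib, Finset.mul_sum, Finset.mul_sum, ← Finset.sum_add_distrib]
    refine Finset.sum_congr rfl fun j _ => ?_
    rw [hpd, hpd, hφ]
    simp only
    rw [← hD]
    ring
  simp only [hpt] at hsum
  have b1 : Integrable (fun x => χ ε x * H x) (volume.restrict Ω) :=
    hHint.bdd_mul (c := 1) (hχc ε).continuous.aestronglyMeasurable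
      (Eventually.of_forall fun x => abs_cutoff_le _)
  have hDc : Continuous fun x => deriv cutoff (height n x₀ x / ε) :=
    (contDiff_cutoff.continuous_deriv (by simp)).comp (continuous_height.div_const ε)
  have b2 : Integrable (fun x => ε⁻¹ * ((inner ℝ (g x) (v x) : ℝ) *
      deriv cutoff (height n x₀ x / ε))) (volume.restrict Ω) := by
    refine Integrable.const_mul ?_ _
    have : ∀ x, (inner ℝ (g x) (v x) : ℝ) * deriv cutoff (height n x₀ x / ε) =
        ∑ i, v x i * (g x i * deriv cutoff (height n x₀ x / ε)) := by
      intro x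
      rw [PiLp.inner_apply, Finset.sum_mul]
      exact Finset.sum_congr rfl fun i _ => by simp; ring
    simp only [this]
    exact integrable_finset_sum _ fun i _ =>
      integrable_mul_continuous hb (hvi i) ((hgi i).continuous.mul hDc)
  rw [integral_add b1 b2, integral_const_mul] at hsum
  -- For positive heights the derivative of the cutoff is minus the profile. Inside `Ω`, on the
  -- support of `g`, no other heights of modulus at most `ε` occur; outside `Ω` the product of `g`
  -- with the profile vanishes, as the cylinder lies in `Ω`.
  have hlayer : ∫ x, (inner ℝ (g x) (v x) : ℝ) * profile (height n x₀ x / ε) =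
      - ∫ x in Ω, (inner ℝ (g x) (v x) : ℝ) * deriv cutoff (height n x₀ x / ε) := by
    rw [← integral_neg, ← integral_indicator hΩo.measurableSet]
    congr 1
    ext x
    by_cases hgx : g x = 0
    · simp [Set.indicator, hgx]
    by_cases hx : x ∈ Ω
    · rw [Set.indicator_of_mem hx]
      by_cases hh : |height n x₀ x| ≤ ε
      · rw [deriv_cutoff_of_pos (div_pos (hloc x hx (hsupp x hgx)
          (hh.trans (hε.2.le.trans (min_le_left _ _)))) hε0)]
        ring
      · have hh' : 1 < |height n x₀ x / ε| := by
          rw [abs_div, abs_of_pos hε0, one_lt_div hε0]; exact not_le.1 hh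
        rw [deriv_cutoff_eq_zero hh', profile_eq_zero]
        · ring
        · rcases lt_abs.1 hh' with h | h
          · exact Or.inr h
          · exact Or.inl (by linarith)
    · rw [Set.indicator_of_notMem hx]
      by_cases hp : profile (height n x₀ x / ε) = 0
      · rw [hp, mul_zero]
      · have h := mem_Icc_of_profile_ne_zero hp
        rw [Set.mem_Icc, le_div_iff₀ hε0, div_le_iff₀ hε0] at h
        refine absurd (hcyl (slab_subset_cylinder hr (hε.2.le.trans (min_le_right _ _))
          ⟨hsupp x hgx, ?_, ?_⟩)) hx
        · linarith [h.1]
        · linarith [h.2]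
  rw [layerMean, hlayer]
  linarith

end

end

/-! ### Tangential part of a polynomial field on a flat boundary portion -/

section

open Metric Filter Topology

section

variable {Ω : Set (Euc d)} {n x₀ x : Euc d} {v q : Euc d → Euc d} {r : ℝ} {p : ℕ}

theorem IsPolyField.comp_planeProj (hq : IsPolyField p q) (n x₀ : Euc d) :
    IsPolyField p fun x => q (planeProj n x₀ x) := by
  obtain ⟨P, hP, rfl⟩ := isPolyField_iff.1 hq
  set l : MvPolynomial (Fin d) ℝ := MvPolynomial.C (inner ℝ n x₀ : ℝ) -
    ∑ k, MvPolynomial.C (n k) * MvPolynomial.X k with hl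
  have hmul : ∀ (c : ℝ) (Q : MvPolynomial (Fin d) ℝ), Q.totalDegree ≤ 1 →
      (MvPolynomial.C c * Q).totalDegree ≤ 1 := fun c Q h =>
    (MvPolynomial.totalDegree_mul _ _).trans (by simpa using h)
  have hld : l.totalDegree ≤ 1 := by
    refine (MvPolynomial.totalDegree_sub _ _).trans (max_le (by simp) ?_)
    exact MvPolynomial.totalDegree_finsetSum_le fun k _ => hmul _ _ (by simp)
  set L : Fin d → MvPolynomial (Fin d) ℝ := fun i => MvPolynomial.X i + MvPolynomial.C (n i) * l
  have hL : ∀ i, (L i).totalDegree ≤ 1 := fun i =>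
    (MvPolynomial.totalDegree_add _ _).trans (max_le (by simp) (hmul _ _ hld))
  refine isPolyField_iff.2 ⟨fun j => MvPolynomial.bind₁ L (P j),
    fun j => totalDegree_bind₁_le (hP j) hL, ?_⟩
  ext x j
  rw [pfield_apply, pfield_apply, pev_bind₁]
  congr 1
  ext i
  simp only [L, hl, pev, planeProj, height, inner_sub_right, PiLp.add_apply, PiLp.smul_apply,
    smul_eq_mul, map_add, map_mul, map_sub, map_sum, MvPolynomial.eval_X, MvPolynomial.eval_C]
  rw [PiLp.inner_apply n x]
  simp only [RCLike.inner_apply, conj_trivial, mul_comm]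

theorem IsPolyField.tangential (hq : IsPolyField p q) (n : Euc d) :
    IsPolyField p fun x => q x - (inner ℝ (q x) n : ℝ) • n := by
  obtain ⟨P, hP⟩ := hq
  refine ⟨fun j => P j - MvPolynomial.C (n j) * ∑ k, MvPolynomial.C (n k) * P k,
    fun j => ⟨?_, fun x => ?_⟩⟩
  · refine (MvPolynomial.totalDegree_sub _ _).trans (max_le (hP j).1 ?_)
    refine (MvPolynomial.totalDegree_mul _ _).trans ?_
    rw [MvPolynomial.totalDegree_C, zero_add]
    refine MvPolynomial.totalDegree_finsetSum_le fun k _ => ?_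
    refine (MvPolynomial.totalDegree_mul _ _).trans ?_
    rw [MvPolynomial.totalDegree_C, zero_add]
    exact (hP k).1
  · simp only [PiLp.sub_apply, PiLp.smul_apply, smul_eq_mul, map_sub, map_mul, map_sum,
      MvPolynomial.eval_C, ← (hP _).2]
    rw [PiLp.inner_apply, mul_comm]
    simp only [RCLike.inner_apply, conj_trivial]

theorem IsPolyField.contDiff (hq : IsPolyField p q) : ContDiff ℝ ∞ q := by
  obtain ⟨P, -, rfl⟩ := isPolyField_iff.1 hq
  exact contDiff_pfield P

theorem IsPolyField.norm_le_ball (d p : ℕ) {κ : ℝ} : ∃ C : ℝ, 0 < C ∧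
    ∀ q : Euc d → Euc d, IsPolyField p q → ∀ (y : Euc d) (ρ : ℝ), 0 < ρ → ∀ x : Euc d,
      ‖x - y‖ ≤ κ * ρ → ‖q x‖ ≤ C * (ρ ^ (-(d : ℝ) / 2) * (slob 0 (ball y ρ) q).toReal) := by
  obtain ⟨C, hC⟩ := pfield_bound (d := d) p κ
  refine ⟨C + 1, by positivity, fun q hq y ρ hρ x hx => ?_⟩
  have hfin : slob 0 (ball y ρ) q ≠ ⊤ := by
    rw [slob_zero_eq_eLpNorm]; exact (hq.memLp isBounded_ball).2.ne
  obtain ⟨P, hP, rfl⟩ := isPolyField_iff.1 hq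
  have h := (hC P hP y ρ hρ x hx).1
  rw [← ENNReal.ofReal_toReal hfin, ← ENNReal.ofReal_mul (by positivity), ← ENNReal.ofReal_coe_nnreal,
    ← ENNReal.ofReal_mul (by positivity), ← ofReal_norm,
    ENNReal.ofReal_le_ofReal_iff (by positivity)] at h
  refine h.trans (mul_le_mul_of_nonneg_right (by linarith) (by positivity))

theorem squeeze_planeProj_sub (hn : ‖n‖ = 1) (x : Euc d) (c : ℝ) :
    squeeze n x₀ (planeProj n x₀ x - c • n) = planeProj n x₀ x - (c / 2) • n := by
  have h : height n x₀ (planeProj n x₀ x - c • n) = c := by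
    rw [sub_eq_add_neg, ← neg_smul, height_add_smul hn, height_planeProj hn]; ring
  rw [squeeze, h, sub_add, ← sub_smul]
  congr 2
  ring

/-- The `k`-fold squeezing map in closed form: it keeps the foot point in the hyperplane and divides
the height by `2^k`. -/
theorem layerMean_div_two_pow (hn : ‖n‖ = 1) (r : ℝ) (k : ℕ) (f : Euc d → ℝ) :
    layerMean n x₀ (r / 2 ^ k) f =
      layerMean n x₀ r fun x => f (planeProj n x₀ x - (height n x₀ x / 2 ^ k) • n) := by
  induction k generalizing f with
  | zero => simp [planeProj]
  | succ k ih =>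
    rw [pow_succ, ← div_div, layerMean_half hn, ih]
    congr 1
    ext x
    rw [squeeze_planeProj_sub hn, div_div]

/-- For continuous fields the layer means converge to the layer mean of the boundary values. -/
theorem tendsto_layerMean_of_continuous (hn : ‖n‖ = 1) (hr : 0 < r) {f : Euc d → ℝ}
    (hf : Continuous f) (hs : ∀ x, f x ≠ 0 → ‖planeProj n x₀ x - x₀‖ ≤ r) :
    Tendsto (fun k : ℕ => layerMean n x₀ (r / 2 ^ k) f) atTop
      (𝓝 (layerMean n x₀ r fun x => f (planeProj n x₀ x))) := by
  simp only [layerMean_div_two_pow hn]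
  refine Tendsto.const_mul _ ?_
  obtain ⟨C, hC, hCp⟩ := exists_profile_le
  obtain ⟨B, hB⟩ := (isCompact_closedBall x₀ (2 * r)).exists_bound_of_continuousOn hf.continuousOn
  have hfin : volume (slab n x₀ r r) ≠ ⊤ :=
    ((measure_mono ((slab_subset_cylinder hr le_rfl).trans (cylinder_subset_ball hn r))).trans_lt
      measure_ball_lt_top).ne
  refine tendsto_integral_of_dominated_convergence
    ((slab n x₀ r r).indicator fun _ => B * C) (fun k => ?_) ?_ (fun k => ?_) ?_
  · refine Continuous.aestronglyMeasurable ?_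
    refine Continuous.mul (hf.comp (continuous_planeProj.sub
      ((continuous_height.div_const _).smul continuous_const)))
      (continuous_profile.comp (continuous_height.div_const r))
  · exact (integrable_indicator_iff (measurableSet_slab r r)).2
      (integrableOn_const (C := B * C) hfin enorm_ne_top)
  · refine Eventually.of_forall fun x => ?_
    set y := planeProj n x₀ x - (height n x₀ x / 2 ^ k) • n with hy
    have hpy : planeProj n x₀ y = planeProj n x₀ x := by
      rw [hy, sub_eq_add_neg, ← neg_smul, planeProj_add_smul hn,
        planeProj_of_height_eq_zero (height_planeProj hn x)]
    by_cases h0 : f y * profile (height n x₀ x / r) = 0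
    · rw [h0, norm_zero]
      refine Set.indicator_nonneg (fun z hz => ?_) x
      exact mul_nonneg ((norm_nonneg _).trans (hB x₀ (mem_closedBall_self (by positivity)))) hC.le
    · have h1 := hs y (left_ne_zero_of_mul h0)
      rw [hpy] at h1
      have h2 := mem_Icc_of_profile_ne_zero (right_ne_zero_of_mul h0)
      rw [Set.mem_Icc, le_div_iff₀ hr, div_le_iff₀ hr] at h2
      have hx : x ∈ slab n x₀ r r := ⟨h1, by linarith [h2.1], by linarith [h2.2]⟩
      have hyB : y ∈ closedBall x₀ (2 * r) := by
        rw [mem_closedBall_iff_norm]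
        have h3 := norm_sub_le_of_planeProj (x₀ := x₀) hn y
        have h4 : height n x₀ y = height n x₀ x / 2 ^ k := by
          rw [hy, sub_eq_add_neg, ← neg_smul, height_add_smul hn, height_planeProj hn]; ring
        have h5 : height n x₀ x / 2 ^ k ≤ height n x₀ x :=
          div_le_self hx.2.1.le (one_le_pow₀ one_le_two)
        rw [h4, abs_of_nonneg (div_nonneg hx.2.1.le (by positivity)), hpy] at h3
        linarith [hx.2.2]
      rw [Set.indicator_of_mem hx, norm_mul]
      refine mul_le_mul (hB y hyB) ?_ (norm_nonneg _) ((norm_nonneg _).trans (hB y hyB))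
      rw [Real.norm_eq_abs, abs_of_nonneg (profile_nonneg _)]
      exact hCp _
  · refine Eventually.of_forall fun x => ?_
    refine Tendsto.mul_const _ ?_
    have h1 : Tendsto (fun k : ℕ => planeProj n x₀ x - (height n x₀ x / 2 ^ k) • n) atTop
        (𝓝 (planeProj n x₀ x - (0 : ℝ) • n)) := by
      refine tendsto_const_nhds.sub (Tendsto.smul_const ?_ n)
      exact tendsto_const_nhds.div_atTop (tendsto_pow_atTop_atTop_of_one_lt one_lt_two)
    rw [zero_smul, sub_zero] at h1
    exact (hf.tendsto _).comp h1

/-- The tangential part of a polynomial field `q` on a flat boundary portion is controlled by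
`q - v` near it, for every field `v` with vanishing tangential trace. -/
theorem exists_norm_tangential_le (d p : ℕ) {θ κ : ℝ} (h1 : 1 / 2 < θ) (hκ : 0 ≤ κ) :
    ∃ C : ℝ, 0 < C ∧ ∀ (Ω : Set (Euc d)) (v q : Euc d → Euc d) (n x₀ a : Euc d) (r ε₁ : ℝ),
      IsOpen Ω → Bornology.IsBounded Ω → MemHZeroCurl Ω v → Measurable v → IsPolyField p q →
      ‖n‖ = 1 → 0 < r → cylinder n x₀ r ⊆ Ω → 0 < ε₁ →
      (∀ x ∈ Ω, ‖planeProj n x₀ x - x₀‖ ≤ r → |height n x₀ x| ≤ ε₁ → 0 < height n x₀ x) →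
      slob θ (cylinder n x₀ r) (fun x => q x - v x) ≠ ⊤ →
      height n x₀ a = 0 → ‖a - x₀‖ ≤ κ * r →
      ‖q a - (inner ℝ (q a) n : ℝ) • n‖ ≤ C * (r ^ (-(d : ℝ) / 2) *
        ((slob 0 (cylinder n x₀ r) fun x => q x - v x).toReal +
          r ^ θ * (slob θ (cylinder n x₀ r) fun x => q x - v x).toReal)) := by
  obtain ⟨t, c, δ, ht0, ht1, hc, hδ, hδ2, hprof⟩ := exists_le_profile
  obtain ⟨C₁, hC₁, hmean⟩ := exists_abs_layerMean_le (θ := θ) d h1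
  obtain ⟨C₂, hC₂, hpoly⟩ := IsPolyField.norm_le_ball d p (κ := (κ + 2) / δ)
  refine ⟨C₂ * (δ ^ (-(d : ℝ) / 2)) * (C₁ * C₂ * δ ^ (-(d : ℝ) / 2) / c), by positivity, ?_⟩
  intro Ω v q n x₀ a r ε₁ hΩo hb hv hvm hq hn hr hcyl hε₁ hloc hfin ha hax
  set F : Euc d → Euc d := fun x => q x - v x with hF
  set Q := (slob 0 (cylinder n x₀ r) F).toReal + r ^ θ * (slob θ (cylinder n x₀ r) F).toReal with hQ
  -- The tangential part of the boundary values of `q`, extended constantly along `n`. It is again a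
  -- polynomial field of degree at most `p`, so norms over different sets are comparable.
  set u : Euc d → Euc d := fun x =>
    q (planeProj n x₀ x) - (inner ℝ (q (planeProj n x₀ x)) n : ℝ) • n with hu
  have hup : IsPolyField p u := (hq.comp_planeProj n x₀).tangential n
  have hun : ∀ x, (inner ℝ (u x) n : ℝ) = 0 := fun x => by
    rw [hu]
    simp only [inner_sub_left, inner_smul_left, real_inner_self_eq_norm_sq, hn]
    simp
  have hproj2 : ∀ x, planeProj n x₀ (planeProj n x₀ x) = planeProj n x₀ x := fun x =>
    planeProj_of_height_eq_zero (height_planeProj hn x)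
  -- On the ball of radius `δ r` around `y` the profile is at least `c` and the bump `β` equals `1`.
  -- All points within `(κ + 1) r` of `x₀` are within `(κ + 2) r` of `y`, which explains the ratio
  -- `(κ + 2) / δ`.
  set y : Euc d := x₀ + (-(t * r)) • n with hy
  have hyx : ‖x₀ - y‖ = t * r := by
    rw [hy, sub_add_cancel_left, norm_neg, norm_smul, hn, mul_one, norm_neg, Real.norm_eq_abs,
      abs_of_nonneg (by positivity)]
  set N := (slob 0 (ball y (δ * r)) u).toReal with hN
  have hN0 : 0 ≤ N := ENNReal.toReal_nonneg
  have hub : ∀ x, ‖x - x₀‖ ≤ (κ + 1) * r → ‖u x‖ ≤ C₂ * ((δ * r) ^ (-(d : ℝ) / 2) * N) := by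
    intro x hx
    refine hpoly u hup y (δ * r) (by positivity) x ?_
    have := norm_sub_le_norm_sub_add_norm_sub x x₀ y
    have e : (κ + 2) / δ * (δ * r) = (κ + 2) * r := by field_simp
    rw [e]
    nlinarith
  -- the test field
  let β : ContDiffBump x₀ := ⟨r / 2, r, by positivity, by linarith⟩
  have hβc : Continuous β := β.continuous
  set g : Euc d → Euc d := fun x => β (planeProj n x₀ x) • u x with hg
  have hgc : ContDiff ℝ ∞ g := (β.contDiff.comp contDiff_planeProj).smul hup.contDiff
  have hβs : ∀ x, β (planeProj n x₀ x) ≠ 0 → ‖planeProj n x₀ x - x₀‖ ≤ r := by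
    intro x hx
    by_contra h
    exact hx (β.zero_of_le_dist (by rw [dist_eq_norm]; exact (not_le.1 h).le))
  have hgs : ∀ x, g x ≠ 0 → ‖planeProj n x₀ x - x₀‖ ≤ r := fun x hx =>
    hβs x fun h => hx (by rw [hg]; simp only [h, zero_smul])
  have hgn : ∀ x, (inner ℝ (g x) n : ℝ) = 0 := fun x => by
    rw [hg]; simp only [inner_smul_left, hun, mul_zero]
  set M := C₂ * ((δ * r) ^ (-(d : ℝ) / 2) * N) with hM
  have hM0 : 0 ≤ M := by positivity
  have hupr : ∀ x, u (planeProj n x₀ x) = u x := fun x => by rw [hu]; simp only [hproj2]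
  have hgl : LayerField n x₀ r M g := by
    refine ⟨hgc.continuous, fun x => ?_, fun x => ?_, hgs⟩
    · by_cases h : β (planeProj n x₀ x) = 0
      · rw [hg]; simpa [h] using hM0
      · rw [hg]
        simp only [norm_smul, Real.norm_eq_abs, abs_of_nonneg β.nonneg]
        refine (mul_le_of_le_one_left (norm_nonneg _) β.le_one).trans ?_
        rw [← hupr x]
        refine hub _ ((hβs x h).trans ?_)
        nlinarith
    · rw [hg]; simp only [hproj2, hupr]
  -- the layer means of the polynomial field and of `v`
  have hlimq := tendsto_layerMean_of_continuous (f := fun x => (inner ℝ (g x) (q x) : ℝ)) hn hr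
    (hgc.continuous.inner hq.continuous) fun x hx => hgs x fun h => hx (by rw [h, inner_zero_left])
  have hlimv : Tendsto (fun k : ℕ => layerMean n x₀ (r / 2 ^ k) fun x => inner ℝ (g x) (v x)) atTop
      (𝓝 0) := by
    refine (tendsto_layerMean_inner hΩo hb hv hn hr hgc hgs hgn hcyl hε₁ hloc).comp ?_
    refine tendsto_nhdsWithin_iff.2 ⟨?_, Eventually.of_forall fun k => Set.mem_Ioi.2 (by positivity)⟩
    exact tendsto_const_nhds.div_atTop (tendsto_pow_atTop_atTop_of_one_lt one_lt_two)
  have hcylb : Bornology.IsBounded (cylinder n x₀ r) := hb.subset hcyl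
  have hvcyl : MemLp v 2 (volume.restrict (cylinder n x₀ r)) :=
    hv.1.mono_measure (Measure.restrict_mono hcyl le_rfl)
  have hF2 : MemLp F 2 (volume.restrict (cylinder n x₀ r)) := (hq.memLp hcylb).sub hvcyl
  have hFm : Measurable F := hq.continuous.measurable.sub hvm
  have hfinm : IsFiniteMeasure (volume.restrict (cylinder n x₀ r)) :=
    ⟨by rw [Measure.restrict_apply_univ]; exact hcylb.measure_lt_top⟩
  set A := layerMean n x₀ r fun x => (inner ℝ (g (planeProj n x₀ x)) (q (planeProj n x₀ x)) : ℝ)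
    with hA
  -- The means of `v` tend to zero and those of `q` to `A`, so the uniform bound for the means of `q
  -- - v` passes to `A`.
  have hAle : A ≤ C₁ * M * r ^ ((d : ℝ) / 2 - 1) * Q := by
    have hlim := (hlimq.sub hlimv).abs
    rw [sub_zero] at hlim
    refine (le_abs_self _).trans (le_of_tendsto hlim (Eventually.of_forall fun k => ?_))
    have hε : 0 < r / 2 ^ k := by positivity
    have hεr : r / 2 ^ k ≤ r := div_le_self hr.le (one_le_pow₀ one_le_two)
    have e : layerMean n x₀ (r / 2 ^ k) (fun x => inner ℝ (g x) (q x)) -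
        layerMean n x₀ (r / 2 ^ k) (fun x => inner ℝ (g x) (v x)) =
        layerMean n x₀ (r / 2 ^ k) fun x => inner ℝ (g x) (F x) := by
      rw [layerMean, layerMean, layerMean, ← mul_sub, ← integral_sub
        (hgl.integrable hr hε hεr ((hq.memLp hcylb).integrable one_le_two))
        (hgl.integrable hr hε hεr (hvcyl.integrable one_le_two))]
      congr 2
      ext x
      rw [hF, inner_sub_right, sub_mul]
    rw [e]
    exact hmean n x₀ r M F g hn hr hgl hFm hF2 hfin k
  -- Coercivity: tested with its own tangential part, the limit mean of `q` is the integral of `β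
  -- |u|²` against a nonnegative profile, hence at least its part over the ball around `y`.
  have hAge : c * r⁻¹ * N ^ 2 ≤ A := by
    have hpt : ∀ x, (inner ℝ (g (planeProj n x₀ x)) (q (planeProj n x₀ x)) : ℝ) =
        inner ℝ (g x) (u x) := by
      intro x
      rw [hgl.comp_planeProj]
      have : q (planeProj n x₀ x) = u x + (inner ℝ (q (planeProj n x₀ x)) n : ℝ) • n := by
        rw [hu]; simp
      rw [this, inner_add_right, inner_smul_right, hgn, mul_zero, add_zero]
    have hpt' : ∀ x, (inner ℝ (g x) (u x) : ℝ) = β (planeProj n x₀ x) * ‖u x‖ ^ 2 := fun x => by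
      rw [hg]; simp only [inner_smul_left, real_inner_self_eq_norm_sq]; rfl
    have hint := hgl.integrable hr hr le_rfl (F := u) ((hup.memLp hcylb).integrable one_le_two)
    have hu2 : IntegrableOn (fun x => ‖u x‖ ^ 2) (ball y (δ * r)) :=
      ((hup.continuous.norm.pow 2).continuousOn.integrableOn_compact
        (isCompact_closedBall y (δ * r))).mono_set ball_subset_closedBall
    have hN2 : N ^ 2 = ∫ x in ball y (δ * r), ‖u x‖ ^ 2 := by
      rw [hN, ← ENNReal.toReal_pow, slob_sq, slobodeckijSq, if_pos rfl,
        integral_eq_lintegral_of_nonneg_ae (Eventually.of_forall fun x => by positivity) hu2.1]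
      congr 2
      ext x
      rw [← ofReal_norm, ENNReal.ofReal_pow (norm_nonneg _)]
    have hnn : ∀ x, 0 ≤ (inner ℝ (g x) (u x) : ℝ) * profile (height n x₀ x / r) := fun x => by
      rw [hpt']; exact mul_nonneg (mul_nonneg β.nonneg (by positivity)) (profile_nonneg _)
    rw [hA]
    simp only [hpt]
    rw [layerMean, mul_comm c, mul_assoc]
    refine mul_le_mul_of_nonneg_left ?_ (by positivity)
    calc c * N ^ 2 = ∫ x in ball y (δ * r), c * ‖u x‖ ^ 2 := by rw [integral_const_mul, hN2]
      _ ≤ ∫ x in ball y (δ * r), (inner ℝ (g x) (u x) : ℝ) * profile (height n x₀ x / r) := by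
          refine setIntegral_mono_on (hu2.const_mul c) hint.integrableOn measurableSet_ball
            fun x hx => ?_
          have hxy := (mem_ball_iff_norm.1 hx).le
          have hpy : planeProj n x₀ y = x₀ := by
            rw [hy, planeProj_add_smul hn, planeProj_of_height_eq_zero height_self]
          have hhy : height n x₀ y = t * r := by
            rw [hy, height_add_smul hn, height_self]; ring
          have h1 := norm_planeProj_sub_le (x₀ := x₀) hn x y
          have h2 := abs_height_sub_le (x₀ := x₀) hn x y
          rw [hpy] at h1
          rw [hhy] at h2
          have hβ1 : β (planeProj n x₀ x) = 1 := by
            refine β.one_of_mem_closedBall (mem_closedBall_iff_norm.2 ?_)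
            show _ ≤ r / 2
            nlinarith
          have hp1 : c ≤ profile (height n x₀ x / r) := by
            refine hprof _ ?_
            have : height n x₀ x / r - t = (height n x₀ x - t * r) / r := by field_simp
            rw [this, abs_div, abs_of_pos hr, div_le_iff₀ hr]
            exact h2.trans hxy
          rw [hpt', hβ1, one_mul, mul_comm]
          exact mul_le_mul_of_nonneg_left hp1 (by positivity)
      _ ≤ _ := setIntegral_le_integral hint (Eventually.of_forall hnn)
  -- conclusion
  have hua : ‖q a - (inner ℝ (q a) n : ℝ) • n‖ ≤ M := by
    have : q a - (inner ℝ (q a) n : ℝ) • n = u a := by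
      rw [hu]; simp only [planeProj_of_height_eq_zero ha]
    rw [this]
    exact hub a (hax.trans (by nlinarith))
  have hQ0 : 0 ≤ Q := by positivity
  -- The lower bound for `A` is quadratic in `N`, while the upper one is linear because the size `M`
  -- of the test field is proportional to `N`. Division by `N` leaves the estimate.
  have hNQ : N ≤ C₁ * C₂ * δ ^ (-(d : ℝ) / 2) / c * Q := by
    rcases hN0.eq_or_lt with h0 | hpos
    · rw [← h0]; positivity
    · have h2 := hAge.trans hAle
      rw [hM, Real.mul_rpow hδ.le hr.le, Real.rpow_sub_one hr.ne'] at h2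
      have e : r ^ (-(d : ℝ) / 2) * r ^ ((d : ℝ) / 2) = 1 := by
        rw [← Real.rpow_add hr, neg_div, neg_add_cancel, Real.rpow_zero]
      have h3 : c * r⁻¹ * N ^ 2 ≤ (r⁻¹ * N) * (C₁ * C₂ * δ ^ (-(d : ℝ) / 2) * Q) := by
        refine h2.trans (le_of_eq ?_)
        calc _ = (r ^ (-(d : ℝ) / 2) * r ^ ((d : ℝ) / 2)) * ((r⁻¹ * N) *
              (C₁ * C₂ * δ ^ (-(d : ℝ) / 2) * Q)) := by ring
          _ = _ := by rw [e, one_mul]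
      have h4 : (r⁻¹ * N) * (c * N) ≤ (r⁻¹ * N) * (C₁ * C₂ * δ ^ (-(d : ℝ) / 2) * Q) := by
        refine le_trans (le_of_eq ?_) h3; ring
      have h5 := le_of_mul_le_mul_left h4 (by positivity)
      rw [div_mul_eq_mul_div, le_div_iff₀ hc, mul_comm]
      exact h5
  refine hua.trans ?_
  rw [hM, Real.mul_rpow hδ.le hr.le]
  calc _ ≤ C₂ * (δ ^ (-(d : ℝ) / 2) * r ^ (-(d : ℝ) / 2) *
        (C₁ * C₂ * δ ^ (-(d : ℝ) / 2) / c * Q)) := by gcongr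
    _ = _ := by ring

end

end

/-! ### Tangential estimate on boundary faces of a mesh -/

section

open Metric Filter Topology

theorem MemHZeroCurl.congr {Ω : Set (Euc d)} {v v' : Euc d → Euc d} (hv : MemHZeroCurl Ω v)
    (h : v =ᵐ[volume.restrict Ω] v') : MemHZeroCurl Ω v' := by
  obtain ⟨hv2, w, hw2, hw, hw0⟩ := hv
  have key : ∀ (i j : Fin d) (φ : Euc d → ℝ),
      ∫ x in Ω, (v x i * partialDeriv j φ x - v x j * partialDeriv i φ x) =
      ∫ x in Ω, (v' x i * partialDeriv j φ x - v' x j * partialDeriv i φ x) := fun i j φ =>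
    integral_congr_ae (by filter_upwards [h] with x hx; rw [hx])
  exact ⟨hv2.ae_eq h, w, hw2, fun i j φ h1 h2 h3 => (hw i j φ h1 h2 h3).trans (key i j φ),
    fun i j φ h1 h2 => (hw0 i j φ h1 h2).trans (key i j φ)⟩

namespace Mesh

variable {Ω : Set (Euc d)} {T : Mesh Ω} {K f : Finset (Euc d)} {n x : Euc d} {p : ℕ} {σ ρ r : ℝ}

theorem interior_hull_subset (hΩ : IsLipschitzDomain Ω) (hK : K ∈ T.elements) :
    interior (hull K) ⊆ Ω :=
  (interior_mono (hull_subset_closure hK)).trans hΩ.interior_closure.subset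

/-- The coordinates of the face equal `1/d` at its centre, and their slopes are at most `1 / (2ρ)`.
-/
theorem bary_pos_of_near_center (hd : 1 ≤ d) (hK : K ∈ T.elements) (hfK : f ⊆ K)
    (hcard : f.card = d) {z : Euc d} (hρ : 0 < ρ) (hB : ball z ρ ⊆ hull K)
    (hx : ‖x - center f‖ < 2 * ρ / d) {a : Euc d} (ha : a ∈ f) : 0 < T.bary K a x := by
  have hd0 : (0 : ℝ) < d := by exact_mod_cast hd
  have h1 := bary_linear_le hK (hfK ha) hρ hB (x - center f)
  have h2 := affineMap_add (T.bary K a) (center f) (x - center f)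
  rw [add_sub_cancel, (center_spec hd hK hfK hcard).2 a ha] at h2
  have h3 : ‖x - center f‖ / (2 * ρ) < (d : ℝ)⁻¹ := by
    rw [div_lt_iff₀ (by positivity)]
    refine hx.trans_eq ?_
    field_simp
  rw [h2]
  linarith [(abs_le.1 h1).1]

theorem cylinder_subset_interior (hd : 1 ≤ d) (hK : K ∈ T.elements) (hfK : f ⊆ K)
    (hcard : f.card = d) (hn : T.IsOutwardNormal f n) {z : Euc d} (hρ : 0 < ρ)
    (hB : ball z ρ ⊆ hull K) :
    cylinder n (center f) (ρ / (2 * d)) ⊆ interior (hull K) := by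
  have hd0 : (0 : ℝ) < d := by exact_mod_cast hd
  obtain ⟨b, hbK, hbf, hKb⟩ := exists_opposite hK hfK hcard
  have hin := inner_normal_eq hK hfK hcard hn (center_spec hd hK hfK hcard).1 hbK hbf
  intro x hx
  rw [mem_interior_hull hK]
  intro a ha
  have hx4 := mem_ball_iff_norm.1 (cylinder_subset_ball hn.1 _ hx)
  rcases hKb a ha with rfl | haf
  · have h1 := hin.2 x
    have h2 : 0 < T.bary K a x * (inner ℝ n (center f - a) : ℝ) := by
      rw [← h1]; exact hx.2.1
    exact pos_of_mul_pos_left h2 hin.1.le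
  · refine bary_pos_of_near_center hd hK hfK hcard hρ hB (hx4.trans_eq ?_) haf
    field_simp
    ring

/-- Near the centre of a boundary face the domain lies on one side of the face. -/
theorem exists_height_pos (hΩ : IsLipschitzDomain Ω) (hd : 1 ≤ d) (hK : K ∈ T.elements)
    (hf : f ∈ T.boundaryFaces) (hfK : f ⊆ K)
    (hn : T.IsOutwardNormal f n) {z : Euc d} (hρ : 0 < ρ) (hB : ball z ρ ⊆ hull K) :
    ∃ ε : ℝ, 0 < ε ∧ ∀ x ∈ Ω, ‖planeProj n (center f) x - center f‖ ≤ ρ / (2 * d) →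
      |height n (center f) x| ≤ ε → 0 < height n (center f) x := by
  classical
  have hd0 : (0 : ℝ) < d := by exact_mod_cast hd
  have hcard := hf.2.1
  set r := ρ / (2 * d) with hr
  have hr0 : 0 < r := by positivity
  obtain ⟨b, hbK, hbf, hKb⟩ := exists_opposite hK hfK hcard
  have hin := inner_normal_eq hK hfK hcard hn (center_spec hd hK hfK hcard).1 hbK hbf
  -- A compact disc in the relative interior of the face. Only `K` among all elements touches it, so
  -- a neighbourhood of the disc meets `Ω` only inside `K`, that is, on one side of the face.
  set C : Set (Euc d) := closedBall (center f) r ∩ {x | height n (center f) x = 0} with hC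
  have hCc : IsCompact C := (isCompact_closedBall _ _).inter_right
    (isClosed_eq continuous_height continuous_const)
  have hCpos : ∀ z ∈ C, ∀ a ∈ f, 0 < T.bary K a z := fun z hz a ha => by
    refine bary_pos_of_near_center hd hK hfK hcard hρ hB
      ((mem_closedBall_iff_norm.1 hz.1).trans_lt ?_) ha
    rw [hr, div_lt_div_iff₀ (by positivity) hd0]
    nlinarith [mul_pos hρ hd0]
  have hCb : ∀ z ∈ C, T.bary K b z = 0 := fun z hz => by
    have h1 := hin.2 z
    have h2 : height n (center f) z = 0 := hz.2
    rw [height, h1] at h2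
    exact (mul_eq_zero.1 h2).resolve_right hin.1.ne'
  have hCf : C ⊆ hull f := fun z hz => by
    rw [mem_hull_subset hK hfK, mem_hull hK]
    refine ⟨fun a ha => ?_, fun a ha haf => ?_⟩
    · rcases hKb a ha with rfl | haf
      · exact (hCb z hz).ge
      · exact (hCpos z hz a haf).le
    · rw [(hKb a ha).resolve_right haf]; exact hCb z hz
  set S := T.elements.erase K with hS
  have hcl : IsClosed (⋃ L ∈ S, hull L) :=
    S.finite_toSet.isClosed_biUnion fun L _ => (isCompact_hull L).isClosed
  have hCO : C ⊆ (⋃ L ∈ S, hull L)ᶜ := by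
    intro z hz hzS
    obtain ⟨L, hL, hzL⟩ := Set.mem_iUnion₂.1 hzS
    rw [hS, Finset.mem_erase] at hL
    exact hL.1 (eq_of_mem_boundaryFace hΩ hf hK hfK (hCf hz) (hCpos z hz) hL.2 hzL)
  obtain ⟨ε, hε, hsub⟩ := hCc.exists_cthickening_subset_open hcl.isOpen_compl hCO
  refine ⟨ε, hε, fun x hx hxr hxε => ?_⟩
  have hpC : planeProj n (center f) x ∈ C :=
    ⟨mem_closedBall_iff_norm.2 hxr, height_planeProj hn.1 x⟩
  have hxO : x ∉ ⋃ L ∈ S, hull L := hsub (mem_cthickening_of_dist_le x _ ε C hpC (by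
    rwa [dist_eq_norm, norm_sub_planeProj hn.1]))
  obtain ⟨L, hL, hxL⟩ := exists_mem_hull (T := T) (subset_closure hx)
  have hLK : L = K := by
    by_contra hne
    exact hxO (Set.mem_biUnion (show L ∈ S from Finset.mem_erase.2 ⟨hne, hL⟩) hxL)
  rw [hLK] at hxL
  have h0 : 0 ≤ height n (center f) x := by
    rw [height, hin.2 x]
    exact mul_nonneg ((mem_hull hK).1 hxL b hbK) hin.1.le
  refine lt_of_le_of_ne h0 fun h => ?_
  rw [planeProj_of_height_eq_zero h.symm] at hpC
  exact notMem_of_mem_frontier hΩ (hf.2.2 (hCf hpC)) hx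

/-- The tangential part of a polynomial field `q` on a boundary face of `K` is controlled by
`q - v` on `K`, for every `v ∈ H₀(curl)`. -/
theorem exists_norm_tangential_face_le (hΩ : IsLipschitzDomain Ω) (hd : 1 ≤ d) (p : ℕ) (hσ : 0 < σ)
    {θ : ℝ} (h1 : 1 / 2 < θ) : ∃ C : ℝ≥0, ∀ T : Mesh Ω, T.ShapeRegular σ →
      ∀ v : Euc d → Euc d, MemHZeroCurl Ω v → ∀ K ∈ T.elements, ∀ f ∈ T.boundaryFaces, f ⊆ K →
        ∀ n, T.IsOutwardNormal f n → ∀ q, IsPolyField p q → ∀ a ∈ hull f,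
          ‖q a - (inner ℝ (q a) n : ℝ) • n‖ₑ ≤ C * (ENNReal.ofReal (diam (hull K) ^ (-(d : ℝ) / 2)) *
            (slob 0 (interior (hull K)) (fun x => q x - v x) +
              ENNReal.ofReal (diam (hull K) ^ θ) *
                slob θ (interior (hull K)) fun x => q x - v x)) := by
  have hd0 : (0 : ℝ) < d := by exact_mod_cast hd
  set κ := 2 * d * σ with hκ
  have hκ0 : 0 < κ := by positivity
  obtain ⟨C, hC, hmain⟩ := exists_norm_tangential_le d p h1 hκ0.le
  refine ⟨Real.toNNReal (C * (κ⁻¹ ^ (-(d : ℝ) / 2) * (1 + κ⁻¹ ^ θ))), ?_⟩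
  intro T hT v hv K hK f hf hfK n hn q hq a ha
  set h := diam (hull K) with hh
  set D := interior (hull K) with hD
  have hh0 : 0 < h := diam_pos hd hK
  have hcard := hf.2.1
  obtain ⟨z, hz⟩ := (fat_element hd hσ hT hK).ball
  set ρ := 1 / σ * h with hρ
  have hρ0 : 0 < ρ := by positivity
  have hB : ball z ρ ⊆ hull K := hz.trans interior_subset
  have hr : ρ / (2 * d) = κ⁻¹ * h := by rw [hρ, hκ]; field_simp
  have hr0 : 0 < κ⁻¹ * h := by positivity
  have hcyl := cylinder_subset_interior hd hK hfK hcard hn hρ0 hB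
  obtain ⟨ε, hε, hloc⟩ := exists_height_pos hΩ hd hK hf hfK hn hρ0 hB
  rw [hr] at hcyl hloc
  have hcylΩ := hcyl.trans (interior_hull_subset hΩ hK)
  have hcen := center_spec hd hK hfK hcard
  have hfin0 : 0 < C * (κ⁻¹ ^ (-(d : ℝ) / 2) * (1 + κ⁻¹ ^ θ)) := by positivity
  -- infinite right hand side
  by_cases htop : slob θ D (fun x => q x - v x) = ⊤
  · rw [htop, ENNReal.mul_top (by rw [Ne, ENNReal.ofReal_eq_zero, not_le]; positivity), add_top,
      ENNReal.mul_top (by rw [Ne, ENNReal.ofReal_eq_zero, not_le]; positivity),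
      ENNReal.mul_top (by simpa using hfin0)]
    exact le_top
  have hv2 := hv.1
  -- The layer estimates need a measurable field; a measurable representative has the same weak
  -- curl, trace and seminorms.
  set v' := hv2.1.mk v with hv'
  have hvv : v =ᵐ[volume.restrict Ω] v' := hv2.1.ae_eq_mk
  have hvm : Measurable v' := hv2.1.stronglyMeasurable_mk.measurable
  have hcongr : (fun x => q x - v x) =ᵐ[volume.restrict (cylinder n (center f) (κ⁻¹ * h))]
      fun x => q x - v' x := by
    filter_upwards [ae_mono (Measure.restrict_mono hcylΩ le_rfl) hvv] with x hx
    rw [hx]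
  have hle : ∀ η, slob η (cylinder n (center f) (κ⁻¹ * h)) (fun x => q x - v' x) ≤
      slob η D fun x => q x - v x := fun η => by
    rw [← slob_congr hcongr]; exact slob_mono hcyl
  have hfin : slob θ D (fun x => q x - v x) ≠ ⊤ := htop
  have h0fin : slob 0 D (fun x => q x - v x) ≠ ⊤ := by
    rw [slob_zero_eq_eLpNorm]
    exact ((hq.memLp (isCompact_hull K).isBounded).mono_measure
      (Measure.restrict_mono interior_subset le_rfl)).sub (hv2.mono_measure
      (Measure.restrict_mono (interior_hull_subset hΩ hK) le_rfl)) |>.2.ne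
  have hah : height n (center f) a = 0 := by
    obtain ⟨b, hbK, hbf, hKb⟩ := exists_opposite hK hfK hcard
    have hin := inner_normal_eq hK hfK hcard hn hcen.1 hbK hbf
    rw [height, hin.2, ((mem_hull_subset hK hfK).1 ha).2 b hbK hbf, zero_mul]
  have hfsub : hull f ⊆ hull K := convexHull_mono (by exact_mod_cast hfK)
  have hax : ‖a - center f‖ ≤ κ * (κ⁻¹ * h) := by
    rw [mul_inv_cancel_left₀ hκ0.ne']
    exact norm_sub_le_diam (hfsub ha) (hfsub hcen.1)
  have key := hmain Ω v' q n (center f) a (κ⁻¹ * h) ε hΩ.isOpen hΩ.isBounded (hv.congr hvv) hvm hq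
    hn.1 hr0 hcylΩ hε hloc (ne_top_of_le_ne_top hfin (hle θ)) hah hax
  rw [← ENNReal.ofReal_toReal hfin, ← ENNReal.ofReal_toReal h0fin, ← ofReal_norm,
    ← ENNReal.ofReal_mul (by positivity), ← ENNReal.ofReal_add (by positivity) (by positivity),
    ← ENNReal.ofReal_mul (by positivity)]
  refine (ENNReal.ofReal_le_ofReal (key.trans ?_)).trans_eq (ENNReal.ofReal_mul hfin0.le)
  have t0 := ENNReal.toReal_mono h0fin (hle 0)
  have t1 := ENNReal.toReal_mono hfin (hle θ)
  set N0 := (slob 0 D fun x => q x - v x).toReal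
  set N1 := (slob θ D fun x => q x - v x).toReal
  have hN0 : 0 ≤ N0 := ENNReal.toReal_nonneg
  have hN1 : 0 ≤ N1 := ENNReal.toReal_nonneg
  rw [Real.mul_rpow (by positivity) hh0.le, Real.mul_rpow (by positivity) hh0.le]
  calc _ ≤ C * (κ⁻¹ ^ (-(d : ℝ) / 2) * h ^ (-(d : ℝ) / 2) * (N0 + κ⁻¹ ^ θ * h ^ θ * N1)) := by
        gcongr
    _ = C * κ⁻¹ ^ (-(d : ℝ) / 2) * h ^ (-(d : ℝ) / 2) * (N0 + κ⁻¹ ^ θ * (h ^ θ * N1)) := by ring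
    _ ≤ C * κ⁻¹ ^ (-(d : ℝ) / 2) * h ^ (-(d : ℝ) / 2) * ((1 + κ⁻¹ ^ θ) * (N0 + h ^ θ * N1)) := by
        gcongr
        have e1 : 0 ≤ κ⁻¹ ^ θ * N0 := by positivity
        have e2 : 0 ≤ h ^ θ * N1 := by positivity
        linarith
    _ = _ := by ring

end Mesh

end

/-! ### The local projection in fractional seminorms -/

section

theorem slob_sub_rev (θ : ℝ) (U : Set (Euc d)) (f g : Euc d → Euc d) :
    slob θ U (fun x => f x - g x) = slob θ U fun x => g x - f x := by
  have h1 : ∀ x, ‖f x - g x‖ₑ = ‖g x - f x‖ₑ := fun x => enorm_sub_rev _ _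
  have h2 : ∀ x y, ‖(f x - g x) - (f y - g y)‖ₑ = ‖(g x - f x) - (g y - f y)‖ₑ := fun x y => by
    rw [← enorm_neg]; congr 1; abel
  simp only [slob, slobodeckijSq, h1, h2]

theorem semi_congr {k : ℕ} {θ : ℝ} {U : Set (Euc d)} {v w : Euc d → Euc d} (hU : IsOpen U)
    (h : v =ᵐ[volume.restrict U] w) : semi k θ U v = semi k θ U w := by
  have : ∀ (I : Fin k → Fin d) g, HasWeakDeriv U I v g ↔ HasWeakDeriv U I w g := fun I g =>
    ⟨fun hg => hg.congr hU h (ae_eq_refl g), fun hg => hg.congr hU h.symm (ae_eq_refl g)⟩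
  simp only [semi, this]

theorem HasWeakDeriv.sub_rev {k : ℕ} {U : Set (Euc d)} {v w g : Euc d → Euc d} {I : Fin k → Fin d}
    (hU : IsOpen U) (h : HasWeakDeriv U I (fun x => v x - w x) g) :
    HasWeakDeriv U I (fun x => w x - v x) fun x => -g x := by
  simpa using (h.sub hU h).sub hU h

theorem semi_sub_rev_le {k : ℕ} {θ : ℝ} {U : Set (Euc d)} {v w : Euc d → Euc d} (hU : IsOpen U)
    (h : ∀ I : Fin k → Fin d, ∃ g, HasWeakDeriv U I (fun x => v x - w x) g) :
    semi k θ U (fun x => w x - v x) ≤ d ^ k * semi k θ U fun x => v x - w x := by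
  choose G hG using h
  refine (semi_le fun I => (hG I).sub_rev hU).trans ?_
  calc ∑ I, slob θ U (fun x => -G I x)
      ≤ ∑ _I : Fin k → Fin d, semi k θ U fun x => v x - w x :=
        Finset.sum_le_sum fun I _ => by
          have := slob_sub_rev θ U (fun _ => 0) (G I)
          simp only [zero_sub, sub_zero] at this
          rw [this]
          exact slob_le_semi hU (hG I)
    _ = _ := by simp

theorem sobolevSeminorm_of_lt_one {θ : ℝ} (h1 : θ < 1) (U : Set (Euc d)) (v : Euc d → Euc d) :
    sobolevSeminorm θ U v = semi 0 θ U v := by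
  have : ⌊θ⌋₊ = 0 := Nat.floor_eq_zero.2 h1
  rw [sobolevSeminorm_eq_semi, this]
  simp

theorem IsPolyField.sum {ι : Type*} (s : Finset ι) {p : ℕ} {q : ι → Euc d → Euc d}
    (h : ∀ i ∈ s, IsPolyField p (q i)) : IsPolyField p fun x => ∑ i ∈ s, q i x := by
  classical
  induction s using Finset.induction_on with
  | empty => simpa using isPolyField_zero p
  | insert a s ha ih =>
    simp only [Finset.sum_insert ha]
    exact (h a (Finset.mem_insert_self a s)).add (ih fun i hi => h i (Finset.mem_insert_of_mem hi))

theorem IsPolyField.exists_hasWeakDeriv {p k : ℕ} {q : Euc d → Euc d} (hq : IsPolyField p q)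
    (U : Set (Euc d)) (I : Fin k → Fin d) : ∃ g, HasWeakDeriv U I q g := by
  obtain ⟨P, -, rfl⟩ := isPolyField_iff.1 hq
  exact ⟨_, hasWeakDeriv_pfield U P I⟩

/-- The exponent `s - d/2` may have either sign, so both directions of the comparison are needed. -/
theorem rpow_le_of_comparable {h h' Λ : ℝ} (hh : 0 < h) (hh' : 0 < h') (hΛ : 1 ≤ Λ)
    (h1 : h ≤ Λ * h') (h2 : h' ≤ Λ * h) (α : ℝ) : h ^ α ≤ Λ ^ |α| * h' ^ α := by
  rcases le_total 0 α with h0 | h0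
  · rw [abs_of_nonneg h0, ← Real.mul_rpow (by positivity) hh'.le]
    exact Real.rpow_le_rpow hh.le h1 h0
  · rw [abs_of_nonpos h0]
    have h3 : h' ^ (-α) ≤ Λ ^ (-α) * h ^ (-α) := by
      rw [← Real.mul_rpow (by positivity) hh.le]
      exact Real.rpow_le_rpow hh'.le h2 (by linarith)
    have e1 : h ^ (-α) * h ^ α = 1 := by rw [← Real.rpow_add hh]; simp
    have e2 : h' ^ (-α) * h' ^ α = 1 := by rw [← Real.rpow_add hh']; simp
    calc h ^ α = (h' ^ (-α) * h' ^ α) * h ^ α := by rw [e2, one_mul]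
      _ ≤ (Λ ^ (-α) * h ^ (-α) * h' ^ α) * h ^ α := by gcongr
      _ = Λ ^ (-α) * h' ^ α * (h ^ (-α) * h ^ α) := by ring
      _ = _ := by rw [e1, mul_one]

namespace Mesh

variable {Ω : Set (Euc d)} {σ s θ : ℝ} {p : ℕ}

/-- The local projection approximates `v` on each element of the patch, in `L²` and in the
fractional seminorm of order `θ`. -/
theorem exists_polyProj_sub_le (hΩ : IsLipschitzDomain Ω) (hd : 2 ≤ d) (hp : 1 ≤ p)
    (hσ : 1 ≤ σ) (hs : 0 < s) (hsp : s ≤ p + 1) (h0 : 0 < θ) (h1 : θ < 1) (hθs : θ ≤ s) :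
    ∃ C : ℝ≥0, ∀ T : Mesh Ω, T.ShapeRegular σ → ∀ v : Euc d → Euc d, MemSobolev s Ω v →
      ∀ K ∈ T.elements, ∀ c ∈ elementNodes p K,
        slob 0 (interior (hull K)) (fun x => polyProj p (T.patch p c) v x - v x) ≤
          C * (ENNReal.ofReal (Metric.diam (hull K) ^ s) * sobolevSeminorm s (T.patch p c) v) ∧
        ENNReal.ofReal (Metric.diam (hull K) ^ θ) *
          slob θ (interior (hull K)) (fun x => polyProj p (T.patch p c) v x - v x) ≤
          C * (ENNReal.ofReal (Metric.diam (hull K) ^ s) * sobolevSeminorm s (T.patch p c) v) := by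
  have hσ0 : 0 < σ := by linarith
  have hκ : 0 < 1 / σ := by positivity
  obtain ⟨C₁, hC₁⟩ := slob_zero_patch_sub_polyProj_le hΩ hd hp hσ hs hsp
  obtain ⟨CB, hCB⟩ := Fat.bramble_hilbert (d := d) (by omega) p hs hsp hκ
  obtain ⟨C₂, hC₂⟩ := Fat.semi_pfield_le (d := d) (by omega) p 0 hκ h0.le h1
  refine ⟨C₁ + 2 * (C₂ * (CB 0 + C₁) + CB θ), fun T hT v hv K hK c hc => ?_⟩
  set D := interior (hull K) with hDdef
  set h := Metric.diam (hull K) with hh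
  set V := sobolevSeminorm s (T.patch p c) v with hV
  set q := polyProj p (T.patch p c) v with hq
  have hh0 : 0 < h := diam_pos (by omega) hK
  have hD : Fat (1 / σ) h D := fat_element (by omega) hσ0 hT hK
  have hKc := mem_nodeElements_of_mem hp hK hc
  have hDpatch : D ⊆ T.patch p c := interior_subset_patch hKc
  have hvD : MemSobolev s D v := hv.mono isOpen_interior hΩ.isOpen (interior_hull_subset hΩ hK)
  have hVD : sobolevSeminorm s D v ≤ V := sobolevSeminorm_mono isOpen_interior isOpen_patch hDpatch
  have hvL := hv.memLp hΩ.isOpen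
  have hqp : IsPolyField p q := (polyProj_spec p (isBounded_patch hΩ)
    (hvL.mono_measure (Measure.restrict_mono (patch_subset hΩ) le_rfl))).1
  have a0 : slob 0 D (fun x => v x - q x) ≤ C₁ * (ENNReal.ofReal (h ^ s) * V) :=
    (slob_mono hDpatch).trans (hC₁ T hT v hv K hK c hc)
  obtain ⟨q', hq', hB⟩ := hCB h D hD v hvD
  have hI : Fin ⌊(0 : ℝ)⌋₊ → Fin d := fun _ => ⟨0, by omega⟩
  have hloc : LocallyIntegrableOn (fun x => v x - q' x) D := by
    obtain ⟨g, hg⟩ := (hB 0 le_rfl hs.le).1 hI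
    exact hg.1
  have hzero := HasWeakDeriv.zero (I := (Fin.elim0 : Fin 0 → Fin d)) hloc
  have a1 : slob 0 D (fun x => v x - q' x) ≤ CB 0 * (ENNReal.ofReal (h ^ s) * V) := by
    refine (slob_zero_le_sobolevSeminorm isOpen_interior hloc).trans ((hB 0 le_rfl hs.le).2.trans ?_)
    rw [sub_zero]
    gcongr
  have a2 : slob θ D (fun x => v x - q' x) ≤ CB θ * (ENNReal.ofReal (h ^ (s - θ)) * V) := by
    refine (slob_le_semi isOpen_interior hzero).trans ?_
    rw [← sobolevSeminorm_of_lt_one h1]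
    refine (hB θ h0.le hθs).2.trans ?_
    gcongr
  have hr : IsPolyField p fun x => q x - q' x := hqp.sub hq'
  have m1 : AEStronglyMeasurable (fun x => v x - q' x) (volume.restrict D) := hloc.aestronglyMeasurable
  have m2 : AEStronglyMeasurable (fun x => v x - q x) (volume.restrict D) := by
    have := m1.sub hr.continuous.aestronglyMeasurable
    refine this.congr (Filter.Eventually.of_forall fun x => ?_)
    simp
  have a3 : slob 0 D (fun x => q x - q' x) ≤ (CB 0 + C₁) * (ENNReal.ofReal (h ^ s) * V) := by
    have e : (fun x => q x - q' x) = fun x => (v x - q' x) - (v x - q x) := by ext1 x; abel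
    rw [e, add_mul]
    exact (slob_zero_sub_le m1 m2).trans (add_le_add a1 a0)
  -- The projection is a best approximation only in `L²`. Its fractional error is obtained by
  -- comparison with the Bramble–Hilbert polynomial `q'`, the inverse estimate being applied to `q -
  -- q'`.
  have a4 : slob θ D (fun x => q x - q' x) ≤
      C₂ * (ENNReal.ofReal (h ^ (-θ)) * ((CB 0 + C₁) * (ENNReal.ofReal (h ^ s) * V))) := by
    refine (slob_le_semi isOpen_interior (HasWeakDeriv.zero
      (I := (Fin.elim0 : Fin 0 → Fin d)) (locallyIntegrableOn_of_continuous hr.continuous D))).trans ?_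
    refine (hC₂ h D hD _ hr).trans ?_
    rw [Nat.cast_zero, neg_zero, zero_sub]
    gcongr
  constructor
  · rw [slob_sub_rev]
    refine a0.trans ?_
    push_cast
    gcongr
    exact le_self_add
  · have e : (fun x => q x - v x) = fun x => (q x - q' x) + (q' x - v x) := by ext1 x; abel
    have m3 : AEStronglyMeasurable (fun x => q' x - v x) (volume.restrict D) := by
      refine m1.neg.congr (Filter.Eventually.of_forall fun x => ?_)
      simp
    have a5 := slob_add_le (θ := θ) hr.continuous.aestronglyMeasurable m3
    rw [← e, slob_sub_rev θ D q' v] at a5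
    have e1 : ENNReal.ofReal (h ^ θ) * ENNReal.ofReal (h ^ (-θ)) = 1 := by
      rw [ofReal_rpow_mul hh0]; simp
    have e2 : ENNReal.ofReal (h ^ θ) * ENNReal.ofReal (h ^ (s - θ)) = ENNReal.ofReal (h ^ s) := by
      rw [ofReal_rpow_mul hh0]; simp
    set W := ENNReal.ofReal (h ^ s) * V with hW
    calc _ ≤ ENNReal.ofReal (h ^ θ) * (2 * (C₂ * (ENNReal.ofReal (h ^ (-θ)) * ((CB 0 + C₁) * W)) +
          CB θ * (ENNReal.ofReal (h ^ (s - θ)) * V))) := by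
          gcongr
          exact a5.trans (by gcongr)
      _ = 2 * (C₂ * ((ENNReal.ofReal (h ^ θ) * ENNReal.ofReal (h ^ (-θ))) * ((CB 0 + C₁) * W)) +
          CB θ * ((ENNReal.ofReal (h ^ θ) * ENNReal.ofReal (h ^ (s - θ))) * V)) := by ring
      _ = (2 * (C₂ * (CB 0 + C₁) + CB θ)) * W := by rw [e1, e2, ← hW]; ring
      _ ≤ _ := by
          push_cast
          gcongr
          exact le_add_self

end Mesh

end

/-! ### Nodal errors and the interpolation estimate -/

section

namespace Mesh

variable {Ω : Set (Euc d)} {σ s m : ℝ} {p : ℕ}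

/-- At a boundary node the local projection is almost normal to each adjacent boundary face. -/
theorem exists_tangential_polyProj_le (hΩ : IsLipschitzDomain Ω) (hd : 2 ≤ d) (hp : 1 ≤ p)
    (hσ : 1 ≤ σ) (hs : 1 / 2 < s) (hsp : s ≤ p + 1) :
    ∃ C : ℝ≥0, ∀ T : Mesh Ω, T.ShapeRegular σ → ∀ v : Euc d → Euc d, MemSobolev s Ω v →
      MemHZeroCurl Ω v → ∀ K ∈ T.elements, ∀ c ∈ elementNodes p K, ∀ f ∈ T.boundaryFaces,
        T.nodePoint p c ∈ hull f → ∀ n, T.IsOutwardNormal f n →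
        ‖polyProj p (T.patch p c) v (T.nodePoint p c) -
          (inner ℝ (polyProj p (T.patch p c) v (T.nodePoint p c)) n : ℝ) • n‖ₑ ≤
          C * (ENNReal.ofReal (Metric.diam (hull K) ^ (s - (d : ℝ) / 2)) *
            sobolevSeminorm s (T.patch p c) v) := by
  have hσ0 : 0 < σ := by linarith
  -- An auxiliary order in `(1/2, 1)` that does not exceed `s`: large enough for the trace argument
  -- and below the order of a full derivative.
  set θ := min s (3 / 4) with hθ
  have hθ1 : 1 / 2 < θ := lt_min hs (by norm_num)
  have hθ2 : θ < 1 := (min_le_right _ _).trans_lt (by norm_num)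
  obtain ⟨C₁, hC₁⟩ := exists_norm_tangential_face_le (σ := σ) hΩ (by omega) p hσ0 hθ1
  obtain ⟨C₂, hC₂⟩ := exists_polyProj_sub_le hΩ hd hp hσ (by linarith) hsp (by linarith) hθ2
    (min_le_left s (3 / 4))
  set Λ := σ ^ ⌊σ ^ d⌋₊ with hΛ
  have hΛ1 : 1 ≤ Λ := one_le_pow₀ hσ
  set α := s - (d : ℝ) / 2 with hα
  refine ⟨C₁ * (2 * C₂) * Real.toNNReal (Λ ^ |α|), ?_⟩
  intro T hT v hv hv0 K hK c hc f hf haf n hn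
  -- The boundary face need not belong to `K`. The estimate is made on its own element `L`, and the
  -- diameters are compared through a vertex common to all elements at the node.
  obtain ⟨L, hL, hfL⟩ := hf.1
  have haL : T.nodePoint p c ∈ hull L := convexHull_mono (by exact_mod_cast hfL) haf
  have hcL := mem_elementNodes_of_nodePoint_mem hp hK hc hL haL
  have hqp : IsPolyField p (polyProj p (T.patch p c) v) := (polyProj_spec p (isBounded_patch hΩ)
    ((hv.memLp hΩ.isOpen).mono_measure (Measure.restrict_mono (patch_subset hΩ) le_rfl))).1
  have h1 := hC₁ T hT v hv0 L hL f hf hfL n hn _ hqp _ haf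
  have h2 := hC₂ T hT v hv L hL c hcL
  obtain ⟨b, hb⟩ := nodeElements_subset_star hp hK hc
  have hKs := hb (mem_nodeElements_of_mem hp hK hc)
  have hLs := hb (mem_nodeElements.2 ⟨hL, haL⟩)
  have hh : 0 < Metric.diam (hull L) := diam_pos (by omega) hL
  have hh' : 0 < Metric.diam (hull K) := diam_pos (by omega) hK
  have hcomp := rpow_le_of_comparable hh hh' hΛ1 (diam_le_of_mem_star hΩ hd hσ hT hLs hKs)
    (diam_le_of_mem_star hΩ hd hσ hT hKs hLs) α
  set V := sobolevSeminorm s (T.patch p c) v with hV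
  set W := ENNReal.ofReal (Metric.diam (hull L) ^ s) * V with hW
  have e1 : ENNReal.ofReal (Metric.diam (hull L) ^ (-(d : ℝ) / 2)) * W =
      ENNReal.ofReal (Metric.diam (hull L) ^ α) * V := by
    rw [hW, ← mul_assoc, ofReal_rpow_mul hh]
    congr 3
    rw [hα]; ring
  calc _ ≤ C₁ * (ENNReal.ofReal (Metric.diam (hull L) ^ (-(d : ℝ) / 2)) * (C₂ * W + C₂ * W)) :=
        h1.trans (mul_le_mul_right (mul_le_mul_right (add_le_add h2.1 h2.2) _) _)
    _ = C₁ * (2 * C₂) * (ENNReal.ofReal (Metric.diam (hull L) ^ (-(d : ℝ) / 2)) * W) := by ring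
    _ ≤ C₁ * (2 * C₂) * (ENNReal.ofReal (Λ ^ |α| * Metric.diam (hull K) ^ α) * V) := by
        rw [e1]; gcongr
    _ = _ := by
        rw [ENNReal.ofReal_mul (by positivity)]
        push_cast
        rw [← ENNReal.ofReal]
        ring

/-- The modification of the nodal values at the boundary is small. -/
theorem exists_nodalValue_sub_le (hΩ : IsLipschitzDomain Ω) (hd : 2 ≤ d) (hp : 1 ≤ p)
    (hσ : 1 ≤ σ) (hs : 1 / 2 < s) (hsp : s ≤ p + 1) :
    ∃ C : ℝ≥0, ∀ T : Mesh Ω, T.ShapeRegular σ → ∀ v : Euc d → Euc d, MemSobolev s Ω v →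
      MemHZeroCurl Ω v → ∀ K ∈ T.elements, ∀ c ∈ elementNodes p K,
        ‖T.nodalValue p v c - polyProj p (T.patch p c) v (T.nodePoint p c)‖ₑ ≤
          C * (ENNReal.ofReal (Metric.diam (hull K) ^ (s - (d : ℝ) / 2)) *
            sobolevSeminorm s (T.patch p c) v) := by
  classical
  obtain ⟨C₁, hC₁⟩ := exists_tangential_polyProj_le hΩ hd hp hσ hs hsp
  obtain ⟨S, hS⟩ := exists_finite_normals hΩ (by omega)
  -- The constant depends on the pair of normals. Since only finitely many normals occur, the sum
  -- over all pairs is uniform in the mesh; irrelevant pairs receive the constant `0`.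
  have hex : ∀ n m : Euc d, ∃ C : ℝ≥0, (‖n‖ = 1 → ‖m‖ = 1 → n ≠ m → n ≠ -m → ∀ u : Euc d,
      ‖u‖ ≤ C * (‖u - (inner ℝ u n : ℝ) • n‖ + ‖u - (inner ℝ u m : ℝ) • m‖)) := fun n m => by
    by_cases h : ‖n‖ = 1 ∧ ‖m‖ = 1 ∧ n ≠ m ∧ n ≠ -m
    · obtain ⟨C, hC⟩ := norm_le_tangential h.1 h.2.1 h.2.2.1 h.2.2.2
      exact ⟨C, fun _ _ _ _ => hC⟩
    · exact ⟨0, fun h1 h2 h3 h4 => absurd ⟨h1, h2, h3, h4⟩ h⟩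
  choose B hB using hex
  set C₂ := ∑ n ∈ S, ∑ m ∈ S, B n m with hC₂
  have hBC : ∀ n ∈ S, ∀ m ∈ S, B n m ≤ C₂ := fun n hn m hm =>
    (Finset.single_le_sum (f := fun m => B n m) (fun _ _ => zero_le) hm).trans
      (Finset.single_le_sum (f := fun n => ∑ m ∈ S, B n m) (fun _ _ => zero_le) hn)
  refine ⟨C₁ + C₂ * (C₁ + C₁), fun T hT v hv hv0 K hK c hc => ?_⟩
  set a := T.nodePoint p c with ha
  set u := polyProj p (T.patch p c) v a with hu
  set W := ENNReal.ofReal (Metric.diam (hull K) ^ (s - (d : ℝ) / 2)) *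
    sobolevSeminorm s (T.patch p c) v with hW
  have htan : ∀ f ∈ T.boundaryFaces, a ∈ hull f → ∀ n, T.IsOutwardNormal f n →
      ‖u - (inner ℝ u n : ℝ) • n‖ₑ ≤ C₁ * W := fun f hf haf n hn =>
    hC₁ T hT v hv hv0 K hK c hc f hf haf n hn
  rw [nodalValue]
  split_ifs with hfr
  swap
  · rw [sub_self, enorm_zero]; exact zero_le
  -- Existence of a boundary face at the node is essential: without one, the condition on the common
  -- normal would be vacuous and the chosen vector arbitrary.
  obtain ⟨f, hf, haf⟩ := exists_boundaryFace hΩ (by omega) T hfr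
  rw [boundaryValue]
  split_ifs with hn
  · rw [enorm_sub_rev]
    refine (htan f hf haf _ (hn.choose_spec f hf haf)).trans ?_
    push_cast
    gcongr
    exact le_self_add
  -- No common normal exists, so the normal of one face fails for another face. The two normals are
  -- neither equal nor opposite, and the two small tangential parts bound the discarded vector.
  · obtain ⟨n, hnf⟩ := exists_isOutwardNormal hΩ (by omega) hf
    push Not at hn
    obtain ⟨f', hf', haf', hnf'⟩ := hn n
    obtain ⟨n', hn'⟩ := exists_isOutwardNormal hΩ (by omega) hf'
    have hne : n ≠ n' := fun h => hnf' (h ▸ hn')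
    have hneg := normal_ne_neg hΩ (by omega) hf hnf haf hf' hn' haf'
    have hub := hB n n' hnf.1 hn'.1 hne hneg u
    have h1 := htan f hf haf n hnf
    have h2 := htan f' hf' haf' n' hn'
    have hub' : ‖u‖ₑ ≤ B n n' * (‖u - (inner ℝ u n : ℝ) • n‖ₑ + ‖u - (inner ℝ u n' : ℝ) • n'‖ₑ) := by
      simp only [enorm_eq_nnnorm]
      exact_mod_cast hub
    rw [zero_sub, enorm_neg]
    calc ‖u‖ₑ ≤ C₂ * (C₁ * W + C₁ * W) := by
          refine hub'.trans ?_
          gcongr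
          exact hBC n (hS T f hf n hnf) n' (hS T f' hf' n' hn')
      _ = C₂ * (C₁ + C₁) * W := by ring
      _ ≤ _ := by
          push_cast
          gcongr
          exact le_add_self

theorem elementNodes_nonempty {T : Mesh Ω} {K : Finset (Euc d)} (hK : K ∈ T.elements) (p : ℕ) :
    (elementNodes p K).Nonempty := by
  classical
  have : K.Nonempty := by
    rw [← Finset.card_pos, T.card_eq K hK]; omega
  obtain ⟨a, ha⟩ := this
  refine ⟨fun x => if x = a then p else 0, mem_elementNodes.2 ⟨?_, ?_⟩⟩
  · simp [ha]
  · intro x hx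
    by_contra h
    rcases eq_or_ne x a with rfl | hne
    · exact h ha
    · simp [hne] at hx

/-- The local error estimate for the boundary-adapted Clément interpolant. -/
theorem exists_clementZero_sub_le (hΩ : IsLipschitzDomain Ω) (hd : 2 ≤ d) (hp : 1 ≤ p)
    (hσ : 1 ≤ σ) (hs : 1 / 2 < s) (hsp : s ≤ p + 1) (hm : 0 ≤ m) (hms : m ≤ s) :
    ∃ C : ℝ≥0, ∀ T : Mesh Ω, T.ShapeRegular σ → ∀ v : Euc d → Euc d, MemSobolev s Ω v →
      MemHZeroCurl Ω v → ∀ K ∈ T.elements,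
        sobolevSeminorm m (interior (hull K)) (fun x => T.clementZero p v x - v x) ≤
          C * ∑ c ∈ elementNodes p K, ENNReal.ofReal (Metric.diam (T.patch p c) ^ (s - m)) *
            sobolevSeminorm s (T.patch p c) v := by
  have hs0 : 0 < s := by linarith
  have hσ0 : 0 < σ := by linarith
  have hκ : 0 < 1 / σ := by positivity
  set k := ⌊m⌋₊ with hk
  set η := m - k with hη
  have hη0 : 0 ≤ η := sub_nonneg.2 (Nat.floor_le hm)
  have hη1 : η < 1 := by have := Nat.lt_floor_add_one m; rw [hη]; linarith
  obtain ⟨C₁, hC₁⟩ := exists_nodalValue_sub_le hΩ hd hp hσ hs hsp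
  obtain ⟨C₂, hC₂⟩ := slob_zero_patch_sub_polyProj_le hΩ hd hp hσ hs0 hsp
  obtain ⟨CB, hCB⟩ := Fat.bramble_hilbert (d := d) (by omega) p hs0 hsp hκ
  obtain ⟨C₃, hC₃⟩ := Fat.semi_pfield_le (d := d) (by omega) p k hκ hη0 hη1
  obtain ⟨C₄, hC₄⟩ := Fat.pfield_le (d := d) p hκ zero_le_one
  set Cn : ℝ≥0 := C₁ + C₄ * (CB 0 + C₂) with hCn
  set Cw : ℝ≥0 := (p : ℝ≥0) ^ p * Cn * (ballConst d).toNNReal with hCw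
  refine ⟨2 * d ^ k * (d ^ k * CB m + C₃ * Cw), fun T hT v hv hv0 K hK => ?_⟩
  set D := interior (hull K) with hDdef
  set h := Metric.diam (hull K) with hh
  set V : (Euc d → ℕ) → ℝ≥0∞ := fun c => sobolevSeminorm s (T.patch p c) v with hV
  have hh0 : 0 < h := diam_pos (by omega) hK
  have hD : Fat (1 / σ) h D := fat_element (by omega) hσ0 hT hK
  have hDpatch : ∀ c ∈ elementNodes p K, D ⊆ T.patch p c := fun c hc =>
    interior_subset_patch (mem_nodeElements_of_mem hp hK hc)
  have hvD : MemSobolev s D v := hv.mono isOpen_interior hΩ.isOpen (interior_hull_subset hΩ hK)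
  have hVD : ∀ c ∈ elementNodes p K, sobolevSeminorm s D v ≤ V c := fun c hc =>
    sobolevSeminorm_mono isOpen_interior isOpen_patch (hDpatch c hc)
  obtain ⟨q, hq, hB⟩ := hCB h D hD v hvD
  have hI : Fin ⌊(0 : ℝ)⌋₊ → Fin d := fun _ => ⟨0, by omega⟩
  have hloc : LocallyIntegrableOn (fun x => v x - q x) D := by
    obtain ⟨g, hg⟩ := (hB 0 le_rfl hs0.le).1 hI
    exact hg.1
  have m1 : AEStronglyMeasurable (fun x => v x - q x) (volume.restrict D) := hloc.aestronglyMeasurable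
  have b0 : slob 0 D (fun x => v x - q x) ≤ CB 0 * (ENNReal.ofReal (h ^ s) * sobolevSeminorm s D v) := by
    refine (slob_zero_le_sobolevSeminorm isOpen_interior hloc).trans ((hB 0 le_rfl hs0.le).2.trans ?_)
    rw [sub_zero]
  -- nodal errors
  set e : (Euc d → ℕ) → Euc d := fun c => T.nodalValue p v c - q (T.nodePoint p c) with he
  have hnodal : ∀ c ∈ elementNodes p K,
      ‖e c‖ₑ ≤ Cn * (ENNReal.ofReal (h ^ (s - (d : ℝ) / 2)) * V c) := by
    intro c hc
    set a := T.nodePoint p c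
    set qc := polyProj p (T.patch p c) v with hqc
    have hqp : IsPolyField p qc := (polyProj_spec p (isBounded_patch hΩ)
      ((hv.memLp hΩ.isOpen).mono_measure (Measure.restrict_mono (patch_subset hΩ) le_rfl))).1
    have hr : IsPolyField p fun x => qc x - q x := hqp.sub hq
    have b1 : slob 0 D (fun x => v x - qc x) ≤ C₂ * (ENNReal.ofReal (h ^ s) * V c) :=
      (slob_mono (hDpatch c hc)).trans (hC₂ T hT v hv K hK c hc)
    have m2 : AEStronglyMeasurable (fun x => v x - qc x) (volume.restrict D) := by
      refine (m1.sub hr.continuous.aestronglyMeasurable).congr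
        (Filter.Eventually.of_forall fun x => ?_)
      simp
    have b2 : slob 0 D (fun x => qc x - q x) ≤ (CB 0 + C₂) * (ENNReal.ofReal (h ^ s) * V c) := by
      have e : (fun x => qc x - q x) = fun x => (v x - q x) - (v x - qc x) := by ext1 x; abel
      rw [e, add_mul]
      refine (slob_zero_sub_le m1 m2).trans (add_le_add (b0.trans ?_) b1)
      gcongr
      exact hVD c hc
    -- Both polynomials are close to `v` in `L²(K)`; the inverse estimate turns this into closeness
    -- at the node at the cost of `h^(-d/2)`.
    have b3 : ‖qc a - q a‖ₑ ≤ C₄ * (CB 0 + C₂) * (ENNReal.ofReal (h ^ (s - (d : ℝ) / 2)) * V c) := by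
      obtain ⟨z, hz⟩ := exists_mem_interior hK
      refine (hC₄ h D hD _ hr a ⟨z, hz, ?_⟩).trans ?_
      · rw [one_mul]
        exact norm_sub_le_diam (nodePoint_mem hp hK hc) (interior_subset hz)
      · have e1 : ENNReal.ofReal (h ^ (-(d : ℝ) / 2)) * ENNReal.ofReal (h ^ s) =
            ENNReal.ofReal (h ^ (s - (d : ℝ) / 2)) := by
          rw [ofReal_rpow_mul hh0]; congr 2; ring
        calc _ ≤ C₄ * (ENNReal.ofReal (h ^ (-(d : ℝ) / 2)) *
              ((CB 0 + C₂) * (ENNReal.ofReal (h ^ s) * V c))) := by gcongr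
          _ = C₄ * (CB 0 + C₂) * ((ENNReal.ofReal (h ^ (-(d : ℝ) / 2)) *
              ENNReal.ofReal (h ^ s)) * V c) := by ring
          _ = _ := by rw [e1]
    have e1 : e c = (T.nodalValue p v c - qc a) + (qc a - q a) := (sub_add_sub_cancel _ _ _).symm
    rw [e1]
    calc _ ≤ ‖T.nodalValue p v c - qc a‖ₑ + ‖qc a - q a‖ₑ := enorm_add_le _ _
      _ ≤ C₁ * (ENNReal.ofReal (h ^ (s - (d : ℝ) / 2)) * V c) +
          C₄ * (CB 0 + C₂) * (ENNReal.ofReal (h ^ (s - (d : ℝ) / 2)) * V c) :=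
        add_le_add (hC₁ T hT v hv hv0 K hK c hc) b3
      _ = _ := by rw [hCn]; push_cast; ring
  -- the polynomial part of the error
  set w : Euc d → Euc d := fun x => ∑ c ∈ elementNodes p K, T.shape p K c x • e c with hw
  have hwp : IsPolyField p w := IsPolyField.sum _ fun c hc => isPolyField_shape_smul hc _
  -- Reproduction of polynomials: the interpolant with nodal values `q(a_c)` is `q`, so only the
  -- nodal errors remain in `w`.
  have hdecomp : ∀ x ∈ D, T.clementZero p v x - v x = (q x - v x) + w x := by
    intro x hx
    rw [clementZero_eq hK (interior_subset hx) v, hw, he]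
    simp only [smul_sub, Finset.sum_sub_distrib]
    rw [← polyField_eq_sum_shape hp hK hq x]
    abel
  set R := ∑ c ∈ elementNodes p K, ENNReal.ofReal (h ^ (s - m)) * V c with hR
  have hvol : volume D ^ (1 / 2 : ℝ) ≤ ENNReal.ofReal (h ^ ((d : ℝ) / 2)) * ballConst d :=
    hD.volume_le hκ
  have hbc : ((ballConst d).toNNReal : ℝ≥0∞) = ballConst d := ENNReal.coe_toNNReal ballConst_ne_top
  -- The volume factor `h^(d/2)` cancels the `h^(-d/2)` of the nodal errors and leaves `h^(s-m)`.
  have hw0 : ENNReal.ofReal (h ^ (-m)) * slob 0 D w ≤ Cw * R := by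
    have hsup : ∀ x ∈ D, ‖w x‖ₑ ≤ ∑ c ∈ elementNodes p K,
        (p : ℝ≥0∞) ^ p * (Cn * (ENNReal.ofReal (h ^ (s - (d : ℝ) / 2)) * V c)) := by
      intro x hx
      refine (enorm_sum_le _ _).trans (Finset.sum_le_sum fun c hc => ?_)
      rw [enorm_smul]
      refine mul_le_mul' ?_ (hnodal c hc)
      rw [Real.enorm_eq_ofReal_abs]
      refine (ENNReal.ofReal_le_ofReal (abs_shape_le hK hc (interior_subset hx))).trans_eq ?_
      rw [ENNReal.ofReal_pow (by positivity), ENNReal.ofReal_natCast]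
    have h1 := (slob_zero_le_sup isOpen_interior.measurableSet hsup).trans (mul_le_mul_right hvol _)
    have e1 : ∀ c, ENNReal.ofReal (h ^ (-m)) * (ENNReal.ofReal (h ^ (s - (d : ℝ) / 2)) *
        ENNReal.ofReal (h ^ ((d : ℝ) / 2)) * V c) = ENNReal.ofReal (h ^ (s - m)) * V c := fun c => by
      rw [ofReal_rpow_mul hh0, ← mul_assoc, ofReal_rpow_mul hh0]
      congr 3; ring
    refine (mul_le_mul_right h1 _).trans (le_of_eq ?_)
    rw [hR, Finset.sum_mul, Finset.mul_sum, Finset.mul_sum]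
    refine Finset.sum_congr rfl fun c _ => ?_
    rw [← e1 c, hCw]
    push_cast
    rw [hbc]
    ring
  have hwsemi : semi k η D w ≤ C₃ * (Cw * R) := by
    refine (hC₃ h D hD w hwp).trans ?_
    rw [show -(k : ℝ) - η = -m by rw [hη]; ring]
    gcongr
  have hqv : semi k η D (fun x => q x - v x) ≤ d ^ k * (CB m * R) := by
    refine (semi_sub_rev_le isOpen_interior (hB m hm hms).1).trans ?_
    gcongr
    refine (hB m hm hms).2.trans ?_
    gcongr
    obtain ⟨c, hc⟩ := elementNodes_nonempty hK p
    refine le_trans ?_ (Finset.single_le_sum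
      (f := fun c => ENNReal.ofReal (h ^ (s - m)) * V c) (fun _ _ => zero_le) hc)
    gcongr
    exact hVD c hc
  have hfinal : sobolevSeminorm m D (fun x => T.clementZero p v x - v x) ≤
      (2 * d ^ k * (d ^ k * CB m + C₃ * Cw) : ℝ≥0) * R := by
    have hae : (fun x => T.clementZero p v x - v x) =ᵐ[volume.restrict D]
        fun x => (q x - v x) + w x := by
      filter_upwards [ae_restrict_mem isOpen_interior.measurableSet] with x hx
      exact hdecomp x hx
    rw [sobolevSeminorm_eq_semi, ← hk, ← hη, semi_congr isOpen_interior hae]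
    refine (semi_add_le isOpen_interior (fun I => ?_)
      (fun I => hwp.exists_hasWeakDeriv D I)).trans ?_
    · obtain ⟨g, hg⟩ := (hB m hm hms).1 I
      exact ⟨_, hg.sub_rev isOpen_interior⟩
    · calc _ ≤ 2 * (d : ℝ≥0∞) ^ k * (d ^ k * (CB m * R) + C₃ * (Cw * R)) := by gcongr
        _ = _ := by push_cast; ring
  refine hfinal.trans ?_
  -- As `s - m ≥ 0` and `K` belongs to the patch, the power of the diameter of `K` is at most that
  -- of the patch.
  refine mul_le_mul_right (Finset.sum_le_sum fun c hc => ?_) _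
  gcongr
  exact diam_le_diam_patch hΩ (mem_nodeElements_of_mem hp hK hc)

end Mesh

end

end ClementFE

end

theorem lemma3p1 (d p : ℕ) (hd : d = 2 ∨ d = 3) (hp : 1 ≤ p)
    (Ω : Set (EuclideanSpace ℝ (Fin d))) (hΩ : IsLipschitzDomain Ω)
    (hsc : SimplyConnectedSpace Ω) (σ s m : ℝ)
    (hs : 1 / 2 < s) (hsp : s ≤ (p : ℝ) + 1) (hm : 0 ≤ m) (hms : m ≤ s) :
    ∃ C : ℝ≥0, ∀ T : Mesh Ω, T.ShapeRegular σ →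
      ∀ v : EuclideanSpace ℝ (Fin d) → EuclideanSpace ℝ (Fin d),
        MemSobolev s Ω v → MemHZeroCurl Ω v →
          ∀ K ∈ T.elements,
            sobolevSeminorm m (interior (convexHull ℝ (K : Set (EuclideanSpace ℝ (Fin d)))))
                (fun x => T.clementZero p v x - v x) ≤
              (C : ℝ≥0∞) * ∑ i ∈ Mesh.elementNodes p K,
                ENNReal.ofReal (Metric.diam (T.patch p i) ^ (s - m)) *
                  sobolevSeminorm s (T.patch p i) v := by
  -- The comparison of diameters by powers of `σ` needs `σ ≥ 1`; shape regularity persists for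
  -- larger parameters.
  obtain ⟨C, hC⟩ := Mesh.exists_clementZero_sub_le (σ := max σ 1) hΩ (by omega) hp (le_max_right _ _)
    hs hsp hm hms
  exact ⟨C, fun T hT => hC T (hT.mono (le_max_left _ _))⟩
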